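/- Let $h>0$ and $\alpha\in\mathbb{R}\setminus\{0\}$. Let $H_h=\big(-i\,\partial_{x_1}+hx_2\big)^2-\partial_{x_2}^2$ be the (self-adjoint) Landau Hamiltonian in $L^2(\mathbb{R}^2)$. Let $S$ be the restriction of $H_h$ to the functions of its domain (which are continuous) that vanish at all points of $\mathbb{Z}^2$, and let $H_{h,\alpha}$ be the self-adjoint extension of $S$ obtained by restricting $S^*$ to the functions $f$ such that, for each $m\in\mathbb{Z}^2$, \[ f(x)=\frac{a_m}{2\pi}\log\frac1{|x-m|}+b_m+o(1)\quad (x\to m),\qquad a_m+\alpha b_m=0, \] for some $a_m,b_m\in\mathbb{C}$. For $z\notin\operatorname{spec}H_h$ let $G_h(x,y;z)$ be the Green function of $H_h$ (the integral kernel of $(H_h-z)^{-1}$), that is \[ G_h(x,y;z)=\frac1{4\pi}\exp\Big(-\frac{ih(x_1-y_1)(x_2+y_2)}2-\frac{h|x-y|^2}4\Big)\,\Gamma\Big(\frac12-\frac z{2h}\Big)\,U\Big(\frac12-\frac z{2h},1;\frac{h|x-y|^2}2\Big), \] where $U$ is the Kummer (Tricomi) confluent hypergeometric function; let, with $\psi=\Gamma'/\Gamma$,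 \[ q(z,h)=\lim_{x\to y}\Big(G_h(x,y;z)-\frac1{2\pi}\log\frac1{|x-y|}\Big)=-\frac1{4\pi}\Big(\psi\Big(\frac12-\frac z{2h}\Big)+\log\frac h2-2\psi(1)\Big) \] (the limit exists and does not depend on $y\in\mathbb{R}^2$); and let, for $m,n\in\mathbb{Z}^2$, $Q(m,n;z,h)=q(z,h)$ if $m=n$ and $Q(m,n;z,h)=G_h(m,n;z)$ otherwise. For $z\notin\operatorname{spec}H_h$ define the symbol \[ L_\alpha(x,p;z,h)=q(z,h)+\alpha^{-1}+\sum_{\substack{m,n\in\mathbb{Z}\\ |m|+|n|\ge1}}\lambda(m,n;z,h)\,e^{i(mx+np)},\qquad x,p\in\mathbb{R}, \] \[ \lambda(m,n;z,h)=\frac1{4\pi}\exp\Big(-\frac{h(m^2+n^2)}4\Big)\,\Gamma\Big(\frac12-\frac z{2h}\Big)\,U\Big(\frac12-\frac z{2h},1;\frac{h(m^2+n^2)}2\Big). \] Then the series converges absolutely, \[ L_\alpha(x,p;z,h)=\sum_{m,n\in\mathbb{Z}}Q\big((0,0),(m,n);z,h\big)e^{-imnh/2}e^{i(mx+np)}+\alpha^{-1},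 \] and $\lambda(m,n;z,h)=F_h\big((0,0),(m,n);z\big)$ for $|m|+|n|\ge1$, where $F_h(x,y;z)=e^{ih(x_1-y_1)(x_2+y_2)/2}\,G_h(x,y;z)$. The Weyl $h$-quantization \[ \widehat L_{h,\alpha}(z)f(x)=\frac1{2\pi h}\int_{\mathbb{R}}\int_{\mathbb{R}}e^{ip(x-y)/h}L_\alpha\Big(\frac{x+y}2,p;z,h\Big)f(y)\,dy\,dp \] (an iterated integral for Schwartz functions $f$) extends to a bounded operator in $L^2(\mathbb{R})$, which is self-adjoint for real $z$. The spectrum of $H_{h,\alpha}$ is real, and $\operatorname{spec}H_{h,\alpha}\setminus\operatorname{spec}H_h$ is the $z$-spectrum of the family $\widehat L_{h,\alpha}(z)$: \[ \operatorname{spec}H_{h,\alpha}\setminus\operatorname{spec}H_h=\big\{z\in\mathbb{C}\setminus\operatorname{spec}H_h:\ 0\in\operatorname{spec}\widehat L_{h,\alpha}(z)\big\}. \] -/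

import Mathlib

open MeasureTheory Filter Topology
open scoped SchwartzMap InnerProductSpace

noncomputable section

namespace PointLandau

/-- The Hilbert space `L²(ℝ²)`. -/
abbrev L2Plane : Type := Lp ℂ 2 (volume : Measure (ℝ × ℝ))

/-- The Hilbert space `L²(ℝ)`. -/
abbrev L2Line : Type := Lp ℂ 2 (volume : Measure ℝ)

/-- The Euclidean distance in the plane (the norm of the Lean type `ℝ × ℝ` is the sup norm). -/
def eDist (x y : ℝ × ℝ) : ℝ := Real.sqrt ((x.1 - y.1) ^ 2 + (x.2 - y.2) ^ 2)

/-- The point of the plane given by a point of the lattice `ℤ²`. -/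
def latticePt (m : ℤ × ℤ) : ℝ × ℝ := ((m.1 : ℝ), (m.2 : ℝ))

/-! ### Spectrum of an unbounded operator -/

section Spectrum

variable {E : Type*} [NormedAddCommGroup E] [InnerProductSpace ℂ E]

/-- `R` is a bounded two-sided inverse of `T - z : dom T → E`. -/
def IsResolventAt (T : E →ₗ.[ℂ] E) (z : ℂ) (R : E →L[ℂ] E) : Prop :=
  (∀ v : E, ∃ hv : R v ∈ T.domain, T ⟨R v, hv⟩ - z • R v = v) ∧
    ∀ u : T.domain, R (T u - z • (u : E)) = u

/-- The spectrum of an unbounded operator. -/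
def unboundedSpectrum (T : E →ₗ.[ℂ] E) : Set ℂ :=
  {z | ¬ ∃ R : E →L[ℂ] E, IsResolventAt T z R}

end Spectrum

/-! ### The Landau Hamiltonian -/

/-- The operator `-i ∂/∂x₁ + h x₂` on Schwartz functions. -/
def momentumOne (h : ℝ) : 𝓢(ℝ × ℝ, ℂ) →L[ℂ] 𝓢(ℝ × ℝ, ℂ) :=
  (-Complex.I) • LineDeriv.lineDerivOpCLM ℂ 𝓢(ℝ × ℝ, ℂ) ((1, 0) : ℝ × ℝ) +
    (h : ℂ) • SchwartzMap.smulLeftCLM ℂ (fun x : ℝ × ℝ => (x.2 : ℂ))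

/-- The differential expression `(-i ∂/∂x₁ + h x₂)² - ∂²/∂x₂²` on Schwartz functions. -/
def landauExpr (h : ℝ) : 𝓢(ℝ × ℝ, ℂ) →L[ℂ] 𝓢(ℝ × ℝ, ℂ) :=
  momentumOne h ∘L momentumOne h -
    LineDeriv.lineDerivOpCLM ℂ 𝓢(ℝ × ℝ, ℂ) ((0, 1) : ℝ × ℝ) ∘L
      LineDeriv.lineDerivOpCLM ℂ 𝓢(ℝ × ℝ, ℂ) ((0, 1) : ℝ × ℝ)

/-- The embedding of the Schwartz space of the plane into `L²(ℝ²)`. -/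
def schwartzToL2 : 𝓢(ℝ × ℝ, ℂ) →ₗ[ℂ] L2Plane :=
  (SchwartzMap.toLpCLM ℂ ℂ 2 (volume : Measure (ℝ × ℝ))).toLinearMap

theorem schwartzToL2_injective : Function.Injective schwartzToL2 :=
  SchwartzMap.injective_toLp 2 (volume : Measure (ℝ × ℝ))

/-- The (essentially self-adjoint) operator in `L²(ℝ²)` with domain the Schwartz functions,
acting by the Landau differential expression. -/
def landauCore (h : ℝ) : L2Plane →ₗ.[ℂ] L2Plane where
  domain := LinearMap.range schwartzToL2
  toFun := schwartzToL2 ∘ₗ (landauExpr h).toLinearMap ∘ₗ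
    (LinearEquiv.ofInjective schwartzToL2 schwartzToL2_injective).symm.toLinearMap

/-- The Landau Hamiltonian `H_h`: the self-adjoint realization of the Landau expression. As the
adjoint of the operator on Schwartz functions it acts in the sense of distributions on all
`f ∈ L²` for which the resulting distribution is in `L²`. -/
def landau (h : ℝ) : L2Plane →ₗ.[ℂ] L2Plane := (landauCore h).adjoint

/-! ### The zero-range perturbation -/

/-- The (classes of) continuous functions that vanish at all points of `ℤ²`. -/
def vanishingOnLattice : Submodule ℂ L2Plane where
  carrier := {f | ∃ F : ℝ × ℝ → ℂ, Continuous F ∧ f =ᵐ[volume] F ∧ ∀ m, F (latticePt m) = 0}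
  zero_mem' := ⟨0, continuous_zero, Lp.coeFn_zero _ _ _, fun _ => rfl⟩
  add_mem' := by
    rintro f g ⟨F, hF, hfF, hF0⟩ ⟨G, hG, hgG, hG0⟩
    exact ⟨F + G, hF.add hG, (Lp.coeFn_add f g).trans (hfF.add hgG),
      fun m => by simp [hF0 m, hG0 m]⟩
  smul_mem' := by
    rintro c f ⟨F, hF, hfF, hF0⟩
    exact ⟨c • F, hF.const_smul c, (Lp.coeFn_smul c f).trans (hfF.const_smul c),
      fun m => by simp [hF0 m]⟩

/-- The restriction `S` of `H_h` to the functions vanishing at all points of `ℤ²`. -/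
def restrictedLandau (h : ℝ) : L2Plane →ₗ.[ℂ] L2Plane :=
  (landau h).domRestrict vanishingOnLattice

/-- `F(x) = (a / 2π) log (1 / |x - m|) + b + o(1)` as `x → m`, `x ≠ m`. -/
def HasLogExpansion (F : ℝ × ℝ → ℂ) (m : ℝ × ℝ) (a b : ℂ) : Prop :=
  Tendsto (fun x => F x - a / (2 * Real.pi) * (Real.log (1 / eDist x m) : ℂ)) (𝓝[≠] m) (𝓝 b)

/-- The functions that have at each `m ∈ ℤ²` a logarithmic expansion with coefficients
`a_m`, `b_m` subject to the boundary condition `a_m + α b_m = 0`. -/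
def pointBoundaryCondition (α : ℝ) : Submodule ℂ L2Plane where
  carrier := {f | ∃ F : ℝ × ℝ → ℂ, f =ᵐ[volume] F ∧
    ∀ m : ℤ × ℤ, ∃ a b : ℂ, HasLogExpansion F (latticePt m) a b ∧ a + α * b = 0}
  zero_mem' := ⟨0, Lp.coeFn_zero _ _ _, fun m => ⟨0, 0, by simp [HasLogExpansion], by simp⟩⟩
  add_mem' := by
    rintro f g ⟨F, hfF, hF⟩ ⟨G, hgG, hG⟩
    refine ⟨F + G, (Lp.coeFn_add f g).trans (hfF.add hgG), fun m => ?_⟩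
    obtain ⟨a, b, hab, h0⟩ := hF m
    obtain ⟨a', b', hab', h0'⟩ := hG m
    refine ⟨a + a', b + b', (Tendsto.add hab hab').congr fun x => ?_, ?_⟩
    · simp only [Pi.add_apply]; ring
    · linear_combination h0 + h0'
  smul_mem' := by
    rintro c f ⟨F, hfF, hF⟩
    refine ⟨c • F, (Lp.coeFn_smul c f).trans (hfF.const_smul c), fun m => ?_⟩
    obtain ⟨a, b, hab, h0⟩ := hF m
    refine ⟨c * a, c * b, (Tendsto.const_mul c hab).congr fun x => ?_, ?_⟩
    · simp only [Pi.smul_apply, smul_eq_mul]; ring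
    · linear_combination c * h0

/-- The operator `H_{h,α}`: the extension of `S` (restriction of the adjoint of `S`) given by the
boundary conditions `a_m(f) + α b_m(f) = 0`, `m ∈ ℤ²`. -/
def pointLandau (h α : ℝ) : L2Plane →ₗ.[ℂ] L2Plane :=
  (restrictedLandau h).adjoint.domRestrict (pointBoundaryCondition α)

/-! ### The explicit functions -/

/-- Kummer's (Tricomi's) confluent hypergeometric function `U(a, 1; x)` of second parameter `1`,
for `x > 0` and `a ∉ {0, -1, -2, …}`, by its logarithmic series
`-Γ(a)⁻¹ ∑ₖ (a)ₖ / (k!)² xᵏ (log x + ψ(a + k) - 2 ψ(1 + k))`. -/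
def kummerUOne (a : ℂ) (x : ℝ) : ℂ :=
  -(Complex.Gamma a)⁻¹ * ∑' k : ℕ,
    (ascPochhammer ℂ k).eval a / ((k.factorial : ℂ) ^ 2) * (x : ℂ) ^ k *
      ((Real.log x : ℂ) + Complex.digamma (a + k) - 2 * Complex.digamma (1 + k))

/-- The Green function `G_h(x, y; z)` of the Landau Hamiltonian. -/
def green (h : ℝ) (z : ℂ) (x y : ℝ × ℝ) : ℂ :=
  1 / (4 * Real.pi) *
    Complex.exp (-(Complex.I * h * (x.1 - y.1) * (x.2 + y.2) / 2) - h * (eDist x y) ^ 2 / 4) *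
    Complex.Gamma (1 / 2 - z / (2 * h)) *
    kummerUOne (1 / 2 - z / (2 * h)) (h * eDist x y ^ 2 / 2)

/-- `F_h(x, y; z) = exp (i h (x₁ - y₁) (x₂ + y₂) / 2) G_h(x, y; z)`. -/
def greenGauged (h : ℝ) (z : ℂ) (x y : ℝ × ℝ) : ℂ :=
  Complex.exp (Complex.I * h * (x.1 - y.1) * (x.2 + y.2) / 2) * green h z x y

/-- `q(z, h)`, the renormalized value of the Green function on the diagonal. -/
def qFun (h : ℝ) (z : ℂ) : ℂ :=
  -(1 / (4 * Real.pi)) * (Complex.digamma (1 / 2 - z / (2 * h)) + (Real.log (h / 2) : ℂ)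
    - 2 * Complex.digamma 1)

/-- The matrix `Q(m, n; z, h)`, `m, n ∈ ℤ²`. -/
def qMatrix (h : ℝ) (z : ℂ) (m n : ℤ × ℤ) : ℂ :=
  if m = n then qFun h z else green h z (latticePt m) (latticePt n)

/-- The coefficients `λ(m, n; z, h)`. -/
def lam (h : ℝ) (z : ℂ) (m n : ℤ) : ℂ :=
  1 / (4 * Real.pi) * Complex.exp (-(h * ((m : ℂ) ^ 2 + (n : ℂ) ^ 2) / 4)) *
    Complex.Gamma (1 / 2 - z / (2 * h)) *
    kummerUOne (1 / 2 - z / (2 * h)) (h * ((m : ℝ) ^ 2 + (n : ℝ) ^ 2) / 2)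

/-- The character `e^{i (m x + n p)}`. -/
def character (m n : ℤ) (x p : ℝ) : ℂ := Complex.exp (Complex.I * (m * x + n * p))

/-- The symbol `L_α(x, p; z, h) = q(z, h) + α⁻¹ + ∑_{|m| + |n| ≥ 1} λ(m, n; z, h) e^{i (m x + n p)}`. -/
def effSymbol (h α : ℝ) (z : ℂ) (x p : ℝ) : ℂ :=
  qFun h z + (α : ℂ)⁻¹ +
    ∑' k : {k : ℤ × ℤ // 1 ≤ |k.1| + |k.2|}, lam h z k.1.1 k.1.2 * character k.1.1 k.1.2 x p

/-! ### Weyl quantization -/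

/-- The integrand of the Weyl quantization of the symbol `L`. -/
def weylIntegrand (h : ℝ) (L : ℝ → ℝ → ℂ) (f : ℝ → ℂ) (x p y : ℝ) : ℂ :=
  Complex.exp (Complex.I * p * (x - y) / h) * L ((x + y) / 2) p * f y

/-- The bounded operator `A` in `L²(ℝ)` is the Weyl `h`-quantization of the symbol `L`:
`(A f)(x) = (2 π h)⁻¹ ∬ e^{i p (x - y) / h} L((x + y) / 2, p) f(y) dy dp` for Schwartz functions
`f`, as a convergent iterated integral. Being bounded, `A` is determined by this. -/
def IsWeylQuantization (h : ℝ) (L : ℝ → ℝ → ℂ) (A : L2Line →L[ℂ] L2Line) : Prop :=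
  ∀ f : 𝓢(ℝ, ℂ), ∀ᵐ x : ℝ,
    (∀ p : ℝ, Integrable (fun y : ℝ => weylIntegrand h L f x p y)) ∧
    Integrable (fun p : ℝ => ∫ y : ℝ, weylIntegrand h L f x p y) ∧
    (A (f.toLp 2 volume) : ℝ → ℂ) x =
      1 / (2 * Real.pi * h) * ∫ p : ℝ, ∫ y : ℝ, weylIntegrand h L f x p y

theorem IsWeylQuantization.unique {h : ℝ} {L : ℝ → ℝ → ℂ} {A B : L2Line →L[ℂ] L2Line}
    (hA : IsWeylQuantization h L A) (hB : IsWeylQuantization h L B) : A = B := by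
  have hd : DenseRange (SchwartzMap.toLpCLM ℂ ℂ 2 (volume : Measure ℝ)) :=
    SchwartzMap.denseRange_toLpCLM (by simp)
  have key : (A : L2Line → L2Line) ∘ SchwartzMap.toLpCLM ℂ ℂ 2 (volume : Measure ℝ) =
      (B : L2Line → L2Line) ∘ SchwartzMap.toLpCLM ℂ ℂ 2 (volume : Measure ℝ) := by
    funext f
    refine Lp.ext ?_
    filter_upwards [hA f, hB f] with x h1 h2
    exact h1.2.2.trans h2.2.2.symm
  exact ContinuousLinearMap.coeFn_injective (hd.equalizer A.continuous B.continuous key)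

/-- The `z`-spectrum of a family of bounded operators `A(z)` with parameter set `D`:
the set of all `z ∈ D` with `0 ∈ spec A(z)`. -/
def pencilSpectrum (D : Set ℂ) (A : ℂ → L2Line →L[ℂ] L2Line) : Set ℂ :=
  {z | z ∈ D ∧ (0 : ℂ) ∈ spectrum ℂ (A z)}

end PointLandau

end

noncomputable section

namespace PointLandau

/-! Krein's resolvent formula reduces the spectral problem to the matrix Q(z) + 1/α on ℓ²(ℤ²). This
matrix and the Weyl operator are two representations of one element of a noncommutative torus, and
the element is invertible in both or in neither.

The Green function. After the gauge phase is removed, G_h depends only on s = |x - y|². What is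
needed about U comes from Kummer's equation: the logarithmic series gives the behaviour at 0
(`isTricomiSol_series`), the Laplace integral gives the growth at infinity when Re a > 0, the
lowering relation carries the growth to the other admissible a, and uniqueness (`kummer_zero`) says
that these are the same function. To see that G_h inverts H_h - z, replace s by s + ε. The kernel
becomes a Schwartz function of each variable, and H_h - z maps it to a smooth bump of total mass
tending to 1, which gives `integral_green_landauExpr` as ε tends to 0. The same regularization shows
that the adjoint of the operator on Schwartz functions has no eigenvalue off the Landau levels
(`LandauRel.eq_zero`). A ladder argument shows that every level is an eigenvalue, so the spectrum of
H_h is exactly the set of levels.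

Krein's formula. Let Γ(z) send ξ to the sum of ξ_m G_h(·, m; z). This is bounded because the Gram
matrix of the Green functions decays like a Gaussian. The domain of S* consists of the functions
R(z)v + Γ(z)ξ (`starRel_iff`). Such a function has at n the logarithmic coefficient ξ_n and the
constant term (R(z)v)(n) + (Q(z)ξ)_n, so the boundary condition reads (Q(z) + 1/α)ξ = -(R(z)v)(n)
(`pointRel_iff`). Hence z is in the resolvent set exactly when Q(z) + 1/α is invertible. For nonreal
z this holds because Q(z) - Q(z)* = (z - z̄)Γ(z̄)*Γ(z̄) and Γ(z̄) is bounded below, so the spectrum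
is real.

The torus. The matrix is the sum of c_k U_k with magnetic shifts U_k on ℓ²(ℤ²), and the quantized
symbol is the sum of c_k W_k, with the same summable c_k, where W_k quantizes e^{i(k₁x + k₂p)}. For
selfadjoint pairs, invertibility amounts to lower bounds for the operator and its adjoint, so it
suffices to transfer lower bounds. From W to U one averages over the characters of ℤ², which are
implemented by isometries of L²(ℝ) (`CovariantSystem.sum_sq_le`). From U to W one tests the matrix
on translates of a vector over a large box, whose boundary is negligible
(`CovariantSystem.le_norm`). No arithmetic condition on h enters. -/

/-! ### Kummer's equation -/

/-- `W` solves Kummer's equation `x W'' + (1 - x) W' - a W = 0` on `(0, ∞)`, with derivative `W'`,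
and `W(x) = -log x + c + o(1)`, `x W'(x) → -1` at `0`. -/
structure IsTricomiSol (a c : ℂ) (W W' : ℝ → ℂ) : Prop where
  deriv : ∀ x > 0, HasDerivAt W (W' x) x
  deriv2 : ∀ x > 0, HasDerivAt W' ((a * W x - (1 - x) * W' x) / x) x
  lim0 : Tendsto (fun x : ℝ => W x + (Real.log x : ℂ)) (𝓝[>] 0) (𝓝 c)
  lim1 : Tendsto (fun x : ℝ => (x : ℂ) * W' x) (𝓝[>] 0) (𝓝 (-1))

/-- Polynomial growth of two functions at infinity. -/
def HasPolyGrowth (W W' : ℝ → ℂ) : Prop :=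
  ∃ (C : ℝ) (N : ℕ), ∀ x ≥ 1, ‖W x‖ ≤ C * x ^ N ∧ ‖W' x‖ ≤ C * x ^ N

/-- With P = xD' the equation becomes the system D' = P/x, P' = aD + P, which is singular at 0. The
initial data force P = O(x), hence the energy |P|²/x + |D|² tends to 0, and Grönwall's inequality
then makes it vanish everywhere. -/
theorem kummer_zero {a : ℂ} {D D' : ℝ → ℂ}
    (h1 : ∀ x > 0, HasDerivAt D (D' x) x)
    (h2 : ∀ x > 0, HasDerivAt D' ((a * D x - (1 - x) * D' x) / x) x)
    (l0 : Tendsto D (𝓝[>] 0) (𝓝 0))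
    (l1 : Tendsto (fun x : ℝ => (x : ℂ) * D' x) (𝓝[>] 0) (𝓝 0)) :
    ∀ x > 0, D x = 0 := by
  set P : ℝ → ℂ := fun x => (x : ℂ) * D' x with hP
  have hPd : ∀ x > 0, HasDerivAt P (a * D x + P x) x := by
    intro x hx
    have hx' : (x : ℂ) ≠ 0 := by exact_mod_cast hx.ne'
    have := (HasDerivAt.ofReal_comp (hasDerivAt_id x)).mul (h2 x hx)
    refine this.congr_deriv ?_
    simp only [hP]; field_simp; simp; ring
  have hD : ∀ x > 0, HasDerivAt D (P x / x) x := by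
    intro x hx
    have hx' : (x : ℂ) ≠ 0 := by exact_mod_cast hx.ne'
    refine (h1 x hx).congr_deriv ?_
    simp only [hP]; field_simp
  -- `P = O(x)` near zero
  obtain ⟨δ, hδ, hδb⟩ : ∃ δ > 0, ∀ x ∈ Set.Ioo (0 : ℝ) δ, ‖a * D x + P x‖ ≤ 1 := by
    have : Tendsto (fun x => ‖a * D x + P x‖) (𝓝[>] 0) (𝓝 0) := by
      simpa using ((l0.const_mul a).add l1).norm
    have := this.eventually (Iic_mem_nhds (zero_lt_one))
    obtain ⟨δ, hδ, hs⟩ := (mem_nhdsGT_iff_exists_Ioo_subset).1 this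
    exact ⟨δ, hδ, fun x hx => hs hx⟩
  have hPb : ∀ x ∈ Set.Ioo (0 : ℝ) δ, ‖P x‖ ≤ x := by
    intro x hx
    have key : ∀ᶠ y in 𝓝[>] (0 : ℝ), ‖P x - P y‖ ≤ x := by
      filter_upwards [Ioo_mem_nhdsGT hx.1] with y hy
      have := (convex_Ioo (0 : ℝ) δ).norm_image_sub_le_of_norm_hasDerivWithin_le (f := P)
        (f' := fun x => a * D x + P x) (C := 1) (x := y) (y := x)
        (fun t ht => (hPd t ht.1).hasDerivWithinAt) hδb ⟨hy.1, hy.2.trans hx.2⟩ hx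
      refine this.trans ?_
      rw [one_mul, Real.norm_eq_abs, abs_of_pos (sub_pos.2 hy.2)]
      linarith [hy.1]
    have lim : Tendsto (fun y => ‖P x - P y‖) (𝓝[>] 0) (𝓝 ‖P x - 0‖) :=
      (tendsto_const_nhds.sub l1).norm
    simpa using le_of_tendsto lim key
  set C : ℝ := 2 + (‖a‖ + 1) ^ 2 with hC
  -- The weight 1/x is chosen because its derivative contributes -|P|²/x². This negative term
  -- absorbs the singular cross term |D||P|/x by completing the square, and `C` is what remains.
  set E : ℝ → ℝ := fun x => ‖P x‖ ^ 2 / x + ‖D x‖ ^ 2 with hE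
  have hElim : Tendsto E (𝓝[>] 0) (𝓝 0) := by
    have e1 : Tendsto (fun x : ℝ => x + ‖D x‖ ^ 2) (𝓝[>] 0) (𝓝 0) := by
      have : Tendsto (fun x : ℝ => x) (𝓝[>] 0) (𝓝 0) := tendsto_nhdsWithin_of_tendsto_nhds tendsto_id
      simpa using this.add (l0.norm.pow 2)
    refine tendsto_of_tendsto_of_tendsto_of_le_of_le' tendsto_const_nhds e1 ?_ ?_
    · filter_upwards [self_mem_nhdsWithin] with x hx
      have : (0 : ℝ) < x := hx
      positivity
    · filter_upwards [Ioo_mem_nhdsGT hδ] with x hx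
      have hx0 := hx.1
      have := hPb x hx
      simp only [hE]
      gcongr
      rw [div_le_iff₀ hx0]
      nlinarith [norm_nonneg (P x)]
  have hEd : ∀ x > 0, ∃ e, HasDerivAt E e x ∧ e ≤ C * E x := by
    intro x hx
    have d1 := ((hPd x hx).norm_sq.div (hasDerivAt_id x) hx.ne').add (hD x hx).norm_sq
    refine ⟨_, d1, ?_⟩
    simp only [id, mul_one, hE]
    have i1 : inner ℝ (P x) (a * D x + P x) ≤ ‖P x‖ * (‖a‖ * ‖D x‖ + ‖P x‖) := by
      refine (real_inner_le_norm _ _).trans ?_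
      gcongr
      refine (norm_add_le _ _).trans ?_
      rw [norm_mul]
    have i2 : inner ℝ (D x) (P x / x) ≤ ‖D x‖ * (‖P x‖ / x) := by
      refine (real_inner_le_norm _ _).trans ?_
      rw [norm_div, Complex.norm_real, Real.norm_eq_abs, abs_of_pos hx]
    set p := ‖P x‖
    set d := ‖D x‖
    have : (2 * inner ℝ (P x) (a * D x + P x) * x - p ^ 2) / x ^ 2 ≤
        (2 * (p * (‖a‖ * d + p)) * x - p ^ 2) / x ^ 2 := by gcongr
    refine (add_le_add this (mul_le_mul_of_nonneg_left i2 zero_le_two)).trans ?_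
    have e : (2 * (p * (‖a‖ * d + p)) * x - p ^ 2) / x ^ 2 + 2 * (d * (p / x)) =
        2 * (p ^ 2 / x) + (‖a‖ + 1) ^ 2 * d ^ 2 - (p / x - (‖a‖ + 1) * d) ^ 2 := by
      field_simp; ring
    rw [e, hC]
    have : 0 ≤ p ^ 2 / x := by positivity
    nlinarith [sq_nonneg (p / x - (‖a‖ + 1) * d), mul_nonneg (sq_nonneg (‖a‖ + 1)) this,
      sq_nonneg d]
  have hanti : AntitoneOn (fun x => Real.exp (-(C * x)) * E x) (Set.Ioi 0) := by
    have hd : ∀ x > 0, ∃ e ≤ 0, HasDerivAt (fun x => Real.exp (-(C * x)) * E x) e x := by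
      intro x hx
      obtain ⟨e, he, hle⟩ := hEd x hx
      have := (((hasDerivAt_id x).const_mul C).neg.exp).mul he
      refine ⟨_, ?_, this⟩
      simp only [id, mul_one, Pi.neg_apply]
      nlinarith [Real.exp_pos (-(C * x))]
    refine antitoneOn_of_deriv_nonpos (convex_Ioi 0) ?_ ?_ ?_
    · intro x hx
      obtain ⟨e, -, he⟩ := hd x hx
      exact he.continuousAt.continuousWithinAt
    · rw [interior_Ioi]
      intro x hx
      obtain ⟨e, -, he⟩ := hd x hx
      exact he.differentiableAt.differentiableWithinAt
    · rw [interior_Ioi]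
      intro x hx
      obtain ⟨e, h0, he⟩ := hd x hx
      rwa [he.deriv]
  intro x hx
  have hlim2 : Tendsto (fun x => Real.exp (-(C * x)) * E x) (𝓝[>] 0) (𝓝 0) := by
    have : Tendsto (fun x => Real.exp (-(C * x))) (𝓝[>] 0) (𝓝 (Real.exp (-(C * 0)))) :=
      tendsto_nhdsWithin_of_tendsto_nhds (Continuous.tendsto (by fun_prop) 0)
    simpa using this.mul hElim
  have hle : Real.exp (-(C * x)) * E x ≤ 0 := by
    refine ge_of_tendsto hlim2 ?_
    filter_upwards [Ioo_mem_nhdsGT hx] with y hy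
    exact hanti hy.1 hx hy.2.le
  have hE0 : E x ≤ 0 := by
    by_contra hcon
    push Not at hcon
    exact absurd hle (not_le.2 (mul_pos (Real.exp_pos _) hcon))
  have : ‖D x‖ ^ 2 ≤ 0 := by
    have : 0 ≤ ‖P x‖ ^ 2 / x := by positivity
    simp only [hE] at hE0
    linarith
  have : ‖D x‖ = 0 := by nlinarith [norm_nonneg (D x)]
  simpa using this

/-- In the difference the logarithms and the constants cancel, so `kummer_zero` applies. This is the
bridge between the series and the integral representation. -/
theorem IsTricomiSol.unique {a c : ℂ} {W W' V V' : ℝ → ℂ} (hW : IsTricomiSol a c W W')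
    (hV : IsTricomiSol a c V V') : ∀ x > 0, W x = V x ∧ W' x = V' x := by
  have hz : ∀ x > 0, W x - V x = 0 := by
    refine kummer_zero (a := a) (D' := fun x => W' x - V' x)
      (fun x hx => (hW.deriv x hx).sub (hV.deriv x hx)) (fun x hx => ?_) ?_ ?_
    · refine ((hW.deriv2 x hx).sub (hV.deriv2 x hx)).congr_deriv ?_
      ring
    · have := hW.lim0.sub hV.lim0
      simpa using this
    · have := hW.lim1.sub hV.lim1
      simp only [sub_self, ← mul_sub] at this
      exact this
  intro x hx
  refine ⟨sub_eq_zero.1 (hz x hx), ?_⟩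
  refine (hW.deriv x hx).unique ((hV.deriv x hx).congr_of_eventuallyEq ?_)
  filter_upwards [Ioi_mem_nhds hx] with y hy
  exact sub_eq_zero.1 (hz y hy)

theorem tendsto_mul_log_zero : Tendsto (fun x : ℝ => (x : ℂ) * (Real.log x : ℂ)) (𝓝[>] 0) (𝓝 0) := by
  have h1 : Tendsto (fun x : ℝ => x * Real.log x) (𝓝[>] 0) (𝓝 0) := by
    have := Real.continuous_mul_log.tendsto 0
    simp only [zero_mul] at this
    exact tendsto_nhdsWithin_of_tendsto_nhds this
  have := (Complex.continuous_ofReal.tendsto 0).comp h1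
  simpa [Function.comp_def] using this

theorem tendsto_ofReal_nhdsGT_zero : Tendsto (fun x : ℝ => (x : ℂ)) (𝓝[>] 0) (𝓝 0) := by
  have := Complex.continuous_ofReal.tendsto 0
  rw [Complex.ofReal_zero] at this
  exact tendsto_nhdsWithin_of_tendsto_nhds this

theorem IsTricomiSol.tendsto_mul_zero {a c : ℂ} {W W' : ℝ → ℂ} (hW : IsTricomiSol a c W W') :
    Tendsto (fun x : ℝ => (x : ℂ) * W x) (𝓝[>] 0) (𝓝 0) := by
  have := (tendsto_ofReal_nhdsGT_zero.mul hW.lim0).sub tendsto_mul_log_zero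
  simp only [zero_mul, sub_zero] at this
  refine this.congr fun x => ?_
  ring

/-- The contiguous relation lowering the parameter. -/
theorem IsTricomiSol.lower {a c : ℂ} {W W' : ℝ → ℂ} (hW : IsTricomiSol a c W W') (ha : a ≠ 1) :
    IsTricomiSol (a - 1) (c + (a - 1)⁻¹)
      (fun x => ((x + a - 1) * W x - x * W' x) / (a - 1)) (fun x => W' x - W x) := by
  have ha' : a - 1 ≠ 0 := sub_ne_zero.2 ha
  refine ⟨fun x hx => ?_, fun x hx => ?_, ?_, ?_⟩
  · have hx' : (x : ℂ) ≠ 0 := by exact_mod_cast hx.ne'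
    have hr := HasDerivAt.ofReal_comp (hasDerivAt_id x)
    have := ((((hr.add_const a).sub_const 1).mul (hW.deriv x hx)).sub
      (hr.mul (hW.deriv2 x hx))).div_const (a - 1)
    refine this.congr_deriv ?_
    field_simp; simp; ring
  · have hx' : (x : ℂ) ≠ 0 := by exact_mod_cast hx.ne'
    refine ((hW.deriv2 x hx).sub (hW.deriv x hx)).congr_deriv ?_
    field_simp; ring
  -- The term -xW'/(a - 1) tends to 1/(a - 1) and shifts the constant. The shift agrees with ψ(a) =
  -- ψ(a - 1) + 1/(a - 1) when c = 2ψ(1) - ψ(a).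
  · have := (((hW.tendsto_mul_zero).sub hW.lim1).div_const (a - 1)).add hW.lim0
    simp only [zero_sub, neg_neg] at this
    rw [one_div, add_comm] at this
    refine this.congr fun x => ?_
    field_simp; ring
  · have := hW.lim1.sub hW.tendsto_mul_zero
    rw [sub_zero] at this
    refine this.congr fun x => ?_
    ring

theorem HasPolyGrowth.lower {W W' : ℝ → ℂ} (hW : HasPolyGrowth W W') (a : ℂ) :
    HasPolyGrowth (fun x => ((x + a - 1) * W x - x * W' x) / (a - 1)) (fun x => W' x - W x) := by
  obtain ⟨C, N, h⟩ := hW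
  have hC : 0 ≤ C := by
    have := (norm_nonneg _).trans (h 1 le_rfl).1
    simpa using this
  refine ⟨C * (‖a‖ + 3) / ‖a - 1‖ + 2 * C, N + 1, fun x hx => ?_⟩
  obtain ⟨h1, h2⟩ := h x hx
  have hx0 : (0 : ℝ) < x := by linarith
  have hpos : 0 ≤ x ^ N := by positivity
  have hle : x ^ N ≤ x ^ (N + 1) := pow_le_pow_right₀ hx (by omega)
  constructor
  · have e1 : ‖((x : ℂ) + a - 1) * W x - x * W' x‖ ≤ C * (‖a‖ + 3) * x ^ (N + 1) := by
      have n1 : ‖(x : ℂ) + a - 1‖ ≤ x + ‖a‖ + 1 := by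
        refine (norm_sub_le _ _).trans ?_
        have := norm_add_le (x : ℂ) a
        rw [Complex.norm_real, Real.norm_eq_abs, abs_of_pos hx0] at this
        simpa using this
      refine (norm_sub_le _ _).trans ?_
      rw [norm_mul, norm_mul, Complex.norm_real, Real.norm_eq_abs, abs_of_pos hx0]
      calc _ ≤ (x + ‖a‖ + 1) * (C * x ^ N) + x * (C * x ^ N) := by gcongr
        _ = C * x ^ N * (2 * x + ‖a‖ + 1) := by ring
        _ ≤ C * x ^ N * ((‖a‖ + 3) * x) := by
            gcongr
            nlinarith [norm_nonneg a]
        _ = _ := by ring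
    rw [norm_div]
    calc _ ≤ C * (‖a‖ + 3) * x ^ (N + 1) / ‖a - 1‖ := by gcongr
      _ = C * (‖a‖ + 3) / ‖a - 1‖ * x ^ (N + 1) := by ring
      _ ≤ _ := by gcongr; linarith
  · refine (norm_sub_le _ _).trans ?_
    calc _ ≤ C * x ^ N + C * x ^ N := by gcongr
      _ = 2 * C * x ^ N := by ring
      _ ≤ (C * (‖a‖ + 3) / ‖a - 1‖ + 2 * C) * x ^ (N + 1) := by
        gcongr
        have : 0 ≤ C * (‖a‖ + 3) / ‖a - 1‖ := by positivity
        linarith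

/-! ### The logarithmic series -/

/-- Coefficients of a power series of exponential type. -/
def ExpType (b : ℕ → ℂ) : Prop := ∃ A B : ℝ, 0 ≤ A ∧ ∀ k, ‖b k‖ ≤ B * (A ^ k / k.factorial)

theorem ExpType.summable {b : ℕ → ℂ} (hb : ExpType b) (x : ℝ) :
    Summable fun k => b k * (x : ℂ) ^ k := by
  obtain ⟨A, B, hA, h⟩ := hb
  refine Summable.of_norm_bounded (((Real.summable_pow_div_factorial (A * |x|))).mul_left B) ?_
  intro k
  rw [norm_mul, norm_pow, Complex.norm_real, Real.norm_eq_abs]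
  calc _ ≤ B * (A ^ k / k.factorial) * |x| ^ k := by gcongr; exact h k
    _ = _ := by rw [mul_pow]; ring

theorem ExpType.derivative {b : ℕ → ℂ} (hb : ExpType b) :
    ExpType fun k => ((k : ℂ) + 1) * b (k + 1) := by
  obtain ⟨A, B, hA, h⟩ := hb
  refine ⟨A, B * A, hA, fun k => ?_⟩
  rw [norm_mul]
  have : ‖(k : ℂ) + 1‖ = k + 1 := by
    have : ((k : ℂ) + 1) = ((k + 1 : ℝ) : ℂ) := by push_cast; rfl
    rw [this, Complex.norm_real, Real.norm_eq_abs, abs_of_nonneg (by positivity)]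
  rw [this]
  calc _ ≤ ((k : ℝ) + 1) * (B * (A ^ (k + 1) / (k + 1).factorial)) := by gcongr; exact h _
    _ = _ := by
      rw [Nat.factorial_succ]; push_cast; field_simp; ring

theorem ExpType.hasDerivAt {b : ℕ → ℂ} (hb : ExpType b) (x : ℝ) :
    HasDerivAt (fun x : ℝ => ∑' k, b k * (x : ℂ) ^ k)
      (∑' k : ℕ, (((k : ℂ) + 1) * b (k + 1)) * (x : ℂ) ^ k) x := by
  obtain ⟨A, B, hA, h⟩ := hb.derivative
  set R := |x| + 1 with hR
  have hR0 : 0 < R := by positivity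
  have hs : Summable fun k : ℕ => B * ((A * R) ^ k / k.factorial) :=
    (Real.summable_pow_div_factorial _).mul_left B
  -- The constant term differentiates to 0, hence the bound 0 at index 0; the other bounds are those
  -- of the derived series moved by one place.
  have hu : Summable fun k : ℕ => if k = 0 then 0 else
      B * ((A * R) ^ (k - 1) / (k - 1).factorial) := by
    rw [← summable_nat_add_iff 1]
    simpa using hs
  have key := hasDerivAt_tsum_of_isPreconnected (𝕜 := ℝ) (g := fun k (y : ℝ) => b k * (y : ℂ) ^ k)
    (g' := fun k y => b k * (k * (y : ℂ) ^ (k - 1))) (t := Set.Ioo (-R) R) (y₀ := 0) (y := x)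
    hu isOpen_Ioo isPreconnected_Ioo ?_ ?_ ?_ ?_ ?_
  · refine key.congr_deriv ?_
    rw [Summable.tsum_eq_zero_add]
    · simp only [Nat.cast_zero, zero_mul, mul_zero, zero_add, Nat.add_sub_cancel]
      refine tsum_congr fun k => ?_
      push_cast; ring
    · rw [← summable_nat_add_iff 1]
      refine (hb.derivative.summable x).congr fun k => ?_
      simp only [Nat.add_sub_cancel]
      push_cast; ring
  · intro k y _
    have := (HasDerivAt.ofReal_comp (hasDerivAt_id y)).pow k
    have := this.const_mul (b k)
    simpa using this
  · intro k y hy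
    rcases k with _ | k
    · simp
    · have e : ‖b (k + 1) * (((k + 1 : ℕ) : ℂ) * (y : ℂ) ^ (k + 1 - 1))‖
          = ‖((k : ℂ) + 1) * b (k + 1)‖ * |y| ^ k := by
        rw [Nat.add_sub_cancel, norm_mul, norm_mul, norm_mul, norm_pow, Complex.norm_real,
          Real.norm_eq_abs]
        push_cast; ring
      rw [e]
      simp only [Nat.add_eq_zero_iff, one_ne_zero, and_false, if_false, Nat.add_sub_cancel]
      have hy' : |y| ≤ R := (abs_lt.2 hy).le
      calc _ ≤ B * (A ^ k / k.factorial) * R ^ k := by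
            gcongr
            · exact (norm_nonneg _).trans (h k)
            · exact h k
        _ = _ := by rw [mul_pow]; ring
  · exact ⟨by linarith, hR0⟩
  · exact hb.summable 0
  · exact abs_lt.1 (by rw [hR]; linarith)

/-- These are the coefficients after the Euler operator x d/dx. The factor k is at most 2^k and is
paid for by doubling the rate. -/
theorem ExpType.theta {b : ℕ → ℂ} (hb : ExpType b) : ExpType fun k => (k : ℂ) * b k := by
  obtain ⟨A, B, hA, h⟩ := hb
  refine ⟨2 * A, B, by positivity, fun k => ?_⟩
  have hB : 0 ≤ B * (A ^ k / k.factorial) := (norm_nonneg _).trans (h k)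
  rw [norm_mul, Complex.norm_natCast]
  calc (k : ℝ) * ‖b k‖ ≤ 2 ^ k * (B * (A ^ k / k.factorial)) := by
        gcongr
        · exact_mod_cast Nat.lt_two_pow_self.le
        · exact h k
    _ = _ := by rw [mul_pow]; ring

theorem ExpType.theta_eq {b : ℕ → ℂ} (hb : ExpType b) (x : ℝ) :
    ∑' k : ℕ, ((k : ℂ) * b k) * (x : ℂ) ^ k =
      x * ∑' k : ℕ, (((k : ℂ) + 1) * b (k + 1)) * (x : ℂ) ^ k := by
  rw [Summable.tsum_eq_zero_add (hb.theta.summable x), ← tsum_mul_left]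
  simp only [Nat.cast_zero, zero_mul, zero_add]
  refine tsum_congr fun k => ?_
  push_cast; ring

section Series

variable (a : ℂ)

/-- `(a)ₖ / (k!)²`. -/
def kummerCoeff (k : ℕ) : ℂ := (ascPochhammer ℂ k).eval a / ((k.factorial : ℂ) ^ 2)

/-- `ψ(a + k) - 2 ψ(1 + k)`. -/
def digammaCoeff (k : ℕ) : ℂ := Complex.digamma (a + k) - 2 * Complex.digamma (1 + k)

/-- The Frobenius recursion: in terms of coefficients it is Kummer's equation for the regular
solution. -/
theorem kummerCoeff_succ (k : ℕ) :
    ((k : ℂ) + 1) ^ 2 * kummerCoeff a (k + 1) = (a + k) * kummerCoeff a k := by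
  have h1 : ((k : ℂ) + 1) ≠ 0 := by exact_mod_cast Nat.succ_ne_zero k
  have h2 : ((k.factorial : ℕ) : ℂ) ≠ 0 := by exact_mod_cast k.factorial_ne_zero
  simp only [kummerCoeff, ascPochhammer_succ_eval, Nat.factorial_succ]
  push_cast
  field_simp

theorem expType_kummerCoeff : ExpType (kummerCoeff a) := by
  refine ⟨‖a‖ + 1, 1, by positivity, fun k => ?_⟩
  induction k with
  | zero => simp [kummerCoeff]
  | succ k ih =>
    have h1 : ((k : ℂ) + 1) ≠ 0 := by exact_mod_cast Nat.succ_ne_zero k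
    have e : kummerCoeff a (k + 1) = (a + k) * kummerCoeff a k / ((k : ℂ) + 1) ^ 2 := by
      rw [← kummerCoeff_succ]; field_simp
    have n1 : ‖(k : ℂ) + 1‖ = k + 1 := by
      have : ((k : ℂ) + 1) = ((k + 1 : ℝ) : ℂ) := by push_cast; rfl
      rw [this, Complex.norm_real, Real.norm_eq_abs, abs_of_nonneg (by positivity)]
    have n2 : ‖a + k‖ ≤ (‖a‖ + 1) * (k + 1) := by
      refine (norm_add_le _ _).trans ?_
      rw [Complex.norm_natCast]
      nlinarith [norm_nonneg a, (Nat.cast_nonneg k : (0 : ℝ) ≤ k), mul_nonneg (norm_nonneg a) (Nat.cast_nonneg k : (0 : ℝ) ≤ k)]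
    rw [e, norm_div, norm_mul, norm_pow, n1]
    calc _ ≤ (‖a‖ + 1) * (k + 1) * (1 * ((‖a‖ + 1) ^ k / k.factorial)) / ((k : ℝ) + 1) ^ 2 := by
          gcongr
      _ = _ := by
        rw [Nat.factorial_succ]; push_cast; field_simp; ring

variable {a}

theorem add_nat_ne_neg (ha : ∀ m : ℕ, a ≠ -m) (k : ℕ) (m : ℕ) : a + k ≠ -m := by
  intro h
  refine ha (k + m) ?_
  push_cast
  linear_combination h

theorem one_add_nat_ne_neg (k : ℕ) (m : ℕ) : (1 : ℂ) + k ≠ -m := by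
  intro h
  have : ((1 + k + m : ℕ) : ℂ) = 0 := by push_cast; linear_combination h
  have := Nat.cast_eq_zero.1 this
  omega

theorem digammaCoeff_succ (ha : ∀ m : ℕ, a ≠ -m) (k : ℕ) :
    digammaCoeff a (k + 1) = digammaCoeff a k + (a + k)⁻¹ - 2 * ((k : ℂ) + 1)⁻¹ := by
  have e1 := Complex.digamma_apply_add_one (a + k) (add_nat_ne_neg ha k)
  have e2 := Complex.digamma_apply_add_one (1 + k) (one_add_nat_ne_neg k)
  simp only [digammaCoeff]
  push_cast
  rw [← add_assoc, ← add_assoc, e1, e2, add_comm (1 : ℂ) (k : ℂ)]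
  ring

/-- The increments of `digammaCoeff` are bounded, so it grows at most linearly, and a linear factor
is again absorbed by doubling the rate. -/
theorem expType_kummerCoeff_mul_digammaCoeff (ha : ∀ m : ℕ, a ≠ -m) :
    ExpType fun k => kummerCoeff a k * digammaCoeff a k := by
  obtain ⟨B, hB⟩ : ∃ B : ℝ, ∀ k : ℕ, ‖(a + k)⁻¹‖ ≤ B := by
    have : Tendsto (fun k : ℕ => (a + k)⁻¹) atTop (𝓝 0) := by
      refine tendsto_inv₀_cobounded.comp ?_
      rw [← tendsto_norm_atTop_iff_cobounded]
      refine tendsto_atTop_mono (f := fun k : ℕ => (k : ℝ) - ‖a‖) (fun k => ?_)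
        (tendsto_atTop_add_const_right _ _ tendsto_natCast_atTop_atTop)
      have := norm_sub_le (a + k) a
      rw [add_sub_cancel_left, Complex.norm_natCast] at this
      linarith
    obtain ⟨B, hB⟩ := (Metric.isBounded_range_of_tendsto _ this).exists_norm_le
    exact ⟨B, fun k => hB _ ⟨k, rfl⟩⟩
  have hB0 : 0 ≤ B := (norm_nonneg _).trans (hB 0)
  set D := ‖digammaCoeff a 0‖ + B + 2 with hD
  have hd : ∀ k : ℕ, ‖digammaCoeff a k‖ ≤ D * (k + 1) := by
    intro k
    induction k with
    | zero => simp [hD]; linarith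
    | succ k ih =>
      rw [digammaCoeff_succ ha]
      have n1 : ‖(2 : ℂ) * ((k : ℂ) + 1)⁻¹‖ ≤ 2 := by
        have : ((k : ℂ) + 1) = ((k + 1 : ℝ) : ℂ) := by push_cast; rfl
        rw [this, norm_mul, norm_inv, Complex.norm_real, Real.norm_eq_abs,
          abs_of_nonneg (by positivity), Complex.norm_ofNat]
        have : ((k : ℝ) + 1)⁻¹ ≤ 1 := inv_le_one_of_one_le₀ (by linarith [(Nat.cast_nonneg k : (0 : ℝ) ≤ k)])
        linarith
      refine (norm_sub_le _ _).trans ?_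
      have := norm_add_le (digammaCoeff a k) (a + k)⁻¹
      have := hB k
      have := norm_nonneg (digammaCoeff a 0)
      push_cast
      nlinarith
  obtain ⟨A, C, hA, h⟩ := expType_kummerCoeff a
  refine ⟨2 * A, C * D, by positivity, fun k => ?_⟩
  have hC : 0 ≤ C * (A ^ k / k.factorial) := (norm_nonneg _).trans (h k)
  have hD0 : 0 ≤ D := by positivity
  rw [norm_mul]
  calc _ ≤ (C * (A ^ k / k.factorial)) * (D * (k + 1)) := by
        gcongr
        · exact h k
        · exact hd k
    _ ≤ (C * (A ^ k / k.factorial)) * (D * 2 ^ k) := by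
        gcongr
        exact_mod_cast Nat.lt_two_pow_self
    _ = _ := by rw [mul_pow]; ring

/-- Frobenius' method with a double exponent: the function is -(M log x + N) with power series M, N.
With `PM` and `PN` the images of M and N under x d/dx, the recursions of the coefficients become a
first order system, from which both the equation and the limits at 0 are read off. -/
theorem isTricomiSol_series (ha : ∀ m : ℕ, a ≠ -m) :
    ∃ W' : ℝ → ℂ, IsTricomiSol a (2 * Complex.digamma 1 - Complex.digamma a)
      (fun x => Complex.Gamma a * kummerUOne a x) W' := by
  have hc := expType_kummerCoeff a
  have hd := expType_kummerCoeff_mul_digammaCoeff ha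
  set M : ℝ → ℂ := fun x => ∑' k, kummerCoeff a k * (x : ℂ) ^ k with hM
  set N : ℝ → ℂ := fun x => ∑' k, (kummerCoeff a k * digammaCoeff a k) * (x : ℂ) ^ k with hN
  set M' : ℝ → ℂ := fun x => ∑' k : ℕ, (((k : ℂ) + 1) * kummerCoeff a (k + 1)) * (x : ℂ) ^ k with hM'
  set PM : ℝ → ℂ := fun x => ∑' k : ℕ, ((k : ℂ) * kummerCoeff a k) * (x : ℂ) ^ k with hPM
  set PN : ℝ → ℂ := fun x =>
    ∑' k : ℕ, ((k : ℂ) * (kummerCoeff a k * digammaCoeff a k)) * (x : ℂ) ^ k with hPN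
  have dM : ∀ x, HasDerivAt M (M' x) x := fun x => hc.hasDerivAt x
  have eM : ∀ x, PM x = x * M' x := fun x => hc.theta_eq x
  have dN : ∀ x > 0, HasDerivAt N (PN x / x) x := fun x hx => by
    refine (hd.hasDerivAt x).congr_deriv ?_
    have hx' : (x : ℂ) ≠ 0 := by exact_mod_cast hx.ne'
    rw [hPN]
    simp only [hd.theta_eq x]
    field_simp
  have dPM : ∀ x, HasDerivAt PM (a * M x + PM x) x := fun x => by
    refine (hc.theta.hasDerivAt x).congr_deriv ?_
    rw [hM, hPM]
    simp only
    rw [← tsum_mul_left, ← Summable.tsum_add ((hc.summable x).mul_left a) (hc.theta.summable x)]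
    refine tsum_congr fun k => ?_
    have := kummerCoeff_succ a k
    push_cast
    linear_combination (x : ℂ) ^ k * this
  -- The inhomogeneous terms M and -2M' come from the increments 1/(a + k) and -2/(k + 1) of
  -- `digammaCoeff`; they cancel what differentiating log x produces.
  have dPN : ∀ x, HasDerivAt PN (a * N x + PN x + M x - 2 * M' x) x := fun x => by
    refine (hd.theta.hasDerivAt x).congr_deriv ?_
    rw [hM, hPN, hM', hN]
    simp only
    rw [← tsum_mul_left, ← tsum_mul_left,
      ← Summable.tsum_add ((hd.summable x).mul_left a) (hd.theta.summable x),
      ← Summable.tsum_add (((hd.summable x).mul_left a).add (hd.theta.summable x)) (hc.summable x),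
      ← Summable.tsum_sub ((((hd.summable x).mul_left a).add (hd.theta.summable x)).add
        (hc.summable x)) ((hc.derivative.summable x).mul_left 2)]
    refine tsum_congr fun k => ?_
    have e1 := kummerCoeff_succ a k
    have e2 := digammaCoeff_succ ha k
    have h1 : ((k : ℂ) + 1) ≠ 0 := by exact_mod_cast Nat.succ_ne_zero k
    have h2 : a + k ≠ 0 := by
      have := ha k
      intro h
      exact this (by linear_combination h)
    have e3 : kummerCoeff a (k + 1) = (a + k) * kummerCoeff a k / ((k : ℂ) + 1) ^ 2 := by
      rw [← e1]; field_simp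
    rw [e2, e3]
    push_cast
    field_simp
  have M0 : M 0 = 1 := by
    rw [hM]
    simp only
    rw [tsum_eq_single 0 (by intro k hk; simp [hk])]
    simp [kummerCoeff]
  have N0 : N 0 = Complex.digamma a - 2 * Complex.digamma 1 := by
    rw [hN]
    simp only
    rw [tsum_eq_single 0 (by intro k hk; simp [hk])]
    simp [kummerCoeff, digammaCoeff]
  have PN0 : PN 0 = 0 := by
    rw [hPN]
    simp only
    rw [tsum_eq_single 0 (by intro k hk; simp [hk])]
    simp
  have hWeq : ∀ x : ℝ, Complex.Gamma a * kummerUOne a x =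
      -(M x * (Real.log x : ℂ) + N x) := by
    intro x
    have hG := Complex.Gamma_ne_zero ha
    simp only [kummerUOne, hM, hN]
    rw [← tsum_mul_right, ← Summable.tsum_add ((hc.summable x).mul_right _) (hd.summable x)]
    rw [neg_mul, mul_neg, ← mul_assoc, mul_inv_cancel₀ hG, one_mul]
    congr 1
    refine tsum_congr fun k => ?_
    simp only [kummerCoeff, digammaCoeff]
    ring
  have hlog : ∀ x : ℝ, 0 < x → HasDerivAt (fun x : ℝ => (Real.log x : ℂ)) ((x : ℂ)⁻¹) x := by
    intro x hx
    have := (Real.hasDerivAt_log hx.ne').ofReal_comp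
    simpa using this
  have contM' : ContinuousAt M' 0 := (hc.derivative.hasDerivAt 0).continuousAt
  refine ⟨fun x => -(PM x * (Real.log x : ℂ) + M x + PN x) / x, fun x hx => ?_, fun x hx => ?_,
    ?_, ?_⟩
  · have hx' : (x : ℂ) ≠ 0 := by exact_mod_cast hx.ne'
    simp_rw [hWeq]
    refine (((dM x).mul (hlog x hx)).add (dN x hx)).neg.congr_deriv ?_
    rw [eM]
    field_simp
  · have hx' : (x : ℂ) ≠ 0 := by exact_mod_cast hx.ne'
    have hr := HasDerivAt.ofReal_comp (hasDerivAt_id x)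
    refine ((((((dPM x).mul (hlog x hx)).add (dM x)).add (dPN x)).neg).div hr hx').congr_deriv ?_
    simp only [hWeq, id, Pi.add_apply, Pi.mul_apply, Pi.neg_apply, eM]
    field_simp
    simp
    ring
  · simp_rw [hWeq]
    have sl : Tendsto (fun x : ℝ => (M x - 1) / x) (𝓝[>] 0) (𝓝 (M' 0)) := by
      have := (hasDerivAt_iff_tendsto_slope.1 (dM 0)).mono_left
        (nhdsWithin_mono 0 (fun x hx => ne_of_gt hx : Set.Ioi (0 : ℝ) ⊆ {0}ᶜ))
      refine this.congr fun x => ?_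
      simp [slope, M0, div_eq_inv_mul]
    have cN : Tendsto N (𝓝[>] 0) (𝓝 (N 0)) :=
      tendsto_nhdsWithin_of_tendsto_nhds ((hd.hasDerivAt 0).continuousAt)
    have := ((sl.mul tendsto_mul_log_zero).add cN).neg
    rw [mul_zero, zero_add, N0, neg_sub] at this
    refine this.congr' ?_
    filter_upwards [self_mem_nhdsWithin] with x hx
    have hx' : (x : ℂ) ≠ 0 := by exact_mod_cast (ne_of_gt hx)
    field_simp
    ring
  · have c1 : Tendsto M' (𝓝[>] 0) (𝓝 (M' 0)) := tendsto_nhdsWithin_of_tendsto_nhds contM'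
    have c2 : Tendsto M (𝓝[>] 0) (𝓝 1) := by
      rw [← M0]; exact tendsto_nhdsWithin_of_tendsto_nhds (dM 0).continuousAt
    have c3 : Tendsto PN (𝓝[>] 0) (𝓝 0) := by
      rw [← PN0]; exact tendsto_nhdsWithin_of_tendsto_nhds (dPN 0).continuousAt
    have := (((c1.mul tendsto_mul_log_zero).add c2).add c3).neg
    rw [mul_zero, zero_add, add_zero] at this
    refine this.congr' ?_
    filter_upwards [self_mem_nhdsWithin] with x hx
    have hx' : (x : ℂ) ≠ 0 := by exact_mod_cast (ne_of_gt hx)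
    rw [eM]
    field_simp

end Series

/-! ### The integral representation -/

theorem integrableOn_rpow_mul_exp {σ x : ℝ} (hσ : -1 < σ) (hx : 0 < x) :
    IntegrableOn (fun t : ℝ => t ^ σ * Real.exp (-(x * t))) (Set.Ioi 0) := by
  have := integrableOn_rpow_mul_exp_neg_mul_rpow (p := 1) hσ one_pos hx
  refine this.congr_fun (fun t _ => ?_) measurableSet_Ioi
  simp

/-- Differentiation of a Laplace transform. -/
theorem hasDerivAt_laplace {g : ℝ → ℂ} (hg : Measurable g)
    (hint : ∀ x > 0, IntegrableOn (fun t : ℝ => (Real.exp (-(x * t)) : ℂ) * g t) (Set.Ioi 0))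
    {x : ℝ} (hx : 0 < x) :
    HasDerivAt (fun x : ℝ => ∫ t in Set.Ioi (0 : ℝ), (Real.exp (-(x * t)) : ℂ) * g t)
      (∫ t in Set.Ioi (0 : ℝ), (Real.exp (-(x * t)) : ℂ) * (-(t * g t))) x := by
  refine (hasDerivAt_integral_of_dominated_loc_of_deriv_le (𝕜 := ℝ)
    (F := fun (x : ℝ) (t : ℝ) => (Real.exp (-(x * t)) : ℂ) * g t)
    (F' := fun x t => (Real.exp (-(x * t)) : ℂ) * (-(t * g t)))
    (bound := fun t => (4 / x) * ‖(Real.exp (-((x / 4) * t)) : ℂ) * g t‖)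
    (s := Set.Ioi (x / 2)) (Ioi_mem_nhds (by linarith)) ?_ (hint x hx) ?_ ?_ ?_ ?_).2
  · refine Eventually.of_forall fun y => Measurable.aestronglyMeasurable ?_
    fun_prop
  · exact Measurable.aestronglyMeasurable (by fun_prop)
  · refine (ae_restrict_iff' measurableSet_Ioi).2 (Eventually.of_forall fun t ht y hy => ?_)
    have ht0 : (0 : ℝ) < t := ht
    have hy0 : x / 2 < y := hy
    rw [norm_mul, norm_neg, norm_mul, norm_mul, Complex.norm_real, Complex.norm_real,
      Complex.norm_real, Real.norm_eq_abs, Real.norm_eq_abs, Real.norm_eq_abs, Real.abs_exp,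
      Real.abs_exp, abs_of_pos ht0]
    -- For y > x/2 the exponential is split into two equal factors: one pays for the extra t of the
    -- derivative, the other keeps the bound integrable.
    have e1 : Real.exp (-(y * t)) ≤ Real.exp (-((x / 4) * t)) * Real.exp (-((x / 4) * t)) := by
      rw [← Real.exp_add]
      refine Real.exp_le_exp.2 ?_
      nlinarith
    have e2 : Real.exp (-((x / 4) * t)) * t ≤ 4 / x := by
      have := Real.add_one_le_exp ((x / 4) * t)
      have h3 : (x / 4) * t ≤ Real.exp ((x / 4) * t) := by linarith
      rw [Real.exp_neg, inv_mul_le_iff₀ (Real.exp_pos _)]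
      have hq : 0 < 4 / x := by positivity
      calc t = (x / 4) * t * (4 / x) := by field_simp
        _ ≤ _ := by gcongr
    calc _ ≤ (Real.exp (-((x / 4) * t)) * Real.exp (-((x / 4) * t))) * (t * ‖g t‖) := by gcongr
      _ = (Real.exp (-((x / 4) * t)) * t) * (Real.exp (-((x / 4) * t)) * ‖g t‖) := by ring
      _ ≤ _ := by gcongr
  · exact ((hint (x / 4) (by linarith)).norm).const_mul _
  · refine Eventually.of_forall fun t y _ => ?_
    have := ((hasDerivAt_id y).mul_const t).neg.exp.ofReal_comp.mul_const (g t)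
    refine this.congr_deriv ?_
    simp
    ring

section

variable (a : ℂ)

/-- `(t / (1 + t)) ^ a`. -/
def ratioPow (t : ℝ) : ℂ := ((t / (1 + t) : ℝ) : ℂ) ^ a

variable {a}

theorem measurable_ratioPow : Measurable (ratioPow a) := by
  unfold ratioPow
  refine Measurable.pow_const (Complex.measurable_ofReal.comp ?_) a
  fun_prop

theorem norm_ratioPow {t : ℝ} (ht : 0 < t) : ‖ratioPow a t‖ = (t / (1 + t)) ^ a.re := by
  rw [ratioPow, Complex.norm_cpow_eq_rpow_re_of_pos (by positivity)]

theorem norm_ratioPow_le_one (ha : 0 < a.re) {t : ℝ} (ht : 0 < t) : ‖ratioPow a t‖ ≤ 1 := by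
  rw [norm_ratioPow ht]
  refine Real.rpow_le_one (by positivity) ?_ ha.le
  rw [div_le_one (by positivity)]; linarith

theorem norm_ratioPow_le (ha : 0 < a.re) {t : ℝ} (ht : 0 < t) : ‖ratioPow a t‖ ≤ t ^ a.re := by
  rw [norm_ratioPow ht]
  refine Real.rpow_le_rpow (by positivity) ?_ ha.le
  exact div_le_self ht.le (by linarith)

theorem hasDerivAt_ratioPow {t : ℝ} (ht : 0 < t) :
    HasDerivAt (ratioPow a) (a * ratioPow a t / (t * (1 + t))) t := by
  have h1 : (0 : ℝ) < t / (1 + t) := by positivity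
  have ht1 : (1 : ℝ) + t ≠ 0 := by positivity
  have hd : HasDerivAt (fun t : ℝ => t / (1 + t)) (1 / (1 + t) ^ 2) t := by
    refine ((hasDerivAt_id t).div ((hasDerivAt_id t).const_add 1) ht1).congr_deriv ?_
    simp
  have h2 : HasDerivAt (fun z : ℂ => z ^ a) (a * ((t / (1 + t) : ℝ) : ℂ) ^ (a - 1))
      ((t / (1 + t) : ℝ) : ℂ) := by
    have := (hasDerivAt_id (((t / (1 + t) : ℝ) : ℂ))).cpow_const (c := a) (Or.inl h1)
    simpa using this
  have := h2.comp_of_eq t hd.ofReal_comp rfl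
  refine this.congr_deriv ?_
  have hne : ((t / (1 + t) : ℝ) : ℂ) ≠ 0 := by exact_mod_cast h1.ne'
  rw [Complex.cpow_sub _ _ hne, Complex.cpow_one, ratioPow]
  have ht' : (t : ℂ) ≠ 0 := by exact_mod_cast ht.ne'
  have ht1' : (1 : ℂ) + t ≠ 0 := by exact_mod_cast ht1
  push_cast
  field_simp

theorem tendsto_ratioPow_zero (ha : 0 < a.re) : Tendsto (ratioPow a) (𝓝[>] 0) (𝓝 0) := by
  have h1 : Tendsto (fun t : ℝ => t ^ a.re) (𝓝[>] 0) (𝓝 0) := by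
    have := (Real.continuousAt_rpow_const 0 a.re (Or.inr ha.le)).tendsto
    rw [Real.zero_rpow ha.ne'] at this
    exact tendsto_nhdsWithin_of_tendsto_nhds this
  refine squeeze_zero_norm' ?_ h1
  filter_upwards [self_mem_nhdsWithin] with t ht
  exact norm_ratioPow_le ha ht

theorem integrableOn_exp_ratioPow (ha : 0 < a.re) {x : ℝ} (hx : 0 < x) :
    IntegrableOn (fun t : ℝ => (Real.exp (-(x * t)) : ℂ) * (ratioPow a t / t)) (Set.Ioi 0) := by
  refine (integrableOn_rpow_mul_exp (σ := a.re - 1) (by linarith) hx).mono' ?_ ?_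
  · have := measurable_ratioPow (a := a)
    exact Measurable.aestronglyMeasurable (by fun_prop)
  · refine (ae_restrict_iff' measurableSet_Ioi).2 (Eventually.of_forall fun t ht => ?_)
    have ht0 : (0 : ℝ) < t := ht
    rw [norm_mul, norm_div, Complex.norm_real, Complex.norm_real, Real.norm_eq_abs,
      Real.norm_eq_abs, Real.abs_exp, abs_of_pos ht0, Real.rpow_sub ht0, Real.rpow_one, mul_comm]
    gcongr
    exact norm_ratioPow_le ha ht0

theorem integrableOn_exp_mul_bounded {g : ℝ → ℂ} (hg : Measurable g)
    (hb : ∀ t > 0, ‖g t‖ ≤ t ^ (0 : ℝ)) {x : ℝ} (hx : 0 < x) :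
    IntegrableOn (fun t : ℝ => (Real.exp (-(x * t)) : ℂ) * g t) (Set.Ioi 0) := by
  refine (integrableOn_rpow_mul_exp (σ := 0) (by norm_num) hx).mono' ?_ ?_
  · exact Measurable.aestronglyMeasurable (by fun_prop)
  · refine (ae_restrict_iff' measurableSet_Ioi).2 (Eventually.of_forall fun t ht => ?_)
    rw [norm_mul, Complex.norm_real, Real.norm_eq_abs, Real.abs_exp, mul_comm]
    gcongr
    exact hb t ht

theorem integrableOn_exp_ratioPow_zero (ha : 0 < a.re) {x : ℝ} (hx : 0 < x) :
    IntegrableOn (fun t : ℝ => (Real.exp (-(x * t)) : ℂ) * ratioPow a t) (Set.Ioi 0) :=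
  integrableOn_exp_mul_bounded measurable_ratioPow
    (fun t ht => by rw [Real.rpow_zero]; exact norm_ratioPow_le_one ha ht) hx

theorem integrableOn_exp_ratioPow_one (ha : 0 < a.re) {x : ℝ} (hx : 0 < x) :
    IntegrableOn (fun t : ℝ => (Real.exp (-(x * t)) : ℂ) * (t * ratioPow a t)) (Set.Ioi 0) := by
  refine (integrableOn_rpow_mul_exp (σ := 1) (by norm_num) hx).mono' ?_ ?_
  · have := measurable_ratioPow (a := a)
    exact Measurable.aestronglyMeasurable (by fun_prop)
  · refine (ae_restrict_iff' measurableSet_Ioi).2 (Eventually.of_forall fun t ht => ?_)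
    have ht0 : (0 : ℝ) < t := ht
    rw [norm_mul, norm_mul, Complex.norm_real, Complex.norm_real, Real.norm_eq_abs,
      Real.norm_eq_abs, Real.abs_exp, abs_of_pos ht0, Real.rpow_one, mul_comm]
    gcongr
    exact mul_le_of_le_one_right ht0.le (norm_ratioPow_le_one ha ht0)

variable (a) in
/-- `∫₀^∞ e^{-x t} t^{a-1} (1 + t)^{-a} dt`, the integral representation of `Γ(a) U(a, 1; x)`. -/
def tricomiInt (x : ℝ) : ℂ :=
  ∫ t in Set.Ioi (0 : ℝ), (Real.exp (-(x * t)) : ℂ) * (ratioPow a t / t)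

variable (a) in
/-- The derivative of `tricomiInt`. -/
def tricomiInt' (x : ℝ) : ℂ :=
  -∫ t in Set.Ioi (0 : ℝ), (Real.exp (-(x * t)) : ℂ) * ratioPow a t

theorem hasDerivAt_tricomiInt (ha : 0 < a.re) {x : ℝ} (hx : 0 < x) :
    HasDerivAt (tricomiInt a) (tricomiInt' a x) x := by
  have := measurable_ratioPow (a := a)
  refine (hasDerivAt_laplace (g := fun t => ratioPow a t / t) (by fun_prop)
    (fun x hx => integrableOn_exp_ratioPow ha hx) hx).congr_deriv ?_
  rw [tricomiInt', ← integral_neg]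
  refine setIntegral_congr_fun measurableSet_Ioi fun t ht => ?_
  have : (t : ℂ) ≠ 0 := by exact_mod_cast (ne_of_gt ht)
  field_simp

/-- Integrate the derivative of e^{-xt}(1 + t)(t/(1 + t))^a over the half-line. The factor 1 + t
clears the denominator t(1 + t) down to t. The boundary terms vanish at 0 because Re a > 0, and at
infinity by exponential decay. -/
theorem tricomiInt_identity (ha : 0 < a.re) {x : ℝ} (hx : 0 < x) :
    (x : ℂ) * ∫ t in Set.Ioi (0 : ℝ), (Real.exp (-(x * t)) : ℂ) * (t * ratioPow a t) =
      a * tricomiInt a x - (1 - x) * tricomiInt' a x := by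
  have hu : ∀ t ∈ Set.Ioi (0 : ℝ), HasDerivAt
      (fun t : ℝ => (Real.exp (-(x * t)) : ℂ) * (1 + t))
      (((-x * Real.exp (-(x * t)) : ℝ) : ℂ) * (1 + t) + (Real.exp (-(x * t)) : ℂ)) t := by
    intro t _
    have h1 := ((hasDerivAt_id t).const_mul x).neg.exp.ofReal_comp
    have h2 := (HasDerivAt.ofReal_comp (hasDerivAt_id t)).const_add (1 : ℂ)
    refine (h1.mul h2).congr_deriv ?_
    simp only [id, Pi.neg_apply]
    push_cast
    ring
  have i0 := integrableOn_exp_ratioPow ha hx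
  have i1 := integrableOn_exp_ratioPow_zero ha hx
  have i2 := integrableOn_exp_ratioPow_one ha hx
  have heq : ∀ t ∈ Set.Ioi (0 : ℝ),
      (((-x * Real.exp (-(x * t)) : ℝ) : ℂ) * (1 + t) + (Real.exp (-(x * t)) : ℂ)) * ratioPow a t +
      (Real.exp (-(x * t)) : ℂ) * (1 + t) * (a * ratioPow a t / (t * (1 + t))) =
      -x * ((Real.exp (-(x * t)) : ℂ) * (t * ratioPow a t)) +
      ((1 - x) * ((Real.exp (-(x * t)) : ℂ) * ratioPow a t) +
      a * ((Real.exp (-(x * t)) : ℂ) * (ratioPow a t / t))) := by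
    intro t ht
    have ht0 : (0 : ℝ) < t := ht
    have h1 : (t : ℂ) ≠ 0 := by exact_mod_cast ht0.ne'
    have h2 : (1 : ℂ) + t ≠ 0 := by
      have : (1 : ℝ) + t ≠ 0 := by positivity
      exact_mod_cast this
    push_cast
    field_simp
    ring
  have hI : IntegrableOn (fun t : ℝ => -x * ((Real.exp (-(x * t)) : ℂ) * (t * ratioPow a t)) +
      ((1 - x) * ((Real.exp (-(x * t)) : ℂ) * ratioPow a t) +
      a * ((Real.exp (-(x * t)) : ℂ) * (ratioPow a t / t)))) (Set.Ioi 0) :=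
    (i2.const_mul _).add ((i1.const_mul _).add (i0.const_mul _))
  have hJ : IntegrableOn (fun t : ℝ =>
      ((1 - x) * ((Real.exp (-(x * t)) : ℂ) * ratioPow a t) +
      a * ((Real.exp (-(x * t)) : ℂ) * (ratioPow a t / t)))) (Set.Ioi 0) :=
    (i1.const_mul _).add (i0.const_mul _)
  have key := integral_Ioi_deriv_mul_eq_sub (a := (0 : ℝ)) (a' := (0 : ℂ)) (b' := (0 : ℂ))
    (v := ratioPow a) hu
    (fun t ht => hasDerivAt_ratioPow ht) (hI.congr_fun (fun t ht => (heq t ht).symm)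
      measurableSet_Ioi) ?_ ?_
  · rw [setIntegral_congr_fun measurableSet_Ioi heq,
      integral_add (i2.const_mul _) hJ,
      integral_add (i1.const_mul _) (i0.const_mul _), integral_const_mul, integral_const_mul,
      integral_const_mul] at key
    simp only [tricomiInt, tricomiInt']
    linear_combination -key
  · have h1 : Tendsto (fun t : ℝ => (Real.exp (-(x * t)) : ℂ) * (1 + t)) (𝓝[>] 0)
        (𝓝 ((Real.exp (-(x * 0)) : ℂ) * (1 + (0 : ℝ)))) :=
      tendsto_nhdsWithin_of_tendsto_nhds (Continuous.tendsto (by fun_prop) 0)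
    have := h1.mul (tendsto_ratioPow_zero ha)
    rw [mul_zero] at this
    exact this
  · have h1 : Tendsto (fun t : ℝ => Real.exp (-(x * t)) * (1 + t)) atTop (𝓝 0) := by
      have e0 : Tendsto (fun t : ℝ => x * t) atTop atTop := tendsto_id.const_mul_atTop hx
      have e1 : Tendsto (fun t : ℝ => Real.exp (-(x * t))) atTop (𝓝 0) :=
        Real.tendsto_exp_neg_atTop_nhds_zero.comp e0
      have e2 : Tendsto (fun t : ℝ => x⁻¹ * ((x * t) ^ 1 * Real.exp (-(x * t)))) atTop (𝓝 0) := by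
        have := ((Real.tendsto_pow_mul_exp_neg_atTop_nhds_zero 1).comp e0).const_mul x⁻¹
        simpa using this
      have := e1.add e2
      rw [add_zero] at this
      refine this.congr fun t => ?_
      field_simp
    refine squeeze_zero_norm' ?_ h1
    filter_upwards [eventually_gt_atTop 0] with t ht
    rw [Pi.mul_apply, norm_mul, norm_mul, Complex.norm_real, Real.norm_eq_abs, Real.abs_exp]
    have : ‖(1 : ℂ) + t‖ = 1 + t := by
      have : ((1 : ℂ) + t) = ((1 + t : ℝ) : ℂ) := by push_cast; rfl
      rw [this, Complex.norm_real, Real.norm_eq_abs, abs_of_nonneg (by positivity)]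
    rw [this]
    exact mul_le_of_le_one_right (by positivity) (norm_ratioPow_le_one ha ht)

theorem hasDerivAt_tricomiInt' (ha : 0 < a.re) {x : ℝ} (hx : 0 < x) :
    HasDerivAt (tricomiInt' a) ((a * tricomiInt a x - (1 - x) * tricomiInt' a x) / x) x := by
  refine (hasDerivAt_laplace (g := fun t => ratioPow a t) measurable_ratioPow
    (fun x hx => integrableOn_exp_ratioPow_zero ha hx) hx).neg.congr_deriv ?_
  have hx' : (x : ℂ) ≠ 0 := by exact_mod_cast hx.ne'
  rw [← tricomiInt_identity ha hx, mul_div_cancel_left₀ _ hx', ← integral_neg]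
  refine setIntegral_congr_fun measurableSet_Ioi fun t _ => ?_
  ring

/-- Substituting t/x for t turns the left side into -∫ e^{-t}(t/(x + t))^a dt, and dominated
convergence gives -∫ e^{-t} dt = -1. -/
theorem tendsto_mul_tricomiInt' (ha : 0 < a.re) :
    Tendsto (fun x : ℝ => (x : ℂ) * tricomiInt' a x) (𝓝[>] 0) (𝓝 (-1)) := by
  have hsub : ∀ x : ℝ, 0 < x → -∫ t in Set.Ioi (0 : ℝ), (Real.exp (-t) : ℂ) * ratioPow a (x⁻¹ * t)
      = (x : ℂ) * tricomiInt' a x := by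
    intro x hx
    have := integral_comp_mul_left_Ioi
      (fun t => (Real.exp (-(x * t)) : ℂ) * ratioPow a t) 0 (inv_pos.2 hx)
    rw [mul_zero, inv_inv] at this
    simp only [mul_inv_cancel_left₀ hx.ne'] at this
    rw [this, tricomiInt', Complex.real_smul]
    ring
  have hl : Tendsto (fun x : ℝ => ∫ t in Set.Ioi (0 : ℝ), (Real.exp (-t) : ℂ) *
      ratioPow a (x⁻¹ * t)) (𝓝[>] 0) (𝓝 (∫ t in Set.Ioi (0 : ℝ), (Real.exp (-t) : ℂ) * 1)) := by
    refine tendsto_integral_filter_of_dominated_convergence (fun t => Real.exp (-t)) ?_ ?_ ?_ ?_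
    · refine Eventually.of_forall fun x => Measurable.aestronglyMeasurable ?_
      have := measurable_ratioPow (a := a)
      fun_prop
    · filter_upwards [self_mem_nhdsWithin] with x hx
      refine (ae_restrict_iff' measurableSet_Ioi).2 (Eventually.of_forall fun t ht => ?_)
      rw [norm_mul, Complex.norm_real, Real.norm_eq_abs, Real.abs_exp]
      exact mul_le_of_le_one_right (Real.exp_pos _).le
        (norm_ratioPow_le_one ha (mul_pos (inv_pos.2 hx) ht))
    · exact integrableOn_exp_neg_Ioi 0
    · refine (ae_restrict_iff' measurableSet_Ioi).2 (Eventually.of_forall fun t ht => ?_)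
      have ht0 : (0 : ℝ) < t := ht
      refine Tendsto.const_mul _ ?_
      have h1 : Tendsto (fun x : ℝ => ((t / (x + t) : ℝ) : ℂ)) (𝓝[>] 0) (𝓝 1) := by
        have : Tendsto (fun x : ℝ => t / (x + t)) (𝓝 0) (𝓝 (t / (0 + t))) :=
          tendsto_const_nhds.div (tendsto_id.add_const t) (by simpa using ht0.ne')
        rw [zero_add, div_self ht0.ne'] at this
        have := (Complex.continuous_ofReal.tendsto 1).comp (tendsto_nhdsWithin_of_tendsto_nhds
          (s := Set.Ioi 0) this)
        simpa [Function.comp_def] using this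
      have h2 : ContinuousAt (fun z : ℂ => z ^ a) 1 :=
        continuousAt_cpow_const (Or.inl (by simp))
      have h3 := h2.tendsto.comp h1
      simp only [Complex.one_cpow] at h3
      refine h3.congr' ?_
      filter_upwards [self_mem_nhdsWithin] with x hx
      have hx0 : (0 : ℝ) < x := hx
      simp only [Function.comp, ratioPow]
      congr 2
      field_simp
  have e1 : (∫ t in Set.Ioi (0 : ℝ), (Real.exp (-t) : ℂ) * 1) = 1 := by
    simp only [mul_one]
    rw [integral_complex_ofReal, integral_exp_neg_Ioi_zero]; simp
  rw [e1] at hl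
  refine hl.neg.congr' ?_
  filter_upwards [self_mem_nhdsWithin] with x hx
  exact hsub x hx

/-- The absolute values of both integrands decrease in x, so the integrals of these absolute values
at x = 1 are bounds and the exponent is 0. Positive exponents arise only when the parameter is
lowered. -/
theorem hasPolyGrowth_tricomiInt (ha : 0 < a.re) :
    HasPolyGrowth (tricomiInt a) (tricomiInt' a) := by
  set C1 := ∫ t in Set.Ioi (0 : ℝ), ‖(Real.exp (-(1 * t)) : ℂ) * (ratioPow a t / t)‖
  set C2 := ∫ t in Set.Ioi (0 : ℝ), ‖(Real.exp (-(1 * t)) : ℂ) * ratioPow a t‖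
  have hC1 : 0 ≤ C1 := integral_nonneg fun _ => norm_nonneg _
  have hC2 : 0 ≤ C2 := integral_nonneg fun _ => norm_nonneg _
  have gen : ∀ (g : ℝ → ℂ), IntegrableOn (fun t : ℝ => (Real.exp (-(1 * t)) : ℂ) * g t) (Set.Ioi 0) →
      ∀ x ≥ 1, ‖∫ t in Set.Ioi (0 : ℝ), (Real.exp (-(x * t)) : ℂ) * g t‖ ≤
      ∫ t in Set.Ioi (0 : ℝ), ‖(Real.exp (-(1 * t)) : ℂ) * g t‖ := by
    intro g hg x hx
    refine norm_integral_le_of_norm_le hg.norm ?_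
    refine (ae_restrict_iff' measurableSet_Ioi).2 (Eventually.of_forall fun t ht => ?_)
    have ht0 : (0 : ℝ) < t := ht
    rw [norm_mul, norm_mul, Complex.norm_real, Complex.norm_real, Real.norm_eq_abs,
      Real.norm_eq_abs, Real.abs_exp, Real.abs_exp]
    gcongr
  refine ⟨C1 + C2, 0, fun x hx => ⟨?_, ?_⟩⟩
  · have := gen (fun t => ratioPow a t / t) (integrableOn_exp_ratioPow ha one_pos) x hx
    rw [pow_zero, mul_one]
    exact this.trans (le_add_of_nonneg_right hC2)
  · have := gen (fun t => ratioPow a t) (integrableOn_exp_ratioPow_zero ha one_pos) x hx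
    rw [pow_zero, mul_one, tricomiInt', norm_neg]
    exact this.trans (le_add_of_nonneg_left hC1)

end

/-! ### Constants in the integral representation -/

theorem digamma_eq_div (s : ℂ) : Complex.digamma s = deriv Complex.Gamma s / Complex.Gamma s := by
  rw [Complex.digamma_def, logDeriv_apply]

theorem ne_neg_nat_of_re_pos {a : ℂ} (ha : 0 < a.re) (m : ℕ) : a ≠ -m := by
  intro h
  rw [h] at ha
  simp at ha
  linarith [(Nat.cast_nonneg m : (0 : ℝ) ≤ m)]

theorem hasDerivAt_Gamma_inv_shift {a : ℂ} (ha : 0 < a.re) :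
    HasDerivAt (fun ε : ℝ => Complex.Gamma a / Complex.Gamma (a + ε)) (-Complex.digamma a) 0 := by
  have hG := Complex.Gamma_ne_zero_of_re_pos ha
  have h1 : HasDerivAt Complex.Gamma (deriv Complex.Gamma a) (a + ((0 : ℝ) : ℂ)) := by
    rw [Complex.ofReal_zero, add_zero]
    exact (Complex.differentiableAt_Gamma a (ne_neg_nat_of_re_pos ha)).hasDerivAt
  have h2 := h1.comp (0 : ℝ) ((HasDerivAt.ofReal_comp (hasDerivAt_id (0 : ℝ))).const_add a)
  have h3 := (hasDerivAt_const (0 : ℝ) (Complex.Gamma a)).div h2 (by simpa using hG)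
  refine h3.congr_deriv ?_
  rw [digamma_eq_div]
  simp
  field_simp

/-- Near u = 1 the numerator is O(1 - u) by the mean value inequality; near u = 0 the power is
integrable because Re a > 0. The point 1/2 separates the two regimes. -/
theorem integrableOn_cpow_sub_one_div {a : ℂ} (ha : 0 < a.re) :
    IntegrableOn (fun u : ℝ => ((u : ℂ) ^ (a - 1) - 1) / (1 - u)) (Set.Ioo 0 1) := by
  have hmeas : Measurable (fun u : ℝ => ((u : ℂ) ^ (a - 1) - 1) / (1 - u)) := by
    have : Measurable fun u : ℝ => (u : ℂ) ^ (a - 1) :=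
      Complex.measurable_ofReal.pow_const _
    fun_prop
  have hderiv : ∀ u : ℝ, 0 < u → HasDerivAt (fun u : ℝ => (u : ℂ) ^ (a - 1))
      ((a - 1) * (u : ℂ) ^ (a - 1 - 1)) u := by
    intro u hu
    have := ((hasDerivAt_id (u : ℂ)).cpow_const (c := a - 1) (Or.inl (by simpa using hu)))
    simpa using this.comp_ofReal
  obtain ⟨C, hC⟩ := isCompact_Icc.exists_bound_of_continuousOn (s := Set.Icc (1 / 2 : ℝ) 1)
    (f := fun u : ℝ => (a - 1) * (u : ℂ) ^ (a - 1 - 1)) (by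
      refine continuousOn_const.mul fun u hu => ContinuousAt.continuousWithinAt ?_
      have hu0 : (0 : ℝ) < u := by linarith [hu.1]
      exact ContinuousAt.comp (f := fun u : ℝ => (u : ℂ)) (g := fun z : ℂ => z ^ (a - 1 - 1))
        (continuousAt_cpow_const (Or.inl (by simpa using hu0))) Complex.continuous_ofReal.continuousAt)
  have hbd : ∀ u ∈ Set.Icc (1 / 2 : ℝ) 1, ‖(u : ℂ) ^ (a - 1) - 1‖ ≤ C * (1 - u) := by
    intro u hu
    have := (convex_Icc (1 / 2 : ℝ) 1).norm_image_sub_le_of_norm_hasDerivWithin_le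
      (f := fun u : ℝ => (u : ℂ) ^ (a - 1)) (C := C) (x := 1) (y := u)
      (fun t ht => (hderiv t (by linarith [ht.1])).hasDerivWithinAt) hC
      (by constructor <;> norm_num) hu
    rw [Complex.ofReal_one, Complex.one_cpow, Real.norm_eq_abs, abs_sub_comm,
      abs_of_nonneg (by linarith [hu.2])] at this
    exact this
  have hC0 : 0 ≤ C := (norm_nonneg _).trans (hC 1 (by constructor <;> norm_num))
  have hI : IntegrableOn (fun u : ℝ => 2 * u ^ (a.re - 1) + (2 + C)) (Set.Ioo 0 1) := by
    refine Integrable.add ?_ (integrableOn_const (by simp))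
    refine Integrable.const_mul ?_ _
    have := intervalIntegral.intervalIntegrable_rpow' (a := 0) (b := 1) (r := a.re - 1)
      (by linarith)
    rwa [intervalIntegrable_iff_integrableOn_Ioo_of_le zero_le_one] at this
  refine hI.mono' hmeas.aestronglyMeasurable ?_
  refine (ae_restrict_iff' measurableSet_Ioo).2 (Eventually.of_forall fun u hu => ?_)
  have h1u : 0 < 1 - u := by linarith [hu.2]
  have en : ‖(1 : ℂ) - u‖ = 1 - u := by
    have : ((1 : ℂ) - u) = ((1 - u : ℝ) : ℂ) := by push_cast; rfl
    rw [this, Complex.norm_real, Real.norm_eq_abs, abs_of_pos h1u]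
  have hp : 0 ≤ u ^ (a.re - 1) := Real.rpow_nonneg hu.1.le _
  rw [norm_div, en, div_le_iff₀ h1u]
  rcases le_or_gt (1 / 2) u with h | h
  · refine (hbd u ⟨h, hu.2.le⟩).trans ?_
    gcongr
    linarith
  · have n1 : ‖(u : ℂ) ^ (a - 1) - 1‖ ≤ u ^ (a.re - 1) + 1 := by
      refine (norm_sub_le _ _).trans ?_
      rw [Complex.norm_cpow_eq_rpow_re_of_pos hu.1]
      simp
    refine n1.trans ?_
    nlinarith

/-- Gauss's integral for ψ. After insertion of (1 - u)^ε the two halves converge separately and are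
beta integrals. Since Γ(ε) = Γ(1 + ε)/ε, their difference is a difference of two quotients at ε = 0,
whose limits are values of -ψ. -/
theorem integral_cpow_sub_one_div {a : ℂ} (ha : 0 < a.re) :
    ∫ u in Set.Ioo (0 : ℝ) 1, ((u : ℂ) ^ (a - 1) - 1) / (1 - u) =
      Complex.digamma 1 - Complex.digamma a := by
  have hI := integrableOn_cpow_sub_one_div ha
  have hmeas : Measurable (fun u : ℝ => ((u : ℂ) ^ (a - 1) - 1) / (1 - u)) := by
    have : Measurable fun u : ℝ => (u : ℂ) ^ (a - 1) :=
      Complex.measurable_ofReal.pow_const _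
    fun_prop
  have l1 : Tendsto (fun ε : ℝ => ∫ u in Set.Ioo (0 : ℝ) 1,
      (((1 - u) ^ ε : ℝ) : ℂ) * (((u : ℂ) ^ (a - 1) - 1) / (1 - u))) (𝓝[>] 0)
      (𝓝 (∫ u in Set.Ioo (0 : ℝ) 1, ((u : ℂ) ^ (a - 1) - 1) / (1 - u))) := by
    refine tendsto_integral_filter_of_dominated_convergence
      (fun u => ‖((u : ℂ) ^ (a - 1) - 1) / (1 - u)‖) ?_ ?_ hI.norm ?_
    · refine Eventually.of_forall fun ε => Measurable.aestronglyMeasurable ?_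
      have : Measurable fun u : ℝ => (1 - u) ^ ε := Measurable.pow_const (by fun_prop) _
      exact (Complex.measurable_ofReal.comp this).mul hmeas
    · filter_upwards [self_mem_nhdsWithin] with ε hε
      refine (ae_restrict_iff' measurableSet_Ioo).2 (Eventually.of_forall fun u hu => ?_)
      have h1u : 0 < 1 - u := by linarith [hu.2]
      rw [norm_mul, Complex.norm_real, Real.norm_eq_abs, abs_of_nonneg (Real.rpow_nonneg h1u.le _)]
      exact mul_le_of_le_one_left (norm_nonneg _)
        (Real.rpow_le_one h1u.le (by linarith [hu.1]) (le_of_lt hε))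
    · refine (ae_restrict_iff' measurableSet_Ioo).2 (Eventually.of_forall fun u hu => ?_)
      have h1u : 0 < 1 - u := by linarith [hu.2]
      have c1 : Tendsto (fun ε : ℝ => (1 - u) ^ ε) (𝓝[>] 0) (𝓝 1) := by
        have := (Real.continuousAt_const_rpow (a := 1 - u) (b := 0) h1u.ne').tendsto
        rw [Real.rpow_zero] at this
        exact tendsto_nhdsWithin_of_tendsto_nhds this
      have c2 := ((Complex.continuous_ofReal.tendsto 1).comp c1).mul_const
        (((u : ℂ) ^ (a - 1) - 1) / (1 - u))
      rw [Complex.ofReal_one, one_mul] at c2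
      exact c2
  have hbeta : ∀ ε : ℝ, 0 < ε → ∫ u in Set.Ioo (0 : ℝ) 1,
      (((1 - u) ^ ε : ℝ) : ℂ) * (((u : ℂ) ^ (a - 1) - 1) / (1 - u)) =
      Complex.betaIntegral a ε - Complex.betaIntegral 1 ε := by
    intro ε hε
    have hεre : 0 < (ε : ℂ).re := by simpa using hε
    have i1 := Complex.betaIntegral_convergent ha hεre
    have i2 := Complex.betaIntegral_convergent (u := 1) (v := ε) (by simp) hεre
    rw [Complex.betaIntegral, Complex.betaIntegral, ← intervalIntegral.integral_sub i1 i2,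
      intervalIntegral.integral_of_le zero_le_one, ← integral_Ioc_eq_integral_Ioo]
    rw [integral_Ioc_eq_integral_Ioo, integral_Ioc_eq_integral_Ioo]
    refine setIntegral_congr_fun measurableSet_Ioo fun u hu => ?_
    have h1u : 0 < 1 - u := by linarith [hu.2]
    have e1 : (1 : ℂ) - u = ((1 - u : ℝ) : ℂ) := by push_cast; rfl
    have hne : ((1 - u : ℝ) : ℂ) ≠ 0 := by exact_mod_cast h1u.ne'
    rw [e1, Complex.cpow_sub _ _ hne, Complex.cpow_one, Complex.ofReal_cpow h1u.le]
    simp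
    field_simp
  have hgam : ∀ ε : ℝ, 0 < ε → Complex.betaIntegral a ε - Complex.betaIntegral 1 ε =
      Complex.Gamma (1 + ε) * ((Complex.Gamma a / Complex.Gamma (a + ε) - 1) / ε -
        (Complex.Gamma 1 / Complex.Gamma (1 + ε) - 1) / ε) := by
    intro ε hε
    have hεre : 0 < (ε : ℂ).re := by simpa using hε
    have b1 := Complex.Gamma_mul_Gamma_eq_betaIntegral ha hεre
    have b2 := Complex.Gamma_mul_Gamma_eq_betaIntegral (s := 1) (t := ε) (by simp) hεre
    have hne : (ε : ℂ) ≠ 0 := by exact_mod_cast hε.ne'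
    have g1 : Complex.Gamma (a + ε) ≠ 0 := Complex.Gamma_ne_zero_of_re_pos (by simp; linarith)
    have g2 : Complex.Gamma (1 + ε) ≠ 0 := Complex.Gamma_ne_zero_of_re_pos (by simp; linarith)
    have g3 : Complex.Gamma (1 + ε) = ε * Complex.Gamma ε := by
      rw [add_comm, Complex.Gamma_add_one _ hne]
    have b1' : Complex.betaIntegral a ε = Complex.Gamma a * Complex.Gamma ε / Complex.Gamma (a + ε) := by
      rw [b1]; field_simp
    have b2' : Complex.betaIntegral 1 ε = Complex.Gamma 1 * Complex.Gamma ε / Complex.Gamma (1 + ε) := by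
      rw [b2]; field_simp
    rw [b1', b2', g3] at *
    have g4 : Complex.Gamma ε ≠ 0 := Complex.Gamma_ne_zero_of_re_pos hεre
    field_simp
    ring
  have slope : ∀ b : ℂ, 0 < b.re → Tendsto (fun ε : ℝ =>
      (Complex.Gamma b / Complex.Gamma (b + ε) - 1) / ε) (𝓝[>] 0) (𝓝 (-Complex.digamma b)) := by
    intro b hb
    have hG := Complex.Gamma_ne_zero_of_re_pos hb
    have := (hasDerivAt_iff_tendsto_slope.1 (hasDerivAt_Gamma_inv_shift hb)).mono_left
      (nhdsWithin_mono 0 (fun x hx => ne_of_gt hx : Set.Ioi (0 : ℝ) ⊆ {0}ᶜ))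
    refine this.congr fun x => ?_
    simp [_root_.slope, div_eq_inv_mul, hG]
  have l2 : Tendsto (fun ε : ℝ => Complex.Gamma (1 + ε) *
      ((Complex.Gamma a / Complex.Gamma (a + ε) - 1) / ε -
        (Complex.Gamma 1 / Complex.Gamma (1 + ε) - 1) / ε)) (𝓝[>] 0)
      (𝓝 (1 * (-Complex.digamma a - -Complex.digamma 1))) := by
    refine Tendsto.mul ?_ ((slope a ha).sub (slope 1 (by simp)))
    have c : ContinuousAt Complex.Gamma 1 :=
      (Complex.differentiableAt_Gamma 1 (ne_neg_nat_of_re_pos (by simp))).continuousAt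
    have c2 : Tendsto (fun ε : ℝ => (1 : ℂ) + ε) (𝓝[>] 0) (𝓝 1) := by
      simpa using (tendsto_ofReal_nhdsGT_zero.const_add (1 : ℂ))
    have := c.tendsto.comp c2
    rwa [Complex.Gamma_one] at this
  have l3 := l2.congr' (f₂ := fun ε : ℝ => ∫ u in Set.Ioo (0 : ℝ) 1,
      (((1 - u) ^ ε : ℝ) : ℂ) * (((u : ℂ) ^ (a - 1) - 1) / (1 - u))) (by
    filter_upwards [self_mem_nhdsWithin] with ε hε
    rw [hbeta ε hε, hgam ε hε])
  rw [tendsto_nhds_unique l1 l3]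
  ring

/-- The substitution t = u/(1 - u) reduces this to Gauss's integral. Subtracting 1/(1 + t) removes
the slow decay at infinity, which is what makes the Laplace integral diverge logarithmically at x =
0. -/
theorem ratioPow_sub_integral {a : ℂ} (ha : 0 < a.re) :
    IntegrableOn (fun t : ℝ => ratioPow a t / t - 1 / (1 + t)) (Set.Ioi 0) ∧
    ∫ t in Set.Ioi (0 : ℝ), (ratioPow a t / t - 1 / (1 + t)) =
      Complex.digamma 1 - Complex.digamma a := by
  set f : ℝ → ℝ := fun u => u / (1 - u)
  have himg : f '' Set.Ioo 0 1 = Set.Ioi 0 := by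
    ext t
    constructor
    · rintro ⟨u, hu, rfl⟩
      exact div_pos hu.1 (by linarith [hu.2])
    · intro ht
      have ht0 : (0 : ℝ) < t := ht
      refine ⟨t / (1 + t), ⟨by positivity, ?_⟩, ?_⟩
      · rw [div_lt_one (by positivity)]; linarith
      · simp only [f]; field_simp; ring
  have hd : ∀ u ∈ Set.Ioo (0 : ℝ) 1, HasDerivWithinAt f (1 / (1 - u) ^ 2) (Set.Ioo 0 1) u := by
    intro u hu
    have h1u : 1 - u ≠ 0 := by linarith [hu.2]
    refine (((hasDerivAt_id u).div ((hasDerivAt_id u).const_sub 1) h1u).congr_deriv ?_).hasDerivWithinAt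
    simp
  have hinj : Set.InjOn f (Set.Ioo 0 1) := by
    intro u hu v hv h
    have h1u : 1 - u ≠ 0 := by linarith [hu.2]
    have h1v : 1 - v ≠ 0 := by linarith [hv.2]
    simp only [f] at h
    rw [div_eq_div_iff h1u h1v] at h
    linarith
  have heq : ∀ u ∈ Set.Ioo (0 : ℝ) 1, ((u : ℂ) ^ (a - 1) - 1) / (1 - u) =
      |1 / (1 - u) ^ 2| • (ratioPow a (f u) / (f u : ℝ) - 1 / (1 + (f u : ℝ))) := by
    intro u hu
    have h1u : 0 < 1 - u := by linarith [hu.2]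
    have e0 : f u / (1 + f u) = u := by simp only [f]; field_simp; ring
    have hu' : (u : ℂ) ≠ 0 := by exact_mod_cast hu.1.ne'
    have h1u' : (1 : ℂ) - u ≠ 0 := by exact_mod_cast h1u.ne'
    rw [ratioPow, e0, abs_of_pos (by positivity), Complex.real_smul, Complex.cpow_sub _ _ hu',
      Complex.cpow_one]
    have e1 : 1 + ((f u : ℝ) : ℂ) = 1 / (1 - u) := by
      simp only [f]; push_cast; field_simp; ring
    rw [e1]
    simp only [f]
    push_cast
    field_simp
  constructor
  · rw [← himg, integrableOn_image_iff_integrableOn_abs_deriv_smul measurableSet_Ioo hd hinj]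
    exact (integrableOn_cpow_sub_one_div ha).congr_fun heq measurableSet_Ioo
  · rw [← himg, integral_image_eq_integral_abs_deriv_smul measurableSet_Ioo hd hinj,
      ← setIntegral_congr_fun measurableSet_Ioo heq, integral_cpow_sub_one_div ha]

theorem integrableOn_log_mul_exp :
    IntegrableOn (fun t : ℝ => |Real.log t| * Real.exp (-t)) (Set.Ioi 0) := by
  have h1 := integrableOn_rpow_mul_exp (σ := 1) (x := 1) (by norm_num) one_pos
  have h2 := integrableOn_rpow_mul_exp (σ := -1 / 2) (x := 1) (by norm_num) one_pos
  refine (h1.add (h2.const_mul 2)).mono' (Measurable.aestronglyMeasurable (by fun_prop)) ?_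
  refine (ae_restrict_iff' measurableSet_Ioi).2 (Eventually.of_forall fun t ht => ?_)
  have ht0 : (0 : ℝ) < t := ht
  have b : |Real.log t| ≤ t + 2 * t ^ (-1 / 2 : ℝ) := by
    have hp : 0 ≤ t ^ (-1 / 2 : ℝ) := Real.rpow_nonneg ht0.le _
    rw [abs_le]
    constructor
    -- For small t the inequality log y ≤ y - 1 is used at y = t^(-1/2), which bounds -log t by an
    -- integrable power.
    · have := Real.log_le_sub_one_of_pos (Real.rpow_pos_of_pos ht0 (-1 / 2))
      rw [Real.log_rpow ht0] at this
      linarith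
    · have := Real.log_le_sub_one_of_pos ht0
      linarith
  simp only [Pi.add_apply, Real.norm_eq_abs, one_mul, Real.rpow_one]
  rw [abs_of_nonneg (by positivity)]
  calc _ ≤ (t + 2 * t ^ (-1 / 2 : ℝ)) * Real.exp (-t) := by gcongr
    _ = _ := by ring

/-- Differentiate Euler's integral for Γ under the integral sign at 1 and use Γ(1) = 1. -/
theorem integral_log_mul_exp :
    ((∫ t in Set.Ioi (0 : ℝ), Real.log t * Real.exp (-t) : ℝ) : ℂ) = Complex.digamma 1 := by
  have h1 := Complex.hasDerivAt_GammaIntegral (s := 1) (by simp)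
  have h2 : HasDerivAt Complex.Gamma (∫ t : ℝ in Set.Ioi 0, (t : ℂ) ^ ((1 : ℂ) - 1) *
      (Real.log t * Real.exp (-t))) 1 := by
    refine h1.congr_of_eventuallyEq ?_
    have : {s : ℂ | 0 < s.re} ∈ 𝓝 (1 : ℂ) :=
      (isOpen_lt continuous_const Complex.continuous_re).mem_nhds (by simp)
    filter_upwards [this] with s hs
    exact Complex.Gamma_eq_integral hs
  rw [digamma_eq_div, h2.deriv, Complex.Gamma_one, div_one, ← integral_complex_ofReal]
  refine integral_congr_ae (Eventually.of_forall fun t => ?_)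
  simp

/-- Rescaling gives ∫ e^{-t}/(x + t) dt. Integration by parts splits off -log x and leaves ∫ log(x +
t) e^{-t} dt, which converges to Γ'(1) = ψ(1). -/
theorem tendsto_laplace_inv_one_add :
    Tendsto (fun x : ℝ => (∫ t in Set.Ioi (0 : ℝ), (Real.exp (-(x * t)) : ℂ) * (1 / (1 + t))) +
      (Real.log x : ℂ)) (𝓝[>] 0) (𝓝 (Complex.digamma 1)) := by
  have hsub : ∀ x : ℝ, 0 < x → ∫ t in Set.Ioi (0 : ℝ), Real.exp (-(x * t)) * (1 / (1 + t)) =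
      ∫ t in Set.Ioi (0 : ℝ), Real.exp (-t) * (1 / (x + t)) := by
    intro x hx
    have := integral_comp_mul_left_Ioi (fun t => Real.exp (-t) * (1 / (x + t))) 0 hx
    rw [mul_zero] at this
    rw [← mul_right_inj' (inv_ne_zero hx.ne'), ← smul_eq_mul x⁻¹ (∫ t in Set.Ioi (0 : ℝ),
      Real.exp (-t) * (1 / (x + t))), ← this, ← integral_const_mul]
    refine setIntegral_congr_fun measurableSet_Ioi fun t ht => ?_
    have ht0 : (0 : ℝ) < t := ht
    field_simp
  have hlogb : ∀ x ∈ Set.Ioo (0 : ℝ) 1, ∀ t > 0, |Real.log (x + t)| ≤ |Real.log t| + t := by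
    intro x hx t ht
    have u1 : Real.log t ≤ Real.log (x + t) := Real.log_le_log ht (by linarith [hx.1])
    have u2 : Real.log (x + t) ≤ t := by
      have := Real.log_le_sub_one_of_pos (x := x + t) (by linarith [hx.1])
      linarith [hx.2]
    rw [abs_le]
    constructor
    · linarith [neg_abs_le (Real.log t)]
    · linarith [abs_nonneg (Real.log t)]
  have hbi : IntegrableOn (fun t : ℝ => (|Real.log t| + t) * Real.exp (-t)) (Set.Ioi 0) := by
    have h1 := integrableOn_rpow_mul_exp (σ := 1) (x := 1) (by norm_num) one_pos
    refine (integrableOn_log_mul_exp.add h1).congr_fun (fun t _ => ?_) measurableSet_Ioi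
    simp; ring
  have hlogi : ∀ x ∈ Set.Ioo (0 : ℝ) 1,
      IntegrableOn (fun t : ℝ => Real.log (x + t) * Real.exp (-t)) (Set.Ioi 0) := by
    intro x hx
    refine hbi.mono' (Measurable.aestronglyMeasurable (by fun_prop)) ?_
    refine (ae_restrict_iff' measurableSet_Ioi).2 (Eventually.of_forall fun t ht => ?_)
    rw [norm_mul, Real.norm_eq_abs, Real.norm_eq_abs, Real.abs_exp]
    gcongr
    exact hlogb x hx t ht
  have hparts : ∀ x ∈ Set.Ioo (0 : ℝ) 1,
      ∫ t in Set.Ioi (0 : ℝ), Real.exp (-t) * (1 / (x + t)) =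
      -Real.log x + ∫ t in Set.Ioi (0 : ℝ), Real.log (x + t) * Real.exp (-t) := by
    intro x hx
    have hx0 := hx.1
    have key := integral_Ioi_mul_deriv_eq_deriv_mul (a := (0 : ℝ)) (a' := Real.log x) (b' := 0)
      (u := fun t => Real.exp (-t)) (u' := fun t => -Real.exp (-t))
      (v := fun t => Real.log (x + t)) (v' := fun t => 1 / (x + t)) ?_ ?_ ?_ ?_ ?_ ?_
    · rw [key, zero_sub, sub_eq_add_neg, ← integral_neg]
      congr 1
      refine integral_congr_ae (Eventually.of_forall fun t => ?_)
      simp only; ring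
    · intro t _
      simpa using (hasDerivAt_id t).neg.exp
    · intro t ht
      have ht0 : (0 : ℝ) < t := ht
      exact ((hasDerivAt_id t).const_add x).log (by simp; linarith)
    · have := (integrableOn_rpow_mul_exp (σ := 0) (x := 1) (by norm_num) one_pos).const_mul x⁻¹
      refine this.mono' (Measurable.aestronglyMeasurable (by fun_prop)) ?_
      refine (ae_restrict_iff' measurableSet_Ioi).2 (Eventually.of_forall fun t ht => ?_)
      have ht0 : (0 : ℝ) < t := ht
      rw [Pi.mul_apply, Real.norm_eq_abs, abs_of_nonneg (by positivity), Real.rpow_zero, one_mul,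
        one_mul, mul_comm, one_div]
      gcongr
      linarith
    · refine ((hlogi x hx).neg).congr_fun (fun t _ => ?_) measurableSet_Ioi
      simp; ring
    · have : Tendsto (fun t => Real.exp (-t) * Real.log (x + t)) (𝓝[>] 0)
          (𝓝 (Real.exp (-0) * Real.log (x + 0))) := by
        refine tendsto_nhdsWithin_of_tendsto_nhds ?_
        refine ContinuousAt.tendsto (f := fun t => Real.exp (-t) * Real.log (x + t)) ?_
        refine ContinuousAt.mul (by fun_prop) (ContinuousAt.log (by fun_prop) (by simpa using hx0.ne'))
      rw [neg_zero, Real.exp_zero, one_mul, add_zero] at this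
      exact this
    · have h0 : Tendsto (fun t : ℝ => (t + 1) * Real.exp (-t)) atTop (𝓝 0) := by
        have := (Real.tendsto_pow_mul_exp_neg_atTop_nhds_zero 1).add
          Real.tendsto_exp_neg_atTop_nhds_zero
        rw [add_zero] at this
        refine this.congr fun t => ?_
        ring
      refine squeeze_zero_norm' ?_ h0
      filter_upwards [eventually_gt_atTop 1] with t ht
      rw [Pi.mul_apply, norm_mul, Real.norm_eq_abs, Real.norm_eq_abs, Real.abs_exp, mul_comm]
      gcongr
      rw [abs_of_nonneg (Real.log_nonneg (by linarith))]
      have := Real.log_le_sub_one_of_pos (x := x + t) (by linarith)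
      linarith [hx.2]
  have hlim : Tendsto (fun x : ℝ => ∫ t in Set.Ioi (0 : ℝ), Real.log (x + t) * Real.exp (-t))
      (𝓝[>] 0) (𝓝 (∫ t in Set.Ioi (0 : ℝ), Real.log t * Real.exp (-t))) := by
    refine tendsto_integral_filter_of_dominated_convergence
      (fun t => (|Real.log t| + t) * Real.exp (-t)) ?_ ?_ hbi ?_
    · exact Eventually.of_forall fun x => Measurable.aestronglyMeasurable (by fun_prop)
    · filter_upwards [Ioo_mem_nhdsGT one_pos] with x hx
      refine (ae_restrict_iff' measurableSet_Ioi).2 (Eventually.of_forall fun t ht => ?_)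
      rw [norm_mul, Real.norm_eq_abs, Real.norm_eq_abs, Real.abs_exp]
      gcongr
      exact hlogb x hx t ht
    · refine (ae_restrict_iff' measurableSet_Ioi).2 (Eventually.of_forall fun t ht => ?_)
      have ht0 : (0 : ℝ) < t := ht
      refine Tendsto.mul_const _ ?_
      refine tendsto_nhdsWithin_of_tendsto_nhds ?_
      have : ContinuousAt (fun x : ℝ => Real.log (x + t)) 0 :=
        ContinuousAt.log (by fun_prop) (by simpa using ht0.ne')
      simpa using this.tendsto
  have h2 := (Complex.continuous_ofReal.tendsto _).comp hlim
  rw [integral_log_mul_exp] at h2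
  refine h2.congr' ?_
  filter_upwards [Ioo_mem_nhdsGT one_pos] with x hx
  have e : ∫ t in Set.Ioi (0 : ℝ), (Real.exp (-(x * t)) : ℂ) * (1 / (1 + t)) =
      ((∫ t in Set.Ioi (0 : ℝ), Real.exp (-(x * t)) * (1 / (1 + t)) : ℝ) : ℂ) := by
    rw [← integral_complex_ofReal]
    refine integral_congr_ae (Eventually.of_forall fun t => ?_)
    push_cast; rfl
  rw [e, hsub x hx.1, hparts x hx, Function.comp]
  push_cast
  ring

/-- Only the constant at 0 needs an argument. The density t^{-1}(t/(1 + t))^a is split into 1/(1 +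
t) and an integrable remainder: the first contributes -log x + ψ(1), the second ψ(1) - ψ(a). -/
theorem isTricomiSol_tricomiInt {a : ℂ} (ha : 0 < a.re) :
    IsTricomiSol a (2 * Complex.digamma 1 - Complex.digamma a) (tricomiInt a) (tricomiInt' a) := by
  refine ⟨fun x hx => hasDerivAt_tricomiInt ha hx, fun x hx => hasDerivAt_tricomiInt' ha hx, ?_,
    tendsto_mul_tricomiInt' ha⟩
  obtain ⟨hi, hv⟩ := ratioPow_sub_integral ha
  have hm := measurable_ratioPow (a := a)
  have l1 : Tendsto (fun x : ℝ => ∫ t in Set.Ioi (0 : ℝ), (Real.exp (-(x * t)) : ℂ) *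
      (ratioPow a t / t - 1 / (1 + t))) (𝓝[>] 0) (𝓝 (Complex.digamma 1 - Complex.digamma a)) := by
    rw [← hv]
    refine tendsto_integral_filter_of_dominated_convergence
      (fun t => ‖ratioPow a t / t - 1 / (1 + t)‖) ?_ ?_ hi.norm ?_
    · exact Eventually.of_forall fun x => Measurable.aestronglyMeasurable (by fun_prop)
    · filter_upwards [self_mem_nhdsWithin] with x hx
      refine (ae_restrict_iff' measurableSet_Ioi).2 (Eventually.of_forall fun t ht => ?_)
      rw [norm_mul, Complex.norm_real, Real.norm_eq_abs, Real.abs_exp]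
      refine mul_le_of_le_one_left (norm_nonneg _) (Real.exp_le_one_iff.2 ?_)
      have : 0 < x * t := mul_pos hx ht
      linarith
    · refine Eventually.of_forall fun t => ?_
      have : Tendsto (fun x : ℝ => (Real.exp (-(x * t)) : ℂ)) (𝓝[>] 0)
          (𝓝 (Real.exp (-(0 * t)) : ℂ)) :=
        tendsto_nhdsWithin_of_tendsto_nhds (Continuous.tendsto (by fun_prop) 0)
      simpa using this.mul_const (ratioPow a t / t - 1 / (1 + t))
  have := l1.add tendsto_laplace_inv_one_add
  rw [show Complex.digamma 1 - Complex.digamma a + Complex.digamma 1 =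
    2 * Complex.digamma 1 - Complex.digamma a by ring] at this
  refine this.congr' ?_
  filter_upwards [self_mem_nhdsWithin] with x hx
  have i1 := integrableOn_exp_ratioPow ha hx
  have i2 : IntegrableOn (fun t : ℝ => (Real.exp (-(x * t)) : ℂ) * (1 / (1 + t))) (Set.Ioi 0) := by
    refine integrableOn_exp_mul_bounded (g := fun t : ℝ => 1 / ((1 : ℂ) + t)) (by fun_prop)
      (fun t ht => ?_) hx
    have : ‖(1 : ℂ) + t‖ = 1 + t := by
      have : ((1 : ℂ) + t) = ((1 + t : ℝ) : ℂ) := by push_cast; rfl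
      rw [this, Complex.norm_real, Real.norm_eq_abs, abs_of_nonneg (by positivity)]
    rw [norm_div, this, norm_one, Real.rpow_zero, div_le_one (by positivity)]
    linarith
  rw [← add_assoc, tricomiInt]
  congr 1
  rw [← integral_add _ i2]
  · refine integral_congr_ae (Eventually.of_forall fun t => ?_)
    simp only; ring
  · refine (i1.sub i2).congr_fun (fun t _ => ?_) measurableSet_Ioi
    simp only [Pi.sub_apply]; ring

/-- `Γ(a) U(a, 1; x)` has polynomial growth. -/
theorem exists_isTricomiSol_hasPolyGrowth (n : ℕ) : ∀ a : ℂ, -(n : ℝ) < a.re → (∀ m : ℕ, a ≠ -m) →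
    ∃ W W', IsTricomiSol a (2 * Complex.digamma 1 - Complex.digamma a) W W' ∧
      HasPolyGrowth W W' := by
  induction n with
  | zero =>
    intro a ha _
    have ha' : 0 < a.re := by simpa using ha
    exact ⟨_, _, isTricomiSol_tricomiInt ha', hasPolyGrowth_tricomiInt ha'⟩
  | succ n ih =>
    intro a ha hne
    obtain ⟨W, W', h1, h2⟩ := ih (a + 1) (by push_cast at ha; simp; linarith)
      (fun m => by
        have := add_nat_ne_neg hne 1 m
        simpa using this)
    have ha0 : a ≠ 0 := by simpa using hne 0
    have h3 := h1.lower (by simpa using ha0)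
    refine ⟨_, _, ?_, h2.lower (a + 1)⟩
    have e1 : a + 1 - 1 = a := by ring
    -- The constant produced by lowering a + 1 to a is the right one, by the functional equation of
    -- ψ.
    have e2 : 2 * Complex.digamma 1 - Complex.digamma (a + 1) + (a + 1 - 1)⁻¹ =
        2 * Complex.digamma 1 - Complex.digamma a := by
      rw [Complex.digamma_apply_add_one a hne, e1]; ring
    rw [e2] at h3
    rw [← e1]
    rw [← e1] at h3
    simpa using h3

/-- The series says nothing useful about large x. The solution obtained from the Laplace integral by
lowering has the same data at 0, so uniqueness transfers its growth bound to the series. -/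
theorem isTricomiSol_kummerUOne {a : ℂ} (ha : ∀ m : ℕ, a ≠ -m) :
    ∃ W' : ℝ → ℂ, IsTricomiSol a (2 * Complex.digamma 1 - Complex.digamma a)
      (fun x => Complex.Gamma a * kummerUOne a x) W' ∧
      HasPolyGrowth (fun x => Complex.Gamma a * kummerUOne a x) W' := by
  obtain ⟨W', h1⟩ := isTricomiSol_series ha
  obtain ⟨n, hn⟩ := exists_nat_gt (-a.re)
  obtain ⟨V, V', h2, C, N, h3⟩ := exists_isTricomiSol_hasPolyGrowth n a (by linarith) ha
  refine ⟨W', h1, C, N, fun x hx => ?_⟩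
  obtain ⟨e1, e2⟩ := h1.unique h2 x (by linarith)
  simp only [e1, e2]
  exact h3 x hx

/-! ### Complex conjugation in the special functions -/

theorem digamma_conj (s : ℂ) :
    Complex.digamma (starRingEnd ℂ s) = starRingEnd ℂ (Complex.digamma s) := by
  rw [digamma_eq_div, digamma_eq_div, map_div₀, Complex.Gamma_conj]
  congr 1
  have : Complex.Gamma = starRingEnd ℂ ∘ Complex.Gamma ∘ starRingEnd ℂ := by
    funext s
    simp [Complex.Gamma_conj]
  conv_lhs => rw [this]
  rw [deriv_conj_conj]
  simp

theorem kummerUOne_conj (a : ℂ) (x : ℝ) :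
    kummerUOne (starRingEnd ℂ a) x = starRingEnd ℂ (kummerUOne a x) := by
  simp only [kummerUOne, map_mul, map_neg, map_inv₀, Complex.conj_tsum]
  rw [Complex.Gamma_conj]
  congr 1
  refine tsum_congr fun k => ?_
  have e1 : (ascPochhammer ℂ k).eval (starRingEnd ℂ a) =
      starRingEnd ℂ ((ascPochhammer ℂ k).eval a) := by
    induction k with
    | zero => simp
    | succ k ih => simp [ascPochhammer_succ_eval, ih]
  have e2 : Complex.digamma (starRingEnd ℂ a + k) = starRingEnd ℂ (Complex.digamma (a + k)) := by
    rw [← digamma_conj]; simp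
  have e3 : starRingEnd ℂ (Complex.digamma (1 + k)) = Complex.digamma (1 + k) := by
    rw [← digamma_conj]; simp
  have e4 : starRingEnd ℂ 2 = 2 := Complex.conj_ofNat 2
  rw [e1, e2]
  simp only [map_mul, map_sub, map_add, map_div₀, map_pow, Complex.conj_ofReal, map_natCast, e3, e4]

/-! ### The radial profile of the Green function -/

/-- `z` is not a Landau level `(2 m + 1) h`. -/
def NotLevel (h : ℝ) (z : ℂ) : Prop := ∀ m : ℕ, (1 / 2 - z / (2 * h) : ℂ) ≠ -m

/-- The Green function as a function of the squared distance, up to the gauge factor. -/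
def radial (h : ℝ) (z : ℂ) (s : ℝ) : ℂ :=
  1 / (4 * Real.pi) * (Real.exp (-(h * s / 4)) : ℂ) *
    (Complex.Gamma (1 / 2 - z / (2 * h)) * kummerUOne (1 / 2 - z / (2 * h)) (h * s / 2))

theorem exists_norm_le_of_tendsto {f : ℝ → ℂ} {l m : ℂ} (hf : ContinuousOn f (Set.Ioi 0))
    (h0 : Tendsto f (𝓝[>] 0) (𝓝 l)) (h1 : Tendsto f atTop (𝓝 m)) :
    ∃ C, ∀ s > 0, ‖f s‖ ≤ C := by
  have e0 := h0.norm.eventually (Iic_mem_nhds (lt_add_one ‖l‖))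
  have e1 := h1.norm.eventually (Iic_mem_nhds (lt_add_one ‖m‖))
  obtain ⟨δ, hδ, hs⟩ := mem_nhdsGT_iff_exists_Ioo_subset.1 e0
  obtain ⟨R, hR⟩ := eventually_atTop.1 e1
  have hδ0 : (0 : ℝ) < δ := hδ
  obtain ⟨C, hC⟩ := isCompact_Icc.exists_bound_of_continuousOn (s := Set.Icc δ R)
    (hf.mono fun s hs => lt_of_lt_of_le hδ0 hs.1)
  refine ⟨max (max (‖l‖ + 1) (‖m‖ + 1)) C, fun s hs0 => ?_⟩
  rcases lt_or_ge s δ with h | h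
  · exact (hs ⟨hs0, h⟩ : ‖f s‖ ≤ ‖l‖ + 1).trans ((le_max_left _ _).trans (le_max_left _ _))
  rcases lt_or_ge R s with h' | h'
  · exact (hR s h'.le : ‖f s‖ ≤ ‖m‖ + 1).trans ((le_max_right _ _).trans (le_max_left _ _))
  · exact (hC s ⟨h, h'⟩).trans (le_max_right _ _)

/-- The factor x^(1/4) beats the logarithm at 0 and e^{-x/4} beats the polynomial growth, so the
products have finite limits at both ends. The exponent 1/4 is small enough for the resulting kernel
bound s^(-1/4) to be locally square integrable in the plane. -/
theorem IsTricomiSol.exists_bound {a c : ℂ} {W W' : ℝ → ℂ} (hW : IsTricomiSol a c W W')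
    (hg : HasPolyGrowth W W') :
    ∃ C, ∀ x > 0, x ^ (1 / 4 : ℝ) * ‖W x‖ * Real.exp (-(x / 4)) ≤ C ∧
      x * ‖W' x‖ * Real.exp (-(x / 4)) ≤ C ∧ x * ‖W x‖ * Real.exp (-(x / 4)) ≤ C := by
  obtain ⟨C, N, hCN⟩ := hg
  have htop : Tendsto (fun x : ℝ => C * x ^ (N + 1) * Real.exp (-(x / 4))) atTop (𝓝 0) := by
    have h4 : Tendsto (fun x : ℝ => x / 4) atTop atTop := tendsto_id.atTop_div_const (by norm_num)
    have := ((Real.tendsto_pow_mul_exp_neg_atTop_nhds_zero (N + 1)).comp h4).const_mul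
      (C * 4 ^ (N + 1))
    rw [mul_zero] at this
    refine this.congr fun x => ?_
    simp only [Function.comp]
    rw [div_pow]
    field_simp
  have hC : 0 ≤ C := by
    have := (norm_nonneg _).trans (hCN 1 le_rfl).1
    simpa using this
  have contW : ContinuousOn W (Set.Ioi 0) := fun x hx =>
    (hW.deriv x hx).continuousAt.continuousWithinAt
  have contW' : ContinuousOn W' (Set.Ioi 0) := fun x hx =>
    (hW.deriv2 x hx).continuousAt.continuousWithinAt
  have hexp0 : Tendsto (fun x : ℝ => (Real.exp (-(x / 4)) : ℂ)) (𝓝[>] 0) (𝓝 1) := by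
    have : Tendsto (fun x : ℝ => (Real.exp (-(x / 4)) : ℂ)) (𝓝[>] 0) (𝓝 (Real.exp (-(0 / 4)) : ℂ)) :=
      tendsto_nhdsWithin_of_tendsto_nhds (Continuous.tendsto (by fun_prop) 0)
    simpa using this
  have hr : ContinuousOn (fun x : ℝ => ((x ^ (1 / 4 : ℝ) : ℝ) : ℂ)) (Set.Ioi 0) := by
    refine Complex.continuous_ofReal.comp_continuousOn ?_
    exact ContinuousOn.rpow_const continuousOn_id fun x hx => Or.inl (ne_of_gt hx)
  obtain ⟨C1, h1⟩ := exists_norm_le_of_tendsto (l := 0) (m := 0)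
    (f := fun x : ℝ => ((x ^ (1 / 4 : ℝ) : ℝ) : ℂ) * W x * (Real.exp (-(x / 4)) : ℂ))
    ((hr.mul contW).mul (by fun_prop)) (by
      have l1 : Tendsto (fun x : ℝ => ((x ^ (1 / 4 : ℝ) : ℝ) : ℂ)) (𝓝[>] 0) (𝓝 0) := by
        have := (Real.continuousAt_rpow_const 0 (1 / 4 : ℝ) (Or.inr (by norm_num))).tendsto
        rw [Real.zero_rpow (by norm_num)] at this
        have := (Complex.continuous_ofReal.tendsto 0).comp
          (tendsto_nhdsWithin_of_tendsto_nhds (s := Set.Ioi 0) this)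
        simpa [Function.comp_def] using this
      have l2 : Tendsto (fun x : ℝ => ((x ^ (1 / 4 : ℝ) : ℝ) : ℂ) * (Real.log x : ℂ)) (𝓝[>] 0)
          (𝓝 0) := by
        have := tendsto_log_mul_rpow_nhdsGT_zero (r := 1 / 4) (by norm_num)
        have := (Complex.continuous_ofReal.tendsto 0).comp this
        rw [Complex.ofReal_zero] at this
        refine this.congr fun x => ?_
        simp only [Function.comp]
        push_cast; ring
      have := ((l1.mul hW.lim0).sub l2).mul hexp0
      rw [zero_mul, sub_zero, zero_mul] at this
      refine this.congr fun x => ?_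
      ring) (by
      refine squeeze_zero_norm' ?_ htop
      filter_upwards [eventually_ge_atTop 1] with x hx
      have hx0 : (0 : ℝ) < x := by linarith
      rw [norm_mul, norm_mul, Complex.norm_real, Complex.norm_real, Real.norm_eq_abs,
        Real.norm_eq_abs, Real.abs_exp, abs_of_nonneg (Real.rpow_nonneg hx0.le _)]
      refine mul_le_mul_of_nonneg_right ?_ (Real.exp_pos _).le
      have b1 : x ^ (1 / 4 : ℝ) ≤ x := by
        conv_rhs => rw [← Real.rpow_one x]
        exact Real.rpow_le_rpow_of_exponent_le hx (by norm_num)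
      calc _ ≤ x * (C * x ^ N) := by
            gcongr
            exact (hCN x hx).1
        _ = _ := by ring)
  obtain ⟨C2, h2⟩ := exists_norm_le_of_tendsto (l := -1) (m := 0)
    (f := fun x : ℝ => (x : ℂ) * W' x * (Real.exp (-(x / 4)) : ℂ))
    (((by fun_prop : ContinuousOn (fun x : ℝ => (x : ℂ)) (Set.Ioi 0)).mul contW').mul
      (by fun_prop)) (by
      have := hW.lim1.mul hexp0
      rwa [mul_one] at this) (by
      refine squeeze_zero_norm' ?_ htop
      filter_upwards [eventually_ge_atTop 1] with x hx
      have hx0 : (0 : ℝ) < x := by linarith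
      rw [norm_mul, norm_mul, Complex.norm_real, Complex.norm_real, Real.norm_eq_abs,
        Real.norm_eq_abs, Real.abs_exp, abs_of_pos hx0]
      refine mul_le_mul_of_nonneg_right ?_ (Real.exp_pos _).le
      calc _ ≤ x * (C * x ^ N) := by
            gcongr
            exact (hCN x hx).2
        _ = _ := by ring)
  obtain ⟨C3, h3⟩ := exists_norm_le_of_tendsto (l := 0) (m := 0)
    (f := fun x : ℝ => (x : ℂ) * W x * (Real.exp (-(x / 4)) : ℂ))
    (((by fun_prop : ContinuousOn (fun x : ℝ => (x : ℂ)) (Set.Ioi 0)).mul contW).mul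
      (by fun_prop)) (by
      have := hW.tendsto_mul_zero.mul hexp0
      rwa [mul_one] at this) (by
      refine squeeze_zero_norm' ?_ htop
      filter_upwards [eventually_ge_atTop 1] with x hx
      have hx0 : (0 : ℝ) < x := by linarith
      rw [norm_mul, norm_mul, Complex.norm_real, Complex.norm_real, Real.norm_eq_abs,
        Real.norm_eq_abs, Real.abs_exp, abs_of_pos hx0]
      refine mul_le_mul_of_nonneg_right ?_ (Real.exp_pos _).le
      calc _ ≤ x * (C * x ^ N) := by
            gcongr
            exact (hCN x hx).1
        _ = _ := by ring)
  refine ⟨max (max C1 C2) C3, fun x hx => ⟨?_, ?_, ?_⟩⟩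
  · refine le_trans (le_of_eq ?_) ((h1 x hx).trans ((le_max_left _ _).trans (le_max_left _ _)))
    rw [norm_mul, norm_mul, Complex.norm_real, Complex.norm_real, Real.norm_eq_abs,
      Real.norm_eq_abs, Real.abs_exp, abs_of_nonneg (Real.rpow_nonneg hx.le _)]
  · refine le_trans (le_of_eq ?_) ((h2 x hx).trans ((le_max_right _ _).trans (le_max_left _ _)))
    rw [norm_mul, norm_mul, Complex.norm_real, Complex.norm_real, Real.norm_eq_abs,
      Real.norm_eq_abs, Real.abs_exp, abs_of_pos hx]
  · refine le_trans (le_of_eq ?_) ((h3 x hx).trans (le_max_right _ _))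
    rw [norm_mul, norm_mul, Complex.norm_real, Complex.norm_real, Real.norm_eq_abs,
      Real.norm_eq_abs, Real.abs_exp, abs_of_pos hx]

/-- The analytic properties of the radial profile `k` with derivative `k'`. -/
structure IsRadialGreen (h : ℝ) (z : ℂ) (k k' : ℝ → ℂ) : Prop where
  deriv : ∀ s > 0, HasDerivAt k (k' s) s
  deriv2 : ∀ s > 0, HasDerivAt k' (((h ^ 2 * s / 4 - z) * k s - 4 * k' s) / (4 * s)) s
  bound : ∃ C > 0, ∀ s > 0, ‖k s‖ ≤ C * (s ^ (-1 / 4 : ℝ) * Real.exp (-(h / 8 * s))) ∧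
    s * ‖k' s‖ ≤ C * Real.exp (-(h / 8 * s))
  lim1 : Tendsto (fun s : ℝ => (s : ℂ) * k' s) (𝓝[>] 0) (𝓝 (-(1 / (4 * Real.pi))))

theorem tendsto_const_mul_nhdsGT_zero {c : ℝ} (hc : 0 < c) :
    Tendsto (fun s : ℝ => c * s) (𝓝[>] 0) (𝓝[>] 0) := by
  refine tendsto_nhdsWithin_iff.2 ⟨?_, ?_⟩
  · have : Tendsto (fun s : ℝ => c * s) (𝓝 0) (𝓝 (c * 0)) := tendsto_id.const_mul c
    rw [mul_zero] at this
    exact tendsto_nhdsWithin_of_tendsto_nhds this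
  · filter_upwards [self_mem_nhdsWithin] with s hs
    exact mul_pos hc hs

/-- With x = hs/2 and the factor e^{-x/2}, Kummer's equation for a = 1/2 - z/(2h) becomes the radial
Landau equation -4sk'' - 4k' + (h²s/4)k = zk. The second part records the constant term, which is
q(z, h) by definition of `qFun`. -/
theorem isRadialGreen_radial {h : ℝ} (hh : 0 < h) {z : ℂ} (hz : NotLevel h z) :
    (∃ k', IsRadialGreen h z (radial h z) k') ∧
    Tendsto (fun s : ℝ => radial h z s + 1 / (4 * Real.pi) * (Real.log s : ℂ)) (𝓝[>] 0)
      (𝓝 (qFun h z)) := by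
  obtain ⟨W', hW, hg⟩ := isTricomiSol_kummerUOne hz
  set a : ℂ := 1 / 2 - z / (2 * h) with ha
  set W : ℝ → ℂ := fun x => Complex.Gamma a * kummerUOne a x with hWdef
  have hh' : (h : ℂ) ≠ 0 := by exact_mod_cast hh.ne'
  have hpi : (Real.pi : ℂ) ≠ 0 := by exact_mod_cast Real.pi_ne_zero
  have hrad : radial h z = fun s => 1 / (4 * Real.pi) * (Real.exp (-(h * s / 4)) : ℂ) *
      W (h * s / 2) := rfl
  have hzeq : z = h * (1 - 2 * a) := by rw [ha]; field_simp; ring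
  have hE : ∀ s : ℝ, HasDerivAt (fun s : ℝ => (Real.exp (-(h * s / 4)) : ℂ))
      ((Real.exp (-(h * s / 4)) : ℂ) * (-(h / 4))) s := by
    intro s
    have := (((hasDerivAt_id s).const_mul h).div_const 4).neg.exp.ofReal_comp
    refine this.congr_deriv ?_
    simp
  have hlin : ∀ s : ℝ, HasDerivAt (fun s : ℝ => h * s / 2) (h / 2) s := fun s => by
    simpa using ((hasDerivAt_id s).const_mul h).div_const 2
  have hd1 : ∀ s > 0, HasDerivAt (fun s : ℝ => W (h * s / 2)) ((h / 2) * W' (h * s / 2)) s := by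
    intro s hs
    have := (hW.deriv (h * s / 2) (by positivity)).scomp s (hlin s)
    refine this.congr_deriv ?_
    simp
  have hd2 : ∀ s > 0, HasDerivAt (fun s : ℝ => W' (h * s / 2)) ((h / 2) *
      ((a * W (h * s / 2) - (1 - ((h * s / 2 : ℝ) : ℂ)) * W' (h * s / 2)) /
        ((h * s / 2 : ℝ) : ℂ))) s := by
    intro s hs
    have := (hW.deriv2 (h * s / 2) (by positivity)).scomp s (hlin s)
    refine this.congr_deriv ?_
    simp
  have hlinT : Tendsto (fun s : ℝ => h * s / 2) (𝓝[>] 0) (𝓝[>] 0) := by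
    refine (tendsto_const_mul_nhdsGT_zero (half_pos hh)).congr fun s => ?_
    ring
  have hexp0 : Tendsto (fun s : ℝ => (Real.exp (-(h * s / 4)) : ℂ)) (𝓝[>] 0) (𝓝 1) := by
    have : Tendsto (fun s : ℝ => (Real.exp (-(h * s / 4)) : ℂ)) (𝓝[>] 0)
        (𝓝 (Real.exp (-(h * 0 / 4)) : ℂ)) :=
      tendsto_nhdsWithin_of_tendsto_nhds (Continuous.tendsto (by fun_prop) 0)
    simpa using this
  have hx0 : Tendsto (fun s : ℝ => ((h * s / 2 : ℝ) : ℂ) * W (h * s / 2)) (𝓝[>] 0) (𝓝 0) :=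
    hW.tendsto_mul_zero.comp hlinT
  have hx1 : Tendsto (fun s : ℝ => ((h * s / 2 : ℝ) : ℂ) * W' (h * s / 2)) (𝓝[>] 0) (𝓝 (-1)) :=
    hW.lim1.comp hlinT
  constructor
  · refine ⟨fun s => 1 / (4 * Real.pi) * (Real.exp (-(h * s / 4)) : ℂ) * (h / 2) *
      (W' (h * s / 2) - W (h * s / 2) / 2), ⟨fun s hs => ?_, fun s hs => ?_, ?_, ?_⟩⟩
    · rw [hrad]
      refine (((hE s).const_mul (1 / (4 * Real.pi : ℂ))).mul (hd1 s hs)).congr_deriv ?_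
      ring
    · have hs' : (s : ℂ) ≠ 0 := by exact_mod_cast hs.ne'
      refine (((((hE s).const_mul (1 / (4 * Real.pi : ℂ)))).mul_const ((h : ℂ) / 2)).mul
        ((hd2 s hs).sub ((hd1 s hs).div_const 2))).congr_deriv ?_
      rw [hrad]
      simp only [Pi.sub_apply]
      rw [hzeq]
      push_cast
      field_simp
      ring
    · obtain ⟨C, hC⟩ := hW.exists_bound hg
      have hC0 : 0 ≤ C := by
        refine le_trans ?_ (hC 1 one_pos).1
        positivity
      have hpi0 := Real.pi_pos
      -- The Gaussian is divided in halves: one is spent on the growth of W at x = hs/2, the other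
      -- remains as the decay e^{-hs/8} of the bound.
      have nE : ∀ s : ℝ, ‖(1 / (4 * Real.pi : ℂ)) * (Real.exp (-(h * s / 4)) : ℂ)‖ =
          1 / (4 * Real.pi) * (Real.exp (-(h / 8 * s)) * Real.exp (-(h * s / 2 / 4))) := by
        intro s
        rw [← Real.exp_add, norm_mul, Complex.norm_real, Real.norm_eq_abs, Real.abs_exp]
        have : (1 / (4 * Real.pi : ℂ)) = ((1 / (4 * Real.pi) : ℝ) : ℂ) := by push_cast; rfl
        rw [this, Complex.norm_real, Real.norm_eq_abs, abs_of_pos (by positivity)]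
        congr 2
        ring
      have b0 : ∀ s > 0, ‖W (h * s / 2)‖ * Real.exp (-(h * s / 2 / 4)) ≤
          C * ((h / 2) ^ (-1 / 4 : ℝ) * s ^ (-1 / 4 : ℝ)) := by
        intro s hs
        have hp : (0 : ℝ) < h * s / 2 := by positivity
        have := (hC (h * s / 2) hp).1
        have e : (h / 2) ^ (-1 / 4 : ℝ) * s ^ (-1 / 4 : ℝ) = (h * s / 2) ^ (-(1 / 4) : ℝ) := by
          rw [← Real.mul_rpow (by positivity) hs.le]
          congr 1 <;> ring
        rw [e, Real.rpow_neg hp.le, ← div_eq_mul_inv, le_div_iff₀ (by positivity),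
          mul_comm, ← mul_assoc]
        exact this
      set C' := 1 / (4 * Real.pi) * C * (h / 2) ^ (-1 / 4 : ℝ) with hC'
      have hk : ∀ s > 0, ‖radial h z s‖ ≤ C' * (s ^ (-1 / 4 : ℝ) * Real.exp (-(h / 8 * s))) := by
        intro s hs
        rw [hrad]
        simp only
        rw [norm_mul, nE]
        calc _ = 1 / (4 * Real.pi) * Real.exp (-(h / 8 * s)) *
              (‖W (h * s / 2)‖ * Real.exp (-(h * s / 2 / 4))) := by ring
          _ ≤ 1 / (4 * Real.pi) * Real.exp (-(h / 8 * s)) *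
              (C * ((h / 2) ^ (-1 / 4 : ℝ) * s ^ (-1 / 4 : ℝ))) := by
              exact mul_le_mul_of_nonneg_left (b0 s hs) (by positivity)
          _ = _ := by rw [hC']; ring
      have hk' : ∀ s > 0, s * ‖1 / (4 * Real.pi) * (Real.exp (-(h * s / 4)) : ℂ) * (h / 2) *
          (W' (h * s / 2) - W (h * s / 2) / 2)‖ ≤
          1 / (4 * Real.pi) * (C + C) * Real.exp (-(h / 8 * s)) := by
        intro s hs
        have hp : (0 : ℝ) < h * s / 2 := by positivity
        have c1 := (hC (h * s / 2) hp).2.1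
        have c2 := (hC (h * s / 2) hp).2.2
        have nh : ‖(h : ℂ) / 2‖ = h / 2 := by
          have : ((h : ℂ) / 2) = ((h / 2 : ℝ) : ℂ) := by push_cast; rfl
          rw [this, Complex.norm_real, Real.norm_eq_abs, abs_of_pos (by positivity)]
        rw [norm_mul, norm_mul, nE, nh]
        have t : ‖W' (h * s / 2) - W (h * s / 2) / 2‖ ≤ ‖W' (h * s / 2)‖ + ‖W (h * s / 2)‖ := by
          refine (norm_sub_le _ _).trans ?_
          rw [norm_div, Complex.norm_ofNat]
          have := norm_nonneg (W (h * s / 2))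
          linarith
        calc _ ≤ s * (1 / (4 * Real.pi) * (Real.exp (-(h / 8 * s)) *
              Real.exp (-(h * s / 2 / 4))) * (h / 2) * (‖W' (h * s / 2)‖ + ‖W (h * s / 2)‖)) := by
              gcongr
          _ = 1 / (4 * Real.pi) * ((h * s / 2) * ‖W' (h * s / 2)‖ * Real.exp (-(h * s / 2 / 4)) +
              (h * s / 2) * ‖W (h * s / 2)‖ * Real.exp (-(h * s / 2 / 4))) *
              Real.exp (-(h / 8 * s)) := by ring
          _ ≤ _ := by gcongr
      refine ⟨max C' (1 / (4 * Real.pi) * (C + C)) + 1, ?_, fun s hs => ⟨?_, ?_⟩⟩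
      · have : 0 ≤ C' := by positivity
        have := le_max_left C' (1 / (4 * Real.pi) * (C + C))
        linarith
      · refine (hk s hs).trans ?_
        gcongr
        exact (le_max_left _ _).trans (by linarith)
      · refine (hk' s hs).trans ?_
        gcongr
        exact (le_max_right _ _).trans (by linarith)
    · have := (hexp0.const_mul (1 / (4 * Real.pi : ℂ))).mul (hx1.sub (hx0.div_const 2))
      rw [mul_one, zero_div, sub_zero, mul_neg, mul_one] at this
      refine this.congr fun s => ?_
      push_cast
      ring
  · have e1 : Tendsto (fun s : ℝ => W (h * s / 2) + (Real.log (h * s / 2) : ℂ)) (𝓝[>] 0)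
        (𝓝 (2 * Complex.digamma 1 - Complex.digamma a)) := hW.lim0.comp hlinT
    -- `(e^{-h s / 4} - 1) W → 0`
    have e2 : Tendsto (fun s : ℝ => ((Real.exp (-(h * s / 4)) : ℂ) - 1) * W (h * s / 2)) (𝓝[>] 0)
        (𝓝 0) := by
      have sl : Tendsto (fun s : ℝ => ((Real.exp (-(h * s / 4)) : ℂ) - 1) / s) (𝓝[>] 0)
          (𝓝 ((Real.exp (-(h * 0 / 4)) : ℂ) * (-(h / 4)))) := by
        have := (hasDerivAt_iff_tendsto_slope.1 (hE 0)).mono_left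
          (nhdsWithin_mono 0 (fun x hx => ne_of_gt hx : Set.Ioi (0 : ℝ) ⊆ {0}ᶜ))
        refine this.congr fun x => ?_
        simp [slope, div_eq_inv_mul]
      have := (sl.mul hx0).mul_const (2 / (h : ℂ))
      rw [mul_zero, zero_mul] at this
      refine this.congr' ?_
      filter_upwards [self_mem_nhdsWithin] with s hs
      have hs' : (s : ℂ) ≠ 0 := by exact_mod_cast (ne_of_gt hs)
      push_cast
      field_simp
    have := ((e1.add e2).sub_const (Real.log (h / 2) : ℂ)).const_mul (1 / (4 * Real.pi : ℂ))
    have hq : 1 / (4 * Real.pi : ℂ) * (2 * Complex.digamma 1 - Complex.digamma a + 0 -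
        (Real.log (h / 2) : ℂ)) = qFun h z := by
      rw [qFun, ha]; ring
    rw [hq] at this
    refine this.congr' ?_
    filter_upwards [self_mem_nhdsWithin] with s hs
    have hs0 : (0 : ℝ) < s := hs
    have : Real.log (h * s / 2) = Real.log (h / 2) + Real.log s := by
      rw [← Real.log_mul (by positivity) hs0.ne']
      congr 1; ring
    rw [this, hrad]
    push_cast
    ring

/-! ### Radial Schwartz functions in the magnetic gauge -/

/-- The squared Euclidean distance. -/
def sqDist (x y : ℝ × ℝ) : ℝ := (x.1 - y.1) ^ 2 + (x.2 - y.2) ^ 2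

/-- The gauge factor `e^{-i h (x₁ - y₁) (x₂ + y₂) / 2}`. -/
def gaugePhase (h : ℝ) (x y : ℝ × ℝ) : ℂ :=
  Complex.exp (((-(h * (x.1 - y.1) * (x.2 + y.2) / 2) : ℝ) : ℂ) * Complex.I)

theorem norm_gaugePhase (h : ℝ) (x y : ℝ × ℝ) : ‖gaugePhase h x y‖ = 1 :=
  Complex.norm_exp_ofReal_mul_I _

theorem sqDist_nonneg (x y : ℝ × ℝ) : 0 ≤ sqDist x y := by unfold sqDist; positivity

theorem sqDist_comm (x y : ℝ × ℝ) : sqDist x y = sqDist y x := by unfold sqDist; ring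

theorem eDist_sq (x y : ℝ × ℝ) : eDist x y ^ 2 = sqDist x y :=
  Real.sq_sqrt (sqDist_nonneg x y)

theorem gaugePhase_conj (h : ℝ) (x y : ℝ × ℝ) :
    starRingEnd ℂ (gaugePhase h x y) = gaugePhase h y x := by
  rw [gaugePhase, gaugePhase, ← Complex.exp_conj, map_mul, Complex.conj_ofReal, Complex.conj_I]
  congr 1
  push_cast; ring

/-- Rapid decay on `[ε, ∞)`. -/
def RapidDecay (ε : ℝ) (f : ℝ → ℂ) : Prop := ∀ N : ℕ, ∃ C, ∀ s ≥ ε, s ^ N * ‖f s‖ ≤ C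

/-- `f` belongs to a class of functions on `(0, ∞)` closed under differentiation and consisting of
functions with rapid decay on `[ε, ∞)`. -/
def IsSmoothRapid (ε : ℝ) (f : ℝ → ℂ) : Prop :=
  ∃ P : (ℝ → ℂ) → Prop, P f ∧
    (∀ g, P g → ∃ g', P g' ∧ ∀ s > 0, HasDerivAt g (g' s) s) ∧ ∀ g, P g → RapidDecay ε g

/-- This allows all derivatives to be controlled through a class stable under one differentiation,
without formulas for the higher derivatives. -/
theorem iteratedDeriv_of_closed {P : (ℝ → ℂ) → Prop}
    (hP : ∀ g, P g → ∃ g', P g' ∧ ∀ s > 0, HasDerivAt g (g' s) s) (n : ℕ) :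
    ∀ f, P f → ContDiffOn ℝ n f (Set.Ioi 0) ∧
      ∃ g, P g ∧ ∀ s > 0, iteratedDerivWithin n f (Set.Ioi 0) s = g s := by
  have hu : UniqueDiffOn ℝ (Set.Ioi (0 : ℝ)) := isOpen_Ioi.uniqueDiffOn
  induction n with
  | zero =>
    intro f hf
    obtain ⟨g, -, hg⟩ := hP f hf
    refine ⟨contDiffOn_zero.2 fun s hs => (hg s hs).continuousAt.continuousWithinAt, f, hf,
      fun s _ => by simp⟩
  | succ n ih =>
    intro f hf
    obtain ⟨g, hPg, hg⟩ := hP f hf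
    have hdw : Set.EqOn (derivWithin f (Set.Ioi 0)) g (Set.Ioi 0) := fun s hs =>
      (hg s hs).hasDerivWithinAt.derivWithin (hu s hs)
    obtain ⟨h1, g2, hg2, he⟩ := ih g hPg
    constructor
    · push_cast
      rw [contDiffOn_succ_iff_derivWithin hu]
      refine ⟨fun s hs => (hg s hs).differentiableAt.differentiableWithinAt, fun h => ?_,
        h1.congr hdw⟩
      exact absurd h (by simp)
    · refine ⟨g2, hg2, fun s hs => ?_⟩
      rw [iteratedDerivWithin_succ', iteratedDerivWithin_congr hdw hs, he s hs]

theorem hasTemperateGrowth_fst : (fun y : ℝ × ℝ => y.1).HasTemperateGrowth :=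
  (ContinuousLinearMap.fst ℝ ℝ ℝ).hasTemperateGrowth

theorem hasTemperateGrowth_snd : (fun y : ℝ × ℝ => y.2).HasTemperateGrowth :=
  (ContinuousLinearMap.snd ℝ ℝ ℝ).hasTemperateGrowth

theorem hasTemperateGrowth_sqDist (x : ℝ × ℝ) (ε : ℝ) :
    (fun y : ℝ × ℝ => sqDist y x + ε).HasTemperateGrowth := by
  have h1 := hasTemperateGrowth_fst
  have h2 := hasTemperateGrowth_snd
  have c : ∀ c : ℝ, (fun _ : ℝ × ℝ => c).HasTemperateGrowth := fun c =>
    Function.HasTemperateGrowth.const c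
  exact (((h1.sub (c x.1)).pow 2).add ((h2.sub (c x.2)).pow 2)).add (c ε)

/-- Every derivative has absolute value 1. Hence multiplication by the gauge phase preserves
Schwartz functions. -/
theorem hasTemperateGrowth_exp_mul_I :
    (fun t : ℝ => Complex.exp ((t : ℂ) * Complex.I)).HasTemperateGrowth := by
  have hder : ∀ t : ℝ, HasDerivAt (fun t : ℝ => Complex.exp ((t : ℂ) * Complex.I))
      (Complex.I * Complex.exp ((t : ℂ) * Complex.I)) t := by
    intro t
    have := ((HasDerivAt.ofReal_comp (hasDerivAt_id t)).mul_const Complex.I).cexp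
    refine this.congr_deriv ?_
    simp; ring
  have hit : ∀ n : ℕ, iteratedDeriv n (fun t : ℝ => Complex.exp ((t : ℂ) * Complex.I)) =
      fun t : ℝ => Complex.I ^ n * Complex.exp ((t : ℂ) * Complex.I) := by
    intro n
    induction n with
    | zero => simp
    | succ n ih =>
      rw [iteratedDeriv_succ, ih]
      funext t
      rw [((hder t).const_mul _).deriv]
      ring
  refine ⟨(Complex.ofRealCLM.contDiff.mul contDiff_const).cexp, fun n => ⟨0, 1, fun t => ?_⟩⟩
  rw [norm_iteratedFDeriv_eq_norm_iteratedDeriv, hit]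
  simp [Complex.norm_exp_ofReal_mul_I]

theorem hasTemperateGrowth_gaugePhase (h : ℝ) (x : ℝ × ℝ) :
    (fun y : ℝ × ℝ => gaugePhase h y x).HasTemperateGrowth := by
  have h1 := hasTemperateGrowth_fst
  have h2 := hasTemperateGrowth_snd
  have c : ∀ c : ℝ, (fun _ : ℝ × ℝ => c).HasTemperateGrowth := fun c =>
    Function.HasTemperateGrowth.const c
  have := (((c (-h / 2)).mul (h1.sub (c x.1))).mul (h2.add (c x.2)))
  have := hasTemperateGrowth_exp_mul_I.comp this
  convert this using 2 with y
  simp only [gaugePhase]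
  congr 3
  simp
  ring

/-- The shift ε keeps the argument away from 0, where f may be singular. The derivatives of the
composite are estimated by the chain rule of order n: those of f decay faster than any power of the
squared distance, those of the inner function grow polynomially. -/
theorem exists_schwartz_radial {ε : ℝ} (hε : 0 < ε) {f : ℝ → ℂ} (hf : IsSmoothRapid ε f)
    (x : ℝ × ℝ) : ∃ X : 𝓢(ℝ × ℝ, ℂ), ∀ y, X y = f (sqDist y x + ε) := by
  obtain ⟨P, hPf, hcl, hdec⟩ := hf
  set ρ : ℝ × ℝ → ℝ := fun y => sqDist y x + ε with hρ
  have hρg := hasTemperateGrowth_sqDist x ε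
  have hρpos : ∀ y, ε ≤ ρ y := fun y => by
    have := sqDist_nonneg y x
    simp only [hρ]; linarith
  have hrange : Set.range ρ ⊆ Set.Ioi 0 := by
    rintro _ ⟨y, rfl⟩
    exact lt_of_lt_of_le hε (hρpos y)
  have hu : UniqueDiffOn ℝ (Set.Ioi (0 : ℝ)) := isOpen_Ioi.uniqueDiffOn
  have hcd : ∀ n : ℕ, ContDiffOn ℝ n f (Set.Ioi 0) := fun n =>
    (iteratedDeriv_of_closed hcl n f hPf).1
  have hdecn : ∀ n : ℕ, RapidDecay ε (iteratedDerivWithin n f (Set.Ioi 0)) := by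
    intro n N
    obtain ⟨g, hg, he⟩ := (iteratedDeriv_of_closed hcl n f hPf).2
    obtain ⟨C, hC⟩ := hdec g hg N
    refine ⟨C, fun s hs => ?_⟩
    rw [he s (lt_of_lt_of_le hε hs)]
    exact hC s hs
  have hsmooth : ContDiff ℝ (⊤ : ℕ∞) (f ∘ ρ) := by
    rw [contDiff_infty]
    intro n
    exact (hcd n).comp_contDiff (hρg.1.of_le (by exact_mod_cast le_top)) (fun y => hrange ⟨y, rfl⟩)
  obtain ⟨K, hK0, hK⟩ : ∃ K : ℝ, 0 < K ∧ ∀ y, 1 + ‖y‖ ≤ K * ρ y := by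
    refine ⟨(2 + ‖x‖) / ε + 1, by positivity, fun y => ?_⟩
    have h1 : ‖y‖ ≤ ‖x‖ + ‖y - x‖ := by
      have := norm_add_le x (y - x)
      simpa using this
    have h2 : ‖y - x‖ ^ 2 ≤ sqDist y x := by
      rw [Prod.norm_def, sqDist]
      rcases max_cases ‖(y - x).1‖ ‖(y - x).2‖ with ⟨h, -⟩ | ⟨h, -⟩ <;> rw [h] <;>
        simp only [Prod.fst_sub, Prod.snd_sub, Real.norm_eq_abs, sq_abs] <;>
        nlinarith [sq_nonneg (y.1 - x.1), sq_nonneg (y.2 - x.2)]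
    have h3 : ‖y - x‖ ≤ 1 + sqDist y x := by nlinarith [norm_nonneg (y - x)]
    have h4 : (2 + ‖x‖) ≤ (2 + ‖x‖) / ε * ρ y := by
      rw [div_mul_eq_mul_div, le_div_iff₀ hε]
      gcongr
      exact hρpos y
    have : sqDist y x ≤ ρ y := by simp only [hρ]; linarith
    rw [add_mul, one_mul]
    linarith
  refine ⟨⟨f ∘ ρ, hsmooth, fun k n => ?_⟩, fun y => rfl⟩
  obtain ⟨j, C0, hC0, hD⟩ := hρg.norm_iteratedFDeriv_le_uniform n
  -- k powers compensate the weight ‖y‖^k, and j n powers compensate the factor ((1 + ‖y‖)^j)^n from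
  -- the derivatives of the inner function.
  set M := k + j * n with hM
  choose! Cf hCf using fun i => hdecn i M
  set C1 := ∑ i ∈ Finset.range (n + 1), |Cf i| with hC1
  refine ⟨n.factorial * C1 * (C0 + 1) ^ n * K ^ M, fun y => ?_⟩
  have hρ0 : 0 < ρ y := lt_of_lt_of_le hε (hρpos y)
  have b1 : ∀ i ≤ n, ‖iteratedFDerivWithin ℝ i f (Set.Ioi 0) (ρ y)‖ ≤ C1 / ρ y ^ M := by
    intro i hi
    rw [norm_iteratedFDerivWithin_eq_norm_iteratedDerivWithin, le_div_iff₀ (by positivity), mul_comm]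
    refine (hCf i (ρ y) (hρpos y)).trans ((le_abs_self _).trans ?_)
    exact Finset.single_le_sum (f := fun i => |Cf i|) (fun _ _ => abs_nonneg _)
      (Finset.mem_range.2 (by omega))
  have hy1 : (1 : ℝ) ≤ (1 + ‖y‖) ^ j := one_le_pow₀ (by linarith [norm_nonneg y])
  have b2 : ∀ i, 1 ≤ i → i ≤ n → ‖iteratedFDeriv ℝ i ρ y‖ ≤ ((C0 + 1) * (1 + ‖y‖) ^ j) ^ i := by
    intro i hi hin
    have hge : 1 ≤ (C0 + 1) * (1 + ‖y‖) ^ j := by nlinarith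
    refine (hD i hin y).trans (le_trans ?_ (le_self_pow₀ hge (by omega)))
    gcongr
    linarith
  have key := norm_iteratedFDeriv_comp_le' (n := n) (N := n) hrange hu (hcd n)
    (hρg.1.of_le (by exact_mod_cast le_top)) le_rfl y b1 b2
  calc ‖y‖ ^ k * ‖iteratedFDeriv ℝ n (f ∘ ρ) y‖
      ≤ (1 + ‖y‖) ^ k * (n.factorial * (C1 / ρ y ^ M) * ((C0 + 1) * (1 + ‖y‖) ^ j) ^ n) := by
        gcongr
        linarith
    _ = n.factorial * C1 * (C0 + 1) ^ n * ((1 + ‖y‖) / ρ y) ^ M := by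
        rw [hM, div_pow, mul_pow, pow_add, pow_mul, pow_add, pow_mul]
        field_simp
    _ ≤ _ := by
        gcongr
        rw [div_le_iff₀ hρ0]
        exact hK y

theorem exists_schwartz_gauge (h : ℝ) {ε : ℝ} (hε : 0 < ε) {f : ℝ → ℂ} (hf : IsSmoothRapid ε f)
    (x : ℝ × ℝ) : ∃ X : 𝓢(ℝ × ℝ, ℂ), ∀ y, X y = gaugePhase h y x * f (sqDist y x + ε) := by
  obtain ⟨X, hX⟩ := exists_schwartz_radial hε hf x
  refine ⟨SchwartzMap.smulLeftCLM ℂ (fun y => gaugePhase h y x) X, fun y => ?_⟩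
  rw [SchwartzMap.smulLeftCLM_apply_apply (hasTemperateGrowth_gaugePhase h x), hX, smul_eq_mul]

/-! ### Rapidly decaying profiles and examples of the smooth class -/

theorem RapidDecay.add {ε : ℝ} {f g : ℝ → ℂ} (hε : 0 < ε) (hf : RapidDecay ε f)
    (hg : RapidDecay ε g) : RapidDecay ε (fun s => f s + g s) := by
  intro N
  obtain ⟨C, hC⟩ := hf N
  obtain ⟨D, hD⟩ := hg N
  refine ⟨C + D, fun s hs => ?_⟩
  have hs0 : 0 < s := lt_of_lt_of_le hε hs
  calc _ ≤ s ^ N * (‖f s‖ + ‖g s‖) := by gcongr; exact norm_add_le _ _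
    _ ≤ _ := by rw [mul_add]; exact add_le_add (hC s hs) (hD s hs)

theorem RapidDecay.polynomial_mul {ε : ℝ} {f : ℝ → ℂ} (hε : 0 < ε) (hf : RapidDecay ε f)
    (p : Polynomial ℂ) : RapidDecay ε (fun s => p.eval (s : ℂ) * f s) := by
  induction p using Polynomial.induction_on' with
  | add p q hp hq =>
    have := hp.add hε hq
    intro N
    obtain ⟨C, hC⟩ := this N
    refine ⟨C, fun s hs => ?_⟩
    simp only [Polynomial.eval_add, add_mul]
    exact hC s hs
  | monomial n c =>
    intro N
    obtain ⟨C, hC⟩ := hf (N + n)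
    refine ⟨‖c‖ * C, fun s hs => ?_⟩
    have hs0 : 0 < s := lt_of_lt_of_le hε hs
    simp only [Polynomial.eval_monomial, norm_mul, norm_pow, Complex.norm_real,
      Real.norm_eq_abs, abs_of_pos hs0]
    calc _ = ‖c‖ * (s ^ (N + n) * ‖f s‖) := by ring
      _ ≤ _ := by gcongr; exact hC s hs

theorem rapidDecay_of_exp_bound {ε c C : ℝ} (hε : 0 < ε) (hc : 0 < c) {f : ℝ → ℂ}
    (hf : ∀ s ≥ ε, ‖f s‖ ≤ C * Real.exp (-(c * s))) : RapidDecay ε f := by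
  intro N
  have hC : 0 ≤ C := by
    have := (norm_nonneg _).trans (hf ε le_rfl)
    exact nonneg_of_mul_nonneg_left this (Real.exp_pos _)
  refine ⟨C * (N.factorial / c ^ N), fun s hs => ?_⟩
  have hs0 : 0 < s := lt_of_lt_of_le hε hs
  have h1 := Real.pow_div_factorial_le_exp (c * s) (by positivity) N
  calc s ^ N * ‖f s‖ ≤ s ^ N * (C * Real.exp (-(c * s))) := by gcongr; exact hf s hs
    _ = C * (s ^ N * Real.exp (-(c * s))) := by ring
    _ ≤ _ := by
      gcongr
      rw [Real.exp_neg, ← div_eq_mul_inv, div_le_iff₀ (Real.exp_pos _)]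
      rw [div_le_iff₀ (by positivity), mul_pow] at h1
      rw [div_mul_eq_mul_div, le_div_iff₀ (by positivity)]
      linarith

/-- The closed class consists of s^{-n}(p k + q k') with polynomials p, q. The radial equation
expresses k'' through k and k' with a denominator s, so differentiation only raises n and changes p,
q. -/
theorem IsRadialGreen.isSmoothRapid {h : ℝ} (hh : 0 < h) {z : ℂ} {k k' : ℝ → ℂ}
    (hk : IsRadialGreen h z k k') {ε : ℝ} (hε : 0 < ε) : IsSmoothRapid ε k := by
  obtain ⟨C, hC, hb⟩ := hk.bound
  have rk : RapidDecay ε k := by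
    refine rapidDecay_of_exp_bound (c := h / 8) (C := C * ε ^ (-1 / 4 : ℝ)) hε (by positivity)
      fun s hs => ?_
    have hs0 : 0 < s := lt_of_lt_of_le hε hs
    refine (hb s hs0).1.trans ?_
    rw [mul_assoc]
    gcongr C * (?_ * _)
    exact Real.rpow_le_rpow_of_nonpos hε hs (by norm_num)
  have rk' : RapidDecay ε k' := by
    refine rapidDecay_of_exp_bound (c := h / 8) (C := C / ε) hε (by positivity) fun s hs => ?_
    have hs0 : 0 < s := lt_of_lt_of_le hε hs
    have := (hb s hs0).2
    rw [div_mul_eq_mul_div, le_div_iff₀ hε]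
    refine le_trans ?_ this
    rw [mul_comm]
    gcongr
  refine ⟨fun g => ∃ (n : ℕ) (p q : Polynomial ℂ), ∀ s > 0, g s =
    ((s : ℂ) ^ n)⁻¹ * (p.eval (s : ℂ) * k s + q.eval (s : ℂ) * k' s), ⟨0, 1, 0, ?_⟩, ?_, ?_⟩
  · intro s _; simp
  · rintro g ⟨n, p, q, hg⟩
    refine ⟨fun s => ((s : ℂ) ^ (n + 1))⁻¹ *
      ((Polynomial.X * Polynomial.derivative p +
        Polynomial.C (1 / 4) * (Polynomial.C ((h : ℂ) ^ 2 / 4) * Polynomial.X - Polynomial.C z) * q -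
        Polynomial.C (n : ℂ) * p).eval (s : ℂ) * k s +
      (Polynomial.X * p + Polynomial.X * Polynomial.derivative q - q -
        Polynomial.C (n : ℂ) * q).eval (s : ℂ) * k' s), ⟨n + 1, _, _, fun s _ => rfl⟩, ?_⟩
    intro s hs
    have hs' : (s : ℂ) ≠ 0 := by exact_mod_cast hs.ne'
    have dp : ∀ p : Polynomial ℂ, HasDerivAt (fun s : ℝ => p.eval (s : ℂ))
        ((Polynomial.derivative p).eval (s : ℂ)) s := fun p => (p.hasDerivAt (s : ℂ)).comp_ofReal
    have dn : HasDerivAt (fun s : ℝ => ((s : ℂ) ^ n)⁻¹) (-(n * (s : ℂ) ^ (n - 1)) / ((s : ℂ) ^ n) ^ 2) s := by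
      have := ((HasDerivAt.ofReal_comp (hasDerivAt_id s)).pow n).inv (pow_ne_zero n hs')
      refine this.congr_deriv ?_
      simp
    have := dn.mul (((dp p).mul (hk.deriv s hs)).add ((dp q).mul (hk.deriv2 s hs)))
    have h2 := this.congr_of_eventuallyEq (f₁ := g) (by
      filter_upwards [Ioi_mem_nhds hs] with t ht
      exact hg t ht)
    refine h2.congr_deriv ?_
    simp only [Polynomial.eval_add, Polynomial.eval_sub, Polynomial.eval_mul, Polynomial.eval_X,
      Polynomial.eval_C, Pi.add_apply, Pi.mul_apply]
    rcases n with _ | n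
    · simp
      field_simp
      ring
    · simp only [Nat.add_sub_cancel]
      push_cast
      field_simp
      ring
  · rintro g ⟨n, p, q, hg⟩ N
    obtain ⟨C1, h1⟩ := ((rk.polynomial_mul hε p).add hε (rk'.polynomial_mul hε q)) N
    refine ⟨(ε ^ n)⁻¹ * C1, fun s hs => ?_⟩
    have hs0 : 0 < s := lt_of_lt_of_le hε hs
    rw [hg s hs0, norm_mul, norm_inv, norm_pow, Complex.norm_real, Real.norm_eq_abs,
      abs_of_pos hs0]
    calc _ = (s ^ n)⁻¹ * (s ^ N * ‖p.eval (s : ℂ) * k s + q.eval (s : ℂ) * k' s‖) := by ring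
      _ ≤ (ε ^ n)⁻¹ * C1 := by
        gcongr
        exact h1 s hs

theorem isSmoothRapid_exp {c : ℝ} (hc : 0 < c) {ε : ℝ} (hε : 0 < ε) :
    IsSmoothRapid ε (fun s => (Real.exp (-(c * s)) : ℂ)) := by
  refine ⟨fun g => ∃ b : ℂ, ∀ s : ℝ, g s = b * (Real.exp (-(c * s)) : ℂ), ⟨1, fun s => by simp⟩, ?_, ?_⟩
  · rintro g ⟨b, hg⟩
    refine ⟨fun s => (-c * b) * (Real.exp (-(c * s)) : ℂ), ⟨_, fun s => rfl⟩, fun s _ => ?_⟩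
    rw [funext hg]
    refine (((hasDerivAt_id s).const_mul c).neg.exp.ofReal_comp.const_mul b).congr_deriv ?_
    simp
    ring
  · rintro g ⟨b, hg⟩
    refine rapidDecay_of_exp_bound (C := ‖b‖) hε hc fun s _ => ?_
    rw [hg, norm_mul, Complex.norm_real, Real.norm_eq_abs, Real.abs_exp]

/-! ### The Landau expression on radial functions -/

theorem lineDerivOp_fst_eq {φ : 𝓢(ℝ × ℝ, ℂ)} {y : ℝ × ℝ} {d : ℂ}
    (hd : HasDerivAt (fun t : ℝ => φ (t, y.2)) d y.1) :
    LineDeriv.lineDerivOpCLM ℂ 𝓢(ℝ × ℝ, ℂ) ((1, 0) : ℝ × ℝ) φ y = d := by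
  have h1 : HasDerivAt (fun t : ℝ => ((t, y.2) : ℝ × ℝ)) ((1, 0) : ℝ × ℝ) y.1 :=
    (hasDerivAt_id y.1).prodMk (hasDerivAt_const y.1 y.2)
  have h2 := (SchwartzMap.hasFDerivAt φ y).comp_hasDerivAt_of_eq y.1 h1 rfl
  have := h2.unique hd
  rw [← this]
  exact SchwartzMap.lineDerivOp_apply_eq_fderiv _ _ _

theorem lineDerivOp_snd_eq {φ : 𝓢(ℝ × ℝ, ℂ)} {y : ℝ × ℝ} {d : ℂ}
    (hd : HasDerivAt (fun t : ℝ => φ (y.1, t)) d y.2) :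
    LineDeriv.lineDerivOpCLM ℂ 𝓢(ℝ × ℝ, ℂ) ((0, 1) : ℝ × ℝ) φ y = d := by
  have h1 : HasDerivAt (fun t : ℝ => ((y.1, t) : ℝ × ℝ)) ((0, 1) : ℝ × ℝ) y.2 :=
    (hasDerivAt_const y.2 y.1).prodMk (hasDerivAt_id y.2)
  have h2 := (SchwartzMap.hasFDerivAt φ y).comp_hasDerivAt_of_eq y.2 h1 rfl
  have := h2.unique hd
  rw [← this]
  exact SchwartzMap.lineDerivOp_apply_eq_fderiv _ _ _

theorem hasTemperateGrowth_snd_ofReal :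
    (fun x : ℝ × ℝ => (x.2 : ℂ)).HasTemperateGrowth :=
  Complex.ofRealCLM.hasTemperateGrowth.comp hasTemperateGrowth_snd

theorem momentumOne_apply {h : ℝ} {φ : 𝓢(ℝ × ℝ, ℂ)} {y : ℝ × ℝ} {d : ℂ}
    (hd : HasDerivAt (fun t : ℝ => φ (t, y.2)) d y.1) :
    momentumOne h φ y = -Complex.I * d + h * y.2 * φ y := by
  have : momentumOne h φ y = -Complex.I *
      (LineDeriv.lineDerivOpCLM ℂ 𝓢(ℝ × ℝ, ℂ) ((1, 0) : ℝ × ℝ) φ y) +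
      h * (SchwartzMap.smulLeftCLM ℂ (fun x : ℝ × ℝ => (x.2 : ℂ)) φ y) := rfl
  rw [this, lineDerivOp_fst_eq hd,
    SchwartzMap.smulLeftCLM_apply_apply hasTemperateGrowth_snd_ofReal, smul_eq_mul]
  ring

/-- The phase changes the Landau gauge into the symmetric gauge centred at x. There the first order
terms form an angular derivative, which kills radial functions, so only the radial Laplacian and the
harmonic potential h²|y - x|²/4 remain. The profile is evaluated at the shifted argument while the
coefficients are not shifted. -/
theorem landauExpr_radial {h ε : ℝ} (hε : 0 < ε) {f f' f'' : ℝ → ℂ}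
    (hf : ∀ s > 0, HasDerivAt f (f' s) s) (hf' : ∀ s > 0, HasDerivAt f' (f'' s) s)
    {x : ℝ × ℝ} {X : 𝓢(ℝ × ℝ, ℂ)} (hX : ∀ y, X y = gaugePhase h y x * f (sqDist y x + ε))
    (y : ℝ × ℝ) :
    landauExpr h X y = gaugePhase h y x * (-4 * sqDist y x * f'' (sqDist y x + ε) -
      4 * f' (sqDist y x + ε) + h ^ 2 * sqDist y x / 4 * f (sqDist y x + ε)) := by
  have hpos : ∀ y, 0 < sqDist y x + ε := fun y => by
    have := sqDist_nonneg y x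
    linarith
  have ds1 : ∀ y : ℝ × ℝ, HasDerivAt (fun t : ℝ => sqDist (t, y.2) x + ε) (2 * (y.1 - x.1)) y.1 := by
    intro y
    have := ((((hasDerivAt_id y.1).sub_const x.1).pow 2).add_const ((y.2 - x.2) ^ 2)).add_const ε
    refine this.congr_deriv ?_
    simp
  have ds2 : ∀ y : ℝ × ℝ, HasDerivAt (fun t : ℝ => sqDist (y.1, t) x + ε) (2 * (y.2 - x.2)) y.2 := by
    intro y
    have := ((((hasDerivAt_id y.2).sub_const x.2).pow 2).const_add ((y.1 - x.1) ^ 2)).add_const ε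
    refine this.congr_deriv ?_
    simp
  have df1 : ∀ {g g' : ℝ → ℂ}, (∀ s > 0, HasDerivAt g (g' s) s) → ∀ y : ℝ × ℝ,
      HasDerivAt (fun t : ℝ => g (sqDist (t, y.2) x + ε))
        (2 * (y.1 - x.1) * g' (sqDist y x + ε)) y.1 := by
    intro g g' hg y
    have := (hg _ (hpos y)).scomp y.1 (h := fun t : ℝ => sqDist (t, y.2) x + ε) (ds1 y)
    refine this.congr_deriv ?_
    rw [Complex.real_smul]; push_cast; rfl
  have df2 : ∀ {g g' : ℝ → ℂ}, (∀ s > 0, HasDerivAt g (g' s) s) → ∀ y : ℝ × ℝ,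
      HasDerivAt (fun t : ℝ => g (sqDist (y.1, t) x + ε))
        (2 * (y.2 - x.2) * g' (sqDist y x + ε)) y.2 := by
    intro g g' hg y
    have := (hg _ (hpos y)).scomp y.2 (h := fun t : ℝ => sqDist (y.1, t) x + ε) (ds2 y)
    refine this.congr_deriv ?_
    rw [Complex.real_smul]; push_cast; rfl
  have dph1 : ∀ y : ℝ × ℝ, HasDerivAt (fun t : ℝ => gaugePhase h (t, y.2) x)
      (-(h * (y.2 + x.2) / 2) * Complex.I * gaugePhase h y x) y.1 := by
    intro y
    have := (((((hasDerivAt_id y.1).sub_const x.1).const_mul h).mul_const (y.2 + x.2)).div_const 2).neg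
    have := (this.ofReal_comp.mul_const Complex.I).cexp
    refine this.congr_deriv ?_
    simp only [gaugePhase, id, Pi.neg_apply]
    push_cast; ring
  have dph2 : ∀ y : ℝ × ℝ, HasDerivAt (fun t : ℝ => gaugePhase h (y.1, t) x)
      (-(h * (y.1 - x.1) / 2) * Complex.I * gaugePhase h y x) y.2 := by
    intro y
    have := (((((hasDerivAt_id y.2).add_const x.2)).const_mul (h * (y.1 - x.1))).div_const 2).neg
    have := (this.ofReal_comp.mul_const Complex.I).cexp
    refine this.congr_deriv ?_
    simp only [gaugePhase, id, Pi.neg_apply]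
    push_cast; ring
  have hlin1 : ∀ y : ℝ × ℝ, HasDerivAt (fun t : ℝ => ((t - x.1 : ℝ) : ℂ)) 1 y.1 := fun y => by
    simpa using ((hasDerivAt_id y.1).sub_const x.1).ofReal_comp
  have hlin2 : ∀ y : ℝ × ℝ, HasDerivAt (fun t : ℝ => ((t - x.2 : ℝ) : ℂ)) 1 y.2 := fun y => by
    simpa using ((hasDerivAt_id y.2).sub_const x.2).ofReal_comp
  -- first order
  have m1 : ∀ y : ℝ × ℝ, momentumOne h X y = gaugePhase h y x *
      (-Complex.I * (2 * ((y.1 - x.1 : ℝ) : ℂ)) * f' (sqDist y x + ε) +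
        h * ((y.2 - x.2 : ℝ) : ℂ) / 2 * f (sqDist y x + ε)) := by
    intro y
    have hd : HasDerivAt (fun t : ℝ => X (t, y.2)) _ y.1 :=
      ((dph1 y).mul (df1 hf y)).congr_of_eventuallyEq (Eventually.of_forall fun t => hX (t, y.2))
    rw [momentumOne_apply hd, hX y]
    have : (y.1, y.2) = y := rfl
    rw [this]
    push_cast
    linear_combination (-(h * (y.2 + x.2) / 2) * gaugePhase h y x * f (sqDist y x + ε) *
      (-1) : ℂ) * Complex.I_mul_I
  have m2 : ∀ y : ℝ × ℝ, LineDeriv.lineDerivOpCLM ℂ 𝓢(ℝ × ℝ, ℂ) ((0, 1) : ℝ × ℝ) X y =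
      gaugePhase h y x * (-(h * ((y.1 - x.1 : ℝ) : ℂ) / 2) * Complex.I * f (sqDist y x + ε) +
        2 * ((y.2 - x.2 : ℝ) : ℂ) * f' (sqDist y x + ε)) := by
    intro y
    have hd : HasDerivAt (fun t : ℝ => X (y.1, t)) _ y.2 :=
      ((dph2 y).mul (df2 hf y)).congr_of_eventuallyEq (Eventually.of_forall fun t => hX (y.1, t))
    rw [lineDerivOp_snd_eq hd]
    have : (y.1, y.2) = y := rfl
    rw [this]
    push_cast
    ring
  have hexp : landauExpr h X y = momentumOne h (momentumOne h X) y -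
      LineDeriv.lineDerivOpCLM ℂ 𝓢(ℝ × ℝ, ℂ) ((0, 1) : ℝ × ℝ)
        (LineDeriv.lineDerivOpCLM ℂ 𝓢(ℝ × ℝ, ℂ) ((0, 1) : ℝ × ℝ) X) y := rfl
  have d1 := ((dph1 y).mul ((((hlin1 y).const_mul 2).const_mul (-Complex.I)).mul (df1 hf' y) |>.add
    ((df1 hf y).const_mul (h * ((y.2 - x.2 : ℝ) : ℂ) / 2)))).congr_of_eventuallyEq
    (f₁ := fun t : ℝ => momentumOne h X (t, y.2)) (Eventually.of_forall fun t => m1 (t, y.2))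
  have d2 := ((dph2 y).mul ((((df2 hf y).const_mul (-(h * ((y.1 - x.1 : ℝ) : ℂ) / 2) * Complex.I))).add
    (((hlin2 y).const_mul 2).mul (df2 hf' y)))).congr_of_eventuallyEq
    (f₁ := fun t : ℝ => LineDeriv.lineDerivOpCLM ℂ 𝓢(ℝ × ℝ, ℂ) ((0, 1) : ℝ × ℝ) X (y.1, t))
    (Eventually.of_forall fun t => m2 (y.1, t))
  rw [hexp, momentumOne_apply d1, lineDerivOp_snd_eq d2, m1]
  have : (y.1, y.2) = y := rfl
  simp only [this, Pi.add_apply, Pi.mul_apply]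
  have hsq : (sqDist y x : ℂ) = (y.1 - x.1) ^ 2 + (y.2 - x.2) ^ 2 := by
    rw [sqDist]; push_cast; rfl
  generalize sqDist y x + ε = r
  rw [hsq]
  push_cast
  ring_nf
  simp only [Complex.I_sq, Complex.I_pow_three]
  ring

/-! ### Symmetry of the Landau expression -/

theorem schwartzToL2_coeFn (φ : 𝓢(ℝ × ℝ, ℂ)) : schwartzToL2 φ =ᵐ[volume] φ :=
  φ.coeFn_toLp 2 volume

theorem dense_range_schwartzToL2 :
    Dense ((LinearMap.range schwartzToL2 : Submodule ℂ L2Plane) : Set L2Plane) :=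
  SchwartzMap.denseRange_toLpCLM (E := ℝ × ℝ) (F := ℂ) (μ := volume) (p := 2) (by simp)

theorem inner_eq_integral (f g : L2Plane) : ⟪f, g⟫_ℂ = ∫ x, starRingEnd ℂ (f x) * g x := by
  rw [L2.inner_def]
  refine integral_congr_ae (Eventually.of_forall fun x => ?_)
  simp only [RCLike.inner_apply]
  ring

theorem inner_schwartzToL2_left (φ : 𝓢(ℝ × ℝ, ℂ)) (g : L2Plane) :
    ⟪schwartzToL2 φ, g⟫_ℂ = ∫ x, starRingEnd ℂ (φ x) * g x := by
  rw [inner_eq_integral]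
  refine integral_congr_ae ?_
  filter_upwards [schwartzToL2_coeFn φ] with x hx
  rw [hx]

theorem inner_schwartzToL2_right (φ : 𝓢(ℝ × ℝ, ℂ)) (g : L2Plane) :
    ⟪g, schwartzToL2 φ⟫_ℂ = ∫ x, starRingEnd ℂ (g x) * φ x := by
  rw [inner_eq_integral]
  refine integral_congr_ae ?_
  filter_upwards [schwartzToL2_coeFn φ] with x hx
  rw [hx]

theorem inner_schwartzToL2 (φ ψ : 𝓢(ℝ × ℝ, ℂ)) :
    ⟪schwartzToL2 φ, schwartzToL2 ψ⟫_ℂ = ∫ x, starRingEnd ℂ (φ x) * ψ x := by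
  rw [inner_schwartzToL2_left]
  refine integral_congr_ae ?_
  filter_upwards [schwartzToL2_coeFn ψ] with x hx
  rw [hx]

theorem inner_lineDeriv (v : ℝ × ℝ) (φ ψ : 𝓢(ℝ × ℝ, ℂ)) :
    ⟪schwartzToL2 (LineDeriv.lineDerivOpCLM ℂ 𝓢(ℝ × ℝ, ℂ) v φ), schwartzToL2 ψ⟫_ℂ =
      -⟪schwartzToL2 φ, schwartzToL2 (LineDeriv.lineDerivOpCLM ℂ 𝓢(ℝ × ℝ, ℂ) v ψ)⟫_ℂ := by
  rw [inner_schwartzToL2, inner_schwartzToL2]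
  have := SchwartzMap.integral_bilinear_lineDerivOp_right_eq_neg_left (μ := volume) φ ψ
    ((ContinuousLinearMap.mul ℝ ℂ).comp (Complex.conjCLE : ℂ →L[ℝ] ℂ)) v
  rw [eq_neg_iff_add_eq_zero, add_comm, ← eq_neg_iff_add_eq_zero]
  exact this

theorem inner_smulLeft_snd (φ ψ : 𝓢(ℝ × ℝ, ℂ)) :
    ⟪schwartzToL2 (SchwartzMap.smulLeftCLM ℂ (fun x : ℝ × ℝ => (x.2 : ℂ)) φ), schwartzToL2 ψ⟫_ℂ =
      ⟪schwartzToL2 φ, schwartzToL2 (SchwartzMap.smulLeftCLM ℂ (fun x : ℝ × ℝ => (x.2 : ℂ)) ψ)⟫_ℂ := by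
  rw [inner_schwartzToL2, inner_schwartzToL2]
  refine integral_congr_ae (Eventually.of_forall fun x => ?_)
  simp only [SchwartzMap.smulLeftCLM_apply_apply hasTemperateGrowth_snd_ofReal, smul_eq_mul,
    map_mul, Complex.conj_ofReal]
  ring

theorem inner_momentumOne (h : ℝ) (φ ψ : 𝓢(ℝ × ℝ, ℂ)) :
    ⟪schwartzToL2 (momentumOne h φ), schwartzToL2 ψ⟫_ℂ =
      ⟪schwartzToL2 φ, schwartzToL2 (momentumOne h ψ)⟫_ℂ := by
  have e : ∀ φ, momentumOne h φ = (-Complex.I) •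
      LineDeriv.lineDerivOpCLM ℂ 𝓢(ℝ × ℝ, ℂ) ((1, 0) : ℝ × ℝ) φ +
    (h : ℂ) • SchwartzMap.smulLeftCLM ℂ (fun x : ℝ × ℝ => (x.2 : ℂ)) φ := fun _ => rfl
  rw [e, e]
  simp only [map_add, map_smul, inner_add_left, inner_add_right, inner_smul_left,
    inner_smul_right, inner_lineDeriv, inner_smulLeft_snd, Complex.conj_ofReal, map_neg,
    Complex.conj_I]
  ring

theorem inner_landauExpr (h : ℝ) (φ ψ : 𝓢(ℝ × ℝ, ℂ)) :
    ⟪schwartzToL2 (landauExpr h φ), schwartzToL2 ψ⟫_ℂ =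
      ⟪schwartzToL2 φ, schwartzToL2 (landauExpr h ψ)⟫_ℂ := by
  have e : ∀ φ, landauExpr h φ = momentumOne h (momentumOne h φ) -
      LineDeriv.lineDerivOpCLM ℂ 𝓢(ℝ × ℝ, ℂ) ((0, 1) : ℝ × ℝ)
        (LineDeriv.lineDerivOpCLM ℂ 𝓢(ℝ × ℝ, ℂ) ((0, 1) : ℝ × ℝ) φ) := fun _ => rfl
  rw [e, e]
  simp only [map_sub, inner_sub_left, inner_sub_right, inner_momentumOne, inner_lineDeriv, neg_neg]

/-! ### The Landau Hamiltonian in weak form -/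

theorem landauCore_apply (h : ℝ) (φ : 𝓢(ℝ × ℝ, ℂ))
    (hφ : schwartzToL2 φ ∈ (landauCore h).domain) :
    landauCore h ⟨schwartzToL2 φ, hφ⟩ = schwartzToL2 (landauExpr h φ) := by
  change schwartzToL2 (landauExpr h
    ((LinearEquiv.ofInjective schwartzToL2 schwartzToL2_injective).symm ⟨schwartzToL2 φ, hφ⟩)) = _
  congr 2
  rw [LinearEquiv.symm_apply_eq]
  rfl

/-- `u` is in the domain of the Landau Hamiltonian and is mapped to `f`. -/
def LandauRel (h : ℝ) (u f : L2Plane) : Prop :=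
  ∃ hu : u ∈ (landau h).domain, landau h ⟨u, hu⟩ = f

/-- The operator is an adjoint with dense core, so membership in its graph is a family of identities
against Schwartz functions. This form avoids elements of domains in what follows. -/
theorem landauRel_iff {h : ℝ} {u f : L2Plane} : LandauRel h u f ↔
    ∀ φ : 𝓢(ℝ × ℝ, ℂ), ⟪f, schwartzToL2 φ⟫_ℂ = ⟪u, schwartzToL2 (landauExpr h φ)⟫_ℂ := by
  have hd : Dense ((landauCore h).domain : Set L2Plane) := dense_range_schwartzToL2
  constructor
  · rintro ⟨hu, rfl⟩ φ
    have hm : schwartzToL2 φ ∈ (landauCore h).domain := ⟨φ, rfl⟩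
    have := (landauCore h).adjoint_isFormalAdjoint hd ⟨u, hu⟩ ⟨schwartzToL2 φ, hm⟩
    rw [landauCore_apply h φ hm] at this
    exact this
  · intro H
    have H' : ∀ x : (landauCore h).domain, ⟪f, (x : L2Plane)⟫_ℂ = ⟪u, landauCore h x⟫_ℂ := by
      rintro ⟨v, hv⟩
      have hv' := hv
      obtain ⟨φ, rfl⟩ := hv'
      rw [landauCore_apply h φ hv]
      exact H φ
    have hu : u ∈ (landau h).domain := LinearPMap.mem_adjoint_domain_of_exists u ⟨f, H'⟩
    exact ⟨hu, LinearPMap.adjoint_apply_eq hd ⟨u, hu⟩ H'⟩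

theorem landauRel_schwartz (h : ℝ) (φ : 𝓢(ℝ × ℝ, ℂ)) :
    LandauRel h (schwartzToL2 φ) (schwartzToL2 (landauExpr h φ)) :=
  landauRel_iff.2 fun ψ => inner_landauExpr h φ ψ

/-! ### Integral operators with kernels dominated by convolution kernels -/

/-- The kernel `G` is measurable and dominated by `w (x - y)` for some `w ∈ L¹ ∩ L²`. -/
structure ConvDominated (w : ℝ × ℝ → ℝ) (G : ℝ × ℝ → ℝ × ℝ → ℂ) : Prop where
  measurable : Measurable (Function.uncurry G)
  le : ∀ x y, ‖G x y‖ ≤ w (x - y)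
  integrable : Integrable w
  memLp : MemLp w 2

section Kernel

variable {w : ℝ × ℝ → ℝ} {G : ℝ × ℝ → ℝ × ℝ → ℂ}

theorem ConvDominated.nonneg (hG : ConvDominated w G) (u : ℝ × ℝ) : 0 ≤ w u := by
  have := (norm_nonneg _).trans (hG.le u 0)
  simpa using this

theorem measurePreserving_const_sub (x : ℝ × ℝ) :
    MeasurePreserving (fun y : ℝ × ℝ => x - y) volume volume :=
  Measure.measurePreserving_sub_left volume x

theorem ConvDominated.memLp_left (hG : ConvDominated w G) (x : ℝ × ℝ) : MemLp (G x) 2 := by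
  have h1 : MemLp (fun y => w (x - y)) 2 :=
    hG.memLp.comp_measurePreserving (measurePreserving_const_sub x)
  refine h1.mono (hG.measurable.comp measurable_prodMk_left).aestronglyMeasurable
    (Eventually.of_forall fun y => ?_)
  exact (hG.le x y).trans (le_abs_self _)

theorem eLpNorm_comp_const_sub (hw : MemLp w 2) (x : ℝ × ℝ) :
    eLpNorm (fun y => w (x - y)) 2 = eLpNorm w 2 :=
  eLpNorm_comp_measurePreserving hw.1 (measurePreserving_const_sub x)

theorem ConvDominated.integrable_mul (hG : ConvDominated w G) {v : ℝ × ℝ → ℂ} (hv : MemLp v 2)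
    (x : ℝ × ℝ) : Integrable (fun y => G x y * v y) :=
  (hG.memLp_left x).integrable_mul hv

/-- The pointwise bound by the Cauchy-Schwarz inequality. -/
theorem ConvDominated.norm_integral_le (hG : ConvDominated w G) (v : L2Plane) (x : ℝ × ℝ) :
    ‖∫ y, G x y * v y‖ ≤ (eLpNorm w 2).toReal * ‖v‖ := by
  have h1 := hG.memLp_left x
  have h2 : MemLp (fun y => starRingEnd ℂ (G x y)) 2 := by
    refine h1.mono ?_ (Eventually.of_forall fun y => by simp)
    exact Complex.continuous_conj.comp_aestronglyMeasurable h1.1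
  have e : ∫ y, G x y * v y = ⟪h2.toLp, v⟫_ℂ := by
    rw [inner_eq_integral]
    refine integral_congr_ae ?_
    filter_upwards [h2.coeFn_toLp] with y hy
    rw [hy, Complex.conj_conj]
  rw [e]
  refine (norm_inner_le_norm _ _).trans ?_
  gcongr
  rw [Lp.norm_toLp]
  refine ENNReal.toReal_mono hG.memLp.2.ne ?_
  rw [← eLpNorm_comp_const_sub hG.memLp x]
  refine eLpNorm_mono fun y => ?_
  simpa using (hG.le x y).trans (le_abs_self _)

/-- Young's inequality L¹ * L² ⊂ L²: write f = f^{1/2} f^{1/2}, apply the Cauchy-Schwarz inequality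
in y, then exchange the integrals. -/
theorem lintegral_conv_sq_le {f v : ℝ × ℝ → ENNReal} (hf : Measurable f) (hv : AEMeasurable v) :
    ∫⁻ x, (∫⁻ y, f (x - y) * v y) ^ 2 ≤ (∫⁻ u, f u) ^ 2 * ∫⁻ y, v y ^ 2 := by
  have hp : (2 : ℝ).HolderConjugate 2 := Real.HolderConjugate.two_two
  have key : ∀ x, (∫⁻ y, f (x - y) * v y) ^ 2 ≤ (∫⁻ u, f u) * ∫⁻ y, f (x - y) * v y ^ 2 := by
    intro x
    have hfx : Measurable fun y => f (x - y) := hf.comp (measurable_const.sub measurable_id)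
    have := ENNReal.lintegral_mul_le_Lp_mul_Lq volume hp
      (f := fun y => f (x - y) ^ (1 / 2 : ℝ)) (g := fun y => f (x - y) ^ (1 / 2 : ℝ) * v y)
      (hfx.pow_const _).aemeasurable ((hfx.pow_const _).aemeasurable.mul hv)
    have e1 : ∀ y, ((fun y => f (x - y) ^ (1 / 2 : ℝ)) *
        (fun y => f (x - y) ^ (1 / 2 : ℝ) * v y)) y = f (x - y) * v y := by
      intro y
      simp only [Pi.mul_apply]
      rw [← mul_assoc, ← ENNReal.rpow_add_of_nonneg _ _ (by norm_num) (by norm_num)]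
      norm_num
    have e2 : ∀ y, (f (x - y) ^ (1 / 2 : ℝ)) ^ (2 : ℝ) = f (x - y) := by
      intro y
      rw [← ENNReal.rpow_mul]; norm_num
    have e3 : ∀ y, (f (x - y) ^ (1 / 2 : ℝ) * v y) ^ (2 : ℝ) = f (x - y) * v y ^ 2 := by
      intro y
      rw [ENNReal.mul_rpow_of_nonneg _ _ (by norm_num), e2, ENNReal.rpow_two]
    simp only [e1, e2, e3] at this
    calc _ ≤ _ := pow_le_pow_left' this 2
      _ = _ := by
        rw [mul_pow, ← ENNReal.rpow_two, ← ENNReal.rpow_two, ← ENNReal.rpow_mul,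
          ← ENNReal.rpow_mul, lintegral_sub_left_eq_self f x]
        norm_num
  have hm : AEMeasurable (Function.uncurry fun x y : ℝ × ℝ => f (x - y) * v y ^ 2)
      (volume.prod volume) :=
    (hf.comp (measurable_fst.sub measurable_snd)).aemeasurable.mul
      ((hv.comp_quasiMeasurePreserving Measure.quasiMeasurePreserving_snd).pow_const 2)
  calc _ ≤ ∫⁻ x, (∫⁻ u, f u) * ∫⁻ y, f (x - y) * v y ^ 2 := lintegral_mono key
    _ = (∫⁻ u, f u) * ∫⁻ x, ∫⁻ y, f (x - y) * v y ^ 2 := by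
      rw [lintegral_const_mul'']
      exact hm.lintegral_prod_right'
    _ = (∫⁻ u, f u) * ∫⁻ y, ∫⁻ x, f (x - y) * v y ^ 2 := by rw [lintegral_lintegral_swap hm]
    _ = (∫⁻ u, f u) * ∫⁻ y, (∫⁻ u, f u) * v y ^ 2 := by
      congr 2
      funext y
      rw [lintegral_mul_const _ (show Measurable fun x => f (x - y) from
        hf.comp (measurable_id.sub measurable_const)), lintegral_sub_right_eq_self f y]
    _ = _ := by
      rw [lintegral_const_mul'' _ (hv.pow_const 2), sq, mul_assoc]

theorem lintegral_enorm_le (hG : ConvDominated w G) {v : ℝ × ℝ → ℂ} (hv : MemLp v 2) :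
    ∫⁻ x, (∫⁻ y, ‖G x y * v y‖ₑ) ^ 2 ≤ (ENNReal.ofReal (∫ u, w u)) ^ 2 * (eLpNorm v 2) ^ 2 := by
  have hm := hG.integrable.1
  -- The weight is only almost everywhere measurable, while the convolution estimate needs a
  -- measurable function; for each x the two agree at almost every y.
  set w' := hm.mk w with hw'
  have hw'm : Measurable fun u => ‖w' u‖ₑ := hm.stronglyMeasurable_mk.measurable.enorm
  have hae : ∀ x, ∀ᵐ y, ‖G x y * v y‖ₑ ≤ ‖w' (x - y)‖ₑ * ‖v y‖ₑ := by
    intro x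
    have := (measurePreserving_const_sub x).quasiMeasurePreserving.ae (hm.ae_eq_mk)
    filter_upwards [this] with y hy
    rw [enorm_mul]
    gcongr
    rw [hw', ← hy, enorm_le_iff_norm_le]
    exact (hG.le x y).trans (le_abs_self _)
  have h1 := lintegral_conv_sq_le hw'm (v := fun y => ‖v y‖ₑ) hv.1.enorm
  refine (lintegral_mono fun x => pow_le_pow_left' (lintegral_mono_ae (hae x)) 2).trans
    (h1.trans (le_of_eq ?_))
  congr 2
  · rw [← ofReal_integral_norm_eq_lintegral_enorm (hG.integrable.congr hm.ae_eq_mk)]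
    congr 1
    refine integral_congr_ae ?_
    filter_upwards [hm.ae_eq_mk] with u hu
    rw [← hu, Real.norm_eq_abs, abs_of_nonneg (hG.nonneg u)]
  · rw [eLpNorm_eq_lintegral_rpow_enorm_toReal (by norm_num) (by norm_num)]
    simp only [ENNReal.toReal_ofNat, ENNReal.rpow_two]
    rw [← ENNReal.rpow_two, ← ENNReal.rpow_mul]
    norm_num

theorem ConvDominated.aestronglyMeasurable_prod (hG : ConvDominated w G) {v : ℝ × ℝ → ℂ}
    (hv : AEStronglyMeasurable v) :
    AEStronglyMeasurable (fun p : (ℝ × ℝ) × (ℝ × ℝ) => G p.1 p.2 * v p.2) (volume.prod volume) :=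
  hG.measurable.aestronglyMeasurable.mul
    (hv.comp_quasiMeasurePreserving Measure.quasiMeasurePreserving_snd)

theorem eLpNorm_two_le_of_lintegral_sq_le {f : ℝ × ℝ → ℂ} {g : ℝ × ℝ → ENNReal} {C : ENNReal}
    (hfg : ∀ x, ‖f x‖ₑ ≤ g x) (hg : ∫⁻ x, g x ^ 2 ≤ C ^ 2) : eLpNorm f 2 ≤ C := by
  rw [eLpNorm_eq_lintegral_rpow_enorm_toReal (by norm_num) (by norm_num)]
  simp only [ENNReal.toReal_ofNat, ENNReal.rpow_two]
  have : (∫⁻ x, ‖f x‖ₑ ^ 2) ≤ C ^ 2 :=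
    (lintegral_mono fun x => pow_le_pow_left' (hfg x) 2).trans hg
  calc _ ≤ (C ^ 2) ^ (1 / 2 : ℝ) := by gcongr
    _ = C := by
      rw [← ENNReal.rpow_two, ← ENNReal.rpow_mul]; norm_num

theorem ConvDominated.eLpNorm_le (hG : ConvDominated w G) {v : ℝ × ℝ → ℂ} (hv : MemLp v 2) :
    eLpNorm (fun x => ∫ y, G x y * v y) 2 ≤ ENNReal.ofReal (∫ u, w u) * eLpNorm v 2 := by
  refine eLpNorm_two_le_of_lintegral_sq_le
    (fun x => enorm_integral_le_lintegral_enorm fun y => G x y * v y) ?_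
  rw [mul_pow]
  exact lintegral_enorm_le hG hv

theorem ConvDominated.memLp_integral (hG : ConvDominated w G) {v : ℝ × ℝ → ℂ} (hv : MemLp v 2) :
    MemLp (fun x => ∫ y, G x y * v y) 2 :=
  ⟨(hG.aestronglyMeasurable_prod hv.1).integral_prod_right',
    (hG.eLpNorm_le hv).trans_lt (ENNReal.mul_lt_top ENNReal.ofReal_lt_top hv.2)⟩

/-- The integral operator with kernel `G`. -/
def ConvDominated.op (hG : ConvDominated w G) : L2Plane →L[ℂ] L2Plane :=
  LinearMap.mkContinuous
    { toFun := fun v => (hG.memLp_integral (Lp.memLp v)).toLp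
      map_add' := fun u v => by
        rw [← MemLp.toLp_add, MemLp.toLp_eq_toLp_iff]
        refine Eventually.of_forall fun x => ?_
        simp only [Pi.add_apply]
        rw [← integral_add (hG.integrable_mul (Lp.memLp u) x) (hG.integrable_mul (Lp.memLp v) x)]
        refine integral_congr_ae ?_
        filter_upwards [Lp.coeFn_add u v] with y hy
        rw [hy, Pi.add_apply, mul_add]
      map_smul' := fun c v => by
        rw [RingHom.id_apply, ← MemLp.toLp_const_smul, MemLp.toLp_eq_toLp_iff]
        refine Eventually.of_forall fun x => ?_
        simp only [Pi.smul_apply, smul_eq_mul]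
        rw [← integral_const_mul]
        refine integral_congr_ae ?_
        filter_upwards [Lp.coeFn_smul c v] with y hy
        rw [hy, Pi.smul_apply, smul_eq_mul]
        ring }
    (∫ u, w u) fun v => by
      have h0 : 0 ≤ ∫ u, w u := integral_nonneg hG.nonneg
      simp only [LinearMap.coe_mk, AddHom.coe_mk]
      rw [Lp.norm_toLp, Lp.norm_def, ← ENNReal.toReal_ofReal h0, ← ENNReal.toReal_mul]
      exact ENNReal.toReal_mono (ENNReal.mul_lt_top ENNReal.ofReal_lt_top (Lp.memLp v).2).ne
        (hG.eLpNorm_le (Lp.memLp v))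

theorem ConvDominated.op_coeFn (hG : ConvDominated w G) (v : L2Plane) :
    hG.op v =ᵐ[volume] fun x => ∫ y, G x y * v y :=
  (hG.memLp_integral (Lp.memLp v)).coeFn_toLp

theorem ConvDominated.norm_op_le (hG : ConvDominated w G) : ‖hG.op‖ ≤ ∫ u, w u :=
  LinearMap.mkContinuous_norm_le _ (integral_nonneg hG.nonneg) _

/-- Fubini's theorem. Absolute integrability of the double integral follows from applying the L²
bound to the absolute values of the kernel and of v. -/
theorem ConvDominated.inner_op (hG : ConvDominated w G) {w' : ℝ × ℝ → ℝ}
    {G' : ℝ × ℝ → ℝ × ℝ → ℂ} (hG' : ConvDominated w' G')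
    (hGG' : ∀ x y, G' x y = starRingEnd ℂ (G y x)) (u v : L2Plane) :
    ⟪u, hG.op v⟫_ℂ = ⟪hG'.op u, v⟫_ℂ := by
  have hint : Integrable (fun p : (ℝ × ℝ) × (ℝ × ℝ) => starRingEnd ℂ (u p.1) * (G p.1 p.2 * v p.2))
      (volume.prod volume) := by
    have hm : AEStronglyMeasurable
        (fun p : (ℝ × ℝ) × (ℝ × ℝ) => starRingEnd ℂ (u p.1) * (G p.1 p.2 * v p.2))
        (volume.prod volume) :=
      (Complex.continuous_conj.comp_aestronglyMeasurable
        ((Lp.memLp u).1.comp_quasiMeasurePreserving Measure.quasiMeasurePreserving_fst)).mul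
        (hG.aestronglyMeasurable_prod (Lp.memLp v).1)
    refine (integrable_prod_iff hm).2 ⟨Eventually.of_forall fun x =>
      (hG.integrable_mul (Lp.memLp v) x).const_mul (starRingEnd ℂ (u x)), ?_⟩
    have h1 : MemLp (fun x => ∫ y, ‖G x y * v y‖) 2 := by
      refine ⟨(hG.aestronglyMeasurable_prod (Lp.memLp v).1).norm.integral_prod_right', ?_⟩
      have : eLpNorm (fun x => ((∫ y, ‖G x y * v y‖ : ℝ) : ℂ)) 2 ≤
          ENNReal.ofReal (∫ u, w u) * eLpNorm v 2 := by
        refine eLpNorm_two_le_of_lintegral_sq_le (g := fun x => ∫⁻ y, ‖G x y * v y‖ₑ)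
          (fun x => ?_) ?_
        · have e := enorm_integral_le_lintegral_enorm (μ := (volume : Measure (ℝ × ℝ)))
            (fun y => ‖G x y * v y‖)
          simp only [enorm_norm] at e
          refine le_trans (le_of_eq ?_) e
          rw [enorm_eq_iff_norm_eq, Complex.norm_real]
        · rw [mul_pow]
          exact lintegral_enorm_le hG (Lp.memLp v)
      refine lt_of_le_of_lt (le_of_eq ?_) (this.trans_lt
        (ENNReal.mul_lt_top ENNReal.ofReal_lt_top (Lp.memLp v).2))
      exact eLpNorm_congr_norm_ae (Eventually.of_forall fun x => by simp)
    have := (Lp.memLp u).norm.integrable_mul h1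
    refine this.congr (Eventually.of_forall fun x => ?_)
    simp only [Pi.mul_apply, norm_mul, RCLike.norm_conj]
    rw [integral_const_mul]
  calc ⟪u, hG.op v⟫_ℂ = ∫ x, ∫ y, starRingEnd ℂ (u x) * (G x y * v y) := by
        rw [inner_eq_integral]
        refine integral_congr_ae ?_
        filter_upwards [hG.op_coeFn v] with x hx
        rw [hx, integral_const_mul]
    _ = ∫ y, ∫ x, starRingEnd ℂ (u x) * (G x y * v y) := integral_integral_swap hint
    _ = _ := by
        rw [inner_eq_integral]
        refine integral_congr_ae ?_
        filter_upwards [hG'.op_coeFn u] with y hy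
        rw [hy, ← integral_conj, ← integral_mul_const]
        congr 1
        funext x
        rw [map_mul, hGG', Complex.conj_conj]
        ring

end Kernel

/-! ### Integrability of the radial bounds -/

/-- The squared Euclidean norm. -/
def sqNorm (u : ℝ × ℝ) : ℝ := u.1 ^ 2 + u.2 ^ 2

theorem sqDist_eq (x y : ℝ × ℝ) : sqDist x y = sqNorm (x - y) := rfl

theorem sqNorm_nonneg (u : ℝ × ℝ) : 0 ≤ sqNorm u := by unfold sqNorm; positivity

theorem sqNorm_neg (u : ℝ × ℝ) : sqNorm (-u) = sqNorm u := by simp [sqNorm]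

theorem sqNorm_pos {u : ℝ × ℝ} (hu : u ≠ 0) : 0 < sqNorm u := by
  rcases (sqNorm_nonneg u).lt_or_eq with h | h
  · exact h
  · exfalso
    apply hu
    have h1 : u.1 ^ 2 + u.2 ^ 2 = 0 := h.symm
    ext
    · exact pow_eq_zero_iff (two_ne_zero) |>.1 (by nlinarith [sq_nonneg u.1, sq_nonneg u.2])
    · exact pow_eq_zero_iff (two_ne_zero) |>.1 (by nlinarith [sq_nonneg u.1, sq_nonneg u.2])

theorem continuous_sqNorm : Continuous sqNorm := by unfold sqNorm; fun_prop

theorem measurable_sqNorm : Measurable sqNorm := continuous_sqNorm.measurable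

theorem ae_fst_ne_zero : ∀ᵐ u : ℝ × ℝ, u.1 ≠ 0 :=
  (Measure.quasiMeasurePreserving_fst (μ := (volume : Measure ℝ)) (ν := volume)).ae
    (Measure.ae_ne volume 0)

theorem ae_snd_ne_zero : ∀ᵐ u : ℝ × ℝ, u.2 ≠ 0 :=
  (Measure.quasiMeasurePreserving_snd (μ := (volume : Measure ℝ)) (ν := volume)).ae
    (Measure.ae_ne volume 0)

theorem integrable_abs_rpow_mul_exp {c p : ℝ} (hc : 0 < c) (hp : -1 < p) :
    Integrable fun t : ℝ => |t| ^ p * Real.exp (-c * t ^ 2) := by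
  have h1 : IntegrableOn (fun t : ℝ => |t| ^ p * Real.exp (-c * t ^ 2)) (Set.Ioi 0) := by
    refine (integrableOn_rpow_mul_exp_neg_mul_sq hc hp).congr_fun (fun t ht => ?_) measurableSet_Ioi
    simp only [abs_of_pos (Set.mem_Ioi.1 ht)]
  have h2 : IntegrableOn (fun t : ℝ => |t| ^ p * Real.exp (-c * t ^ 2)) (Set.Iic 0) := by
    rw [← Measure.map_neg_eq_self (volume : Measure ℝ)]
    let m : MeasurableEmbedding fun x : ℝ => -x := (Homeomorph.neg ℝ).measurableEmbedding
    rw [m.integrableOn_map_iff]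
    simp_rw [Function.comp_def, abs_neg, Set.neg_preimage, Set.neg_Iic, neg_zero, neg_sq]
    exact (integrableOn_Ici_iff_integrableOn_Ioi (by finiteness)).2 h1
  rw [← integrableOn_univ, ← Set.Iic_union_Ioi (a := (0 : ℝ))]
  exact h2.union h1

/-- Since |u₁||u₂| ≤ |u|² and p ≤ 0, the function is dominated by a product of functions of one
variable, each integrable because p > -1. No polar coordinates are needed. -/
theorem integrable_sqNorm_rpow_mul_exp {c p : ℝ} (hc : 0 < c) (hp : -1 < p) (hp0 : p ≤ 0) :
    Integrable fun u : ℝ × ℝ => sqNorm u ^ p * Real.exp (-(c * sqNorm u)) := by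
  have h1 := integrable_abs_rpow_mul_exp hc hp
  have h2 : Integrable (fun u : ℝ × ℝ => (|u.1| ^ p * Real.exp (-c * u.1 ^ 2)) *
    (|u.2| ^ p * Real.exp (-c * u.2 ^ 2))) := h1.mul_prod h1
  refine h2.mono' ?_ ?_
  · exact ((measurable_sqNorm.pow_const p).mul
      (measurable_sqNorm.const_mul c).neg.exp).aestronglyMeasurable
  · filter_upwards [ae_fst_ne_zero, ae_snd_ne_zero] with u hu1 hu2
    have e : Real.exp (-(c * sqNorm u)) = Real.exp (-c * u.1 ^ 2) * Real.exp (-c * u.2 ^ 2) := by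
      rw [← Real.exp_add, sqNorm]; congr 1; ring
    have a1 := abs_pos.2 hu1
    have a2 := abs_pos.2 hu2
    have hle : |u.1| * |u.2| ≤ sqNorm u := by
      rw [sqNorm, ← sq_abs u.1, ← sq_abs u.2]
      nlinarith [sq_nonneg (|u.1| - |u.2|)]
    have hs : sqNorm u ^ p ≤ |u.1| ^ p * |u.2| ^ p := by
      rw [← Real.mul_rpow a1.le a2.le]
      exact Real.rpow_le_rpow_of_nonpos (mul_pos a1 a2) hle hp0
    have hs0 : 0 ≤ sqNorm u ^ p := Real.rpow_nonneg (sqNorm_nonneg u) p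
    rw [Real.norm_eq_abs, abs_of_nonneg (by positivity), e]
    calc _ ≤ (|u.1| ^ p * |u.2| ^ p) * (Real.exp (-c * u.1 ^ 2) * Real.exp (-c * u.2 ^ 2)) := by
          gcongr
      _ = _ := by ring

/-- The dominating radial function. -/
def weight (c : ℝ) (u : ℝ × ℝ) : ℝ := sqNorm u ^ (-1 / 4 : ℝ) * Real.exp (-(c * sqNorm u))

theorem weight_nonneg (c : ℝ) (u : ℝ × ℝ) : 0 ≤ weight c u :=
  mul_nonneg (Real.rpow_nonneg (sqNorm_nonneg u) _) (Real.exp_pos _).le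

theorem integrable_weight {c : ℝ} (hc : 0 < c) : Integrable (weight c) :=
  integrable_sqNorm_rpow_mul_exp hc (by norm_num) (by norm_num)

theorem memLp_weight {c : ℝ} (hc : 0 < c) : MemLp (weight c) 2 := by
  rw [memLp_two_iff_integrable_sq_norm (integrable_weight hc).1]
  refine (integrable_sqNorm_rpow_mul_exp (c := 2 * c) (p := -1 / 2) (by positivity) (by norm_num)
    (by norm_num)).congr (Eventually.of_forall fun u => ?_)
  simp only [Real.norm_eq_abs, sq_abs, weight]
  rw [mul_pow, ← Real.rpow_natCast, ← Real.rpow_mul (sqNorm_nonneg u), ← Real.exp_nat_mul]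
  congr 2
  · norm_num
  · push_cast; ring

/-! ### The regularized Green function -/

theorem NotLevel.conj {h : ℝ} {z : ℂ} (hz : NotLevel h z) : NotLevel h (starRingEnd ℂ z) := by
  intro m hm
  apply hz m
  have := congrArg (starRingEnd ℂ) hm
  simpa [map_ofNat] using this

theorem radial_conj (h : ℝ) (z : ℂ) (s : ℝ) :
    radial h (starRingEnd ℂ z) s = starRingEnd ℂ (radial h z s) := by
  have e : (1 / 2 - starRingEnd ℂ z / (2 * h) : ℂ) = starRingEnd ℂ (1 / 2 - z / (2 * h)) := by
    simp [map_ofNat]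
  rw [radial, radial, e, Complex.Gamma_conj, kummerUOne_conj]
  simp only [map_mul, Complex.conj_ofReal, map_div₀, map_one, map_ofNat]

/-- The derivative of the radial part of the Green function. -/
def radialDeriv (h : ℝ) (z : ℂ) : ℝ → ℂ := deriv (radial h z)

/-- The anonymous derivative is replaced by `deriv`, which is a definite function and therefore
commutes with complex conjugation in z. -/
theorem isRadialGreen {h : ℝ} (hh : 0 < h) {z : ℂ} (hz : NotLevel h z) :
    IsRadialGreen h z (radial h z) (radialDeriv h z) := by
  obtain ⟨k', hk⟩ := (isRadialGreen_radial hh hz).1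
  have e : ∀ s > 0, radialDeriv h z s = k' s := fun s hs => (hk.deriv s hs).deriv
  obtain ⟨C, hC, hb⟩ := hk.bound
  refine ⟨fun s hs => ?_, fun s hs => ?_, ⟨C, hC, fun s hs => ?_⟩, ?_⟩
  · rw [e s hs]; exact hk.deriv s hs
  · rw [e s hs]
    exact (hk.deriv2 s hs).congr_of_eventuallyEq (by
      filter_upwards [Ioi_mem_nhds hs] with t ht using e t ht)
  · rw [e s hs]; exact hb s hs
  · refine hk.lim1.congr' ?_
    filter_upwards [self_mem_nhdsWithin] with s hs
    rw [e s hs]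

theorem radialDeriv_conj (h : ℝ) (z : ℂ) (s : ℝ) :
    radialDeriv h (starRingEnd ℂ z) s = starRingEnd ℂ (radialDeriv h z s) := by
  have : radial h (starRingEnd ℂ z) = fun s => star (radial h z s) := by
    funext s; exact radial_conj h z s
  rw [radialDeriv, this, deriv.star]
  rfl

/-- The Green function, regularized by a shift of the squared distance. -/
def regGreen (h : ℝ) (z : ℂ) (ε : ℝ) (x y : ℝ × ℝ) : ℂ :=
  gaugePhase h x y * radial h z (sqDist x y + ε)

theorem green_eq (h : ℝ) (z : ℂ) (x y : ℝ × ℝ) : green h z x y = regGreen h z 0 x y := by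
  have e : Complex.exp (-(Complex.I * h * (x.1 - y.1) * (x.2 + y.2) / 2) - h * (eDist x y) ^ 2 / 4)
      = gaugePhase h x y * (Real.exp (-(h * sqDist x y / 4)) : ℂ) := by
    rw [gaugePhase, Complex.ofReal_exp, ← Complex.exp_add]
    congr 1
    rw [← Complex.ofReal_pow, eDist_sq]
    push_cast; ring
  rw [green, e, regGreen, radial, add_zero, eDist_sq]
  ring

theorem regGreen_conj (h : ℝ) (z : ℂ) (ε : ℝ) (x y : ℝ × ℝ) :
    regGreen h (starRingEnd ℂ z) ε x y = starRingEnd ℂ (regGreen h z ε y x) := by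
  rw [regGreen, regGreen, map_mul, gaugePhase_conj, radial_conj, sqDist_comm]

/-- The radial profile is singular at 0. Composed with the absolute value it is continuous off one
point, which suffices for measurability whatever its value there. -/
theorem measurable_comp_of_continuousOn {k : ℝ → ℂ} (hk : ContinuousOn k (Set.Ioi 0))
    {α : Type*} [MeasurableSpace α] {f : α → ℝ} (hf : Measurable f) (h0 : ∀ a, 0 ≤ f a) :
    Measurable fun a => k (f a) := by
  have h1 : Measurable fun s : ℝ => k |s| := by
    refine measurable_of_continuousOn_compl_singleton 0 ?_
    exact hk.comp continuous_abs.continuousOn fun s hs => abs_pos.2 hs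
  have e : (fun a => k (f a)) = (fun s : ℝ => k |s|) ∘ f := by
    funext a
    simp only [Function.comp, abs_of_nonneg (h0 a)]
  rw [e]
  exact h1.comp hf

theorem measurable_gaugePhase (h : ℝ) : Measurable (Function.uncurry (gaugePhase h)) := by
  have : Continuous (Function.uncurry (gaugePhase h)) := by
    unfold gaugePhase Function.uncurry
    fun_prop
  exact this.measurable

theorem continuous_sqDist : Continuous (Function.uncurry sqDist) := by
  unfold sqDist Function.uncurry
  fun_prop

section Green

variable {h : ℝ} {z : ℂ}

theorem IsRadialGreen.continuousOn {k k' : ℝ → ℂ} (hk : IsRadialGreen h z k k') :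
    ContinuousOn k (Set.Ioi 0) := fun s hs => (hk.deriv s hs).continuousAt.continuousWithinAt

theorem IsRadialGreen.continuousOn' {k k' : ℝ → ℂ} (hk : IsRadialGreen h z k k') :
    ContinuousOn k' (Set.Ioi 0) := fun s hs => (hk.deriv2 s hs).continuousAt.continuousWithinAt

theorem measurable_radial_comp (hh : 0 < h) (hz : NotLevel h z) {α : Type*} [MeasurableSpace α]
    {f : α → ℝ} (hf : Measurable f) (h0 : ∀ a, 0 ≤ f a) : Measurable fun a => radial h z (f a) :=
  measurable_comp_of_continuousOn (isRadialGreen hh hz).continuousOn hf h0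

/-- The domination of the Green function, uniform in the regularization. -/
theorem exists_norm_radial_le (hh : 0 < h) (hz : NotLevel h z) :
    ∃ C > 0, ∀ ε ≥ 0, ∀ u : ℝ × ℝ, u ≠ 0 →
      ‖radial h z (sqNorm u + ε)‖ ≤ C * weight (h / 8) u := by
  obtain ⟨C, hC, hb⟩ := (isRadialGreen hh hz).bound
  refine ⟨C, hC, fun ε hε u hu => ?_⟩
  have hs := sqNorm_pos hu
  refine (hb (sqNorm u + ε) (by linarith)).1.trans ?_
  rw [weight]
  gcongr C * (?_ * ?_)
  · exact Real.rpow_le_rpow_of_nonpos hs (by linarith) (by norm_num)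
  · refine Real.exp_le_exp.2 ?_
    nlinarith

theorem ae_ne_zero : ∀ᵐ u : ℝ × ℝ, u ≠ 0 := by
  filter_upwards [ae_fst_ne_zero] with u hu h0
  exact hu (by rw [h0]; rfl)

theorem integrable_norm_radial (hh : 0 < h) (hz : NotLevel h z) {ε : ℝ} (hε : 0 ≤ ε) :
    Integrable fun u => ‖radial h z (sqNorm u + ε)‖ := by
  obtain ⟨C, hC, hb⟩ := exists_norm_radial_le hh hz
  refine ((integrable_weight (c := h / 8) (by positivity)).const_mul C).mono'
    (measurable_radial_comp hh hz (measurable_sqNorm.add_const ε) fun u =>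
      add_nonneg (sqNorm_nonneg u) hε).norm.aestronglyMeasurable ?_
  filter_upwards [ae_ne_zero] with u hu
  rw [norm_norm]
  exact hb ε hε u hu

theorem memLp_norm_radial (hh : 0 < h) (hz : NotLevel h z) {ε : ℝ} (hε : 0 ≤ ε) :
    MemLp (fun u => ‖radial h z (sqNorm u + ε)‖) 2 := by
  obtain ⟨C, hC, hb⟩ := exists_norm_radial_le hh hz
  refine ((memLp_weight (c := h / 8) (by positivity)).const_mul C).mono
    (measurable_radial_comp hh hz (measurable_sqNorm.add_const ε) fun u =>
      add_nonneg (sqNorm_nonneg u) hε).norm.aestronglyMeasurable ?_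
  filter_upwards [ae_ne_zero] with u hu
  rw [norm_norm]
  exact (hb ε hε u hu).trans (le_abs_self _)

theorem convDominated_regGreen (hh : 0 < h) (hz : NotLevel h z) {ε : ℝ} (hε : 0 ≤ ε) :
    ConvDominated (fun u => ‖radial h z (sqNorm u + ε)‖) (regGreen h z ε) where
  measurable := (measurable_gaugePhase h).mul (measurable_radial_comp hh hz
    (continuous_sqDist.measurable.add_const ε) fun p => add_nonneg (sqDist_nonneg _ _) hε)
  le x y := by rw [regGreen, norm_mul, norm_gaugePhase, one_mul, sqDist_eq]
  integrable := integrable_norm_radial hh hz hε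
  memLp := memLp_norm_radial hh hz hε

theorem convDominated_regGreen_sub (hh : 0 < h) (hz : NotLevel h z) {ε : ℝ} (hε : 0 ≤ ε) :
    ConvDominated (fun u => ‖radial h z (sqNorm u + ε) - radial h z (sqNorm u + 0)‖)
      (fun x y => regGreen h z ε x y - regGreen h z 0 x y) where
  measurable := (convDominated_regGreen hh hz hε).measurable.sub
    (convDominated_regGreen hh hz le_rfl).measurable
  le x y := by
    rw [regGreen, regGreen, ← mul_sub, norm_mul, norm_gaugePhase, one_mul, sqDist_eq]
  integrable := by
    refine ((integrable_norm_radial hh hz hε).add (integrable_norm_radial hh hz le_rfl)).mono'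
      ?_ (Eventually.of_forall fun u => by rw [norm_norm]; exact norm_sub_le _ _)
    exact ((measurable_radial_comp hh hz (measurable_sqNorm.add_const ε) fun u =>
      add_nonneg (sqNorm_nonneg u) hε).sub (measurable_radial_comp hh hz
      (measurable_sqNorm.add_const 0) fun u => add_nonneg (sqNorm_nonneg u)
      le_rfl)).norm.aestronglyMeasurable
  memLp := by
    refine ((memLp_norm_radial hh hz hε).add (memLp_norm_radial hh hz le_rfl)).mono
      ?_ (Eventually.of_forall fun u => by
        rw [norm_norm]; exact (norm_sub_le _ _).trans (le_abs_self _))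
    exact ((measurable_radial_comp hh hz (measurable_sqNorm.add_const ε) fun u =>
      add_nonneg (sqNorm_nonneg u) hε).sub (measurable_radial_comp hh hz
      (measurable_sqNorm.add_const 0) fun u => add_nonneg (sqNorm_nonneg u)
      le_rfl)).norm.aestronglyMeasurable

/-- Dominated convergence with a bound uniform in ε. By the convolution estimate the L¹ norm
dominates the operator norm, so the regularized Green operators converge in norm. -/
theorem tendsto_integral_regGreen_sub (hh : 0 < h) (hz : NotLevel h z) :
    Tendsto (fun ε : ℝ => ∫ u, ‖radial h z (sqNorm u + ε) - radial h z (sqNorm u + 0)‖)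
      (𝓝[>] 0) (𝓝 0) := by
  obtain ⟨C, hC, hb⟩ := exists_norm_radial_le hh hz
  have h0 : (𝓝 (0 : ℝ)) = 𝓝 (∫ _ : ℝ × ℝ, (0 : ℝ)) := by simp
  rw [h0]
  refine tendsto_integral_filter_of_dominated_convergence (fun u => 2 * (C * weight (h / 8) u))
    ?_ ?_ (((integrable_weight (by positivity)).const_mul C).const_mul 2) ?_
  · filter_upwards [self_mem_nhdsWithin] with ε hε
    exact (convDominated_regGreen_sub hh hz (le_of_lt hε)).integrable.1
  · filter_upwards [self_mem_nhdsWithin] with ε hε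
    filter_upwards [ae_ne_zero] with u hu
    rw [norm_norm]
    have := hb ε (le_of_lt hε) u hu
    have := hb 0 le_rfl u hu
    exact (norm_sub_le _ _).trans (by linarith)
  · filter_upwards [ae_ne_zero] with u hu
    have hc : ContinuousAt (radial h z) (sqNorm u + 0) :=
      ((isRadialGreen hh hz).deriv _ (by rw [add_zero]; exact sqNorm_pos hu)).continuousAt
    have h1 : Tendsto (fun ε : ℝ => radial h z (sqNorm u + ε)) (𝓝[>] 0)
        (𝓝 (radial h z (sqNorm u + 0))) :=
      hc.tendsto.comp (tendsto_nhdsWithin_of_tendsto_nhds (tendsto_id.const_add (sqNorm u)))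
    have := (h1.sub_const (radial h z (sqNorm u + 0))).norm
    simpa using this

end Green

/-! ### The approximation of the delta function -/

/-- `σ²` times the residue of the equation of the regularized Green function. -/
def resid (h : ℝ) (z : ℂ) (σ : ℝ) : ℂ := σ * (-z * radial h z σ - 4 * radialDeriv h z σ)

/-- The result of applying `H_h - z` to the regularized Green function. -/
def regDelta (h : ℝ) (z : ℂ) (ε : ℝ) (x y : ℝ × ℝ) : ℂ :=
  gaugePhase h x y * (ε * resid h z (sqDist x y + ε) / (sqDist x y + ε : ℝ) ^ 2)

theorem resid_conj (h : ℝ) (z : ℂ) (σ : ℝ) :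
    resid h (starRingEnd ℂ z) σ = starRingEnd ℂ (resid h z σ) := by
  simp only [resid, radial_conj, radialDeriv_conj, map_mul, map_sub, map_neg, Complex.conj_ofReal,
    map_ofNat]

theorem regDelta_conj (h : ℝ) (z : ℂ) (ε : ℝ) (x y : ℝ × ℝ) :
    regDelta h (starRingEnd ℂ z) ε x y = starRingEnd ℂ (regDelta h z ε y x) := by
  simp only [regDelta, resid_conj, map_mul, gaugePhase_conj, map_div₀, map_pow,
    Complex.conj_ofReal, sqDist_comm y x]

section Green

variable {h : ℝ} {z : ℂ}

theorem mul_norm_radial_le (hh : 0 < h) (hz : NotLevel h z) :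
    ∃ C > 0, ∀ σ > 0, σ * ‖radial h z σ‖ ≤ C * (σ ^ (3 / 4 : ℝ) * Real.exp (-(h / 8 * σ))) := by
  obtain ⟨C, hC, hb⟩ := (isRadialGreen hh hz).bound
  refine ⟨C, hC, fun σ hσ => ?_⟩
  calc σ * ‖radial h z σ‖ ≤ σ * (C * (σ ^ (-1 / 4 : ℝ) * Real.exp (-(h / 8 * σ)))) := by
        gcongr; exact (hb σ hσ).1
    _ = _ := by
      have : σ ^ (3 / 4 : ℝ) = σ * σ ^ (-1 / 4 : ℝ) := by
        nth_rewrite 2 [← Real.rpow_one σ]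
        rw [← Real.rpow_add hσ]; norm_num
      rw [this]; ring

theorem exists_norm_resid_le (hh : 0 < h) (hz : NotLevel h z) :
    ∃ C > 0, ∀ σ > 0, ‖resid h z σ‖ ≤ C := by
  obtain ⟨C, hC, hb⟩ := (isRadialGreen hh hz).bound
  obtain ⟨D, hD, hd⟩ := mul_norm_radial_le hh hz
  refine ⟨‖z‖ * (D * (1 + 8 / h)) + 4 * C, by positivity, fun σ hσ => ?_⟩
  have h1 : σ ^ (3 / 4 : ℝ) * Real.exp (-(h / 8 * σ)) ≤ 1 + 8 / h := by
    have a1 : σ ^ (3 / 4 : ℝ) ≤ 1 + σ := by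
      rcases le_total σ 1 with hs | hs
      · exact (Real.rpow_le_one hσ.le hs (by norm_num)).trans (by linarith)
      · calc σ ^ (3 / 4 : ℝ) ≤ σ ^ (1 : ℝ) := Real.rpow_le_rpow_of_exponent_le hs (by norm_num)
          _ ≤ 1 + σ := by rw [Real.rpow_one]; linarith
    have a2 := Real.add_one_le_exp (h / 8 * σ)
    rw [Real.exp_neg, ← div_eq_mul_inv, div_le_iff₀ (Real.exp_pos _)]
    calc σ ^ (3 / 4 : ℝ) ≤ 1 + σ := a1
      _ ≤ (1 + 8 / h) * (h / 8 * σ + 1) := by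
        have : 8 / h * (h / 8 * σ) = σ := by field_simp
        have h3 : 0 < 8 / h := by positivity
        have h4 : 0 < h / 8 * σ := by positivity
        linarith
      _ ≤ _ := by gcongr
  have h2 : Real.exp (-(h / 8 * σ)) ≤ 1 := Real.exp_le_one_iff.2 (by
    have : 0 < h / 8 * σ := by positivity
    linarith)
  have h3 := (hb σ hσ).2
  have h4 := hd σ hσ
  calc ‖resid h z σ‖ ≤ ‖z‖ * (σ * ‖radial h z σ‖) + 4 * (σ * ‖radialDeriv h z σ‖) := by
        rw [resid, norm_mul, Complex.norm_real, Real.norm_eq_abs, abs_of_pos hσ]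
        refine (mul_le_mul_of_nonneg_left (norm_sub_le _ _) hσ.le).trans (le_of_eq ?_)
        rw [norm_mul, norm_mul, norm_neg, Complex.norm_ofNat]
        ring
    _ ≤ ‖z‖ * (D * (1 + 8 / h)) + 4 * (C * 1) := by
        have h5 : σ * ‖radial h z σ‖ ≤ D * (1 + 8 / h) := h4.trans (by gcongr)
        have h6 : σ * ‖radialDeriv h z σ‖ ≤ C * 1 := h3.trans (by gcongr)
        exact add_le_add (mul_le_mul_of_nonneg_left h5 (norm_nonneg z)) (by linarith)
    _ = _ := by ring

/-- The term with the profile itself vanishes like σ^{3/4}; the derivative term contributes -4 ·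
(-1/(4π)) = 1/π. -/
theorem tendsto_resid (hh : 0 < h) (hz : NotLevel h z) :
    Tendsto (resid h z) (𝓝[>] 0) (𝓝 (1 / Real.pi)) := by
  obtain ⟨D, hD, hd⟩ := mul_norm_radial_le hh hz
  have h1 : Tendsto (fun σ : ℝ => (σ : ℂ) * radial h z σ) (𝓝[>] 0) (𝓝 0) := by
    rw [tendsto_zero_iff_norm_tendsto_zero]
    have h2 : Tendsto (fun σ : ℝ => D * (σ ^ (3 / 4 : ℝ) * Real.exp (-(h / 8 * σ)))) (𝓝[>] 0)
        (𝓝 (D * ((0 : ℝ) ^ (3 / 4 : ℝ) * Real.exp (-(h / 8 * 0))))) := by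
      refine tendsto_nhdsWithin_of_tendsto_nhds (Tendsto.const_mul D (Tendsto.mul ?_ ?_))
      · exact (Real.continuousAt_rpow_const 0 (3 / 4) (Or.inr (by norm_num))).tendsto
      · exact (by fun_prop : Continuous fun σ : ℝ => Real.exp (-(h / 8 * σ))).tendsto 0
    rw [Real.zero_rpow (by norm_num), zero_mul, mul_zero] at h2
    refine squeeze_zero' (Eventually.of_forall fun _ => norm_nonneg _) ?_ h2
    filter_upwards [self_mem_nhdsWithin] with σ hσ
    rw [norm_mul, Complex.norm_real, Real.norm_eq_abs, abs_of_pos hσ]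
    exact hd σ hσ
  have h2 := (h1.const_mul (-z)).sub ((isRadialGreen hh hz).lim1.const_mul 4)
  refine (h2.congr fun σ => ?_).trans_eq ?_
  · rw [resid]; ring
  · congr 1
    have : (Real.pi : ℂ) ≠ 0 := by exact_mod_cast Real.pi_ne_zero
    field_simp
    ring

/-! ### The mass of the limit -/

theorem integrable_one_add_sqNorm : Integrable fun u : ℝ × ℝ => ((1 + sqNorm u) ^ 2)⁻¹ := by
  -- The exponent 4 exceeds the dimension 2; the sup norm is smaller than the Euclidean norm, so
  -- this function dominates.
  have h1 : Integrable (fun u : ℝ × ℝ => (1 + ‖u‖ ^ 2) ^ (-(4 : ℝ) / 2)) :=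
    integrable_rpow_neg_one_add_norm_sq (by simp; norm_num)
  refine h1.mono' (((measurable_sqNorm.const_add 1).pow_const 2).inv).aestronglyMeasurable
    (Eventually.of_forall fun u => ?_)
  have h0 := sqNorm_nonneg u
  have hle : ‖u‖ ^ 2 ≤ sqNorm u := by
    rw [Prod.norm_def, sqNorm]
    rcases max_cases ‖u.1‖ ‖u.2‖ with ⟨h, -⟩ | ⟨h, -⟩ <;> rw [h] <;>
      simp only [Real.norm_eq_abs, sq_abs] <;> nlinarith [sq_nonneg u.1, sq_nonneg u.2]
  rw [Real.norm_eq_abs, abs_of_nonneg (by positivity), ← Real.rpow_natCast, ← Real.rpow_neg (by positivity)]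
  norm_num
  gcongr

/-- Polar coordinates give (1/2) · 2π. This mass cancels the limit 1/π of `resid`, so the
approximate delta function has total mass 1 in the limit. -/
theorem integral_one_add_sqNorm : ∫ u : ℝ × ℝ, ((1 + sqNorm u) ^ 2)⁻¹ = Real.pi := by
  rw [← integral_comp_polarCoord_symm]
  have e : ∀ p ∈ polarCoord.target, p.1 • ((1 + sqNorm (polarCoord.symm p)) ^ 2)⁻¹ =
      (p.1 * ((1 + p.1 ^ 2) ^ 2)⁻¹) * 1 := by
    intro p _
    have : sqNorm (polarCoord.symm p) = p.1 ^ 2 := by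
      simp only [sqNorm, polarCoord_symm_apply]
      nlinarith [Real.sin_sq_add_cos_sq p.2]
    rw [this, smul_eq_mul, mul_one]
  rw [setIntegral_congr_fun (by rw [polarCoord_target]; measurability) e, polarCoord_target]
  have := setIntegral_prod_mul (μ := (volume : Measure ℝ)) (ν := (volume : Measure ℝ))
    (fun r : ℝ => r * ((1 + r ^ 2) ^ 2)⁻¹) (fun _ : ℝ => (1 : ℝ)) (Set.Ioi 0)
    (Set.Ioo (-Real.pi) Real.pi)
  refine this.trans ?_
  have hr : ∫ r in Set.Ioi (0 : ℝ), r * ((1 + r ^ 2) ^ 2)⁻¹ = 1 / 2 := by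
    have hd : ∀ r ∈ Set.Ici (0 : ℝ), HasDerivAt (fun r : ℝ => -(1 / 2) * (1 + r ^ 2)⁻¹)
        (r * ((1 + r ^ 2) ^ 2)⁻¹) r := by
      intro r _
      have h1 : HasDerivAt (fun r : ℝ => 1 + r ^ 2) (2 * r) r := by
        simpa using (hasDerivAt_pow 2 r).const_add 1
      refine ((h1.inv (by positivity)).const_mul (-(1 / 2))).congr_deriv ?_
      field_simp
    have hlim : Tendsto (fun r : ℝ => -(1 / 2) * (1 + r ^ 2)⁻¹) atTop (𝓝 (-(1 / 2) * 0)) := by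
      refine Tendsto.const_mul _ (tendsto_inv_atTop_zero.comp ?_)
      exact tendsto_atTop_add_const_left _ _ (tendsto_pow_atTop two_ne_zero)
    rw [integral_Ioi_of_hasDerivAt_of_nonneg' hd (fun r hr => by
      have : 0 < r := hr
      positivity) hlim]
    norm_num
  rw [hr]
  simp only [integral_const, MeasurableSet.univ, measureReal_restrict_apply, Set.univ_inter,
    Real.volume_real_Ioo, smul_eq_mul, mul_one]
  rw [max_eq_left (by linarith [Real.pi_pos])]
  ring

/-! ### Convergence to the delta function -/

theorem convDominated_regDelta (hh : 0 < h) (hz : NotLevel h z) {ε : ℝ} (hε : 0 < ε) :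
    ∃ w, ConvDominated w (regDelta h z ε) := by
  obtain ⟨C, hC, hb⟩ := exists_norm_resid_le hh hz
  set c := min 1 ε with hc
  have hc0 : 0 < c := lt_min one_pos hε
  have hkey : ∀ u : ℝ × ℝ, ((sqNorm u + ε) ^ 2)⁻¹ ≤ (c ^ 2)⁻¹ * ((1 + sqNorm u) ^ 2)⁻¹ := by
    intro u
    have h0 := sqNorm_nonneg u
    rw [← mul_inv, ← mul_pow]
    gcongr
    have h1 : c ≤ 1 := min_le_left _ _
    have h2 : c ≤ ε := min_le_right _ _
    nlinarith
  set D := ε * C * (c ^ 2)⁻¹ with hD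
  have hD0 : 0 < D := by positivity
  refine ⟨fun u => D * ((1 + sqNorm u) ^ 2)⁻¹, ?_, ?_, integrable_one_add_sqNorm.const_mul D, ?_⟩
  · refine (measurable_gaugePhase h).mul ?_
    have hs : Measurable fun p : (ℝ × ℝ) × (ℝ × ℝ) => sqDist p.1 p.2 + ε :=
      continuous_sqDist.measurable.add_const ε
    refine (measurable_const.mul (measurable_comp_of_continuousOn (k := resid h z) ?_ hs fun p =>
      add_nonneg (sqDist_nonneg _ _) hε.le)).div ((Complex.measurable_ofReal.comp hs).pow_const 2)
    exact Complex.continuous_ofReal.continuousOn.mul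
      ((continuousOn_const.mul (isRadialGreen hh hz).continuousOn).sub
        (continuousOn_const.mul (isRadialGreen hh hz).continuousOn'))
  · intro x y
    have h0 := sqNorm_nonneg (x - y)
    rw [regDelta, norm_mul, norm_gaugePhase, one_mul, sqDist_eq, norm_div, norm_mul, norm_pow,
      Complex.norm_real, Complex.norm_real, Real.norm_eq_abs, Real.norm_eq_abs, abs_of_pos hε,
      abs_of_pos (by positivity), div_eq_mul_inv]
    calc _ ≤ ε * C * ((c ^ 2)⁻¹ * ((1 + sqNorm (x - y)) ^ 2)⁻¹) := by
          gcongr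
          · exact hb _ (by positivity)
          · exact hkey _
      _ = _ := by rw [hD]; ring
  · rw [memLp_two_iff_integrable_sq_norm (integrable_one_add_sqNorm.const_mul D).1]
    refine (integrable_one_add_sqNorm.const_mul (D ^ 2)).mono'
      ((integrable_one_add_sqNorm.const_mul D).1.norm.pow 2) (Eventually.of_forall fun u => ?_)
    have h0 := sqNorm_nonneg u
    have h1 : ((1 + sqNorm u) ^ 2)⁻¹ ≤ 1 := inv_le_one_of_one_le₀ (one_le_pow₀ (by linarith))
    have h2 : 0 ≤ ((1 + sqNorm u) ^ 2)⁻¹ := by positivity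
    rw [Real.norm_eq_abs, abs_of_nonneg (by positivity), Real.norm_eq_abs,
      abs_of_nonneg (by positivity), mul_pow]
    gcongr
    nlinarith

/-- Under y = x + √ε v the kernel becomes `resid` at ε(1 + |v|²) times (1 + |v|²)^{-2}, independent
of ε in its decay. Dominated convergence applies, and the phase tends to 1. -/
theorem tendsto_integral_regDelta (hh : 0 < h) (hz : NotLevel h z) {φ : ℝ × ℝ → ℂ}
    (hφ : Continuous φ) {M : ℝ} (hM : ∀ y, ‖φ y‖ ≤ M) (x : ℝ × ℝ) :
    Tendsto (fun ε : ℝ => ∫ y, regDelta h z ε x y * φ y) (𝓝[>] 0) (𝓝 (φ x)) := by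
  obtain ⟨C, hC, hb⟩ := exists_norm_resid_le hh hz
  set F : ℝ → ℝ × ℝ → ℂ := fun ε v => gaugePhase h x (x + √ε • v) *
    (resid h z (ε * (1 + sqNorm v)) * (((1 + sqNorm v) ^ 2)⁻¹ : ℝ)) * φ (x + √ε • v) with hF
  have hs0 := sqNorm_nonneg
  have e1 : ∀ ε > 0, ∫ y, regDelta h z ε x y * φ y = ∫ v, F ε v := by
    intro ε hε
    have hsq : √ε ^ 2 = ε := Real.sq_sqrt hε.le
    rw [← integral_add_left_eq_self _ x]
    have h2 := Measure.integral_comp_smul (volume : Measure (ℝ × ℝ))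
      (fun y => regDelta h z ε x (x + y) * φ (x + y)) √ε
    have hfr : Module.finrank ℝ (ℝ × ℝ) = 2 := by simp
    rw [hfr, hsq, abs_of_pos (by positivity)] at h2
    have h3 : ∫ y, regDelta h z ε x (x + y) * φ (x + y) =
        ε • ∫ v : ℝ × ℝ, regDelta h z ε x (x + √ε • v) * φ (x + √ε • v) := by
      rw [h2, smul_smul, mul_inv_cancel₀ hε.ne', one_smul]
    rw [h3, ← integral_smul]
    congr 1
    funext v
    have hd : sqDist x (x + √ε • v) + ε = ε * (1 + sqNorm v) := by
      simp only [sqDist, sqNorm, Prod.fst_add, Prod.snd_add, Prod.smul_fst, Prod.smul_snd,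
        smul_eq_mul]
      linear_combination (v.1 ^ 2 + v.2 ^ 2) * hsq
    have hs := hs0 v
    have hε' : (ε : ℂ) ≠ 0 := by exact_mod_cast hε.ne'
    have hs' : (1 + sqNorm v : ℂ) ≠ 0 := by exact_mod_cast (by positivity : (1 + sqNorm v) ≠ 0)
    rw [regDelta, hd, Complex.real_smul]
    simp only [hF]
    push_cast
    field_simp
  have e2 : φ x = ∫ v : ℝ × ℝ, 1 * (1 / Real.pi * (((1 + sqNorm v) ^ 2)⁻¹ : ℝ)) * φ x := by
    rw [integral_mul_const, integral_const_mul, integral_const_mul, integral_complex_ofReal,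
      integral_one_add_sqNorm]
    have : (Real.pi : ℂ) ≠ 0 := by exact_mod_cast Real.pi_ne_zero
    field_simp
  rw [e2]
  have hcont : ∀ v : ℝ × ℝ, Tendsto (fun ε : ℝ => x + √ε • v) (𝓝[>] 0) (𝓝 x) := by
    intro v
    have : Tendsto (fun ε : ℝ => x + √ε • v) (𝓝 0) (𝓝 (x + √0 • v)) :=
      (by fun_prop : Continuous fun ε : ℝ => x + √ε • v).tendsto 0
    simpa using tendsto_nhdsWithin_of_tendsto_nhds this
  have hg : Continuous fun y => gaugePhase h x y := by unfold gaugePhase; fun_prop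
  have hrc : ContinuousOn (resid h z) (Set.Ioi 0) :=
    Complex.continuous_ofReal.continuousOn.mul
      ((continuousOn_const.mul (isRadialGreen hh hz).continuousOn).sub
        (continuousOn_const.mul (isRadialGreen hh hz).continuousOn'))
  refine Tendsto.congr' (f₁ := fun ε => ∫ v, F ε v) (by
    filter_upwards [self_mem_nhdsWithin] with ε hε using (e1 ε hε).symm) ?_
  refine tendsto_integral_filter_of_dominated_convergence
    (fun v => C * M * ((1 + sqNorm v) ^ 2)⁻¹) ?_ ?_ (integrable_one_add_sqNorm.const_mul _) ?_
  · filter_upwards [self_mem_nhdsWithin] with ε hε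
    have hε0 : 0 < ε := hε
    have c1 : Continuous fun v : ℝ × ℝ => x + √ε • v := by fun_prop
    refine (((hg.comp c1).measurable.mul ((measurable_comp_of_continuousOn hrc
      ((measurable_sqNorm.const_add 1).const_mul ε) fun v => ?_).mul ?_)).mul
      (hφ.comp c1).measurable).aestronglyMeasurable
    · have := hs0 v; positivity
    · exact Complex.measurable_ofReal.comp ((measurable_sqNorm.const_add 1).pow_const 2).inv
  · filter_upwards [self_mem_nhdsWithin] with ε hε
    have hε0 : 0 < ε := hε
    refine Eventually.of_forall fun v => ?_
    have := hs0 v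
    simp only [hF]
    rw [norm_mul, norm_mul, norm_gaugePhase, one_mul, norm_mul, Complex.norm_real,
      Real.norm_eq_abs, abs_of_nonneg (by positivity)]
    calc _ ≤ C * ((1 + sqNorm v) ^ 2)⁻¹ * M := by
          gcongr
          · exact hb _ (by positivity)
          · exact hM _
      _ = _ := by ring
  · refine Eventually.of_forall fun v => ?_
    refine Tendsto.mul (Tendsto.mul ?_ (Tendsto.mul ?_ tendsto_const_nhds)) ?_
    · have := hg.continuousAt.tendsto.comp (hcont v)
      have e : gaugePhase h x x = 1 := by simp [gaugePhase]
      rwa [e] at this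
    · have : Tendsto (fun ε : ℝ => ε * (1 + sqNorm v)) (𝓝[>] 0) (𝓝[>] 0) := by
        have := tendsto_const_mul_nhdsGT_zero (c := 1 + sqNorm v) (by have := hs0 v; positivity)
        exact this.congr fun ε => mul_comm _ _
      exact (tendsto_resid hh hz).comp this
    · exact hφ.continuousAt.tendsto.comp (hcont v)

end Green

/-! ### The resolvent of the Landau Hamiltonian -/

section Green

variable {h : ℝ} {z : ℂ}

/-- The radial equation holds at σ = s + ε, whereas the Landau expression carries the coefficient s
= σ - ε. Everything cancels except a multiple of ε. -/
theorem exists_schwartz_regGreen (hh : 0 < h) (hz : NotLevel h z) {ε : ℝ} (hε : 0 < ε)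
    (x : ℝ × ℝ) : ∃ X : 𝓢(ℝ × ℝ, ℂ), (∀ y, X y = regGreen h z ε y x) ∧
      ∀ y, landauExpr h X y - z * X y = regDelta h z ε y x := by
  have hk := isRadialGreen hh hz
  obtain ⟨X, hX⟩ := exists_schwartz_gauge h hε (hk.isSmoothRapid hh hε) x
  refine ⟨X, hX, fun y => ?_⟩
  rw [landauExpr_radial hε hk.deriv hk.deriv2 hX y, hX y, regDelta, resid]
  have hp : 0 < sqDist y x + ε := by
    have := sqDist_nonneg y x
    linarith
  have hp' : ((sqDist y x + ε : ℝ) : ℂ) ≠ 0 := by exact_mod_cast hp.ne'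
  have hsd : (sqDist y x : ℂ) = ((sqDist y x + ε : ℝ) : ℂ) - ε := by push_cast; ring
  rw [hsd]
  generalize sqDist y x + ε = σ at hp'
  field_simp
  ring

/-- For fixed x the kernel is the conjugate of a Schwartz function attached to z̄, so the symmetry
of the Landau expression moves the operator onto it. -/
theorem integral_regGreen_landauExpr (hh : 0 < h) (hz : NotLevel h z) {ε : ℝ} (hε : 0 < ε)
    (φ : 𝓢(ℝ × ℝ, ℂ)) (x : ℝ × ℝ) :
    ∫ y, regGreen h z ε x y * (landauExpr h φ y - z * φ y) = ∫ y, regDelta h z ε x y * φ y := by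
  obtain ⟨X, hX, hLX⟩ := exists_schwartz_regGreen hh hz.conj hε x
  have e1 : ∫ y, regGreen h z ε x y * (landauExpr h φ y - z * φ y) =
      ⟪schwartzToL2 X, schwartzToL2 (landauExpr h φ - z • φ)⟫_ℂ := by
    rw [inner_schwartzToL2]
    congr 1
    funext y
    rw [hX, regGreen_conj, Complex.conj_conj]
    rfl
  have e2 : ∫ y, regDelta h z ε x y * φ y =
      ⟪schwartzToL2 (landauExpr h X - starRingEnd ℂ z • X), schwartzToL2 φ⟫_ℂ := by
    rw [inner_schwartzToL2]
    congr 1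
    funext y
    have : (landauExpr h X - starRingEnd ℂ z • X) y = landauExpr h X y - starRingEnd ℂ z * X y := rfl
    rw [this, hLX, regDelta_conj, Complex.conj_conj]
  rw [e1, e2]
  simp only [map_sub, map_smul, inner_sub_left, inner_sub_right, inner_smul_left,
    inner_smul_right, inner_landauExpr, Complex.conj_conj]

/-- The Green function inverts `H_h - z` on Schwartz functions, pointwise. -/
theorem integral_green_landauExpr (hh : 0 < h) (hz : NotLevel h z) (φ : 𝓢(ℝ × ℝ, ℂ))
    (x : ℝ × ℝ) :
    ∫ y, regGreen h z 0 x y * (landauExpr h φ y - z * φ y) = φ x := by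
  set ψ : 𝓢(ℝ × ℝ, ℂ) := landauExpr h φ - z • φ with hψ
  have hψy : ∀ y, landauExpr h φ y - z * φ y = ψ y := fun y => rfl
  have hmem : MemLp (fun y => ψ y) 2 := ψ.memLp 2
  obtain ⟨M, hM⟩ : ∃ M, ∀ y, ‖ψ y‖ ≤ M :=
    ⟨_, fun y => SchwartzMap.norm_le_seminorm ℝ ψ y⟩
  obtain ⟨N, hN⟩ : ∃ N, ∀ y, ‖φ y‖ ≤ N :=
    ⟨_, fun y => SchwartzMap.norm_le_seminorm ℝ φ y⟩
  have h1 := tendsto_integral_regDelta hh hz φ.continuous hN x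
  refine tendsto_nhds_unique (f := fun ε : ℝ => ∫ y, regGreen h z ε x y * ψ y) ?_
    (h1.congr' (by
      filter_upwards [self_mem_nhdsWithin] with ε hε
      exact (integral_regGreen_landauExpr hh hz hε φ x).symm))
  rw [tendsto_iff_norm_sub_tendsto_zero]
  have h2 := (tendsto_integral_regGreen_sub hh hz).mul_const M
  rw [zero_mul] at h2
  refine squeeze_zero' (Eventually.of_forall fun _ => norm_nonneg _) ?_ h2
  filter_upwards [self_mem_nhdsWithin] with ε hε
  have hε0 : (0 : ℝ) ≤ ε := le_of_lt hε
  have hc := convDominated_regGreen_sub hh hz hε0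
  simp only [hψy]
  rw [← integral_sub ((convDominated_regGreen hh hz hε0).integrable_mul hmem x)
    ((convDominated_regGreen hh hz le_rfl).integrable_mul hmem x)]
  rw [← integral_sub_left_eq_self
    (fun u => ‖radial h z (sqNorm u + ε) - radial h z (sqNorm u + 0)‖) volume x,
    ← integral_mul_const]
  refine norm_integral_le_of_norm_le ?_ (Eventually.of_forall fun y => ?_)
  · exact ((hc.integrable.comp_sub_left x).mul_const M)
  · rw [← sub_mul, norm_mul]
    exact mul_le_mul (hc.le x y) (hM y) (norm_nonneg _) (hc.nonneg _)

/-- The integral operator with the Green function as its kernel. -/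
def greenOp (hh : 0 < h) (hz : NotLevel h z) : L2Plane →L[ℂ] L2Plane :=
  (convDominated_regGreen hh hz le_rfl).op

theorem greenOp_coeFn (hh : 0 < h) (hz : NotLevel h z) (v : L2Plane) :
    greenOp hh hz v =ᵐ[volume] fun x => ∫ y, regGreen h z 0 x y * v y :=
  (convDominated_regGreen hh hz le_rfl).op_coeFn v

theorem inner_greenOp (hh : 0 < h) (hz : NotLevel h z) (u v : L2Plane) :
    ⟪u, greenOp hh hz v⟫_ℂ = ⟪greenOp hh hz.conj u, v⟫_ℂ :=
  (convDominated_regGreen hh hz le_rfl).inner_op (convDominated_regGreen hh hz.conj le_rfl)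
    (fun x y => regGreen_conj h z 0 x y) u v

theorem integral_green_schwartz (hh : 0 < h) (hz : NotLevel h z) (φ : 𝓢(ℝ × ℝ, ℂ)) (x : ℝ × ℝ) :
    ∫ y, regGreen h z 0 x y * (schwartzToL2 (landauExpr h φ) - z • schwartzToL2 φ : L2Plane) y
      = φ x := by
  rw [← integral_green_landauExpr hh hz φ x]
  refine integral_congr_ae ?_
  filter_upwards [Lp.coeFn_sub (schwartzToL2 (landauExpr h φ)) (z • schwartzToL2 φ),
    Lp.coeFn_smul z (schwartzToL2 φ), schwartzToL2_coeFn φ, schwartzToL2_coeFn (landauExpr h φ)]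
    with y h1 h2 h3 h4
  rw [h1, Pi.sub_apply, h2, Pi.smul_apply, h3, h4, smul_eq_mul]

theorem greenOp_landauExpr (hh : 0 < h) (hz : NotLevel h z) (φ : 𝓢(ℝ × ℝ, ℂ)) :
    greenOp hh hz (schwartzToL2 (landauExpr h φ) - z • schwartzToL2 φ) = schwartzToL2 φ := by
  refine Lp.ext ?_
  filter_upwards [greenOp_coeFn hh hz (schwartzToL2 (landauExpr h φ) - z • schwartzToL2 φ),
    schwartzToL2_coeFn φ] with x h1 h2
  rw [h1, h2, integral_green_schwartz hh hz]

/-- By duality: the Green operator at z is the adjoint of that at z̄, which inverts H_h - z̄ on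
Schwartz functions. -/
theorem landauRel_greenOp (hh : 0 < h) (hz : NotLevel h z) (v : L2Plane) :
    LandauRel h (greenOp hh hz v) (v + z • greenOp hh hz v) := by
  rw [landauRel_iff]
  intro φ
  have h1 := inner_greenOp hh hz.conj v
    (schwartzToL2 (landauExpr h φ) - starRingEnd ℂ z • schwartzToL2 φ)
  rw [greenOp_landauExpr] at h1
  simp only [Complex.conj_conj] at h1
  rw [inner_add_left, h1, inner_sub_right, inner_smul_left, inner_smul_right]
  ring

/-- Testing w against regularized Green functions shows that the operator with kernel `regDelta`
annihilates w. Its adjoint sends φ to the regularized Green operator applied to (H_h - z̄)φ, and by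
norm convergence this tends to φ. So w is orthogonal to all Schwartz functions. Used at z and z̄,
this plays the role of essential self-adjointness of the core. -/
theorem LandauRel.eq_zero (hh : 0 < h) (hz : NotLevel h z) {w : L2Plane}
    (hw : LandauRel h w (z • w)) : w = 0 := by
  rw [landauRel_iff] at hw
  have hw' : ∀ φ : 𝓢(ℝ × ℝ, ℂ),
      ⟪w, schwartzToL2 (landauExpr h φ - starRingEnd ℂ z • φ)⟫_ℂ = 0 := by
    intro φ
    rw [map_sub, map_smul, inner_sub_right, ← hw φ, inner_smul_left, inner_smul_right, sub_self]
  have hzero : ∀ ε > 0, ∀ y, ∫ x, regDelta h z ε y x * w x = 0 := by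
    intro ε hε y
    obtain ⟨X, hX, hLX⟩ := exists_schwartz_regGreen hh hz.conj hε y
    have := hw' X
    rw [inner_schwartzToL2_right] at this
    have h2 := congrArg (starRingEnd ℂ) this
    rw [map_zero, ← integral_conj] at h2
    rw [← h2]
    congr 1
    funext x
    have e : (landauExpr h X - starRingEnd ℂ z • X) x = landauExpr h X x - starRingEnd ℂ z * X x := rfl
    rw [e, hLX, regDelta_conj, map_mul, Complex.conj_conj, Complex.conj_conj, mul_comm]
  have horth : ∀ φ : 𝓢(ℝ × ℝ, ℂ), ⟪w, schwartzToL2 φ⟫_ℂ = 0 := by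
    intro φ
    set ψ : L2Plane := schwartzToL2 (landauExpr h φ) - starRingEnd ℂ z • schwartzToL2 φ with hψ
    have hK : greenOp hh hz.conj ψ = schwartzToL2 φ := greenOp_landauExpr hh hz.conj φ
    rw [← hK]
    have hz0 : ∀ ε (hε : 0 < ε), ⟪w, (convDominated_regGreen hh hz.conj hε.le).op ψ⟫_ℂ = 0 := by
      intro ε hε
      obtain ⟨w1, hd1⟩ := convDominated_regDelta hh hz hε
      obtain ⟨w2, hd2⟩ := convDominated_regDelta hh hz.conj hε
      have e1 : (convDominated_regGreen hh hz.conj hε.le).op ψ = hd2.op (schwartzToL2 φ) := by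
        refine Lp.ext ?_
        filter_upwards [(convDominated_regGreen hh hz.conj hε.le).op_coeFn ψ,
          hd2.op_coeFn (schwartzToL2 φ)] with x h1 h2
        rw [h1, h2]
        have a1 : ∫ y, regGreen h (starRingEnd ℂ z) ε x y * ψ y = ∫ y,
            regGreen h (starRingEnd ℂ z) ε x y * (landauExpr h φ y - starRingEnd ℂ z * φ y) := by
          refine integral_congr_ae ?_
          filter_upwards [Lp.coeFn_sub (schwartzToL2 (landauExpr h φ))
            (starRingEnd ℂ z • schwartzToL2 φ), Lp.coeFn_smul (starRingEnd ℂ z) (schwartzToL2 φ),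
            schwartzToL2_coeFn φ, schwartzToL2_coeFn (landauExpr h φ)] with y h1 h2 h3 h4
          rw [hψ, h1, Pi.sub_apply, h2, Pi.smul_apply, h3, h4, smul_eq_mul]
        rw [a1, integral_regGreen_landauExpr hh hz.conj hε φ x]
        refine integral_congr_ae ?_
        filter_upwards [schwartzToL2_coeFn φ] with y hy
        rw [hy]
      rw [e1, hd2.inner_op hd1 (fun x y => by rw [regDelta_conj, Complex.conj_conj])]
      have e2 : hd1.op w = 0 := by
        refine Lp.ext ?_
        filter_upwards [hd1.op_coeFn w, Lp.coeFn_zero ℂ 2 (volume : Measure (ℝ × ℝ))] with y h1 h2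
        rw [h1, h2, hzero ε hε]
        rfl
      rw [e2, inner_zero_left]
    have hlim : Tendsto (fun ε : ℝ => ‖w‖ * ((∫ u, ‖radial h (starRingEnd ℂ z) (sqNorm u + ε) -
        radial h (starRingEnd ℂ z) (sqNorm u + 0)‖) * ‖ψ‖)) (𝓝[>] 0) (𝓝 0) := by
      have := ((tendsto_integral_regGreen_sub hh hz.conj).mul_const ‖ψ‖).const_mul ‖w‖
      simpa using this
    have hle : ∀ᶠ ε : ℝ in 𝓝[>] 0, ‖⟪w, greenOp hh hz.conj ψ⟫_ℂ‖ ≤ ‖w‖ *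
        ((∫ u, ‖radial h (starRingEnd ℂ z) (sqNorm u + ε) -
          radial h (starRingEnd ℂ z) (sqNorm u + 0)‖) * ‖ψ‖) := by
      filter_upwards [self_mem_nhdsWithin] with ε hε
      have hε0 : (0 : ℝ) < ε := hε
      have hsub := convDominated_regGreen_sub hh hz.conj hε0.le
      have e3 : hsub.op ψ = (convDominated_regGreen hh hz.conj hε0.le).op ψ -
          greenOp hh hz.conj ψ := by
        refine Lp.ext ?_
        filter_upwards [hsub.op_coeFn ψ, (convDominated_regGreen hh hz.conj hε0.le).op_coeFn ψ,
          greenOp_coeFn hh hz.conj ψ, Lp.coeFn_sub ((convDominated_regGreen hh hz.conj hε0.le).op ψ)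
          (greenOp hh hz.conj ψ)] with x h1 h2 h3 h4
        rw [h1, h4, Pi.sub_apply, h2, h3, ← integral_sub
          ((convDominated_regGreen hh hz.conj hε0.le).integrable_mul (Lp.memLp ψ) x)
          ((convDominated_regGreen hh hz.conj le_rfl).integrable_mul (Lp.memLp ψ) x)]
        simp only [sub_mul]
      have e4 : ⟪w, greenOp hh hz.conj ψ⟫_ℂ = -⟪w, hsub.op ψ⟫_ℂ := by
        rw [e3, inner_sub_right, hz0 ε hε0, zero_sub, neg_neg]
      rw [e4, norm_neg]
      refine (norm_inner_le_norm _ _).trans ?_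
      gcongr
      exact (hsub.op.le_opNorm ψ).trans (by gcongr; exact hsub.norm_op_le)
    have := ge_of_tendsto hlim hle
    exact norm_le_zero_iff.1 this
  have hd := dense_range_schwartzToL2
  refine hd.eq_zero_of_inner_left ℂ fun v hv => ?_
  obtain ⟨φ, rfl⟩ := hv
  exact horth φ

theorem LandauRel.sub {u f u' f' : L2Plane} (h1 : LandauRel h u f) (h2 : LandauRel h u' f') :
    LandauRel h (u - u') (f - f') := by
  rw [landauRel_iff] at *
  intro φ
  rw [inner_sub_left, inner_sub_left, h1, h2]

theorem LandauRel.eq_greenOp (hh : 0 < h) (hz : NotLevel h z) {u f : L2Plane}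
    (hu : LandauRel h u f) : u = greenOp hh hz (f - z • u) := by
  have h1 := hu.sub (landauRel_greenOp hh hz (f - z • u))
  have h2 : f - (f - z • u + z • greenOp hh hz (f - z • u)) =
      z • (u - greenOp hh hz (f - z • u)) := by rw [smul_sub]; abel
  rw [h2] at h1
  exact sub_eq_zero.1 (LandauRel.eq_zero hh hz h1)

theorem isResolventAt_greenOp (hh : 0 < h) (hz : NotLevel h z) :
    IsResolventAt (landau h) z (greenOp hh hz) := by
  constructor
  · intro v
    obtain ⟨hu, he⟩ := landauRel_greenOp hh hz v
    exact ⟨hu, by rw [he]; abel⟩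
  · intro u
    exact (LandauRel.eq_greenOp hh hz ⟨u.2, rfl⟩).symm

theorem IsResolventAt.unique {E : Type*} [NormedAddCommGroup E] [InnerProductSpace ℂ E]
    {T : E →ₗ.[ℂ] E} {R R' : E →L[ℂ] E} (hR : IsResolventAt T z R) (hR' : IsResolventAt T z R') :
    R = R' := by
  ext v
  obtain ⟨hv, he⟩ := hR.1 v
  have := hR'.2 ⟨R v, hv⟩
  rw [he] at this
  exact this.symm

/-- The functions in the range of the resolvent are continuous. -/
theorem continuous_integral_green (hh : 0 < h) (hz : NotLevel h z) (v : L2Plane) :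
    Continuous fun x => ∫ y, regGreen h z 0 x y * v y := by
  have hc := convDominated_regGreen hh hz le_rfl
  -- A vector orthogonal to the range of H_h - z on Schwartz functions would be an eigenvector at
  -- z̄, which is excluded.
  have hdense : Dense (Set.range fun φ : 𝓢(ℝ × ℝ, ℂ) =>
      (schwartzToL2 (landauExpr h φ) - z • schwartzToL2 φ : L2Plane)) := by
    let T : 𝓢(ℝ × ℝ, ℂ) →ₗ[ℂ] L2Plane :=
      schwartzToL2 ∘ₗ (landauExpr h).toLinearMap - z • schwartzToL2
    have hT : Dense ((LinearMap.range T : Submodule ℂ L2Plane) : Set L2Plane) := by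
      rw [Submodule.dense_iff_topologicalClosure_eq_top, Submodule.topologicalClosure_eq_top_iff,
        Submodule.eq_bot_iff]
      intro w hw
      refine LandauRel.eq_zero hh hz.conj ?_
      rw [landauRel_iff]
      intro φ
      have h1 := (Submodule.mem_orthogonal' _ w).1 hw (T φ) ⟨φ, rfl⟩
      have h2 : T φ = schwartzToL2 (landauExpr h φ) - z • schwartzToL2 φ := rfl
      rw [h2, inner_sub_right, inner_smul_right, sub_eq_zero] at h1
      rw [inner_smul_left, Complex.conj_conj, h1]
    exact hT
  have hseq : v ∈ closure (Set.range fun φ : 𝓢(ℝ × ℝ, ℂ) =>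
      (schwartzToL2 (landauExpr h φ) - z • schwartzToL2 φ : L2Plane)) := hdense v
  rw [mem_closure_iff_seq_limit] at hseq
  obtain ⟨s, hs, hlim⟩ := hseq
  choose φ hφ using hs
  -- By the Cauchy-Schwarz inequality, with a constant independent of x, L² convergence of the
  -- sources gives uniform convergence of the Schwartz functions they generate.
  have hunif : TendstoUniformly (fun n x => φ n x) (fun x => ∫ y, regGreen h z 0 x y * v y)
      atTop := by
    rw [Metric.tendstoUniformly_iff]
    intro ε hε
    set A := (eLpNorm (fun u => ‖radial h z (sqNorm u + 0)‖) 2).toReal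
    have h1 : Tendsto (fun n => A * ‖v - s n‖) atTop (𝓝 0) := by
      have := ((tendsto_const_nhds (x := v)).sub hlim).norm.const_mul A
      simpa using this
    filter_upwards [h1.eventually (gt_mem_nhds hε)] with n hn x
    have e : φ n x = ∫ y, regGreen h z 0 x y * s n y := by
      rw [← hφ n]
      exact (integral_green_schwartz hh hz (φ n) x).symm
    rw [dist_eq_norm, e, ← integral_sub (hc.integrable_mul (Lp.memLp v) x)
      (hc.integrable_mul (Lp.memLp (s n)) x)]
    have e2 : ∫ y, (regGreen h z 0 x y * v y - regGreen h z 0 x y * s n y) =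
        ∫ y, regGreen h z 0 x y * (v - s n : L2Plane) y := by
      refine integral_congr_ae ?_
      filter_upwards [Lp.coeFn_sub v (s n)] with y hy
      rw [hy, Pi.sub_apply, mul_sub]
    rw [e2]
    exact (hc.norm_integral_le (v - s n) x).trans_lt hn
  exact hunif.continuous (Eventually.of_forall fun n => (φ n).continuous).frequently

end Green

/-! ### The Landau levels -/

theorem lineDerivOp_comm (v w : ℝ × ℝ) (φ : 𝓢(ℝ × ℝ, ℂ)) :
    LineDeriv.lineDerivOpCLM ℂ 𝓢(ℝ × ℝ, ℂ) v (LineDeriv.lineDerivOpCLM ℂ 𝓢(ℝ × ℝ, ℂ) w φ) =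
      LineDeriv.lineDerivOpCLM ℂ 𝓢(ℝ × ℝ, ℂ) w (LineDeriv.lineDerivOpCLM ℂ 𝓢(ℝ × ℝ, ℂ) v φ) := by
  have e : ∀ v w : ℝ × ℝ, ∀ y, LineDeriv.lineDerivOpCLM ℂ 𝓢(ℝ × ℝ, ℂ) v
      (LineDeriv.lineDerivOpCLM ℂ 𝓢(ℝ × ℝ, ℂ) w φ) y = fderiv ℝ (fderiv ℝ φ) y v w := by
    intro v w y
    have h1 : ((LineDeriv.lineDerivOpCLM ℂ 𝓢(ℝ × ℝ, ℂ) w φ : 𝓢(ℝ × ℝ, ℂ)) : ℝ × ℝ → ℂ) =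
        fun y => fderiv ℝ φ y w := by
      funext y
      exact SchwartzMap.lineDerivOp_apply_eq_fderiv _ _ _
    have h2 : LineDeriv.lineDerivOpCLM ℂ 𝓢(ℝ × ℝ, ℂ) v
      (LineDeriv.lineDerivOpCLM ℂ 𝓢(ℝ × ℝ, ℂ) w φ) y = fderiv ℝ
        (LineDeriv.lineDerivOpCLM ℂ 𝓢(ℝ × ℝ, ℂ) w φ : 𝓢(ℝ × ℝ, ℂ)) y v :=
      SchwartzMap.lineDerivOp_apply_eq_fderiv _ _ _
    rw [h2, h1]
    have hd : DifferentiableAt ℝ (fderiv ℝ φ) y :=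
      ((φ.smooth 2).fderiv_right (m := 1) (by norm_num)).differentiable (by norm_num) y
    rw [fderiv_clm_apply hd (differentiableAt_const w)]
    simp
  ext y
  rw [e, e]
  have hs : IsSymmSndFDerivAt ℝ φ y :=
    (φ.smooth 2).contDiffAt.isSymmSndFDerivAt (by simp)
  exact hs v w

/-- The canonical commutation relation: the only contribution is the derivative of h x₂. -/
theorem lineDerivOp_snd_momentumOne (h : ℝ) (φ : 𝓢(ℝ × ℝ, ℂ)) :
    LineDeriv.lineDerivOpCLM ℂ 𝓢(ℝ × ℝ, ℂ) ((0, 1) : ℝ × ℝ) (momentumOne h φ) =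
      momentumOne h (LineDeriv.lineDerivOpCLM ℂ 𝓢(ℝ × ℝ, ℂ) ((0, 1) : ℝ × ℝ) φ) + (h : ℂ) • φ := by
  have e : ∀ φ, momentumOne h φ = (-Complex.I) •
      LineDeriv.lineDerivOpCLM ℂ 𝓢(ℝ × ℝ, ℂ) ((1, 0) : ℝ × ℝ) φ +
    (h : ℂ) • SchwartzMap.smulLeftCLM ℂ (fun x : ℝ × ℝ => (x.2 : ℂ)) φ := fun _ => rfl
  have hx : LineDeriv.lineDerivOpCLM ℂ 𝓢(ℝ × ℝ, ℂ) ((0, 1) : ℝ × ℝ)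
      (SchwartzMap.smulLeftCLM ℂ (fun x : ℝ × ℝ => (x.2 : ℂ)) φ) =
      SchwartzMap.smulLeftCLM ℂ (fun x : ℝ × ℝ => (x.2 : ℂ))
        (LineDeriv.lineDerivOpCLM ℂ 𝓢(ℝ × ℝ, ℂ) ((0, 1) : ℝ × ℝ) φ) + φ := by
    ext y
    have h1 : HasDerivAt (fun t : ℝ => φ (y.1, t))
        (LineDeriv.lineDerivOpCLM ℂ 𝓢(ℝ × ℝ, ℂ) ((0, 1) : ℝ × ℝ) φ y) y.2 := by
      have h1 : HasDerivAt (fun t : ℝ => ((y.1, t) : ℝ × ℝ)) ((0, 1) : ℝ × ℝ) y.2 :=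
        (hasDerivAt_const y.2 y.1).prodMk (hasDerivAt_id y.2)
      exact (SchwartzMap.hasFDerivAt φ y).comp_hasDerivAt_of_eq y.2 h1 rfl
    have h2 := ((hasDerivAt_id y.2).ofReal_comp.mul h1).congr_of_eventuallyEq
      (f₁ := fun t : ℝ => SchwartzMap.smulLeftCLM ℂ (fun x : ℝ × ℝ => (x.2 : ℂ)) φ (y.1, t))
      (Eventually.of_forall fun t => by
        beta_reduce
        rw [SchwartzMap.smulLeftCLM_apply_apply hasTemperateGrowth_snd_ofReal, smul_eq_mul]
        rfl)
    rw [lineDerivOp_snd_eq h2, add_apply,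
      SchwartzMap.smulLeftCLM_apply_apply hasTemperateGrowth_snd_ofReal, smul_eq_mul]
    simp only [id, Complex.ofReal_one, one_mul]
    ring
  rw [e, e, map_add, map_smul, map_smul, hx, lineDerivOp_comm, smul_add, add_assoc]

/-- The creation operator of the Landau levels. -/
def creation (h : ℝ) (φ : 𝓢(ℝ × ℝ, ℂ)) : 𝓢(ℝ × ℝ, ℂ) :=
  momentumOne h φ - LineDeriv.lineDerivOpCLM ℂ 𝓢(ℝ × ℝ, ℂ) ((0, 1) : ℝ × ℝ) φ

theorem landauExpr_creation (h : ℝ) (φ : 𝓢(ℝ × ℝ, ℂ)) :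
    landauExpr h (creation h φ) = creation h (landauExpr h φ) + (2 * h : ℂ) • creation h φ := by
  have e : ∀ φ, landauExpr h φ = momentumOne h (momentumOne h φ) -
      LineDeriv.lineDerivOpCLM ℂ 𝓢(ℝ × ℝ, ℂ) ((0, 1) : ℝ × ℝ)
        (LineDeriv.lineDerivOpCLM ℂ 𝓢(ℝ × ℝ, ℂ) ((0, 1) : ℝ × ℝ) φ) := fun _ => rfl
  simp only [e, creation, map_sub, lineDerivOp_snd_momentumOne, map_add, map_smul]
  module

/-- Annihilation after creation. Its value on an eigenfunction of positive eigenvalue is nonzero, so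
creation never produces the zero function. -/
theorem lineDerivOp_creation (h : ℝ) (φ : 𝓢(ℝ × ℝ, ℂ)) :
    momentumOne h (creation h φ) +
      LineDeriv.lineDerivOpCLM ℂ 𝓢(ℝ × ℝ, ℂ) ((0, 1) : ℝ × ℝ) (creation h φ) =
      landauExpr h φ + (h : ℂ) • φ := by
  have e : ∀ φ, landauExpr h φ = momentumOne h (momentumOne h φ) -
      LineDeriv.lineDerivOpCLM ℂ 𝓢(ℝ × ℝ, ℂ) ((0, 1) : ℝ × ℝ)
        (LineDeriv.lineDerivOpCLM ℂ 𝓢(ℝ × ℝ, ℂ) ((0, 1) : ℝ × ℝ) φ) := fun _ => rfl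
  simp only [e, creation, map_sub, lineDerivOp_snd_momentumOne]
  module

/-- Start with the Gaussian in the gauge centred at 0 and climb by 2h with the creation operator.
The shift 1 in the squared distance only multiplies the Gaussian by a constant. -/
theorem exists_landau_eigenfunction {h : ℝ} (hh : 0 < h) (m : ℕ) :
    ∃ φ : 𝓢(ℝ × ℝ, ℂ), φ ≠ 0 ∧ landauExpr h φ = ((2 * m + 1) * h : ℂ) • φ := by
  induction m with
  | zero =>
    have hf : ∀ s > (0 : ℝ), HasDerivAt (fun s : ℝ => (Real.exp (-(h / 4 * s)) : ℂ))
        (-(h / 4) * (Real.exp (-(h / 4 * s)) : ℂ)) s := by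
      intro s _
      refine (((hasDerivAt_id s).const_mul (h / 4)).neg.exp.ofReal_comp).congr_deriv ?_
      simp
      ring
    obtain ⟨X, hX⟩ := exists_schwartz_gauge h one_pos
      (isSmoothRapid_exp (c := h / 4) (by positivity) one_pos) 0
    refine ⟨X, fun h0 => ?_, ?_⟩
    · have := hX 0
      rw [h0] at this
      have hne : gaugePhase h 0 0 * (Real.exp (-(h / 4 * (sqDist 0 0 + 1))) : ℂ) ≠ 0 := by
        refine mul_ne_zero (Complex.exp_ne_zero _) ?_
        exact_mod_cast (Real.exp_pos _).ne'
      exact hne this.symm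
    · ext y
      rw [landauExpr_radial one_pos hf (fun s hs => (hf s hs).const_mul _) hX y,
        smul_apply, hX y, smul_eq_mul]
      push_cast
      ring
  | succ m ih =>
    obtain ⟨φ, hφ, he⟩ := ih
    have hcs : creation h ((((2 * m + 1) * h : ℂ)) • φ) = (((2 * m + 1) * h : ℂ)) • creation h φ := by
      simp only [creation, map_smul, smul_sub]
    refine ⟨creation h φ, fun h0 => hφ ?_, ?_⟩
    · have h1 := lineDerivOp_creation h φ
      rw [h0, map_zero, map_zero, add_zero, he, ← add_smul] at h1
      rcases smul_eq_zero.1 h1.symm with h2 | h2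
      · exfalso
        have : ((2 * m + 1) * h + h : ℝ) = 0 := by exact_mod_cast h2
        have h3 : (0 : ℝ) < (2 * m + 1) * h + h := by positivity
        linarith
      · exact h2
    · rw [landauExpr_creation, he, hcs, ← add_smul]
      congr 1
      push_cast; ring

/-- The spectrum of the Landau Hamiltonian consists of the Landau levels. -/
theorem notMem_unboundedSpectrum_landau {h : ℝ} (hh : 0 < h) {z : ℂ} :
    z ∉ unboundedSpectrum (landau h) ↔ NotLevel h z := by
  constructor
  · intro hz m hm
    have hz' : ∃ R, IsResolventAt (landau h) z R := not_not.1 hz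
    obtain ⟨R, hR⟩ := hz'
    obtain ⟨φ, hφ, he⟩ := exists_landau_eigenfunction hh m
    have hh' : (h : ℂ) ≠ 0 := by exact_mod_cast hh.ne'
    have hzm : z = (2 * m + 1) * h := by
      field_simp at hm
      linear_combination -hm
    obtain ⟨hd, hL⟩ := landauRel_schwartz h φ
    have := hR.2 ⟨_, hd⟩
    rw [hL, he, map_smul, hzm] at this
    simp only [sub_self, map_zero] at this
    exact hφ (schwartzToL2_injective (by rw [← this, map_zero]))
  · intro hz h1
    exact h1 ⟨_, isResolventAt_greenOp hh hz⟩

/-! ### The Green function near the diagonal and the coefficients of the symbol -/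

/-- The radial factor has the expansion already. The phase differs from 1 by O(|x - y|), while the
radial factor is O(|x - y|^{-1/2}), so the phase does not affect the limit. -/
theorem hasLogExpansion_green {h : ℝ} (hh : 0 < h) {z : ℂ} (hz : NotLevel h z) (y : ℝ × ℝ) :
    Tendsto (fun x => green h z x y - 1 / (2 * Real.pi) * (Real.log (1 / eDist x y) : ℂ))
        (𝓝[≠] y) (𝓝 (qFun h z)) := by
  have hlim := (isRadialGreen_radial hh hz).2
  obtain ⟨C, hC, hb⟩ := (isRadialGreen hh hz).bound
  have hpos : ∀ x ≠ y, 0 < sqDist x y := fun x hx => sqNorm_pos (sub_ne_zero.2 hx)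
  have hs : Tendsto (fun x => sqDist x y) (𝓝[≠] y) (𝓝[>] 0) := by
    refine tendsto_nhdsWithin_iff.2 ⟨?_, ?_⟩
    · have : Continuous fun x => sqDist x y := by unfold sqDist; fun_prop
      have := this.tendsto y
      have h0 : sqDist y y = 0 := by simp [sqDist]
      rw [h0] at this
      exact tendsto_nhdsWithin_of_tendsto_nhds this
    · filter_upwards [self_mem_nhdsWithin] with x hx using hpos x hx
  have h1 := hlim.comp hs
  have h2 : Tendsto (fun x => (gaugePhase h x y - 1) * radial h z (sqDist x y)) (𝓝[≠] y) (𝓝 0) := by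
    rw [tendsto_zero_iff_norm_tendsto_zero]
    have hb2 : Tendsto (fun x : ℝ × ℝ => (|h * (x.2 + y.2) / 2| * C) * (sqDist x y) ^ (1 / 4 : ℝ))
        (𝓝[≠] y) (𝓝 0) := by
      have c1 : Continuous fun x : ℝ × ℝ => |h * (x.2 + y.2) / 2| * C := by fun_prop
      have c2 := tendsto_nhdsWithin_of_tendsto_nhds (s := {y}ᶜ) (c1.tendsto y)
      have c3 : Tendsto (fun x => (sqDist x y) ^ (1 / 4 : ℝ)) (𝓝[≠] y) (𝓝 ((0 : ℝ) ^ (1 / 4 : ℝ))) :=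
        (Real.continuousAt_rpow_const 0 (1 / 4) (Or.inr (by norm_num))).tendsto.comp
          (hs.mono_right nhdsWithin_le_nhds)
      rw [Real.zero_rpow (by norm_num)] at c3
      simpa using c2.mul c3
    refine squeeze_zero' (Eventually.of_forall fun _ => norm_nonneg _) ?_ hb2
    filter_upwards [self_mem_nhdsWithin] with x hx
    have hp := hpos x hx
    have a1 : ‖gaugePhase h x y - 1‖ ≤ |h * (x.2 + y.2) / 2| * (sqDist x y) ^ (1 / 2 : ℝ) := by
      have := Real.norm_exp_I_mul_ofReal_sub_one_le (x := -(h * (x.1 - y.1) * (x.2 + y.2) / 2))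
      rw [mul_comm Complex.I] at this
      refine this.trans ?_
      rw [Real.norm_eq_abs, abs_neg, ← Real.sqrt_eq_rpow]
      have a2 : |x.1 - y.1| ≤ √(sqDist x y) := by
        rw [← Real.sqrt_sq_eq_abs]
        refine Real.sqrt_le_sqrt ?_
        rw [sqDist]; nlinarith [sq_nonneg (x.2 - y.2)]
      calc |h * (x.1 - y.1) * (x.2 + y.2) / 2| = |h * (x.2 + y.2) / 2| * |x.1 - y.1| := by
            rw [← abs_mul]; congr 1; ring
        _ ≤ _ := by gcongr
    have a3 : ‖radial h z (sqDist x y)‖ ≤ C * (sqDist x y) ^ (-1 / 4 : ℝ) := by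
      refine (hb _ hp).1.trans ?_
      gcongr
      have : Real.exp (-(h / 8 * sqDist x y)) ≤ 1 := Real.exp_le_one_iff.2 (by
        have : 0 < h / 8 * sqDist x y := by positivity
        linarith)
      have h0 : 0 ≤ sqDist x y ^ (-1 / 4 : ℝ) := Real.rpow_nonneg hp.le _
      nlinarith
    rw [norm_mul]
    calc _ ≤ (|h * (x.2 + y.2) / 2| * (sqDist x y) ^ (1 / 2 : ℝ)) *
          (C * (sqDist x y) ^ (-1 / 4 : ℝ)) := by gcongr
      _ = (|h * (x.2 + y.2) / 2| * C) * ((sqDist x y) ^ (1 / 2 : ℝ) * (sqDist x y) ^ (-1 / 4 : ℝ)) := by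
          ring
      _ = _ := by rw [← Real.rpow_add hp]; norm_num
  have h3 := h2.add h1
  rw [zero_add] at h3
  refine h3.congr' ?_
  filter_upwards [self_mem_nhdsWithin] with x hx
  have hp := hpos x hx
  have hl : Real.log (1 / eDist x y) = -(1 / 2) * Real.log (sqDist x y) := by
    rw [one_div, Real.log_inv, ← eDist_sq, Real.log_pow]
    push_cast; ring
  rw [green_eq, regGreen, add_zero, hl]
  simp only [Function.comp]
  have : (Real.pi : ℂ) ≠ 0 := by exact_mod_cast Real.pi_ne_zero
  push_cast
  field_simp
  ring

theorem greenGauged_eq (h : ℝ) (z : ℂ) (x y : ℝ × ℝ) :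
    greenGauged h z x y = radial h z (sqDist x y) := by
  rw [greenGauged, green_eq, regGreen, add_zero, gaugePhase, ← mul_assoc, ← Complex.exp_add]
  have : Complex.I * h * (x.1 - y.1) * (x.2 + y.2) / 2 +
      ((-(h * (x.1 - y.1) * (x.2 + y.2) / 2) : ℝ) : ℂ) * Complex.I = 0 := by push_cast; ring
  rw [this, Complex.exp_zero, one_mul]

theorem lam_eq (h : ℝ) (z : ℂ) (m n : ℤ) :
    lam h z m n = radial h z ((m : ℝ) ^ 2 + (n : ℝ) ^ 2) := by
  rw [lam, radial, Complex.ofReal_exp]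
  have : -((h : ℂ) * ((m : ℂ) ^ 2 + (n : ℂ) ^ 2) / 4) =
      ((-(h * ((m : ℝ) ^ 2 + (n : ℝ) ^ 2) / 4) : ℝ) : ℂ) := by push_cast; ring
  rw [this]
  ring

/-- The coefficients of the symbol, without the constant `α⁻¹`. -/
def coeff (h : ℝ) (z : ℂ) (k : ℤ × ℤ) : ℂ :=
  if k = 0 then qFun h z else radial h z ((k.1 : ℝ) ^ 2 + (k.2 : ℝ) ^ 2)

/-- Invariance under magnetic translations: the matrix is a convolution twisted by the gauge phase.
This is what makes it a sum of twisted shifts, and thus an element of a noncommutative torus. -/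
theorem qMatrix_eq (h : ℝ) (z : ℂ) (m n : ℤ × ℤ) :
    qMatrix h z m n = gaugePhase h (latticePt m) (latticePt n) * coeff h z (n - m) := by
  rw [qMatrix, coeff]
  rcases eq_or_ne m n with rfl | hmn
  · simp [gaugePhase]
  · rw [if_neg hmn, if_neg (sub_ne_zero.2 hmn.symm), green_eq, regGreen, add_zero]
    congr 2
    simp only [sqDist, latticePt, Prod.fst_sub, Prod.snd_sub]
    push_cast; ring

theorem summable_exp_neg_sq {c : ℝ} (hc : 0 < c) :
    Summable fun k : ℤ × ℤ => Real.exp (-(c * ((k.1 : ℝ) ^ 2 + (k.2 : ℝ) ^ 2))) := by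
  have h1 : Summable fun n : ℕ => Real.exp (-(c * (n : ℝ) ^ 2)) := by
    refine Summable.of_nonneg_of_le (fun _ => (Real.exp_pos _).le) (fun n => ?_)
      (summable_geometric_of_lt_one (r := Real.exp (-c)) (Real.exp_pos _).le
        (Real.exp_lt_one_iff.2 (by linarith)))
    rw [← Real.exp_nat_mul]
    refine Real.exp_le_exp.2 ?_
    have : (n : ℝ) ≤ (n : ℝ) ^ 2 := by exact_mod_cast Nat.le_self_pow two_ne_zero n
    nlinarith
  have h2 : Summable fun n : ℤ => Real.exp (-(c * (n : ℝ) ^ 2)) := by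
    refine Summable.of_nat_of_neg (by simpa using h1) (by simpa using h1)
  have h3 := h2.mul_of_nonneg h2 (fun _ => (Real.exp_pos _).le) (fun _ => (Real.exp_pos _).le)
  refine h3.congr fun k => ?_
  rw [← Real.exp_add]
  congr 1; ring

/-- Away from the origin |k|² ≥ 1, so the singular power is at most 1 and the Gaussian bound is
summable; the one exceptional index is ignored. -/
theorem summable_coeff {h : ℝ} (hh : 0 < h) {z : ℂ} (hz : NotLevel h z) :
    Summable fun k => ‖coeff h z k‖ := by
  obtain ⟨C, hC, hb⟩ := (isRadialGreen hh hz).bound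
  have h1 := (summable_exp_neg_sq (c := h / 8) (by positivity)).mul_left C
  refine Summable.of_norm_bounded_eventually h1 ?_
  rw [Filter.eventually_cofinite]
  refine (Set.finite_singleton (0 : ℤ × ℤ)).subset fun k hk => ?_
  by_contra h0
  apply hk
  have h0' : k ≠ 0 := h0
  rw [norm_norm, coeff, if_neg h0']
  have hk1 : (1 : ℝ) ≤ (k.1 : ℝ) ^ 2 + (k.2 : ℝ) ^ 2 := by
    have : 1 ≤ k.1 ^ 2 + k.2 ^ 2 := by
      by_contra hlt
      have h1 : k.1 ^ 2 + k.2 ^ 2 ≤ 0 := by omega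
      apply h0'
      ext
      · exact pow_eq_zero_iff (two_ne_zero) |>.1 (by nlinarith [sq_nonneg k.1, sq_nonneg k.2])
      · exact pow_eq_zero_iff (two_ne_zero) |>.1 (by nlinarith [sq_nonneg k.1, sq_nonneg k.2])
    exact_mod_cast this
  refine (hb _ (by linarith)).1.trans ?_
  gcongr
  have := Real.rpow_le_one_of_one_le_of_nonpos hk1 (by norm_num : (-1 / 4 : ℝ) ≤ 0)
  calc _ ≤ 1 * Real.exp (-(h / 8 * ((k.1 : ℝ) ^ 2 + (k.2 : ℝ) ^ 2))) := by gcongr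
    _ = _ := one_mul _

/-! ### The two forms of the symbol -/

theorem norm_character (m n : ℤ) (x p : ℝ) : ‖character m n x p‖ = 1 := by
  have : Complex.I * ((m : ℂ) * x + n * p) = ((m * x + n * p : ℝ) : ℂ) * Complex.I := by
    push_cast; ring
  rw [character, this, Complex.norm_exp_ofReal_mul_I]

theorem qMatrix_zero_mul_exp (h : ℝ) (z : ℂ) (k : ℤ × ℤ) :
    qMatrix h z (0, 0) k * Complex.exp (-(Complex.I * k.1 * k.2 * h / 2)) = coeff h z k := by
  rw [qMatrix_eq, gaugePhase]
  have : k - (0, 0) = k := sub_zero k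
  rw [this, mul_right_comm, ← Complex.exp_add]
  simp only [latticePt]
  have e : (((-(h * (((0 : ℤ) : ℝ) - k.1) * (((0 : ℤ) : ℝ) + k.2) / 2) : ℝ) : ℂ) * Complex.I) +
      -(Complex.I * k.1 * k.2 * h / 2) = 0 := by
    push_cast; ring
  rw [e, Complex.exp_zero, one_mul]

theorem norm_qMatrix_zero (h : ℝ) (z : ℂ) (k : ℤ × ℤ) :
    ‖qMatrix h z (0, 0) k‖ = ‖coeff h z k‖ := by
  rw [qMatrix_eq, norm_mul, norm_gaugePhase, one_mul]
  congr 2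
  exact sub_zero k

theorem summable_coeff_mul_character {h : ℝ} (hh : 0 < h) {z : ℂ} (hz : NotLevel h z) (x p : ℝ) :
    Summable fun k : ℤ × ℤ => coeff h z k * character k.1 k.2 x p := by
  refine Summable.of_norm ((summable_coeff hh hz).congr fun k => ?_)
  rw [norm_mul, norm_character, mul_one]

theorem effSymbol_eq {h : ℝ} (hh : 0 < h) (α : ℝ) {z : ℂ} (hz : NotLevel h z) (x p : ℝ) :
    effSymbol h α z x p =
      (∑' k : ℤ × ℤ, coeff h z k * character k.1 k.2 x p) + (α : ℂ)⁻¹ := by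
  have hs := summable_coeff_mul_character hh hz x p
  rw [effSymbol, hs.tsum_eq_add_tsum_ite 0]
  have h0 : coeff h z 0 * character (0 : ℤ × ℤ).1 (0 : ℤ × ℤ).2 x p = qFun h z := by
    simp [coeff, character]
  rw [h0]
  have hset : ∀ k : ℤ × ℤ, 1 ≤ |k.1| + |k.2| ↔ k ≠ 0 := by
    intro k
    constructor
    · rintro hk rfl
      simp at hk
    · intro hk
      by_contra hlt
      apply hk
      have h1 := abs_nonneg k.1
      have h2 := abs_nonneg k.2
      ext
      · exact abs_eq_zero.1 (by omega)
      · exact abs_eq_zero.1 (by omega)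
  have h1 : ∑' k : {k : ℤ × ℤ // 1 ≤ |k.1| + |k.2|}, lam h z k.1.1 k.1.2 *
      character k.1.1 k.1.2 x p = ∑' k : ℤ × ℤ,
        if k = 0 then 0 else coeff h z k * character k.1 k.2 x p := by
    have := tsum_subtype {k : ℤ × ℤ | 1 ≤ |k.1| + |k.2|}
      (fun k => lam h z k.1 k.2 * character k.1 k.2 x p)
    refine this.trans (tsum_congr fun k => ?_)
    by_cases hk : k = 0
    · rw [if_pos hk, Set.indicator_of_notMem]
      simp [hk]
    · rw [if_neg hk, Set.indicator_of_mem (show k ∈ {k : ℤ × ℤ | 1 ≤ |k.1| + |k.2|} from (hset k).2 hk),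
        lam_eq, coeff, if_neg hk]
  rw [h1]
  ring

/-! ### Hilbert space preliminaries -/

/-- The Hilbert space `ℓ²(ℤ²)`. -/
abbrev Seq : Type := lp (fun _ : ℤ × ℤ => ℂ) 2

section Hilbert

variable {H : Type*} [NormedAddCommGroup H] [InnerProductSpace ℂ H]

theorem exists_pos_bound_of_isUnit {T : H →L[ℂ] H} (hT : IsUnit T) :
    ∃ c > 0, ∀ x, c * ‖x‖ ≤ ‖T x‖ := by
  obtain ⟨u, rfl⟩ := hT
  set B : H →L[ℂ] H := ↑u⁻¹ with hB
  refine ⟨(‖B‖ + 1)⁻¹, by positivity, fun x => ?_⟩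
  have h1 : B ((u : H →L[ℂ] H) x) = x := by
    have : (B * (u : H →L[ℂ] H)) x = x := by rw [hB, Units.inv_mul]; rfl
    exact this
  rw [inv_mul_le_iff₀ (by positivity)]
  calc ‖x‖ = ‖B ((u : H →L[ℂ] H) x)‖ := by rw [h1]
    _ ≤ ‖B‖ * ‖(u : H →L[ℂ] H) x‖ := B.le_opNorm _
    _ ≤ _ := by gcongr; linarith

/-- The bound for T makes it injective with closed range; the bound for the adjoint makes the range
dense. -/
theorem isUnit_of_bounds [CompleteSpace H] {T T' : H →L[ℂ] H} (hTT' : ∀ x y, ⟪T' x, y⟫_ℂ = ⟪x, T y⟫_ℂ) {c : ℝ}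
    (hc : 0 < c) (h1 : ∀ x, c * ‖x‖ ≤ ‖T x‖) (h2 : ∀ x, c * ‖x‖ ≤ ‖T' x‖) : IsUnit T := by
  rw [ContinuousLinearMap.isUnit_iff_bijective,
    ContinuousLinearMap.bijective_iff_dense_range_and_antilipschitz]
  constructor
  · rw [Submodule.topologicalClosure_eq_top_iff, Submodule.eq_bot_iff]
    intro w hw
    have h3 : T' w = 0 := by
      refine ext_inner_right ℂ fun v => ?_
      rw [hTT', inner_zero_left]
      exact (Submodule.mem_orthogonal' _ w).1 hw (T v) ⟨v, rfl⟩
    have h4 := h2 w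
    rw [h3, norm_zero] at h4
    exact norm_le_zero_iff.1 (by
      by_contra h5
      have : 0 < c * ‖w‖ := mul_pos hc (not_le.1 h5)
      linarith)
  · refine ⟨⟨c⁻¹, by positivity⟩, AddMonoidHomClass.antilipschitz_of_bound T fun x => ?_⟩
    change ‖x‖ ≤ c⁻¹ * ‖T x‖
    rw [le_inv_mul_iff₀ hc]
    exact h1 x

/-- Lower bounds, unlike invertibility, can be compared between operators on different Hilbert
spaces. Here the adjoint is always the same operator with z replaced by z̄. -/
theorem isUnit_iff_bounds [CompleteSpace H] {T T' : H →L[ℂ] H} (hTT' : ∀ x y, ⟪T' x, y⟫_ℂ = ⟪x, T y⟫_ℂ) :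
    IsUnit T ↔ (∃ c > 0, ∀ x, c * ‖x‖ ≤ ‖T x‖) ∧ ∃ c > 0, ∀ x, c * ‖x‖ ≤ ‖T' x‖ := by
  constructor
  · intro hT
    have e : T' = T.adjoint := by
      rw [ContinuousLinearMap.eq_adjoint_iff]
      exact hTT'
    refine ⟨exists_pos_bound_of_isUnit hT, exists_pos_bound_of_isUnit ?_⟩
    rw [e, ← ContinuousLinearMap.star_eq_adjoint]
    exact hT.star
  · rintro ⟨⟨c, hc, h1⟩, ⟨d, hd, h2⟩⟩
    refine isUnit_of_bounds hTT' (lt_min hc hd) (fun x => le_trans ?_ (h1 x))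
      fun x => le_trans ?_ (h2 x)
    · gcongr; exact min_le_left _ _
    · gcongr; exact min_le_right _ _

/-- A Bessel inequality from Schur's test on the Gram matrix. With A the left side and S the sum of
⟪g m, v⟫ g m, one has A ≤ ‖S‖‖v‖ and ‖S‖² ≤ CA, hence A ≤ C‖v‖² after division by A. -/
theorem sum_norm_inner_sq_le {g : ℤ × ℤ → H} {c : ℤ × ℤ → ℝ} (hc : Summable c)
    (hg : ∀ m n, ‖⟪g m, g n⟫_ℂ‖ ≤ c (m - n)) (v : H) (F : Finset (ℤ × ℤ)) :
    ∑ m ∈ F, ‖⟪g m, v⟫_ℂ‖ ^ 2 ≤ (∑' k, c k) * ‖v‖ ^ 2 := by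
  have hc0 : ∀ k, 0 ≤ c k := fun k => (norm_nonneg _).trans (by simpa using hg k 0)
  set C := ∑' k, c k
  set a : ℤ × ℤ → ℂ := fun m => ⟪g m, v⟫_ℂ
  set A := ∑ m ∈ F, ‖a m‖ ^ 2
  set S := ∑ m ∈ F, a m • g m with hS
  have hA0 : 0 ≤ A := Finset.sum_nonneg fun _ _ => by positivity
  have hC0 : 0 ≤ C := tsum_nonneg hc0
  have h1 : A ≤ ‖S‖ * ‖v‖ := by
    have e : ⟪S, v⟫_ℂ = (A : ℂ) := by
      rw [hS, sum_inner, Complex.ofReal_sum]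
      refine Finset.sum_congr rfl fun m _ => ?_
      rw [inner_smul_left, Complex.ofReal_pow, ← Complex.conj_mul']
    calc A = ‖⟪S, v⟫_ℂ‖ := by rw [e, Complex.norm_real, Real.norm_eq_abs, abs_of_nonneg hA0]
      _ ≤ _ := norm_inner_le_norm _ _
  have hsum1 : ∀ m, ∑ n ∈ F, c (m - n) ≤ C := fun m => by
    have := Summable.sum_le_tsum F (fun n _ => hc0 (m - n))
      ((Equiv.subLeft m).summable_iff.2 hc)
    rwa [show ∑' i, c (m - i) = C from (Equiv.subLeft m).tsum_eq c] at this
  have hsum2 : ∀ n, ∑ m ∈ F, c (m - n) ≤ C := fun n => by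
    have := Summable.sum_le_tsum F (fun m _ => hc0 (m - n))
      ((Equiv.subRight n).summable_iff.2 hc)
    rwa [show ∑' i, c (i - n) = C from (Equiv.subRight n).tsum_eq c] at this
  have h2 : ‖S‖ ^ 2 ≤ C * A := by
    have e : ((‖S‖ ^ 2 : ℝ) : ℂ) = ∑ m ∈ F, ∑ n ∈ F, starRingEnd ℂ (a m) * (a n * ⟪g m, g n⟫_ℂ) := by
      have := inner_self_eq_norm_sq_to_K (𝕜 := ℂ) S
      push_cast
      rw [show ((‖S‖ : ℝ) : ℂ) ^ 2 = ⟪S, S⟫_ℂ from this.symm]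
      conv_lhs => rw [hS]
      rw [sum_inner]
      refine Finset.sum_congr rfl fun m _ => ?_
      rw [inner_sum]
      refine Finset.sum_congr rfl fun n _ => ?_
      rw [inner_smul_left, inner_smul_right]
    have hn : ‖S‖ ^ 2 ≤ ∑ m ∈ F, ∑ n ∈ F, (‖a m‖ ^ 2 + ‖a n‖ ^ 2) / 2 * c (m - n) := by
      calc ‖S‖ ^ 2 = ‖((‖S‖ ^ 2 : ℝ) : ℂ)‖ := by
            rw [Complex.norm_real, Real.norm_eq_abs, abs_of_nonneg (by positivity)]
        _ ≤ ∑ m ∈ F, ∑ n ∈ F, ‖starRingEnd ℂ (a m) * (a n * ⟪g m, g n⟫_ℂ)‖ := by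
            rw [e]
            exact (norm_sum_le _ _).trans (Finset.sum_le_sum fun m _ => norm_sum_le _ _)
        _ ≤ _ := by
            refine Finset.sum_le_sum fun m _ => Finset.sum_le_sum fun n _ => ?_
            rw [norm_mul, norm_mul, RCLike.norm_conj, ← mul_assoc]
            refine mul_le_mul ?_ (hg m n) (norm_nonneg _) (by positivity)
            nlinarith [sq_nonneg (‖a m‖ - ‖a n‖)]
    have hx : ∑ m ∈ F, ∑ n ∈ F, ‖a m‖ ^ 2 * c (m - n) ≤ C * A := by
      rw [Finset.mul_sum]
      refine Finset.sum_le_sum fun m _ => ?_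
      rw [← Finset.mul_sum, mul_comm]
      gcongr
      exact hsum1 m
    have hy : ∑ m ∈ F, ∑ n ∈ F, ‖a n‖ ^ 2 * c (m - n) ≤ C * A := by
      rw [Finset.sum_comm, Finset.mul_sum]
      refine Finset.sum_le_sum fun n _ => ?_
      rw [← Finset.mul_sum, mul_comm]
      gcongr
      exact hsum2 n
    have hsplit : ∑ m ∈ F, ∑ n ∈ F, (‖a m‖ ^ 2 + ‖a n‖ ^ 2) / 2 * c (m - n) =
        (∑ m ∈ F, ∑ n ∈ F, ‖a m‖ ^ 2 * c (m - n) + ∑ m ∈ F, ∑ n ∈ F, ‖a n‖ ^ 2 * c (m - n)) / 2 := by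
      rw [← Finset.sum_add_distrib, Finset.sum_div]
      refine Finset.sum_congr rfl fun m _ => ?_
      rw [← Finset.sum_add_distrib, Finset.sum_div]
      exact Finset.sum_congr rfl fun n _ => by ring
    linarith
  rcases hA0.eq_or_lt with h0 | h0
  · rw [← h0]; positivity
  · have h3 : A ^ 2 ≤ (C * A) * ‖v‖ ^ 2 := by
      calc A ^ 2 ≤ (‖S‖ * ‖v‖) ^ 2 := by gcongr
        _ = ‖S‖ ^ 2 * ‖v‖ ^ 2 := by ring
        _ ≤ _ := by gcongr
    nlinarith

/-- A family of vectors whose Gram matrix is dominated by a summable convolution matrix. -/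
def AlmostOrthogonal (g : ℤ × ℤ → H) : Prop :=
  ∃ c : ℤ × ℤ → ℝ, Summable c ∧ ∀ m n, ‖⟪g m, g n⟫_ℂ‖ ≤ c (m - n)

variable {g : ℤ × ℤ → H}

theorem AlmostOrthogonal.exists_analysis (hg : AlmostOrthogonal g) :
    ∃ A : H →L[ℂ] Seq, ∀ v m, A v m = ⟪g m, v⟫_ℂ := by
  obtain ⟨c, hc, hgc⟩ := hg
  have hb := sum_norm_inner_sq_le hc hgc
  have hC0 : 0 ≤ ∑' k, c k := tsum_nonneg fun k => (norm_nonneg _).trans (by simpa using hgc k 0)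
  have hmem : ∀ v, Memℓp (fun m => ⟪g m, v⟫_ℂ) 2 := fun v =>
    memℓp_gen' (C := (∑' k, c k) * ‖v‖ ^ 2) fun F => by simpa using hb v F
  let A0 : H →ₗ[ℂ] Seq :=
    { toFun := fun v => ⟨fun m => ⟪g m, v⟫_ℂ, hmem v⟩
      map_add' := fun u v => by
        ext m
        exact inner_add_right _ _ _
      map_smul' := fun a v => by
        ext m
        exact inner_smul_right _ _ _ }
  refine ⟨A0.mkContinuous √(∑' k, c k) fun v => ?_, fun v m => rfl⟩
  refine lp.norm_le_of_forall_sum_le (by simp) (by positivity) fun F => ?_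
  have := hb v F
  simp only [ENNReal.toReal_ofNat, Real.rpow_two]
  rw [mul_pow, Real.sq_sqrt hC0]
  exact this

/-- The operator `v ↦ (⟪g m, v⟫)ₘ`. -/
def AlmostOrthogonal.analysis (hg : AlmostOrthogonal g) : H →L[ℂ] Seq := hg.exists_analysis.choose

theorem AlmostOrthogonal.analysis_apply (hg : AlmostOrthogonal g) (v : H) (m : ℤ × ℤ) :
    hg.analysis v m = ⟪g m, v⟫_ℂ := hg.exists_analysis.choose_spec v m

variable [CompleteSpace H]

/-- The operator `ξ ↦ ∑ ξₘ g m`. -/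
def AlmostOrthogonal.synthesis (hg : AlmostOrthogonal g) : Seq →L[ℂ] H := hg.analysis.adjoint

theorem AlmostOrthogonal.inner_synthesis_left (hg : AlmostOrthogonal g) (ξ : Seq) (v : H) :
    ⟪hg.synthesis ξ, v⟫_ℂ = ⟪ξ, hg.analysis v⟫_ℂ :=
  ContinuousLinearMap.adjoint_inner_left _ _ _

theorem AlmostOrthogonal.synthesis_single (hg : AlmostOrthogonal g) (m : ℤ × ℤ) (a : ℂ) :
    hg.synthesis (lp.single 2 m a) = a • g m := by
  refine ext_inner_right ℂ fun v => ?_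
  rw [hg.inner_synthesis_left, lp.inner_single_left, hg.analysis_apply, inner_smul_left,
    RCLike.inner_apply, mul_comm]

theorem AlmostOrthogonal.hasSum_synthesis (hg : AlmostOrthogonal g) (ξ : Seq) :
    HasSum (fun m => ξ m • g m) (hg.synthesis ξ) := by
  have h1 := (lp.hasSum_single (by norm_num) ξ).mapL hg.synthesis
  simpa only [hg.synthesis_single] using h1

end Hilbert

/-! ### Matrix operators on `ℓ²(ℤ²)` -/

theorem Seq.sum_sq_le (ξ : Seq) (F : Finset (ℤ × ℤ)) : ∑ n ∈ F, ‖ξ n‖ ^ 2 ≤ ‖ξ‖ ^ 2 := by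
  have := lp.sum_rpow_le_norm_rpow (p := 2) (by simp) ξ F
  simpa using this

theorem exists_weightedShift {p : ℤ × ℤ → ℂ} (hp : ∀ n, ‖p n‖ ≤ 1) (k : ℤ × ℤ) :
    ∃ U : Seq →L[ℂ] Seq, ‖U‖ ≤ 1 ∧ ∀ ξ n, U ξ n = p n * ξ (n + k) := by
  have hb : ∀ (ξ : Seq) (F : Finset (ℤ × ℤ)), ∑ n ∈ F, ‖p n * ξ (n + k)‖ ^ 2 ≤ ‖ξ‖ ^ 2 := by
    intro ξ F
    calc ∑ n ∈ F, ‖p n * ξ (n + k)‖ ^ 2 ≤ ∑ n ∈ F, ‖ξ (n + k)‖ ^ 2 := by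
          refine Finset.sum_le_sum fun n _ => ?_
          rw [norm_mul]
          gcongr
          exact mul_le_of_le_one_left (norm_nonneg _) (hp n)
      _ = ∑ n ∈ F.map (Equiv.addRight k).toEmbedding, ‖ξ n‖ ^ 2 := by
          rw [Finset.sum_map]; rfl
      _ ≤ _ := ξ.sum_sq_le _
  let U0 : Seq →ₗ[ℂ] Seq :=
    { toFun := fun ξ => ⟨fun n => p n * ξ (n + k),
        memℓp_gen' (C := ‖ξ‖ ^ 2) fun F => by simpa using hb ξ F⟩
      map_add' := fun ξ η => by
        ext n
        exact mul_add _ _ _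
      map_smul' := fun a ξ => by
        ext n
        exact mul_left_comm _ _ _ }
  refine ⟨U0.mkContinuous 1 fun ξ => ?_, LinearMap.mkContinuous_norm_le _ zero_le_one _,
    fun ξ n => rfl⟩
  refine lp.norm_le_of_forall_sum_le (by simp) (by positivity) fun F => ?_
  simp only [ENNReal.toReal_ofNat, Real.rpow_two, one_mul]
  exact hb ξ F

/-- The matrix operator with entries `p n m * c (m - n)`, where `p` is bounded and `c` summable. -/
theorem exists_matrixOp {c : ℤ × ℤ → ℂ} (hc : Summable fun k => ‖c k‖) {p : ℤ × ℤ → ℤ × ℤ → ℂ}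
    (hp : ∀ n m, ‖p n m‖ ≤ 1) : ∃ B : Seq →L[ℂ] Seq, ∀ ξ n,
      HasSum (fun k => c k * (p n (n + k) * ξ (n + k))) (B ξ n) := by
  choose U hU1 hU using fun k => exists_weightedShift (p := fun n => p n (n + k)) (fun n => hp _ _) k
  have hs : Summable fun k => c k • U k := by
    refine Summable.of_norm_bounded hc fun k => ?_
    rw [norm_smul]
    exact mul_le_of_le_one_right (norm_nonneg _) (hU1 k)
  refine ⟨∑' k, c k • U k, fun ξ n => ?_⟩
  have h1 := hs.hasSum.mapL (ContinuousLinearMap.apply ℂ Seq ξ)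
  have h2 := h1.mapL (lp.evalCLM ℂ (fun _ : ℤ × ℤ => ℂ) 2 n)
  refine h2.congr_fun fun k => ?_
  change _ = (c k • U k) ξ n
  rw [← hU]
  rfl

/-! ### The deficiency vectors -/

section Deficiency

variable {h : ℝ} {z : ℂ}

theorem memLp_regGreen_left (hh : 0 < h) (hz : NotLevel h z) (y : ℝ × ℝ) :
    MemLp (fun x => regGreen h z 0 x y) 2 := by
  have h1 := (convDominated_regGreen hh hz.conj le_rfl).memLp_left y
  refine h1.mono ?_ (Eventually.of_forall fun x => ?_)
  · exact ((convDominated_regGreen hh hz le_rfl).measurable.comp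
      (measurable_id.prodMk measurable_const)).aestronglyMeasurable
  · rw [regGreen_conj, RCLike.norm_conj]

/-- The function `G_h(·, m; z)` as an element of `L²`. -/
def gammaVec (hh : 0 < h) (hz : NotLevel h z) (m : ℤ × ℤ) : L2Plane :=
  (memLp_regGreen_left hh hz (latticePt m)).toLp

theorem gammaVec_coeFn (hh : 0 < h) (hz : NotLevel h z) (m : ℤ × ℤ) :
    gammaVec hh hz m =ᵐ[volume] fun x => regGreen h z 0 x (latticePt m) :=
  (memLp_regGreen_left hh hz (latticePt m)).coeFn_toLp

/-- Pairing with a deficiency vector at z evaluates the resolvent at z̄ at a lattice point; this is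
the source of all conjugations below. -/
theorem inner_gammaVec (hh : 0 < h) (hz : NotLevel h z) (m : ℤ × ℤ) (v : L2Plane) :
    ⟪gammaVec hh hz m, v⟫_ℂ = ∫ y, regGreen h (starRingEnd ℂ z) 0 (latticePt m) y * v y := by
  rw [inner_eq_integral]
  refine integral_congr_ae ?_
  filter_upwards [gammaVec_coeFn hh hz m] with y hy
  rw [hy, regGreen_conj]

/-- Half of each Gaussian is spent, through |u - v|² ≤ 2(|u|² + |v|²), on decay in the distance of
the centres; the other half keeps the product integrable. -/
theorem weight_mul_weight_le {c : ℝ} (hc : 0 < c) (u v : ℝ × ℝ) :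
    weight c u * weight c v ≤
      Real.exp (-(c / 4 * sqNorm (u - v))) * (weight (c / 2) u * weight (c / 2) v) := by
  have h1 : ∀ u, weight c u = weight (c / 2) u * Real.exp (-(c / 2 * sqNorm u)) := by
    intro u
    rw [weight, weight, mul_assoc, ← Real.exp_add]
    congr 2; ring
  have h2 : Real.exp (-(c / 2 * sqNorm u)) * Real.exp (-(c / 2 * sqNorm v)) ≤
      Real.exp (-(c / 4 * sqNorm (u - v))) := by
    rw [← Real.exp_add]
    refine Real.exp_le_exp.2 ?_
    have h3 : sqNorm (u - v) ≤ 2 * (sqNorm u + sqNorm v) := by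
      simp only [sqNorm, Prod.fst_sub, Prod.snd_sub]
      nlinarith [sq_nonneg (u.1 + v.1), sq_nonneg (u.2 + v.2)]
    nlinarith
  calc weight c u * weight c v = (weight (c / 2) u * weight (c / 2) v) *
        (Real.exp (-(c / 2 * sqNorm u)) * Real.exp (-(c / 2 * sqNorm v))) := by
        rw [h1 u, h1 v]; ring
    _ ≤ _ := by
        rw [mul_comm (Real.exp (-(c / 4 * sqNorm (u - v))))]
        have := weight_nonneg (c / 2) u
        have := weight_nonneg (c / 2) v
        gcongr

theorem sqDist_latticePt (m n : ℤ × ℤ) :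
    sqDist (latticePt m) (latticePt n) = ((m - n).1 : ℝ) ^ 2 + ((m - n).2 : ℝ) ^ 2 := by
  simp [sqDist, latticePt]

theorem integrable_weight_sq {c : ℝ} (hc : 0 < c) : Integrable fun u => weight c u ^ 2 := by
  have := (memLp_two_iff_integrable_sq_norm (integrable_weight hc).1).1 (memLp_weight hc)
  simpa using this

/-- The Gram matrix decays like a Gaussian in m - n: this factor is pulled out of the product of the
two weights, and what is left is bounded by half the sum of squares, whose integrals do not depend
on m and n. -/
theorem almostOrthogonal_gammaVec (hh : 0 < h) (hz : NotLevel h z) :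
    AlmostOrthogonal (gammaVec hh hz) := by
  obtain ⟨C, hC, hb⟩ := exists_norm_radial_le hh hz
  set D := C ^ 2 * ∫ u, weight (h / 16) u ^ 2
  refine ⟨fun k => D * Real.exp (-(h / 32 * ((k.1 : ℝ) ^ 2 + (k.2 : ℝ) ^ 2))),
    (summable_exp_neg_sq (by positivity)).mul_left D, fun m n => ?_⟩
  beta_reduce
  rw [inner_eq_integral, ← sqDist_latticePt]
  have hi := integrable_weight_sq (c := h / 16) (by positivity)
  have htr : ∀ m : ℤ × ℤ, Integrable fun x => weight (h / 16) (x - latticePt m) ^ 2 := fun m =>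
    hi.comp_sub_right (latticePt m)
  have hint : ∀ m : ℤ × ℤ, ∫ x, weight (h / 16) (x - latticePt m) ^ 2 =
      ∫ u, weight (h / 16) u ^ 2 := fun m =>
    integral_sub_right_eq_self (fun u => weight (h / 16) u ^ 2) (latticePt m)
  set E := Real.exp (-(h / 32 * sqDist (latticePt m) (latticePt n)))
  have hE : 0 < E := Real.exp_pos _
  have hne : ∀ m : ℤ × ℤ, ∀ᵐ x : ℝ × ℝ, x - latticePt m ≠ 0 := fun m => by
    filter_upwards [Measure.ae_ne volume (latticePt m)] with x hx using sub_ne_zero.2 hx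
  refine (norm_integral_le_of_norm_le (g := fun x => C ^ 2 * E *
    ((weight (h / 16) (x - latticePt m) ^ 2 + weight (h / 16) (x - latticePt n) ^ 2) / 2))
    ((((htr m).add (htr n)).div_const 2).const_mul (C ^ 2 * E)) ?_).trans (le_of_eq ?_)
  · filter_upwards [gammaVec_coeFn hh hz m, gammaVec_coeFn hh hz n, hne m, hne n] with x h1 h2 h3 h4
    rw [h1, h2, norm_mul, RCLike.norm_conj, regGreen, regGreen, norm_mul, norm_mul,
      norm_gaugePhase, norm_gaugePhase, one_mul, one_mul, sqDist_eq, sqDist_eq]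
    have b1 := hb 0 le_rfl _ h3
    have b2 := hb 0 le_rfl _ h4
    have b3 := weight_mul_weight_le (c := h / 8) (by positivity) (x - latticePt m) (x - latticePt n)
    have e1 : sqNorm (x - latticePt m - (x - latticePt n)) = sqDist (latticePt m) (latticePt n) := by
      rw [sqDist_eq, ← sqNorm_neg]; congr 1; abel
    have e2 : h / 8 / 4 = h / 32 := by ring
    have e3 : h / 8 / 2 = h / 16 := by ring
    rw [e1, e2, e3] at b3
    calc _ ≤ (C * weight (h / 8) (x - latticePt m)) * (C * weight (h / 8) (x - latticePt n)) :=
          mul_le_mul b1 b2 (norm_nonneg _) ((norm_nonneg _).trans b1)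
      _ = C ^ 2 * (weight (h / 8) (x - latticePt m) * weight (h / 8) (x - latticePt n)) := by ring
      _ ≤ C ^ 2 * (E * (weight (h / 16) (x - latticePt m) * weight (h / 16) (x - latticePt n))) := by
          gcongr
      _ = C ^ 2 * E * (weight (h / 16) (x - latticePt m) * weight (h / 16) (x - latticePt n)) := by
          ring
      _ ≤ _ := by
          gcongr
          nlinarith [sq_nonneg (weight (h / 16) (x - latticePt m) - weight (h / 16) (x - latticePt n))]
  · rw [integral_const_mul, integral_div, integral_add (htr m) (htr n), hint, hint]
    simp only [D]
    ring

/-! ### The dual family -/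

theorem isSmoothRapid_of_hasCompactSupport {f : ℝ → ℂ} (hf : ContDiff ℝ (⊤ : ℕ∞) f)
    (hc : HasCompactSupport f) (ε : ℝ) : IsSmoothRapid ε f := by
  refine ⟨fun g => ContDiff ℝ (⊤ : ℕ∞) g ∧ HasCompactSupport g, ⟨hf, hc⟩, ?_, ?_⟩
  · rintro g ⟨hg, hgc⟩
    refine ⟨deriv g, ⟨?_, hgc.deriv⟩, fun s _ => ?_⟩
    · exact (contDiff_infty_iff_deriv.1 hg).2
    · exact (hg.differentiable (by simp) s).hasDerivAt
  · rintro g ⟨hg, hgc⟩ N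
    have hc1 : Continuous fun s : ℝ => (s : ℂ) ^ N * g s :=
      (Complex.continuous_ofReal.pow N).mul hg.continuous
    obtain ⟨C, hC⟩ := hc1.bounded_above_of_compact_support (hgc.mul_left (f := fun s : ℝ => (s : ℂ) ^ N))
    refine ⟨C, fun s _ => le_trans ?_ (hC s)⟩
    rw [norm_mul, norm_pow, Complex.norm_real, Real.norm_eq_abs]
    exact mul_le_mul_of_nonneg_right ((le_abs_self _).trans (abs_pow s N).le) (norm_nonneg _)

theorem exists_bump : ∃ f : ℝ → ℂ, ContDiff ℝ (⊤ : ℕ∞) f ∧ HasCompactSupport f ∧ f 1 = 1 ∧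
    ∀ s, 17 / 16 < s → f s = 0 ∧ deriv f s = 0 ∧ deriv (deriv f) s = 0 := by
  -- The centre 1 corresponds to the lattice point itself, since the squared distance will be
  -- shifted by 1. Radius 1/16 in the squared distance means distance at most 1/4, so the supports
  -- at different lattice points are disjoint.
  let b : ContDiffBump (1 : ℝ) := ⟨1 / 32, 1 / 16, by norm_num, by norm_num⟩
  have hz : ∀ s : ℝ, 17 / 16 < s → (b s : ℂ) = 0 := by
    intro s hs
    rw [b.zero_of_le_dist]
    · simp
    · rw [Real.dist_eq, abs_of_pos (by linarith)]
      change (1 / 16 : ℝ) ≤ _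
      linarith
  have hd : ∀ g : ℝ → ℂ, (∀ s : ℝ, 17 / 16 < s → g s = 0) → ∀ s : ℝ, 17 / 16 < s → deriv g s = 0 := by
    intro g hg s hs
    have : g =ᶠ[𝓝 s] fun _ => 0 := by
      filter_upwards [Ioi_mem_nhds hs] with t ht using hg t ht
    rw [this.deriv_eq, deriv_const]
  refine ⟨fun s => (b s : ℂ), ?_, ?_, ?_, fun s hs => ⟨hz s hs, hd _ hz s hs, hd _ (hd _ hz) s hs⟩⟩
  · exact Complex.ofRealCLM.contDiff.comp b.contDiff
  · exact b.hasCompactSupport.comp_left (g := fun t : ℝ => (t : ℂ)) Complex.ofReal_zero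
  · have : b 1 = 1 := b.one_of_mem_closedBall (Metric.mem_closedBall_self b.rIn_pos.le)
    simp [this]

theorem one_le_sqDist_latticePt {m n : ℤ × ℤ} (hmn : m ≠ n) :
    1 ≤ sqDist (latticePt m) (latticePt n) := by
  rw [sqDist_latticePt]
  have : 1 ≤ (m - n).1 ^ 2 + (m - n).2 ^ 2 := by
    by_contra hlt
    have h1 : (m - n).1 ^ 2 + (m - n).2 ^ 2 ≤ 0 := by omega
    apply sub_ne_zero.2 hmn
    ext
    · exact pow_eq_zero_iff (two_ne_zero) |>.1 (by nlinarith [sq_nonneg (m - n).1, sq_nonneg (m - n).2])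
    · exact pow_eq_zero_iff (two_ne_zero) |>.1 (by nlinarith [sq_nonneg (m - n).1, sq_nonneg (m - n).2])
  exact_mod_cast this

/-- A family of `L²` functions with disjoint supports that is dual to the deficiency vectors. -/
theorem exists_dualFamily (hh : 0 < h) (hz : NotLevel h z) : ∃ ψ : ℤ × ℤ → L2Plane,
    AlmostOrthogonal ψ ∧ ∀ m n, ⟪gammaVec hh hz n, ψ m⟫_ℂ = if m = n then 1 else 0 := by
  obtain ⟨f, hf, hfc, hf1, hf0⟩ := exists_bump
  have hdf : Differentiable ℝ f := hf.differentiable (by simp)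
  have hf' : ContDiff ℝ (⊤ : ℕ∞) (deriv f) := (contDiff_infty_iff_deriv.1 hf).2
  have hdf' : Differentiable ℝ (deriv f) := hf'.differentiable (by simp)
  -- Each X m is a bump with value 1 at m and 0 at the other lattice points. The dual vectors are
  -- (H_h - z̄)X m, because the resolvent at z̄ returns X m, which is then evaluated at n.
  choose X hX using fun m : ℤ × ℤ => exists_schwartz_gauge h one_pos
    (isSmoothRapid_of_hasCompactSupport hf hfc 1) (latticePt m)
  set Ψ : ℝ → ℂ := fun s => -4 * s * deriv (deriv f) (s + 1) - 4 * deriv f (s + 1) +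
    h ^ 2 * s / 4 * f (s + 1) - starRingEnd ℂ z * f (s + 1) with hΨ
  have hLX : ∀ m y, (landauExpr h (X m) - starRingEnd ℂ z • X m) y =
      gaugePhase h y (latticePt m) * Ψ (sqDist y (latticePt m)) := by
    intro m y
    have e : (landauExpr h (X m) - starRingEnd ℂ z • X m) y =
      landauExpr h (X m) y - starRingEnd ℂ z * X m y := rfl
    rw [e, landauExpr_radial one_pos (fun s _ => (hdf s).hasDerivAt)
      (fun s _ => (hdf' s).hasDerivAt) (hX m) y, hX m y]
    simp only [hΨ]
    ring
  have hΨ0 : ∀ s, 1 / 16 < s → Ψ s = 0 := by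
    intro s hs
    obtain ⟨a, b, c⟩ := hf0 (s + 1) (by linarith)
    simp only [hΨ, a, b, c]
    ring
  set ψ : ℤ × ℤ → L2Plane := fun m => schwartzToL2 (landauExpr h (X m) - starRingEnd ℂ z • X m)
    with hψ
  refine ⟨ψ, ?_, fun m n => ?_⟩
  · set N := ∫ u, ‖Ψ (sqNorm u)‖ ^ 2
    refine ⟨fun k => if k = 0 then N else 0, (hasSum_ite_eq 0 N).summable, fun m n => ?_⟩
    simp only [hψ]
    rw [inner_schwartzToL2]
    by_cases hmn : m = n
    · subst hmn
      rw [if_pos (sub_self m)]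
      refine (norm_integral_le_integral_norm _).trans (le_of_eq ?_)
      refine Eq.trans ?_
        (integral_sub_right_eq_self (fun u => ‖Ψ (sqNorm u)‖ ^ 2) (latticePt m))
      congr 1
      funext y
      rw [norm_mul, RCLike.norm_conj, hLX, norm_mul, norm_gaugePhase, one_mul, sqDist_eq, sq]
    · rw [if_neg (sub_ne_zero.2 hmn)]
      refine le_of_eq ?_
      rw [norm_eq_zero]
      refine integral_eq_zero_of_ae (Eventually.of_forall fun y => ?_)
      beta_reduce
      rw [hLX, hLX]
      have h1 := one_le_sqDist_latticePt hmn
      -- Lattice points at squared distance at least 1 cannot both be within squared distance 1/16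
      -- of y, so one of the two factors vanishes.
      have h2 : sqDist (latticePt m) (latticePt n) ≤
          2 * (sqDist y (latticePt m) + sqDist y (latticePt n)) := by
        simp only [sqDist]
        nlinarith [sq_nonneg (2 * y.1 - (latticePt m).1 - (latticePt n).1),
          sq_nonneg (2 * y.2 - (latticePt m).2 - (latticePt n).2)]
      rcases lt_or_ge (1 / 16) (sqDist y (latticePt m)) with h3 | h3
      · simp [hΨ0 _ h3]
      · have h4 : 1 / 16 < sqDist y (latticePt n) := by linarith
        simp [hΨ0 _ h4]
  · rw [inner_gammaVec]
    simp only [hψ]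
    rw [map_sub, map_smul, integral_green_schwartz hh hz.conj, hX]
    by_cases hmn : m = n
    · subst hmn
      have h0 : sqDist (latticePt m) (latticePt m) = 0 := by simp [sqDist]
      rw [if_pos rfl, h0, zero_add, hf1, mul_one]
      simp [gaugePhase]
    · rw [if_neg hmn, (hf0 _ (by
        have := one_le_sqDist_latticePt (Ne.symm hmn)
        linarith)).1, mul_zero]

end Deficiency

/-! ### Logarithmic expansions -/

theorem HasLogExpansion.add {F F' : ℝ × ℝ → ℂ} {p : ℝ × ℝ} {a b a' b' : ℂ}
    (h1 : HasLogExpansion F p a b) (h2 : HasLogExpansion F' p a' b') :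
    HasLogExpansion (fun x => F x + F' x) p (a + a') (b + b') :=
  (Tendsto.add h1 h2).congr fun x => by ring

theorem hasLogExpansion_of_continuousAt {F : ℝ × ℝ → ℂ} {p : ℝ × ℝ} (hF : ContinuousAt F p) :
    HasLogExpansion F p 0 (F p) := by
  have : Tendsto F (𝓝[≠] p) (𝓝 (F p)) := tendsto_nhdsWithin_of_tendsto_nhds hF
  exact this.congr fun x => by simp

theorem tendsto_log_inv_eDist (p : ℝ × ℝ) :
    Tendsto (fun x => Real.log (1 / eDist x p)) (𝓝[≠] p) atTop := by
  have h1 : Tendsto (fun x => eDist x p) (𝓝[≠] p) (𝓝[>] 0) := by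
    refine tendsto_nhdsWithin_iff.2 ⟨?_, ?_⟩
    · have hc : Continuous fun x => eDist x p := by unfold eDist; fun_prop
      have := hc.tendsto p
      have h0 : eDist p p = 0 := by simp [eDist]
      rw [h0] at this
      exact tendsto_nhdsWithin_of_tendsto_nhds this
    · filter_upwards [self_mem_nhdsWithin] with x hx
      exact Real.sqrt_pos.2 (sqNorm_pos (sub_ne_zero.2 hx))
  have h2 : Tendsto (fun t : ℝ => Real.log (1 / t)) (𝓝[>] 0) atTop := by
    simp only [one_div]
    exact Real.tendsto_log_atTop.comp tendsto_inv_nhdsGT_zero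
  exact h2.comp h1

/-- The coefficients belong to the L² class: the representatives agree on a set of full measure,
which is dense, so limits along it determine them. A difference of logarithmic coefficients would
make the difference of the expansions unbounded. -/
theorem HasLogExpansion.unique {F F' : ℝ × ℝ → ℂ} {p : ℝ × ℝ} {a b a' b' : ℂ}
    (h1 : HasLogExpansion F p a b) (h2 : HasLogExpansion F' p a' b') (hF : F =ᵐ[volume] F') :
    a = a' ∧ b = b' := by
  set S : Set (ℝ × ℝ) := {x | F x = F' x ∧ x ≠ p} with hS
  have hd : Dense S := by
    refine Measure.dense_of_ae (μ := (volume : Measure (ℝ × ℝ))) ?_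
    filter_upwards [hF, Measure.ae_ne volume p] with x hx hp using ⟨hx, hp⟩
  have hne : (𝓝[S] p).NeBot := mem_closure_iff_nhdsWithin_neBot.1 (hd p)
  have hle : 𝓝[S] p ≤ 𝓝[≠] p := nhdsWithin_mono p fun x hx => hx.2
  have h3 : Tendsto (fun x => (a' - a) / (2 * Real.pi) * (Real.log (1 / eDist x p) : ℂ)) (𝓝[S] p)
      (𝓝 (b - b')) := by
    refine ((h1.mono_left hle).sub (h2.mono_left hle)).congr' ?_
    filter_upwards [self_mem_nhdsWithin] with x hx
    rw [hx.1]; ring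
  have ha : a' - a = 0 := by
    by_contra ha
    have h4 : Tendsto (fun x => ‖(a' - a) / (2 * Real.pi) * (Real.log (1 / eDist x p) : ℂ)‖)
        (𝓝[S] p) atTop := by
      simp only [norm_mul, Complex.norm_real]
      refine Tendsto.const_mul_atTop ?_
        (tendsto_norm_atTop_atTop.comp ((tendsto_log_inv_eDist p).mono_left hle))
      have : (Real.pi : ℂ) ≠ 0 := by exact_mod_cast Real.pi_ne_zero
      exact norm_pos_iff.2 (div_ne_zero ha (mul_ne_zero two_ne_zero this))
    exact not_tendsto_nhds_of_tendsto_atTop h4 _ h3.norm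
  refine ⟨(sub_eq_zero.1 ha).symm, ?_⟩
  rw [ha] at h3
  simp only [zero_div, zero_mul] at h3
  exact (sub_eq_zero.1 (tendsto_nhds_unique tendsto_const_nhds h3).symm)

/-! ### The singular functions near the lattice -/

section Deficiency

variable {h : ℝ} {z : ℂ}

/-- The closed unit square around the lattice point `n`. -/
def cell (n : ℤ × ℤ) : Set (ℝ × ℝ) := {x | |x.1 - n.1| ≤ 1 / 2 ∧ |x.2 - n.2| ≤ 1 / 2}

theorem exists_mem_cell (x : ℝ × ℝ) : ∃ n, x ∈ cell n :=
  ⟨(round x.1, round x.2), abs_sub_round x.1, abs_sub_round x.2⟩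

theorem cell_mem_nhds (n : ℤ × ℤ) : cell n ∈ 𝓝 (latticePt n) := by
  have h1 : Continuous fun x : ℝ × ℝ => |x.1 - n.1| := by fun_prop
  have h2 : Continuous fun x : ℝ × ℝ => |x.2 - n.2| := by fun_prop
  have e1 := h1.tendsto (latticePt n)
  have e2 := h2.tendsto (latticePt n)
  simp only [latticePt, sub_self, abs_zero] at e1 e2
  filter_upwards [e1.eventually (ge_mem_nhds (show (0 : ℝ) < 1 / 2 by norm_num)),
    e2.eventually (ge_mem_nhds (show (0 : ℝ) < 1 / 2 by norm_num))] with x a b using ⟨a, b⟩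

/-- The first bound keeps the Green function of m away from its singularity throughout the cell of
n; the second gives decay as m moves away from n. -/
theorem sqDist_of_mem_cell {x : ℝ × ℝ} {m n : ℤ × ℤ} (hx : x ∈ cell n) (hmn : m ≠ n) :
    1 / 4 ≤ sqDist x (latticePt m) ∧
      sqDist (latticePt m) (latticePt n) / 2 - 1 / 2 ≤ sqDist x (latticePt m) := by
  obtain ⟨h1, h2⟩ := hx
  have aux : ∀ (t : ℝ) (i j : ℤ), |t - j| ≤ 1 / 2 → i ≠ j → 1 / 4 ≤ (t - i) ^ 2 := by
    intro t i j ht hij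
    have h3 : (1 : ℝ) ≤ |(i : ℝ) - j| := by
      have : 1 ≤ |i - j| := Int.one_le_abs (sub_ne_zero.2 hij)
      exact_mod_cast this
    have h4 : |(i : ℝ) - j| ≤ |t - i| + |t - j| := by
      have := abs_sub_le (i : ℝ) t j
      rwa [abs_sub_comm (i : ℝ) t] at this
    have h5 : 1 / 2 ≤ |t - i| := by linarith
    rw [← sq_abs]; nlinarith
  constructor
  · simp only [sqDist, latticePt]
    by_cases hi : m.1 = n.1
    · have hj : m.2 ≠ n.2 := fun hj => hmn (Prod.ext hi hj)
      nlinarith [aux x.2 m.2 n.2 h2 hj, sq_nonneg (x.1 - m.1)]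
    · nlinarith [aux x.1 m.1 n.1 h1 hi, sq_nonneg (x.2 - m.2)]
  · have h3 : (x.1 - n.1) ^ 2 ≤ 1 / 4 := by rw [← sq_abs]; nlinarith [abs_nonneg (x.1 - n.1)]
    have h4 : (x.2 - n.2) ^ 2 ≤ 1 / 4 := by rw [← sq_abs]; nlinarith [abs_nonneg (x.2 - n.2)]
    simp only [sqDist, latticePt]
    nlinarith [sq_nonneg (2 * x.1 - m.1 - n.1), sq_nonneg (2 * x.2 - m.2 - n.2)]

theorem exists_regGreen_bound_cell (hh : 0 < h) (hz : NotLevel h z) :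
    ∃ D > 0, ∀ n, ∀ x ∈ cell n, ∀ m ≠ n, ‖regGreen h z 0 x (latticePt m)‖ ≤
      D * Real.exp (-(h / 16 * (((m - n).1 : ℝ) ^ 2 + ((m - n).2 : ℝ) ^ 2))) := by
  obtain ⟨C, hC, hb⟩ := (isRadialGreen hh hz).bound
  -- The power is evaluated at the smallest squared distance 1/4, and e^{h/16} compensates the -1/2
  -- in the lower bound of the squared distance at rate h/8.
  refine ⟨C * (1 / 4 : ℝ) ^ (-1 / 4 : ℝ) * Real.exp (h / 16), by positivity, fun n x hx m hmn => ?_⟩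
  obtain ⟨h1, h2⟩ := sqDist_of_mem_cell hx hmn
  rw [regGreen, norm_mul, norm_gaugePhase, one_mul, add_zero, ← sqDist_latticePt]
  refine (hb _ (by linarith)).1.trans ?_
  rw [mul_assoc, mul_assoc, ← Real.exp_add]
  gcongr C * (?_ * ?_)
  · exact Real.rpow_le_rpow_of_nonpos (by norm_num) h1 (by norm_num)
  · refine Real.exp_le_exp.2 ?_
    nlinarith

theorem summable_exp_neg_sq_sub {c : ℝ} (hc : 0 < c) (n : ℤ × ℤ) :
    Summable fun m : ℤ × ℤ => Real.exp (-(c * (((m - n).1 : ℝ) ^ 2 + ((m - n).2 : ℝ) ^ 2))) :=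
  (Equiv.subRight n).summable_iff.2 (summable_exp_neg_sq hc)

/-- In the cell of n every term but the n-th has a summable bound. The n-th may even be a junk value
at the lattice point; one term does not matter. -/
theorem summable_singular (hh : 0 < h) (hz : NotLevel h z) (ξ : Seq) (x : ℝ × ℝ) :
    Summable fun m => ξ m * regGreen h z 0 x (latticePt m) := by
  obtain ⟨D, hD, hb⟩ := exists_regGreen_bound_cell hh hz
  obtain ⟨n, hn⟩ := exists_mem_cell x
  refine Summable.of_norm_bounded_eventually
    ((summable_exp_neg_sq_sub (c := h / 16) (by positivity) n).mul_left (‖ξ‖ * D)) ?_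
  rw [Filter.eventually_cofinite]
  refine (Set.finite_singleton n).subset fun m hm => ?_
  by_contra h0
  apply hm
  rw [norm_mul, mul_assoc]
  exact mul_le_mul (lp.norm_apply_le_norm (by norm_num) ξ m) (hb n x hn m h0) (norm_nonneg _)
    (norm_nonneg _)

/-- The synthesis operator of the deficiency vectors. -/
def gammaOp (hh : 0 < h) (hz : NotLevel h z) : Seq →L[ℂ] L2Plane :=
  (almostOrthogonal_gammaVec hh hz).synthesis

/-- A sequence of partial sums converges in L^p, so a subsequence converges almost everywhere,
necessarily to the pointwise sum. It identifies the abstract sums of this file with explicit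
functions. -/
theorem ae_eq_of_hasSum_lp {X ι : Type*} [MeasurableSpace X] {μ : Measure X} {p : ENNReal}
    [Fact (1 ≤ p)] [Countable ι] {g : ι → Lp ℂ p μ} {s : Lp ℂ p μ}
    (hs : HasSum g s) {G : ι → X → ℂ} (hG : ∀ i, g i =ᵐ[μ] G i)
    (hsum : ∀ x, Summable fun i => G i x) : s =ᵐ[μ] fun x => ∑' i, G i x := by
  obtain ⟨F, hF⟩ := Filter.exists_seq_tendsto (atTop : Filter (Finset ι))
  have h1 : Tendsto (fun n => ∑ i ∈ F n, g i) atTop (𝓝 s) := hs.comp hF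
  have h2 := tendstoInMeasure_of_tendsto_Lp h1
  obtain ⟨ns, hns, h3⟩ := h2.exists_seq_tendsto_ae
  have hall : ∀ᵐ x ∂μ, ∀ i, g i x = G i x := ae_all_iff.2 hG
  have hsumae : ∀ᵐ x ∂μ, ∀ n, (∑ i ∈ F n, g i : Lp ℂ p μ) x = ∑ i ∈ F n, g i x := by
    refine ae_all_iff.2 fun n => ?_
    filter_upwards [Lp.coeFn_finsetSum (F n) g] with x hx
    rw [hx, Finset.sum_apply]
  filter_upwards [h3, hall, hsumae] with x h4 h5 h6
  refine tendsto_nhds_unique h4 ?_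
  have h7 := (hsum x).hasSum.comp (hF.comp hns.tendsto_atTop)
  refine h7.congr fun k => ?_
  simp only [Function.comp]
  rw [h6]
  exact Finset.sum_congr rfl fun i _ => (h5 i).symm

theorem gammaOp_coeFn (hh : 0 < h) (hz : NotLevel h z) (ξ : Seq) :
    gammaOp hh hz ξ =ᵐ[volume] fun x => ∑' m, ξ m * regGreen h z 0 x (latticePt m) := by
  refine ae_eq_of_hasSum_lp ((almostOrthogonal_gammaVec hh hz).hasSum_synthesis ξ) (fun m => ?_)
    (summable_singular hh hz ξ)
  filter_upwards [Lp.coeFn_smul (ξ m) (gammaVec hh hz m), gammaVec_coeFn hh hz m] with x h1 h2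
  rw [h1, Pi.smul_apply, h2, smul_eq_mul]

/-- The operator with matrix `Q(m, n; z, h)`. -/
theorem exists_qOp (hh : 0 < h) (hz : NotLevel h z) : ∃ B : Seq →L[ℂ] Seq, ∀ ξ n,
    HasSum (fun m => qMatrix h z n m * ξ m) (B ξ n) := by
  obtain ⟨B, hB⟩ := exists_matrixOp (summable_coeff hh hz)
    (p := fun n m => gaugePhase h (latticePt n) (latticePt m)) (fun n m => (norm_gaugePhase _ _ _).le)
  refine ⟨B, fun ξ n => ?_⟩
  rw [← (Equiv.addLeft n).hasSum_iff]
  refine (hB ξ n).congr_fun fun k => ?_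
  simp only [Function.comp, Equiv.coe_addLeft, qMatrix_eq, add_sub_cancel_left]
  ring

/-- The operator with matrix `Q(m, n; z, h)` on `ℓ²(ℤ²)`. -/
def qOp (hh : 0 < h) (hz : NotLevel h z) : Seq →L[ℂ] Seq := (exists_qOp hh hz).choose

theorem hasSum_qOp (hh : 0 < h) (hz : NotLevel h z) (ξ : Seq) (n : ℤ × ℤ) :
    HasSum (fun m => qMatrix h z n m * ξ m) (qOp hh hz ξ n) := (exists_qOp hh hz).choose_spec ξ n

theorem regGreen_eq_qMatrix {m n : ℤ × ℤ} (hmn : m ≠ n) :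
    regGreen h z 0 (latticePt n) (latticePt m) = qMatrix h z n m := by
  rw [qMatrix, if_neg hmn.symm, green_eq]

/-- Near n only the n-th term is singular, and it contributes ξ_n and ξ_n q. The others sum to a
continuous function by uniform convergence on the cell, and their value at n is the off-diagonal
part of Qξ. -/
theorem hasLogExpansion_singular (hh : 0 < h) (hz : NotLevel h z) (ξ : Seq) (n : ℤ × ℤ) :
    HasLogExpansion (fun x => ∑' m, ξ m * regGreen h z 0 x (latticePt m)) (latticePt n) (ξ n)
      (qOp hh hz ξ n) := by
  obtain ⟨D, hD, hb⟩ := exists_regGreen_bound_cell hh hz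
  have e1 : (fun x => ∑' m, ξ m * regGreen h z 0 x (latticePt m)) = fun x =>
      ξ n * regGreen h z 0 x (latticePt n) +
        ∑' m, if m = n then 0 else ξ m * regGreen h z 0 x (latticePt m) := by
    funext x
    exact (summable_singular hh hz ξ x).tsum_eq_add_tsum_ite n
  have e2 : qOp hh hz ξ n = ξ n * qFun h z +
      ∑' m, if m = n then 0 else ξ m * regGreen h z 0 (latticePt n) (latticePt m) := by
    rw [← (hasSum_qOp hh hz ξ n).tsum_eq, (hasSum_qOp hh hz ξ n).summable.tsum_eq_add_tsum_ite n]
    congr 1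
    · rw [qMatrix, if_pos rfl, mul_comm]
    · refine tsum_congr fun m => ?_
      split_ifs with hm
      · rfl
      · rw [regGreen_eq_qMatrix hm, mul_comm]
  have h1 : HasLogExpansion (fun x => ξ n * regGreen h z 0 x (latticePt n)) (latticePt n) (ξ n)
      (ξ n * qFun h z) := by
    refine (Tendsto.const_mul (ξ n) (hasLogExpansion_green hh hz (latticePt n))).congr fun x => ?_
    rw [green_eq]; ring
  have h2 : ContinuousAt (fun x => ∑' m, if m = n then 0 else
      ξ m * regGreen h z 0 x (latticePt m)) (latticePt n) := by
    refine ContinuousOn.continuousAt (s := cell n) ?_ (cell_mem_nhds n)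
    refine continuousOn_tsum (u := fun m => ‖ξ‖ * (D *
      Real.exp (-(h / 16 * (((m - n).1 : ℝ) ^ 2 + ((m - n).2 : ℝ) ^ 2))))) (fun m => ?_) ?_ ?_
    · by_cases hm : m = n
      · simp only [if_pos hm]
        exact continuousOn_const
      · simp only [if_neg hm]
        refine continuousOn_const.mul ?_
        have c1 : Continuous fun x => gaugePhase h x (latticePt m) := by
          unfold gaugePhase; fun_prop
        have c2 : Continuous fun x => sqDist x (latticePt m) + 0 := by
          unfold sqDist; fun_prop
        refine c1.continuousOn.mul ((isRadialGreen hh hz).continuousOn.comp c2.continuousOn ?_)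
        intro x hx
        have := (sqDist_of_mem_cell hx hm).1
        simp only [Set.mem_Ioi]
        linarith
    · exact ((summable_exp_neg_sq_sub (by positivity) n).mul_left D).mul_left ‖ξ‖
    · intro m x hx
      by_cases hm : m = n
      · simp only [if_pos hm, norm_zero]
        positivity
      · simp only [if_neg hm, norm_mul]
        exact mul_le_mul (lp.norm_apply_le_norm (by norm_num) ξ m) (hb n x hx m hm) (norm_nonneg _)
          (norm_nonneg _)
  rw [e1, e2]
  have := h1.add (hasLogExpansion_of_continuousAt h2)
  rwa [add_zero] at this

/-- The boundary values of the functions in the range of the resolvent of `H_h` plus singular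
functions. -/
theorem hasLogExpansion_decomposition (hh : 0 < h) (hz : NotLevel h z) (v : L2Plane) (ξ : Seq) :
    ∃ F : ℝ × ℝ → ℂ, (greenOp hh hz v + gammaOp hh hz ξ : L2Plane) =ᵐ[volume] F ∧
      ∀ n, HasLogExpansion F (latticePt n) (ξ n)
        ((∫ y, regGreen h z 0 (latticePt n) y * v y) + qOp hh hz ξ n) := by
  refine ⟨fun x => (∫ y, regGreen h z 0 x y * v y) +
    ∑' m, ξ m * regGreen h z 0 x (latticePt m), ?_, fun n => ?_⟩
  · filter_upwards [Lp.coeFn_add (greenOp hh hz v) (gammaOp hh hz ξ), greenOp_coeFn hh hz v,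
      gammaOp_coeFn hh hz ξ] with x h1 h2 h3
    rw [h1, Pi.add_apply, h2, h3]
  · have := (hasLogExpansion_of_continuousAt (p := latticePt n)
      (continuous_integral_green hh hz v).continuousAt).add (hasLogExpansion_singular hh hz ξ n)
    rwa [zero_add] at this

end Deficiency

/-! ### The adjoint of the restricted operator -/

section Krein

variable {h : ℝ} {z : ℂ}

/-- The analysis operator of the deficiency vectors. -/
def traceOp (hh : 0 < h) (hz : NotLevel h z) : L2Plane →L[ℂ] Seq :=
  (almostOrthogonal_gammaVec hh hz).analysis

theorem traceOp_apply (hh : 0 < h) (hz : NotLevel h z) (v : L2Plane) (m : ℤ × ℤ) :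
    traceOp hh hz v m = ∫ y, regGreen h (starRingEnd ℂ z) 0 (latticePt m) y * v y := by
  rw [← inner_gammaVec hh hz]
  exact (almostOrthogonal_gammaVec hh hz).analysis_apply v m

theorem inner_gammaOp_left (hh : 0 < h) (hz : NotLevel h z) (ξ : Seq) (v : L2Plane) :
    ⟪gammaOp hh hz ξ, v⟫_ℂ = ⟪ξ, traceOp hh hz v⟫_ℂ :=
  (almostOrthogonal_gammaVec hh hz).inner_synthesis_left ξ v

/-- Bounded operators `P`, `P*` with `traceOp ∘ P = 1`, `P* ∘ gammaOp = 1`. -/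
theorem exists_dualOps (hh : 0 < h) (hz : NotLevel h z) :
    ∃ (P : Seq →L[ℂ] L2Plane) (P' : L2Plane →L[ℂ] Seq),
      (∀ ξ v, ⟪P ξ, v⟫_ℂ = ⟪ξ, P' v⟫_ℂ) ∧ (∀ ξ, traceOp hh hz (P ξ) = ξ) ∧
      ∀ ξ, P' (gammaOp hh hz ξ) = ξ := by
  obtain ⟨ψ, hψ, hdual⟩ := exists_dualFamily hh hz
  have h1 : ∀ ξ, traceOp hh hz (hψ.synthesis ξ) = ξ := by
    have : (traceOp hh hz).comp hψ.synthesis = ContinuousLinearMap.id ℂ Seq := by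
      refine lp.ext_continuousLinearMap (by norm_num) fun m => ?_
      ext
      simp only [ContinuousLinearMap.comp_apply, lp.singleContinuousLinearMap_apply,
        hψ.synthesis_single, ContinuousLinearMap.id_apply, one_smul]
      rw [traceOp, AlmostOrthogonal.analysis_apply, hdual, lp.single_apply, Pi.single_apply]
      simp only [eq_comm]
    intro ξ
    exact DFunLike.congr_fun this ξ
  refine ⟨hψ.synthesis, hψ.analysis, hψ.inner_synthesis_left, h1, fun ξ => ?_⟩
  refine ext_inner_left ℂ fun η => ?_
  rw [← hψ.inner_synthesis_left, ← inner_conj_symm, inner_gammaOp_left, h1, inner_conj_symm]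

/-- The orthogonal complement of the kernel of Γ* is the range of Γ, without closure: v - PΓ*v is a
bounded projection onto the kernel because P is a right inverse of Γ*. -/
theorem exists_gammaOp_eq (hh : 0 < h) (hz : NotLevel h z) {w : L2Plane}
    (hw : ∀ v, traceOp hh hz v = 0 → ⟪w, v⟫_ℂ = 0) : ∃ ξ, w = gammaOp hh hz ξ := by
  obtain ⟨P, P', hPP', h1, -⟩ := exists_dualOps hh hz
  refine ⟨P' w, ext_inner_right ℂ fun v => ?_⟩
  have h2 := hw (v - P (traceOp hh hz v)) (by rw [map_sub, h1, sub_self])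
  rw [inner_sub_right, sub_eq_zero] at h2
  rw [h2, inner_gammaOp_left, ← inner_conj_symm, hPP', inner_conj_symm]

/-- The trace consists of the values of R(z̄)v at the lattice points, and the continuous
representative is unique. Hence the domain of S is the image under R(z̄) of the kernel of the trace.
-/
theorem mem_vanishing_iff (hh : 0 < h) (hz : NotLevel h z) (v : L2Plane) :
    greenOp hh hz.conj v ∈ vanishingOnLattice ↔ traceOp hh hz v = 0 := by
  have hc := continuous_integral_green hh hz.conj v
  constructor
  · rintro ⟨F, hF, hae, h0⟩
    have e : F = fun x => ∫ y, regGreen h (starRingEnd ℂ z) 0 x y * v y :=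
      (hF.ae_eq_iff_eq volume hc).1 (hae.symm.trans (greenOp_coeFn hh hz.conj v))
    ext m
    rw [traceOp_apply]
    have := h0 m
    rw [e] at this
    exact this
  · intro h0
    refine ⟨_, hc, greenOp_coeFn hh hz.conj v, fun m => ?_⟩
    rw [← traceOp_apply hh hz, h0]
    rfl

theorem mem_restricted_domain {u : L2Plane} : u ∈ (restrictedLandau h).domain ↔
    u ∈ vanishingOnLattice ∧ u ∈ (landau h).domain := Iff.rfl

theorem greenOp_injective (hh : 0 < h) (hz : NotLevel h z) {v : L2Plane}
    (hv : greenOp hh hz v = 0) : v = 0 := by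
  have h1 := landauRel_greenOp hh hz v
  rw [hv, smul_zero, add_zero] at h1
  obtain ⟨hu, he⟩ := h1
  rw [← he]
  exact (landau h).map_zero

/-- If w is orthogonal to the domain, then R(z)w is orthogonal to the kernel of the trace, so R(z)w
= Γ(z)ξ. The left side has no logarithmic singularities, hence ξ = 0, and R(z) is injective. -/
theorem dense_restricted_domain (hh : 0 < h) (hz : NotLevel h z) :
    Dense ((restrictedLandau h).domain : Set L2Plane) := by
  rw [Submodule.dense_iff_topologicalClosure_eq_top, Submodule.topologicalClosure_eq_top_iff,
    Submodule.eq_bot_iff]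
  intro w hw
  obtain ⟨ξ, hξ⟩ := exists_gammaOp_eq hh hz (w := greenOp hh hz w) fun v hv => by
    have h1 : greenOp hh hz.conj v ∈ (restrictedLandau h).domain :=
      mem_restricted_domain.2 ⟨(mem_vanishing_iff hh hz v).2 hv, (landauRel_greenOp hh hz.conj v).1⟩
    have h2 := (Submodule.mem_orthogonal' _ w).1 hw _ h1
    rw [inner_greenOp] at h2
    simpa only [Complex.conj_conj] using h2
  have hξ0 : ξ = 0 := by
    ext n
    obtain ⟨F, hF, hE⟩ := hasLogExpansion_decomposition hh hz w 0
    obtain ⟨F', hF', hE'⟩ := hasLogExpansion_decomposition hh hz 0 ξ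
    rw [map_zero, add_zero] at hF
    rw [map_zero, zero_add, ← hξ] at hF'
    exact (HasLogExpansion.unique (hE n) (hE' n) (hF.symm.trans hF')).1.symm
  rw [hξ0, map_zero] at hξ
  exact greenOp_injective hh hz hξ

/-- `u` is in the domain of the adjoint of the restricted operator and is mapped to `f`. -/
def StarRel (h : ℝ) (u f : L2Plane) : Prop :=
  ∃ hu : u ∈ (restrictedLandau h).adjoint.domain, (restrictedLandau h).adjoint ⟨u, hu⟩ = f

/-- Since the domain of S is R(z̄) applied to the kernel of the trace, the adjoint relation says
that u - R(z)(f - zu) is orthogonal to that kernel, hence lies in the range of Γ(z). -/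
theorem starRel_iff (hh : 0 < h) (hz : NotLevel h z) {u f : L2Plane} : StarRel h u f ↔
    ∃ ξ, u = greenOp hh hz (f - z • u) + gammaOp hh hz ξ := by
  have hd := dense_restricted_domain hh hz
  have key : StarRel h u f ↔ ∀ v, traceOp hh hz v = 0 →
      ⟪u - greenOp hh hz (f - z • u), v⟫_ℂ = 0 := by
    have hform : ∀ v, ⟪u - greenOp hh hz (f - z • u), v⟫_ℂ = ⟪u, v + starRingEnd ℂ z •
        greenOp hh hz.conj v⟫_ℂ - ⟪f, greenOp hh hz.conj v⟫_ℂ := by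
      intro v
      have h1 := inner_greenOp hh hz.conj (f - z • u) v
      simp only [Complex.conj_conj] at h1
      rw [inner_sub_left, ← h1, inner_sub_left, inner_add_right, inner_smul_left, inner_smul_right]
      ring
    constructor
    · rintro ⟨hu, rfl⟩ v hv
      obtain ⟨hg, hge⟩ := landauRel_greenOp hh hz.conj v
      have hm : greenOp hh hz.conj v ∈ (restrictedLandau h).domain :=
        mem_restricted_domain.2 ⟨(mem_vanishing_iff hh hz v).2 hv, hg⟩
      have h2 := (restrictedLandau h).adjoint_isFormalAdjoint hd ⟨u, hu⟩ ⟨_, hm⟩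
      have h3 : restrictedLandau h ⟨_, hm⟩ = v + starRingEnd ℂ z • greenOp hh hz.conj v := hge
      rw [h3] at h2
      rw [hform, sub_eq_zero]
      exact h2.symm
    · intro H
      have H' : ∀ x : (restrictedLandau h).domain,
          ⟪f, (x : L2Plane)⟫_ℂ = ⟪u, restrictedLandau h x⟫_ℂ := by
        rintro ⟨g, hg⟩
        obtain ⟨hg1, hg2⟩ := mem_restricted_domain.1 hg
        set f' := landau h ⟨g, hg2⟩ with hf'
        have hL : LandauRel h g f' := ⟨hg2, rfl⟩
        have hgK := hL.eq_greenOp hh hz.conj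
        have h3 : restrictedLandau h ⟨g, hg⟩ = f' := rfl
        have h4 := H (f' - starRingEnd ℂ z • g) (by
          rw [← mem_vanishing_iff hh hz, ← hgK]; exact hg1)
        rw [hform, ← hgK, sub_eq_zero, sub_add_cancel] at h4
        rw [h3]
        exact h4.symm
      have hu : u ∈ (restrictedLandau h).adjoint.domain :=
        LinearPMap.mem_adjoint_domain_of_exists u ⟨f, H'⟩
      exact ⟨hu, LinearPMap.adjoint_apply_eq hd ⟨u, hu⟩ H'⟩
  rw [key]
  constructor
  · intro H
    obtain ⟨ξ, hξ⟩ := exists_gammaOp_eq hh hz H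
    exact ⟨ξ, by rw [← hξ]; abel⟩
  · rintro ⟨ξ, hξ⟩ v hv
    have : u - greenOp hh hz (f - z • u) = gammaOp hh hz ξ := by
      nth_rewrite 1 [hξ]; abel
    rw [this, inner_gammaOp_left, hv, inner_zero_right]

/-! ### The point perturbation -/

/-- `u` is in the domain of the point perturbation and is mapped to `f`. -/
def PointRel (h α : ℝ) (u f : L2Plane) : Prop :=
  ∃ hu : u ∈ (pointLandau h α).domain, pointLandau h α ⟨u, hu⟩ = f

/-- The operator `Q(z) + α⁻¹` on `ℓ²(ℤ²)`. -/
def mOp (α : ℝ) (hh : 0 < h) (hz : NotLevel h z) : Seq →L[ℂ] Seq :=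
  qOp hh hz + (α : ℂ)⁻¹ • ContinuousLinearMap.id ℂ Seq

theorem traceOp_conj_apply (hh : 0 < h) (hz : NotLevel h z) (v : L2Plane) (m : ℤ × ℤ) :
    traceOp hh hz.conj v m = ∫ y, regGreen h z 0 (latticePt m) y * v y := by
  rw [traceOp_apply, Complex.conj_conj]

/-- For u = R(z)v + Γ(z)ξ the logarithmic coefficient at n is ξ_n and the constant term is
(R(z)v)(n) + (Qξ)_n. Division of the boundary condition by α gives an equation for ξ alone. -/
theorem pointRel_iff {α : ℝ} (hα : α ≠ 0) (hh : 0 < h) (hz : NotLevel h z) {u f : L2Plane} :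
    PointRel h α u f ↔ ∃ ξ, u = greenOp hh hz (f - z • u) + gammaOp hh hz ξ ∧
      mOp α hh hz ξ = -traceOp hh hz.conj (f - z • u) := by
  have hα' : (α : ℂ) ≠ 0 := by exact_mod_cast hα
  have hcond : ∀ ξ, mOp α hh hz ξ = -traceOp hh hz.conj (f - z • u) ↔ ∀ n, ξ n + α *
      ((∫ y, regGreen h z 0 (latticePt n) y * (f - z • u : L2Plane) y) + qOp hh hz ξ n) = 0 := by
    intro ξ
    have e : ∀ n, mOp α hh hz ξ n = qOp hh hz ξ n + (α : ℂ)⁻¹ * ξ n := fun n => rfl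
    have e2 : ∀ n, (-traceOp hh hz.conj (f - z • u) : Seq) n =
      -(∫ y, regGreen h z 0 (latticePt n) y * (f - z • u : L2Plane) y) := fun n => by
        rw [← traceOp_conj_apply hh hz]; rfl
    constructor
    · intro H n
      have := congrArg (fun η : Seq => η n) H
      simp only [e, e2] at this
      field_simp at this
      linear_combination this
    · intro H
      ext n
      rw [e, e2]
      field_simp
      linear_combination H n
  have hdom : PointRel h α u f ↔ StarRel h u f ∧ u ∈ pointBoundaryCondition α :=
    ⟨fun ⟨hu, he⟩ => ⟨⟨hu.2, he⟩, hu.1⟩, fun ⟨⟨hu, he⟩, hb⟩ => ⟨⟨hb, hu⟩, he⟩⟩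
  rw [hdom, starRel_iff hh hz]
  constructor
  · rintro ⟨⟨ξ, hξ⟩, F, hF, hE⟩
    refine ⟨ξ, hξ, (hcond ξ).2 fun n => ?_⟩
    obtain ⟨F', hF', hE'⟩ := hasLogExpansion_decomposition hh hz (f - z • u) ξ
    rw [← hξ] at hF'
    obtain ⟨a, b, hab, h0⟩ := hE n
    obtain ⟨rfl, rfl⟩ := HasLogExpansion.unique hab (hE' n) (hF.symm.trans hF')
    exact h0
  · rintro ⟨ξ, hξ, hM⟩
    refine ⟨⟨ξ, hξ⟩, ?_⟩
    obtain ⟨F', hF', hE'⟩ := hasLogExpansion_decomposition hh hz (f - z • u) ξ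
    rw [← hξ] at hF'
    exact ⟨F', hF', fun n => ⟨_, _, hE' n, (hcond ξ).1 hM n⟩⟩

/-- Krein's criterion. -/
theorem notMem_unboundedSpectrum_pointLandau {α : ℝ} (hα : α ≠ 0) (hh : 0 < h)
    (hz : NotLevel h z) :
    z ∉ unboundedSpectrum (pointLandau h α) ↔ IsUnit (mOp α hh hz) := by
  obtain ⟨P, -, -, hP, -⟩ := exists_dualOps hh hz.conj
  obtain ⟨-, P', -, -, hP'⟩ := exists_dualOps hh hz
  constructor
  · intro hz'
    obtain ⟨R, hR1, hR2⟩ := not_not.1 hz'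
    rw [ContinuousLinearMap.isUnit_iff_bijective]
    constructor
    -- A null vector ξ yields the solution Γ(z)ξ of the eigenvalue equation at z; it is zero when z
    -- is in the resolvent set, and Γ(z) has a left inverse.
    · rw [injective_iff_map_eq_zero]
      intro ξ hξ
      have hrel : PointRel h α (gammaOp hh hz ξ) (z • gammaOp hh hz ξ) := by
        rw [pointRel_iff hα hh hz]
        exact ⟨ξ, by rw [sub_self, map_zero, zero_add], by rw [sub_self, map_zero, hξ, neg_zero]⟩
      obtain ⟨hu, he⟩ := hrel
      have := hR2 ⟨_, hu⟩
      rw [he] at this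
      simp only [sub_self, map_zero] at this
      rw [← hP' ξ, ← this, map_zero]
    -- Apply the resolvent to a function whose trace is -η; the coefficients of the solution are
    -- mapped to η.
    · intro η
      obtain ⟨hu, he⟩ := hR1 (P (-η))
      have hrel : PointRel h α (R (P (-η))) (P (-η) + z • R (P (-η))) :=
        ⟨hu, sub_eq_iff_eq_add.1 he⟩
      rw [pointRel_iff hα hh hz] at hrel
      obtain ⟨ξ, -, hM⟩ := hrel
      exact ⟨ξ, by rw [hM, add_sub_cancel_right, hP, neg_neg]⟩
  · rintro ⟨U, hU⟩ hz'
    apply hz'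
    set B : Seq →L[ℂ] Seq := ↑U⁻¹
    have hB1 : ∀ ξ, mOp α hh hz (B ξ) = ξ := fun ξ => by
      have : ((U : Seq →L[ℂ] Seq) * B) ξ = ξ := by rw [Units.mul_inv]; rfl
      rw [← hU]; exact this
    have hB2 : ∀ ξ, B (mOp α hh hz ξ) = ξ := fun ξ => by
      have : (B * (U : Seq →L[ℂ] Seq)) ξ = ξ := by rw [Units.inv_mul]; rfl
      rw [← hU]; exact this
    -- Krein's formula R(z) - Γ(z)(Q(z) + 1/α)^{-1}Γ(z̄)*.
    refine ⟨greenOp hh hz - (gammaOp hh hz).comp (B.comp (traceOp hh hz.conj)), ?_, ?_⟩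
    · intro v
      set u := (greenOp hh hz - (gammaOp hh hz).comp (B.comp (traceOp hh hz.conj))) v with hu
      have hrel : PointRel h α u (v + z • u) := by
        rw [pointRel_iff hα hh hz, add_sub_cancel_right]
        refine ⟨-B (traceOp hh hz.conj v), ?_, ?_⟩
        · rw [map_neg, ← sub_eq_add_neg]; rfl
        · rw [map_neg, hB1]
      obtain ⟨hd, he⟩ := hrel
      exact ⟨hd, by rw [he]; abel⟩
    · intro u
      have hrel : PointRel h α u (pointLandau h α u) := ⟨u.2, rfl⟩
      rw [pointRel_iff hα hh hz] at hrel
      obtain ⟨ξ, h1, h2⟩ := hrel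
      have h3 : B (traceOp hh hz.conj (pointLandau h α u - z • (u : L2Plane))) = -ξ := by
        rw [← hB2 ξ, h2, map_neg, neg_neg]
      have h4 : (greenOp hh hz - (gammaOp hh hz).comp (B.comp (traceOp hh hz.conj)))
          (pointLandau h α u - z • (u : L2Plane)) =
          greenOp hh hz (pointLandau h α u - z • (u : L2Plane)) -
          gammaOp hh hz (B (traceOp hh hz.conj (pointLandau h α u - z • (u : L2Plane)))) := rfl
      rw [h4, h3, map_neg, sub_neg_eq_add, ← h1]

end Krein

/-! ### Reality of the spectrum of the point perturbation -/

section Reality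

variable {h : ℝ} {z : ℂ}

theorem notLevel_of_im_ne_zero (hh : 0 < h) (hz : z.im ≠ 0) : NotLevel h z := by
  intro m hm
  have hh' : (h : ℂ) ≠ 0 := by exact_mod_cast hh.ne'
  have e : z = ((h + 2 * h * m : ℝ) : ℂ) := by
    push_cast
    field_simp at hm
    linear_combination -hm
  exact hz (by rw [e, Complex.ofReal_im])

theorem qFun_conj (h : ℝ) (z : ℂ) : qFun h (starRingEnd ℂ z) = starRingEnd ℂ (qFun h z) := by
  have e : (1 / 2 - starRingEnd ℂ z / (2 * h) : ℂ) = starRingEnd ℂ (1 / 2 - z / (2 * h)) := by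
    simp [map_ofNat]
  have e1 : starRingEnd ℂ (Complex.digamma 1) = Complex.digamma 1 := by
    rw [← digamma_conj, map_one]
  rw [qFun, qFun, e, digamma_conj]
  simp only [map_mul, map_neg, map_sub, map_add, e1, Complex.conj_ofReal, map_div₀, map_one,
    map_ofNat]

theorem coeff_conj (h : ℝ) (z : ℂ) (k : ℤ × ℤ) :
    coeff h (starRingEnd ℂ z) k = starRingEnd ℂ (coeff h z k) := by
  rw [coeff, coeff, qFun_conj, radial_conj]
  split_ifs <;> rfl

theorem coeff_neg (h : ℝ) (z : ℂ) (k : ℤ × ℤ) : coeff h z (-k) = coeff h z k := by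
  rw [coeff, coeff]
  simp

theorem qMatrix_conj (h : ℝ) (z : ℂ) (m n : ℤ × ℤ) :
    qMatrix h (starRingEnd ℂ z) n m = starRingEnd ℂ (qMatrix h z m n) := by
  rw [qMatrix_eq, qMatrix_eq, map_mul, coeff_conj, gaugePhase_conj, ← coeff_neg, neg_sub]

theorem qOp_single (hh : 0 < h) (hz : NotLevel h z) (m n : ℤ × ℤ) :
    qOp hh hz (lp.single 2 m (1 : ℂ)) n = qMatrix h z n m := by
  refine (hasSum_qOp hh hz _ n).unique ?_
  convert hasSum_single m (f := fun k => qMatrix h z n k * (lp.single 2 m (1 : ℂ) : Seq) k) ?_ using 1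
  · simp
  · intro k hk
    simp [lp.single_apply, hk]

/-- Bounded operators on ℓ² are determined by their entries on the unit vectors, and those satisfy
`qMatrix_conj`. -/
theorem inner_qOp_left (hh : 0 < h) (hz : NotLevel h z) (ξ η : Seq) :
    ⟪qOp hh hz.conj ξ, η⟫_ℂ = ⟪ξ, qOp hh hz η⟫_ℂ := by
  have e : qOp hh hz.conj = (qOp hh hz).adjoint := by
    refine lp.ext_continuousLinearMap (by norm_num) fun m => ?_
    ext n
    simp only [ContinuousLinearMap.comp_apply, lp.singleContinuousLinearMap_apply]
    rw [qOp_single]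
    have h1 : ⟪(lp.single 2 n (1 : ℂ) : Seq), (qOp hh hz).adjoint (lp.single 2 m (1 : ℂ))⟫_ℂ =
        ⟪qOp hh hz (lp.single 2 n (1 : ℂ)), (lp.single 2 m (1 : ℂ) : Seq)⟫_ℂ :=
      ContinuousLinearMap.adjoint_inner_right _ _ _
    rw [lp.inner_single_left, lp.inner_single_right, qOp_single] at h1
    simp only [RCLike.inner_apply, map_one, mul_one, one_mul] at h1
    rw [h1, qMatrix_conj]
  rw [e, ContinuousLinearMap.adjoint_inner_left]

theorem inner_mOp_left (α : ℝ) (hh : 0 < h) (hz : NotLevel h z) (ξ η : Seq) :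
    ⟪mOp α hh hz.conj ξ, η⟫_ℂ = ⟪ξ, mOp α hh hz η⟫_ℂ := by
  simp only [mOp, add_apply, smul_apply, ContinuousLinearMap.id_apply, inner_add_left,
    inner_add_right, inner_smul_left, inner_smul_right, map_inv₀, Complex.conj_ofReal]
  rw [inner_qOp_left]

/-- The function Γ(z̄)ξ is an eigenvector of S* at z̄. Decompose it also at the point z and compare
the expansions at the lattice: the logarithmic coefficients show that ξ is the same, and the
constant terms give the identity. -/
theorem qOp_sub_qOp_conj (hh : 0 < h) (hz : NotLevel h z) (ξ : Seq) :
    qOp hh hz ξ - qOp hh hz.conj ξ =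
      (z - starRingEnd ℂ z) • traceOp hh hz.conj (gammaOp hh hz.conj ξ) := by
  set u := gammaOp hh hz.conj ξ with hu
  have hrel : StarRel h u (starRingEnd ℂ z • u) := by
    rw [starRel_iff hh hz.conj]
    exact ⟨ξ, by rw [sub_self, map_zero, zero_add]⟩
  rw [starRel_iff hh hz] at hrel
  obtain ⟨η, hη⟩ := hrel
  obtain ⟨F, hF, hE⟩ := hasLogExpansion_decomposition hh hz (starRingEnd ℂ z • u - z • u) η
  obtain ⟨F', hF', hE'⟩ := hasLogExpansion_decomposition hh hz.conj 0 ξ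
  rw [← hη] at hF
  rw [map_zero, zero_add, ← hu] at hF'
  have hboth := fun n => HasLogExpansion.unique (hE n) (hE' n) (hF.symm.trans hF')
  have hηξ : η = ξ := by ext n; exact (hboth n).1
  subst hηξ
  ext n
  have h2 := (hboth n).2
  rw [← traceOp_conj_apply hh hz] at h2
  have h3 : traceOp hh hz.conj.conj (0 : L2Plane) n = 0 := by rw [map_zero]; rfl
  rw [traceOp_conj_apply hh hz.conj] at h3
  rw [h3, zero_add, ← sub_smul, map_smul] at h2
  have e1 : ((starRingEnd ℂ z - z) • traceOp hh hz.conj u : Seq) n =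
    (starRingEnd ℂ z - z) * traceOp hh hz.conj u n := rfl
  have e2 : ((z - starRingEnd ℂ z) • traceOp hh hz.conj u : Seq) n =
    (z - starRingEnd ℂ z) * traceOp hh hz.conj u n := rfl
  have e3 : (qOp hh hz η - qOp hh hz.conj η : Seq) n = qOp hh hz η n - qOp hh hz.conj η n := rfl
  rw [e1] at h2
  rw [e2, e3, ← h2]
  ring

/-- The real constant 1/α drops out of the imaginary part of ⟪ξ, (Q + 1/α)ξ⟫, which is Im z
‖Γ(z̄)ξ‖². Since Γ(z̄) has a bounded left inverse, this dominates a multiple of ‖ξ‖². -/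
theorem exists_mOp_bound (α : ℝ) (hh : 0 < h) (hz : NotLevel h z) (him : z.im ≠ 0) :
    ∃ c > 0, ∀ ξ, c * ‖ξ‖ ≤ ‖mOp α hh hz ξ‖ := by
  obtain ⟨-, P', -, -, hP'⟩ := exists_dualOps hh hz.conj
  refine ⟨|z.im| / (‖P'‖ ^ 2 + 1), by positivity, fun ξ => ?_⟩
  set u := gammaOp hh hz.conj ξ
  have h1 : ‖ξ‖ ≤ ‖P'‖ * ‖u‖ := by
    conv_lhs => rw [← hP' ξ]
    exact P'.le_opNorm _
  have h2 : ⟪ξ, mOp α hh hz ξ⟫_ℂ - ⟪mOp α hh hz ξ, ξ⟫_ℂ =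
      (z - starRingEnd ℂ z) * ((‖u‖ : ℂ) ^ 2) := by
    have e1 : ⟪mOp α hh hz ξ, ξ⟫_ℂ = ⟪ξ, mOp α hh hz.conj ξ⟫_ℂ := by
      rw [← inner_conj_symm, ← inner_mOp_left, inner_conj_symm]
    have e2 : mOp α hh hz ξ - mOp α hh hz.conj ξ = qOp hh hz ξ - qOp hh hz.conj ξ := by
      simp only [mOp, add_apply, add_sub_add_right_eq_sub, smul_apply]
    rw [e1, ← inner_sub_right, e2, qOp_sub_qOp_conj, inner_smul_right, ← inner_gammaOp_left,
      inner_self_eq_norm_sq_to_K]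
    rfl
  have h3 : 2 * |z.im| * ‖u‖ ^ 2 ≤ 2 * (‖ξ‖ * ‖mOp α hh hz ξ‖) := by
    have e1 : ‖(z - starRingEnd ℂ z) * ((‖u‖ : ℂ) ^ 2)‖ = 2 * |z.im| * ‖u‖ ^ 2 := by
      rw [Complex.sub_conj, norm_mul, norm_mul, Complex.norm_I, mul_one, Complex.norm_real,
        Real.norm_eq_abs, abs_mul, abs_two, norm_pow, Complex.norm_real, norm_norm]
    rw [← e1, ← h2]
    refine (norm_sub_le _ _).trans ?_
    have a := norm_inner_le_norm (𝕜 := ℂ) ξ (mOp α hh hz ξ)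
    have b := norm_inner_le_norm (𝕜 := ℂ) (mOp α hh hz ξ) ξ
    linarith
  rcases eq_or_lt_of_le (norm_nonneg ξ) with h0 | h0
  · rw [← h0, mul_zero]; positivity
  rw [div_mul_eq_mul_div, div_le_iff₀ (by positivity)]
  have h4 : ‖ξ‖ ^ 2 ≤ (‖P'‖ ^ 2 + 1) * ‖u‖ ^ 2 := by
    have : ‖ξ‖ ^ 2 ≤ (‖P'‖ * ‖u‖) ^ 2 := by gcongr
    nlinarith [sq_nonneg ‖u‖]
  have h5 : |z.im| * ‖ξ‖ ^ 2 ≤ (‖P'‖ ^ 2 + 1) * (‖ξ‖ * ‖mOp α hh hz ξ‖) := by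
    calc |z.im| * ‖ξ‖ ^ 2 ≤ |z.im| * ((‖P'‖ ^ 2 + 1) * ‖u‖ ^ 2) := by gcongr
      _ = (‖P'‖ ^ 2 + 1) * (|z.im| * ‖u‖ ^ 2) := by ring
      _ ≤ _ := mul_le_mul_of_nonneg_left (by linarith) (by positivity)
  refine le_of_mul_le_mul_left ?_ h0
  calc ‖ξ‖ * (|z.im| * ‖ξ‖) = |z.im| * ‖ξ‖ ^ 2 := by ring
    _ ≤ _ := h5
    _ = _ := by ring

theorem im_eq_zero_of_mem_spectrum {α : ℝ} (hα : α ≠ 0) (hh : 0 < h)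
    (hz : z ∈ unboundedSpectrum (pointLandau h α)) : z.im = 0 := by
  by_contra him
  have hl := notLevel_of_im_ne_zero hh him
  refine (notMem_unboundedSpectrum_pointLandau hα hh hl).2 ?_ hz
  rw [isUnit_iff_bounds (inner_mOp_left α hh hl)]
  exact ⟨exists_mOp_bound α hh hl him, exists_mOp_bound α hh hl.conj (by simpa using him)⟩

end Reality

/-! ### Two representations of the noncommutative torus -/

section Torus

variable {H : Type*} [NormedAddCommGroup H] [InnerProductSpace ℂ H]

/-- The characters of the two-dimensional torus. -/
def torusChar (n : ℤ × ℤ) (θ : UnitAddCircle × UnitAddCircle) : ℂ :=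
  fourier n.1 θ.1 * fourier n.2 θ.2

theorem continuous_torusChar (n : ℤ × ℤ) : Continuous (torusChar n) := by
  unfold torusChar
  fun_prop

theorem torusChar_add (m n : ℤ × ℤ) (θ : UnitAddCircle × UnitAddCircle) :
    torusChar (m + n) θ = torusChar m θ * torusChar n θ := by
  simp only [torusChar, Prod.fst_add, Prod.snd_add, fourier_add]
  ring

theorem torusChar_neg (n : ℤ × ℤ) (θ : UnitAddCircle × UnitAddCircle) :
    torusChar (-n) θ = starRingEnd ℂ (torusChar n θ) := by
  simp only [torusChar, Prod.fst_neg, Prod.snd_neg, fourier_neg, map_mul]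

/-- The normalized Haar measure of the two-dimensional torus. -/
def torusMeasure : Measure (UnitAddCircle × UnitAddCircle) :=
  (AddCircle.haarAddCircle (T := 1)).prod (AddCircle.haarAddCircle (T := 1))

instance : IsProbabilityMeasure torusMeasure := by unfold torusMeasure; infer_instance

theorem integral_fourier (n : ℤ) :
    ∫ t : UnitAddCircle, fourier n t ∂AddCircle.haarAddCircle = if n = 0 then 1 else 0 := by
  have h1 := congrFun (fourierCoeff_fourier (T := 1) n) 0
  rw [fourierCoeff] at h1
  simp only [neg_zero, fourier_zero, one_smul, Pi.single_apply] at h1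
  rw [h1]
  simp only [eq_comm]

theorem integral_torusChar (n : ℤ × ℤ) :
    ∫ θ, torusChar n θ ∂torusMeasure = if n = 0 then 1 else 0 := by
  rw [torusMeasure]
  unfold torusChar
  rw [integral_prod_mul (fun t : UnitAddCircle => (fourier n.1 t : ℂ))
    (fun t : UnitAddCircle => (fourier n.2 t : ℂ)), integral_fourier, integral_fourier]
  simp only [Prod.ext_iff, Prod.fst_zero, Prod.snd_zero]
  split_ifs <;> simp_all

theorem integrable_torus {E : Type*} [NormedAddCommGroup E]
    {f : UnitAddCircle × UnitAddCircle → E} (hf : Continuous f) : Integrable f torusMeasure :=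
  hf.integrable_of_hasCompactSupport (HasCompactSupport.of_compactSpace f)

/-- Parseval's identity with coefficients in a Hilbert space: orthogonality of the characters
replaces any orthogonality among the vectors. -/
theorem integral_norm_sq_trigPolynomial (S : Finset (ℤ × ℤ)) (v : ℤ × ℤ → H) :
    ∫ θ, ‖∑ n ∈ S, torusChar n θ • v n‖ ^ 2 ∂torusMeasure = ∑ n ∈ S, ‖v n‖ ^ 2 := by
  have e1 : ∀ θ, ((‖∑ n ∈ S, torusChar n θ • v n‖ ^ 2 : ℝ) : ℂ) =
      ∑ n ∈ S, ∑ m ∈ S, torusChar (m - n) θ * ⟪v n, v m⟫_ℂ := by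
    intro θ
    have h0 : ((‖∑ n ∈ S, torusChar n θ • v n‖ ^ 2 : ℝ) : ℂ) =
        ⟪∑ n ∈ S, torusChar n θ • v n, ∑ n ∈ S, torusChar n θ • v n⟫_ℂ := by
      rw [inner_self_eq_norm_sq_to_K]; push_cast; rfl
    rw [h0, sum_inner]
    refine Finset.sum_congr rfl fun n _ => ?_
    rw [inner_sum]
    refine Finset.sum_congr rfl fun m _ => ?_
    rw [inner_smul_left, inner_smul_right, sub_eq_add_neg, torusChar_add, torusChar_neg]
    ring
  have hc : ∀ n m : ℤ × ℤ, Integrable (fun θ => torusChar (m - n) θ * ⟪v n, v m⟫_ℂ) torusMeasure :=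
    fun n m => integrable_torus ((continuous_torusChar _).mul continuous_const)
  have e2 : ((∫ θ, ‖∑ n ∈ S, torusChar n θ • v n‖ ^ 2 ∂torusMeasure : ℝ) : ℂ) =
      ((∑ n ∈ S, ‖v n‖ ^ 2 : ℝ) : ℂ) := by
    rw [← integral_complex_ofReal]
    simp only [e1]
    rw [integral_finsetSum _ fun n _ => integrable_finsetSum _ fun m _ => hc n m]
    push_cast
    refine Finset.sum_congr rfl fun n hn => ?_
    rw [integral_finsetSum _ fun m _ => hc n m, Finset.sum_eq_single n]
    · rw [integral_mul_const, integral_torusChar, if_pos (sub_self n), one_mul,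
        inner_self_eq_norm_sq_to_K]
      rfl
    · intro m _ hmn
      rw [integral_mul_const, integral_torusChar, if_neg (sub_ne_zero.2 hmn), zero_mul]
    · exact fun h => absurd hn h
  exact_mod_cast e2

theorem sum_sub_eq_sum {E : Type*} [AddCommMonoid E] {S S' : Finset (ℤ × ℤ)} {f : ℤ × ℤ → E}
    (k : ℤ × ℤ) (hf : ∀ m ∉ S, f m = 0) (hS : ∀ m ∈ S, k + m ∈ S') :
    ∑ n ∈ S', f (n - k) = ∑ m ∈ S, f m := by
  symm
  refine Finset.sum_of_injOn (fun m => k + m) (fun a _ b _ hab => add_left_cancel hab)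
    (fun m hm => hS m hm) (fun n _ hn => hf _ fun hmem => hn ⟨n - k, hmem, by simp⟩)
    (fun m _ => by simp)

/-- Unitaries `W k`, `T m` with `W k T m = g (k + m, m) T (k + m)`, such that the gauge
transformations `W k ↦ χ(k) W k` by characters of `ℤ²` are implemented by isometries. -/
structure CovariantSystem (g : ℤ × ℤ → ℤ × ℤ → ℂ) (W : ℤ × ℤ → H →L[ℂ] H)
    (T : ℤ × ℤ → H ≃ₗᵢ[ℂ] H) : Prop where
  norm_phase : ∀ n m, ‖g n m‖ = 1
  comp : ∀ k m u, W k (T m u) = g (k + m) m • T (k + m) u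
  gauge : ∀ θ, ∃ V : H →ₗᵢ[ℂ] H, ∀ k u, W k (V u) = torusChar k θ • V (W k u)

variable {g : ℤ × ℤ → ℤ × ℤ → ℂ} {W : ℤ × ℤ → H →L[ℂ] H} {T : ℤ × ℤ → H ≃ₗᵢ[ℂ] H}

/-- Fix a unit vector u and apply the lower bound to V_θ applied to the sum of χ_m(θ)ξ_m T_m u. By
covariance the image is V_θ of a trigonometric polynomial whose n-th coefficient is the n-th entry
of the matrix applied to ξ, times T_n u. Integrating over θ and using Parseval's identity leaves the
scalar inequality. -/
theorem CovariantSystem.sum_sq_le [Nontrivial H] (hW : CovariantSystem g W T)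
    {F S S' : Finset (ℤ × ℤ)} {a ξ : ℤ × ℤ → ℂ} {c : ℝ} (hc : 0 ≤ c)
    (hA : ∀ u, c * ‖u‖ ≤ ‖∑ k ∈ F, a k • W k u‖) (hξ : ∀ m ∉ S, ξ m = 0)
    (hS : ∀ k ∈ F, ∀ m ∈ S, k + m ∈ S') :
    c ^ 2 * ∑ m ∈ S, ‖ξ m‖ ^ 2 ≤
      ∑ n ∈ S', ‖∑ k ∈ F, a k * (g n (n - k) * ξ (n - k))‖ ^ 2 := by
  obtain ⟨u, hu⟩ := exists_norm_eq H (zero_le_one' ℝ)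
  have hnorm : ∀ (b : ℂ) n, ‖b • T n u‖ ^ 2 = ‖b‖ ^ 2 := fun b n => by
    rw [norm_smul, LinearIsometryEquiv.norm_map, hu, mul_one]
  have key : ∀ θ, c ^ 2 * ‖∑ m ∈ S, torusChar m θ • (ξ m • T m u)‖ ^ 2 ≤
      ‖∑ n ∈ S', torusChar n θ •
        ((∑ k ∈ F, a k * (g n (n - k) * ξ (n - k))) • T n u)‖ ^ 2 := by
    intro θ
    obtain ⟨V, hV⟩ := hW.gauge θ
    set x := ∑ m ∈ S, torusChar m θ • (ξ m • T m u) with hx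
    have h1 := hA (V x)
    rw [V.norm_map] at h1
    set Φ : ℤ × ℤ → ℤ × ℤ → H := fun k m =>
      (torusChar (k + m) θ * (a k * (g (k + m) m * ξ m))) • T (k + m) u with hΦ
    have h2 : ∑ k ∈ F, a k • W k (V x) = V (∑ k ∈ F, ∑ m ∈ S, Φ k m) := by
      rw [map_sum V (fun k => ∑ m ∈ S, Φ k m)]
      refine Finset.sum_congr rfl fun k _ => ?_
      rw [hV, ← map_smul, ← map_smul, hx,
        map_sum (W k), Finset.smul_sum, Finset.smul_sum]
      congr 1
      refine Finset.sum_congr rfl fun m _ => ?_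
      rw [map_smul, map_smul, hW.comp, hΦ]
      simp only [smul_smul, torusChar_add]
      congr 1; ring
    have h3 : ∑ k ∈ F, ∑ m ∈ S, Φ k m = ∑ n ∈ S', torusChar n θ •
        ((∑ k ∈ F, a k * (g n (n - k) * ξ (n - k))) • T n u) := by
      have : ∀ k ∈ F, ∑ m ∈ S, Φ k m = ∑ n ∈ S', Φ k (n - k) := fun k hk =>
        (sum_sub_eq_sum k (fun m hm => by simp [hΦ, hξ m hm]) (hS k hk)).symm
      rw [Finset.sum_congr rfl this, Finset.sum_comm]
      refine Finset.sum_congr rfl fun n _ => ?_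
      rw [Finset.sum_smul, Finset.smul_sum]
      refine Finset.sum_congr rfl fun k _ => ?_
      simp only [hΦ, add_sub_cancel, smul_smul]
    rw [h2, V.norm_map, h3] at h1
    rw [← mul_pow]
    gcongr
  have hcont : ∀ (S : Finset (ℤ × ℤ)) (v : ℤ × ℤ → H),
      Continuous fun θ => ‖∑ n ∈ S, torusChar n θ • v n‖ ^ 2 := fun S v =>
    ((continuous_finsetSum _ fun n _ =>
      (continuous_torusChar n).smul continuous_const).norm).pow 2
  have := integral_mono (μ := torusMeasure) (integrable_torus ((hcont S _).const_mul (c ^ 2)))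
    (integrable_torus (hcont S' _)) key
  rw [integral_const_mul, integral_norm_sq_trigPolynomial, integral_norm_sq_trigPolynomial] at this
  simpa only [hnorm] using this

theorem Seq.norm_sq_eq_sum {ξ : Seq} {S : Finset (ℤ × ℤ)} (hξ : ∀ m ∉ S, ξ m = 0) :
    ‖ξ‖ ^ 2 = ∑ m ∈ S, ‖ξ m‖ ^ 2 := by
  have h1 := lp.norm_rpow_eq_tsum (p := 2) (by simp) ξ
  simp only [ENNReal.toReal_ofNat, Real.rpow_ofNat] at h1
  rw [h1, tsum_eq_sum fun m hm => by rw [hξ m hm]; simp]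

theorem exists_seq_of_support {ξ : ℤ × ℤ → ℂ} {S : Finset (ℤ × ℤ)} (hξ : ∀ m ∉ S, ξ m = 0) :
    ∃ η : Seq, ∀ m, η m = ξ m := by
  have h0 : Memℓp ξ 0 := memℓp_zero (S.finite_toSet.subset fun m hm => by
    by_contra h; exact hm (hξ m h))
  exact ⟨⟨ξ, h0.of_exponent_ge (by simp)⟩, fun m => rfl⟩

/-- A lower bound for a finite matrix holds for vector-valued sequences as well. -/
theorem sum_sq_le_vector {S S' F : Finset (ℤ × ℤ)} {s : ℤ × ℤ → ℤ × ℤ → ℂ} {c : ℝ}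
    (hc : ∀ ξ : ℤ × ℤ → ℂ, (∀ m ∉ S, ξ m = 0) →
      c * ∑ m ∈ S, ‖ξ m‖ ^ 2 ≤ ∑ n ∈ S', ‖∑ k ∈ F, s n k * ξ (n - k)‖ ^ 2)
    {v : ℤ × ℤ → H} (hv : ∀ m ∉ S, v m = 0) :
    c * ∑ m ∈ S, ‖v m‖ ^ 2 ≤ ∑ n ∈ S', ‖∑ k ∈ F, s n k • v (n - k)‖ ^ 2 := by
  -- The finitely many values span a finite dimensional space; the scalar bound is applied to each
  -- coordinate in an orthonormal basis and summed.
  let V := Submodule.span ℂ (v '' S)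
  have hfin : FiniteDimensional ℂ V := FiniteDimensional.span_of_finite ℂ (S.finite_toSet.image v)
  let b := stdOrthonormalBasis ℂ V
  have hmem : ∀ m, v m ∈ V := fun m => by
    by_cases hm : m ∈ S
    · exact Submodule.subset_span ⟨m, hm, rfl⟩
    · rw [hv m hm]; exact V.zero_mem
  have hpars : ∀ w ∈ V, ‖w‖ ^ 2 = ∑ i, ‖⟪(b i : H), w⟫_ℂ‖ ^ 2 := fun w hw =>
    (b.sum_sq_norm_inner_right ⟨w, hw⟩).symm
  have e1 : ∑ m ∈ S, ‖v m‖ ^ 2 = ∑ i, ∑ m ∈ S, ‖⟪(b i : H), v m⟫_ℂ‖ ^ 2 := by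
    rw [Finset.sum_comm]
    exact Finset.sum_congr rfl fun m _ => hpars _ (hmem m)
  have e2 : ∑ n ∈ S', ‖∑ k ∈ F, s n k • v (n - k)‖ ^ 2 =
      ∑ i, ∑ n ∈ S', ‖∑ k ∈ F, s n k * ⟪(b i : H), v (n - k)⟫_ℂ‖ ^ 2 := by
    rw [Finset.sum_comm]
    refine Finset.sum_congr rfl fun n _ => ?_
    rw [hpars _ (V.sum_mem fun k _ => V.smul_mem _ (hmem _))]
    simp only [inner_sum, inner_smul_right]
  rw [e1, e2, Finset.mul_sum]
  exact Finset.sum_le_sum fun i _ => hc _ fun m hm => by rw [hv m hm, inner_zero_right]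

/-! ### Lattice boxes and the averaging argument -/

/-- The box `[-N, N]²` of the lattice. -/
def latticeBox (N : ℕ) : Finset (ℤ × ℤ) := Finset.Icc (-(N : ℤ)) N ×ˢ Finset.Icc (-(N : ℤ)) N

theorem mem_latticeBox {N : ℕ} {n : ℤ × ℤ} : n ∈ latticeBox N ↔ |n.1| ≤ N ∧ |n.2| ≤ N := by
  simp only [latticeBox, Finset.mem_product, Finset.mem_Icc, abs_le]

theorem card_latticeBox (N : ℕ) : ((latticeBox N).card : ℝ) = (2 * N + 1) ^ 2 := by
  have : (Finset.Icc (-(N : ℤ)) N).card = 2 * N + 1 := by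
    rw [Int.card_Icc]; omega
  rw [latticeBox, Finset.card_product, this]
  push_cast; ring

theorem add_mem_latticeBox {M N : ℕ} {m n : ℤ × ℤ} (hm : m ∈ latticeBox M)
    (hn : n ∈ latticeBox N) : m + n ∈ latticeBox (M + N) := by
  rw [mem_latticeBox] at *
  push_cast
  exact ⟨(abs_add_le _ _).trans (add_le_add hm.1 hn.1),
    (abs_add_le _ _).trans (add_le_add hm.2 hn.2)⟩

theorem neg_mem_latticeBox {N : ℕ} {n : ℤ × ℤ} (hn : n ∈ latticeBox N) : -n ∈ latticeBox N := by
  rw [mem_latticeBox] at *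
  simpa using hn

theorem exists_subset_latticeBox (F : Finset (ℤ × ℤ)) : ∃ R, ∀ k ∈ F, k ∈ latticeBox R := by
  refine ⟨F.sup fun k => k.1.natAbs + k.2.natAbs, fun k hk => ?_⟩
  have := Finset.le_sup (f := fun k : ℤ × ℤ => k.1.natAbs + k.2.natAbs) hk
  rw [mem_latticeBox]
  rw [Int.abs_eq_natAbs, Int.abs_eq_natAbs]
  constructor <;> omega

theorem CovariantSystem.inv_comp (hW : CovariantSystem g W T) (k n : ℤ × ℤ) (u : H) :
    (T n).symm (W k u) = g n (n - k) • (T (n - k)).symm u := by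
  have h1 := hW.comp k (n - k) ((T (n - k)).symm u)
  rw [LinearIsometryEquiv.apply_symm_apply, add_sub_cancel] at h1
  rw [h1, map_smul, LinearIsometryEquiv.symm_apply_apply]

/-- The volumes grow like 4N² and the boundary layer only like N, so dividing by the volume removes
the error term in the limit. -/
theorem le_of_forall_box {a b d : ℝ} {R : ℕ} (hb : 0 ≤ b)
    (h : ∀ N : ℕ, R ≤ N → (2 * N + 1) ^ 2 * a ≤ (2 * (N + R) + 1) ^ 2 * b +
      ((2 * (N + R) + 1) ^ 2 - (2 * ((N : ℝ) - R) + 1) ^ 2) * d) : a ≤ b := by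
  by_contra hlt
  push Not at hlt
  obtain ⟨N, hN⟩ := exists_nat_gt ((4 * R * b + 8 * R * d + 4 * R ^ 2 * b) / (a - b))
  rw [div_lt_iff₀ (by linarith)] at hN
  have h1 := h (N + R) (by omega)
  push_cast at h1
  set X : ℝ := 2 * ((N : ℝ) + R) + 1 with hX
  have hX1 : 1 ≤ X := by have := Nat.cast_nonneg (α := ℝ) N; have := Nat.cast_nonneg (α := ℝ) R; linarith
  have hXN : (N : ℝ) ≤ X := by have := Nat.cast_nonneg (α := ℝ) N; have := Nat.cast_nonneg (α := ℝ) R; linarith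
  have h2 : X * (X * (a - b)) ≤ X * (4 * R * b + 8 * R * d) + 4 * R ^ 2 * b := by
    have e1 : 2 * ((N : ℝ) + R + R) + 1 = X + 2 * R := by rw [hX]; ring
    have e2 : 2 * ((N : ℝ) + R - R) + 1 = X - 2 * R := by rw [hX]; ring
    rw [e1, e2] at h1
    nlinarith
  have h3 : 4 * R ^ 2 * b ≤ X * (4 * R ^ 2 * b) := le_mul_of_one_le_left (by positivity) hX1
  have h4 : X * (X * (a - b)) ≤ X * (4 * R * b + 8 * R * d + 4 * R ^ 2 * b) := by linarith
  have h5 := le_of_mul_le_mul_left h4 (by linarith)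
  have h6 : N * (a - b) ≤ X * (a - b) := mul_le_mul_of_nonneg_right hXN (by linarith)
  linarith

/-- This is amenability of ℤ². Test the matrix on the vector-valued sequence T_m^{-1}u cut off to a
box. At every n whose F-neighbourhood lies in the box the result is T_n^{-1} of the operator applied
to u, of the same norm for all such n. The remaining n form a boundary layer with terms of size at
most (Λ‖u‖)². -/
theorem CovariantSystem.le_norm (hW : CovariantSystem g W T) {F : Finset (ℤ × ℤ)}
    {a : ℤ × ℤ → ℂ} {c : ℝ}
    (hM : ∀ S S' : Finset (ℤ × ℤ), (∀ k ∈ F, ∀ m ∈ S, k + m ∈ S') → ∀ ξ : ℤ × ℤ → ℂ,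
      (∀ m ∉ S, ξ m = 0) → c ^ 2 * ∑ m ∈ S, ‖ξ m‖ ^ 2 ≤
        ∑ n ∈ S', ‖∑ k ∈ F, a k * g n (n - k) * ξ (n - k)‖ ^ 2) (u : H) :
    c * ‖u‖ ≤ ‖∑ k ∈ F, a k • W k u‖ := by
  obtain ⟨R, hR⟩ := exists_subset_latticeBox F
  set Λ := ∑ k ∈ F, ‖a k‖
  suffices h : (c * ‖u‖) ^ 2 ≤ ‖∑ k ∈ F, a k • W k u‖ ^ 2 from
    le_of_sq_le_sq h (norm_nonneg _)
  refine le_of_forall_box (R := R) (d := (Λ * ‖u‖) ^ 2) (by positivity)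
    fun N hN => ?_
  classical
  set S := latticeBox N
  set S' := latticeBox (R + N)
  set v : ℤ × ℤ → H := fun m => if m ∈ S then (T m).symm u else 0 with hv
  have h1 := sum_sq_le_vector (v := v) (hM S S' fun k hk m hm => add_mem_latticeBox (hR k hk) hm)
    (fun m hm => if_neg hm)
  have e1 : ∑ m ∈ S, ‖v m‖ ^ 2 = (2 * N + 1) ^ 2 * ‖u‖ ^ 2 := by
    have : ∀ m ∈ S, ‖v m‖ ^ 2 = ‖u‖ ^ 2 := fun m hm => by
      rw [hv]; simp only [if_pos hm, LinearIsometryEquiv.norm_map]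
    rw [Finset.sum_congr rfl this, Finset.sum_const, nsmul_eq_mul, card_latticeBox]
  have hvle : ∀ m, ‖v m‖ ≤ ‖u‖ := fun m => by
    rw [hv]; beta_reduce
    split_ifs
    · rw [LinearIsometryEquiv.norm_map]
    · simp
  -- F lies in the box of radius R, so for n in the box of radius N - R no translate n - k is cut
  -- off.
  have hB : latticeBox (N - R) ⊆ S' := fun n hn => by
    rw [mem_latticeBox] at *
    omega
  have h2 : ∑ n ∈ S', ‖∑ k ∈ F, (a k * g n (n - k)) • v (n - k)‖ ^ 2 ≤
      (S'.card : ℝ) * ‖∑ k ∈ F, a k • W k u‖ ^ 2 +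
        ((S'.card : ℝ) - (latticeBox (N - R)).card) * (Λ * ‖u‖) ^ 2 := by
    rw [← Finset.sum_sdiff hB, add_comm]
    have hin : ∀ n ∈ latticeBox (N - R), ‖∑ k ∈ F, (a k * g n (n - k)) • v (n - k)‖ ^ 2 =
        ‖∑ k ∈ F, a k • W k u‖ ^ 2 := by
      intro n hn
      rw [← (T n).symm.norm_map (∑ k ∈ F, a k • W k u), map_sum]
      congr 2
      refine Finset.sum_congr rfl fun k hk => ?_
      have hmem : n - k ∈ S := by
        have := add_mem_latticeBox hn (neg_mem_latticeBox (hR k hk))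
        rwa [Nat.sub_add_cancel hN, ← sub_eq_add_neg] at this
      rw [map_smul, hW.inv_comp, smul_smul, hv]
      simp only [if_pos hmem]
    have hout : ∀ n ∈ S' \ latticeBox (N - R),
        ‖∑ k ∈ F, (a k * g n (n - k)) • v (n - k)‖ ^ 2 ≤ (Λ * ‖u‖) ^ 2 := by
      intro n _
      gcongr
      refine (norm_sum_le _ _).trans ?_
      rw [Finset.sum_mul]
      refine Finset.sum_le_sum fun k _ => ?_
      rw [norm_smul, norm_mul, hW.norm_phase, mul_one]
      exact mul_le_mul_of_nonneg_left (hvle _) (norm_nonneg _)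
    rw [Finset.sum_congr rfl hin, Finset.sum_const, nsmul_eq_mul]
    have h3 := Finset.sum_le_card_nsmul _ _ _ hout
    rw [nsmul_eq_mul, Finset.cast_card_sdiff hB] at h3
    have h4 : ((latticeBox (N - R)).card : ℝ) ≤ S'.card := by
      exact_mod_cast Finset.card_le_card hB
    have h5 := mul_le_mul_of_nonneg_right h4 (sq_nonneg ‖∑ k ∈ F, a k • W k u‖)
    linarith
  have h3 := h1.trans h2
  rw [e1, card_latticeBox, card_latticeBox, Nat.cast_sub hN] at h3
  push_cast at h3
  have e2 : (2 * ((R : ℝ) + N) + 1) = 2 * (N + R) + 1 := by ring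
  rw [e2] at h3
  linarith [mul_pow c ‖u‖ 2]

theorem exists_bound_of_norm_sub_lt {E : Type*} [NormedAddCommGroup E] [NormedSpace ℂ E]
    {A B : E →L[ℂ] E} {c ε : ℝ} (hA : ∀ u, c * ‖u‖ ≤ ‖A u‖) (hAB : ‖B - A‖ ≤ ε) (u : E) :
    (c - ε) * ‖u‖ ≤ ‖B u‖ := by
  have h1 := (B - A).le_of_opNorm_le hAB u
  have h2 : A u = B u - (B - A) u := by simp
  have h3 := norm_sub_le (B u) ((B - A) u)
  rw [← h2] at h3
  linarith [hA u]

/-- Both sums converge in operator norm, so a common finite truncation is close to each of them. For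
the truncation the bound transfers with the same constant, in one direction on finitely supported
sequences, which are dense, and in the other by averaging over boxes. -/
theorem CovariantSystem.exists_bound_iff [Nontrivial H] (hW : CovariantSystem g W T)
    {a : ℤ × ℤ → ℂ} {U : ℤ × ℤ → Seq →L[ℂ] Seq}
    (hU : ∀ k ξ n, U k ξ n = g n (n - k) * ξ (n - k)) {A : H →L[ℂ] H} {M : Seq →L[ℂ] Seq}
    (hA : HasSum (fun k => a k • W k) A) (hM : HasSum (fun k => a k • U k) M) :
    (∃ c > 0, ∀ u, c * ‖u‖ ≤ ‖A u‖) ↔ ∃ c > 0, ∀ ξ, c * ‖ξ‖ ≤ ‖M ξ‖ := by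
  have hclose : ∀ ε > 0, ∃ F : Finset (ℤ × ℤ), ‖∑ k ∈ F, a k • W k - A‖ ≤ ε ∧
      ‖∑ k ∈ F, a k • U k - M‖ ≤ ε := by
    intro ε hε
    have h1 := (Metric.tendsto_nhds.1 hA ε hε).and (Metric.tendsto_nhds.1 hM ε hε)
    obtain ⟨F, hF1, hF2⟩ := h1.exists
    rw [dist_eq_norm] at hF1 hF2
    exact ⟨F, hF1.le, hF2.le⟩
  have hUF : ∀ (F : Finset (ℤ × ℤ)) (ξ : Seq) n, (∑ k ∈ F, a k • U k) ξ n =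
      ∑ k ∈ F, a k * (g n (n - k) * ξ (n - k)) := by
    intro F ξ n
    rw [sum_apply, lp.coeFn_sum, Finset.sum_apply]
    refine Finset.sum_congr rfl fun k _ => ?_
    rw [← hU]; rfl
  have hWF : ∀ (F : Finset (ℤ × ℤ)) u, (∑ k ∈ F, a k • W k) u = ∑ k ∈ F, a k • W k u := by
    intro F u
    rw [sum_apply]; rfl
  constructor
  · rintro ⟨c, hc, hb⟩
    -- The constant loses c/4 in passing to the truncation and c/4 in returning, so c/2 survives.
    obtain ⟨F, hF1, hF2⟩ := hclose (c / 4) (by positivity)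
    have hbF := exists_bound_of_norm_sub_lt hb hF1
    refine ⟨c - c / 4 - c / 4, by linarith,
      exists_bound_of_norm_sub_lt (A := ∑ k ∈ F, a k • U k) ?_ (by rwa [norm_sub_rev])⟩
    have hfin : ∀ (S : Finset (ℤ × ℤ)) (ξ : Seq), (∀ m ∉ S, ξ m = 0) →
        (c - c / 4) * ‖ξ‖ ≤ ‖(∑ k ∈ F, a k • U k) ξ‖ := by
      classical
      intro S ξ hξ
      have h1 := hW.sum_sq_le (F := F) (S' := (F ×ˢ S).image fun p => p.1 + p.2)
        (by linarith : 0 ≤ c - c / 4) (fun u => by rw [← hWF]; exact hbF u) hξ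
        fun k hk m hm => Finset.mem_image.2 ⟨(k, m), Finset.mem_product.2 ⟨hk, hm⟩, rfl⟩
      simp only [← hUF] at h1
      rw [← Seq.norm_sq_eq_sum hξ, ← mul_pow] at h1
      exact le_of_sq_le_sq (h1.trans (Seq.sum_sq_le _ _)) (norm_nonneg _)
    intro ξ
    have h1 : Tendsto (fun S : Finset (ℤ × ℤ) => ∑ m ∈ S, (lp.single 2 m (ξ m) : Seq)) atTop (𝓝 ξ) :=
      lp.hasSum_single (by norm_num) ξ
    refine le_of_tendsto_of_tendsto' (h1.norm.const_mul _)
      ((((∑ k ∈ F, a k • U k).continuous.tendsto _).comp h1).norm) fun S => hfin S _ fun m hm => ?_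
    rw [lp.coeFn_sum, Finset.sum_apply]
    refine Finset.sum_eq_zero fun n hn => ?_
    rw [lp.single_apply, Pi.single_eq_of_ne]
    rintro rfl
    exact hm hn
  · rintro ⟨c, hc, hb⟩
    obtain ⟨F, hF1, hF2⟩ := hclose (c / 4) (by positivity)
    have hbF := exists_bound_of_norm_sub_lt hb hF2
    refine ⟨c - c / 4 - c / 4, by linarith,
      exists_bound_of_norm_sub_lt (A := ∑ k ∈ F, a k • W k) ?_ (by rwa [norm_sub_rev])⟩
    intro u
    rw [hWF]
    refine hW.le_norm (fun S S' hS ξ hξ => ?_) u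
    obtain ⟨η, hη⟩ := exists_seq_of_support hξ
    have h1 := hbF η
    have h2 : ((c - c / 4) * ‖η‖) ^ 2 ≤ ‖(∑ k ∈ F, a k • U k) η‖ ^ 2 :=
      pow_le_pow_left₀ (mul_nonneg (by linarith) (norm_nonneg _)) h1 2
    rw [mul_pow, Seq.norm_sq_eq_sum (S := S) fun m hm => by rw [hη, hξ m hm],
      Seq.norm_sq_eq_sum (S := S') fun n hn => ?_] at h2
    · simpa only [hUF, hη, mul_assoc] using h2
    · rw [hUF]
      refine Finset.sum_eq_zero fun k hk => ?_
      have : n - k ∉ S := fun hmem => hn (by simpa using hS k hk _ hmem)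
      rw [hη, hξ _ this, mul_zero, mul_zero]

end Torus

/-! ### Modulated translations of the line -/

section ModulatedTranslation

theorem memLp_modTrans (a b : ℝ) (f : L2Line) :
    MemLp (fun x => Complex.exp (((a * x : ℝ) : ℂ) * Complex.I) * f (x + b)) 2 := by
  have h1 : MemLp (fun x => f (x + b)) 2 :=
    (Lp.memLp f).comp_measurePreserving (measurePreserving_add_right volume b)
  refine h1.mono ?_ (Eventually.of_forall fun x => ?_)
  · exact AEStronglyMeasurable.mul (Continuous.aestronglyMeasurable (by fun_prop)) h1.1
  · rw [norm_mul, Complex.norm_exp_ofReal_mul_I, one_mul]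

theorem ae_comp_add_right {P : ℝ → Prop} (hP : ∀ᵐ x, P x) (b : ℝ) : ∀ᵐ x, P (x + b) :=
  (measurePreserving_add_right volume b).quasiMeasurePreserving.ae hP

/-- The isometry `f ↦ e^{i a x} f(x + b)` of `L²(ℝ)`. -/
def modTrans (a b : ℝ) : L2Line →ₗᵢ[ℂ] L2Line where
  toFun f := (memLp_modTrans a b f).toLp
  map_add' f g := by
    refine Lp.ext ?_
    filter_upwards [(memLp_modTrans a b (f + g)).coeFn_toLp, (memLp_modTrans a b f).coeFn_toLp,
      (memLp_modTrans a b g).coeFn_toLp, Lp.coeFn_add (memLp_modTrans a b f).toLp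
        (memLp_modTrans a b g).toLp, ae_comp_add_right (Lp.coeFn_add f g) b] with x h1 h2 h3 h4 h5
    rw [h1, h4, Pi.add_apply, h2, h3, h5, Pi.add_apply, mul_add]
  map_smul' c f := by
    refine Lp.ext ?_
    filter_upwards [(memLp_modTrans a b (c • f)).coeFn_toLp, (memLp_modTrans a b f).coeFn_toLp,
      Lp.coeFn_smul c (memLp_modTrans a b f).toLp,
      ae_comp_add_right (Lp.coeFn_smul c f) b] with x h1 h2 h3 h4
    rw [RingHom.id_apply, h1, h3, Pi.smul_apply, h2, h4, Pi.smul_apply, smul_eq_mul, smul_eq_mul]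
    ring
  norm_map' f := by
    change ‖(memLp_modTrans a b f).toLp‖ = ‖f‖
    rw [Lp.norm_toLp, Lp.norm_def]
    congr 1
    rw [← eLpNorm_comp_measurePreserving (Lp.memLp f).1 (measurePreserving_add_right volume b)]
    refine eLpNorm_congr_norm_ae (Eventually.of_forall fun x => ?_)
    rw [norm_mul, Complex.norm_exp_ofReal_mul_I, one_mul]
    rfl

theorem modTrans_coeFn (a b : ℝ) (f : L2Line) : modTrans a b f =ᵐ[volume]
    fun x => Complex.exp (((a * x : ℝ) : ℂ) * Complex.I) * f (x + b) :=
  (memLp_modTrans a b f).coeFn_toLp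

theorem modTrans_zero (f : L2Line) : modTrans 0 0 f = f := by
  refine Lp.ext ?_
  filter_upwards [modTrans_coeFn 0 0 f] with x hx
  rw [hx]; simp

theorem modTrans_modTrans (a b a' b' : ℝ) (f : L2Line) : modTrans a b (modTrans a' b' f) =
    Complex.exp (((a' * b : ℝ) : ℂ) * Complex.I) • modTrans (a + a') (b + b') f := by
  refine Lp.ext ?_
  filter_upwards [modTrans_coeFn a b (modTrans a' b' f), ae_comp_add_right (modTrans_coeFn a' b' f) b,
    Lp.coeFn_smul (Complex.exp (((a' * b : ℝ) : ℂ) * Complex.I)) (modTrans (a + a') (b + b') f),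
    modTrans_coeFn (a + a') (b + b') f] with x h1 h2 h3 h4
  rw [h1, h2, h3, Pi.smul_apply, h4, smul_eq_mul, ← mul_assoc, ← mul_assoc, ← Complex.exp_add,
    ← Complex.exp_add, add_assoc]
  congr 2
  push_cast; ring

theorem modTrans_surjective (a b : ℝ) : Function.Surjective (modTrans a b) := by
  intro f
  refine ⟨Complex.exp (((a * b : ℝ) : ℂ) * Complex.I) • modTrans (-a) (-b) f, ?_⟩
  rw [map_smul, modTrans_modTrans, smul_smul, ← Complex.exp_add, add_neg_cancel, add_neg_cancel,
    modTrans_zero]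
  have : ((a * b : ℝ) : ℂ) * Complex.I + ((-a * b : ℝ) : ℂ) * Complex.I = 0 := by push_cast; ring
  rw [this, Complex.exp_zero, one_smul]

/-- The unitary `f ↦ e^{i a x} f(x + b)` of `L²(ℝ)`. -/
def modTransEquiv (a b : ℝ) : L2Line ≃ₗᵢ[ℂ] L2Line :=
  LinearIsometryEquiv.ofSurjective (modTrans a b) (modTrans_surjective a b)

theorem modTransEquiv_apply (a b : ℝ) (f : L2Line) : modTransEquiv a b f = modTrans a b f := rfl

instance : Nontrivial L2Line := by
  have hne : volume (Set.Icc (0 : ℝ) 1) ≠ ⊤ := by simp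
  refine ⟨indicatorConstLp 2 measurableSet_Icc hne (1 : ℂ), 0, fun h0 => ?_⟩
  have h1 := congrArg norm h0
  rw [norm_indicatorConstLp (by simp) (by simp), norm_zero] at h1
  simp at h1

variable (h : ℝ)

/-- The Weyl quantization of the character `e^{i (k₁ x + k₂ p)}`. -/
def weylOp (k : ℤ × ℤ) : L2Line →L[ℂ] L2Line :=
  Complex.exp (((k.1 * k.2 * h / 2 : ℝ) : ℂ) * Complex.I) •
    (modTrans k.1 (k.2 * h)).toContinuousLinearMap

theorem weylOp_apply (k : ℤ × ℤ) (f : L2Line) : weylOp h k f =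
    Complex.exp (((k.1 * k.2 * h / 2 : ℝ) : ℂ) * Complex.I) • modTrans k.1 (k.2 * h) f := rfl

theorem norm_weylOp_apply (k : ℤ × ℤ) (f : L2Line) : ‖weylOp h k f‖ = ‖f‖ := by
  rw [weylOp_apply, norm_smul, Complex.norm_exp_ofReal_mul_I, one_mul, LinearIsometry.norm_map]

theorem weylOp_weylOp_neg (k : ℤ × ℤ) (f : L2Line) : weylOp h k (weylOp h (-k) f) = f := by
  rw [weylOp_apply, weylOp_apply, map_smul, modTrans_modTrans, smul_smul, smul_smul,
    ← Complex.exp_add, ← Complex.exp_add]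
  have e1 : ((k.1 * k.2 * h / 2 : ℝ) : ℂ) * Complex.I +
      (((-k).1 * (-k).2 * h / 2 : ℝ) : ℂ) * Complex.I +
        (((-k).1 * (k.2 * h) : ℝ) : ℂ) * Complex.I = 0 := by
    simp only [Prod.fst_neg, Prod.snd_neg]
    push_cast; ring
  have e2 : (k.1 : ℝ) + ((-k).1 : ℤ) = 0 := by simp
  have e3 : (k.2 : ℝ) * h + ((-k).2 : ℤ) * h = 0 := by simp
  rw [e1, e2, e3, Complex.exp_zero, one_smul, modTrans_zero]

theorem inner_weylOp (k : ℤ × ℤ) (f g : L2Line) :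
    ⟪weylOp h (-k) f, g⟫_ℂ = ⟪f, weylOp h k g⟫_ℂ := by
  have h1 : ∀ u v : L2Line, ⟪weylOp h k u, weylOp h k v⟫_ℂ = ⟪u, v⟫_ℂ := by
    intro u v
    rw [weylOp_apply, weylOp_apply, inner_smul_left, inner_smul_right, LinearIsometry.inner_map_map,
      ← mul_assoc, ← Complex.exp_conj, ← Complex.exp_add, map_mul, Complex.conj_ofReal,
      Complex.conj_I, mul_neg, neg_add_cancel, Complex.exp_zero, one_mul]
  rw [← h1, weylOp_weylOp_neg]

/-- The unitary `f ↦ e^{i m₁ (x + m₂ h)} f(x + m₂ h)`. -/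
def lineShift (m : ℤ × ℤ) : L2Line ≃ₗᵢ[ℂ] L2Line :=
  (modTransEquiv m.1 0).trans (modTransEquiv 0 (m.2 * h))

theorem lineShift_apply (m : ℤ × ℤ) (f : L2Line) : lineShift h m f =
    Complex.exp (((m.1 * (m.2 * h) : ℝ) : ℂ) * Complex.I) • modTrans m.1 (m.2 * h) f := by
  rw [lineShift, LinearIsometryEquiv.trans_apply, modTransEquiv_apply, modTransEquiv_apply,
    modTrans_modTrans, zero_add, add_zero]

variable {h}

/-- The order of modulation and translation in `lineShift` is chosen so that the cocycle of the Weyl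
operators is exactly the gauge phase of the Green function at the lattice points. -/
theorem covariantSystem_weylOp (hh : 0 < h) :
    CovariantSystem (fun n m => gaugePhase h (latticePt n) (latticePt m)) (weylOp h)
      (lineShift h) where
  norm_phase n m := norm_gaugePhase _ _ _
  comp k m u := by
    rw [lineShift_apply, lineShift_apply, weylOp_apply, map_smul, modTrans_modTrans, smul_smul,
      smul_smul, smul_smul, gaugePhase, ← Complex.exp_add, ← Complex.exp_add, ← Complex.exp_add]
    have e1 : (k.1 : ℝ) + m.1 = ((k + m).1 : ℤ) := by simp
    have e2 : (k.2 : ℝ) * h + m.2 * h = ((k + m).2 : ℤ) * h := by push_cast [Prod.snd_add]; ring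
    rw [e1, e2]
    congr 2
    simp only [latticePt, Prod.fst_add, Prod.snd_add]
    push_cast; ring
  gauge θ := by
    obtain ⟨θ1, θ2⟩ := θ
    induction θ1 using QuotientAddGroup.induction_on with | H x1 => ?_
    induction θ2 using QuotientAddGroup.induction_on with | H x2 => ?_
    -- Commuting two modulated translations produces a scalar phase. This choice makes it
    -- e^{2πi(k₁x₁ + k₂x₂)}.
    refine ⟨modTrans (2 * Real.pi * x2 / h) (-(2 * Real.pi * x1)), fun k u => ?_⟩
    have hh' : (h : ℂ) ≠ 0 := by exact_mod_cast hh.ne'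
    rw [weylOp_apply, weylOp_apply, map_smul, modTrans_modTrans, modTrans_modTrans, smul_smul,
      smul_smul, smul_smul, torusChar]
    have e1 : (fourier k.1 (x1 : UnitAddCircle) : ℂ) = _ := fourier_coe_apply
    have e2 : (fourier k.2 (x2 : UnitAddCircle) : ℂ) = _ := fourier_coe_apply
    erw [e1, e2]
    rw [← Complex.exp_add, ← Complex.exp_add, ← Complex.exp_add, ← Complex.exp_add,
      add_comm (k.1 : ℝ), add_comm ((k.2 : ℝ) * h)]
    congr 2
    push_cast
    field_simp
    ring

end ModulatedTranslation

/-! ### The quantized symbols -/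

section Quantized

variable {h : ℝ} {z : ℂ}

/-- The Fourier coefficients of the symbol `L_α`. -/
def symbolCoeff (h α : ℝ) (z : ℂ) (k : ℤ × ℤ) : ℂ := coeff h z k + if k = 0 then (α : ℂ)⁻¹ else 0

theorem summable_symbolCoeff (α : ℝ) (hh : 0 < h) (hz : NotLevel h z) :
    Summable fun k => ‖symbolCoeff h α z k‖ := by
  refine Summable.of_norm_bounded ((summable_coeff hh hz).add
    (summable_of_ne_finset_zero (f := fun k : ℤ × ℤ => ‖if k = 0 then (α : ℂ)⁻¹ else 0‖)
      (s := {0}) fun k hk => ?_)) fun k => ?_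
  · rw [if_neg (by simpa using hk), norm_zero]
  · rw [norm_norm]
    exact norm_add_le _ _

theorem symbolCoeff_conj (h α : ℝ) (z : ℂ) (k : ℤ × ℤ) :
    symbolCoeff h α (starRingEnd ℂ z) k = starRingEnd ℂ (symbolCoeff h α z k) := by
  rw [symbolCoeff, symbolCoeff, map_add, coeff_conj]
  split_ifs <;> simp

theorem symbolCoeff_neg (h α : ℝ) (z : ℂ) (k : ℤ × ℤ) :
    symbolCoeff h α z (-k) = symbolCoeff h α z k := by
  rw [symbolCoeff, symbolCoeff, coeff_neg]
  simp

theorem hasSum_ite_zero {E : Type*} [AddCommMonoid E] [TopologicalSpace E] (f : ℤ × ℤ → E) :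
    HasSum (fun k => if k = 0 then f k else 0) (f 0) := by
  convert hasSum_single (0 : ℤ × ℤ) (f := fun k => if k = 0 then f k else 0) ?_ using 1
  · simp
  · intro k hk
    rw [if_neg hk]

theorem effSymbol_eq_tsum (α : ℝ) (hh : 0 < h) (hz : NotLevel h z) (x p : ℝ) :
    effSymbol h α z x p = ∑' k : ℤ × ℤ, symbolCoeff h α z k * character k.1 k.2 x p := by
  rw [effSymbol_eq hh α hz]
  have h1 := (summable_coeff_mul_character hh hz x p).hasSum.add
    (hasSum_ite_zero fun k : ℤ × ℤ => (α : ℂ)⁻¹ * character k.1 k.2 x p)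
  have e0 : character (0 : ℤ × ℤ).1 (0 : ℤ × ℤ).2 x p = 1 := by simp [character]
  rw [e0, mul_one] at h1
  refine (HasSum.tsum_eq (h1.congr_fun fun k => ?_)).symm
  rw [symbolCoeff]
  split_ifs <;> ring

/-- The Weyl quantization of the symbol `L_α`. -/
def quantizedSymbol (h α : ℝ) (z : ℂ) : L2Line →L[ℂ] L2Line :=
  ∑' k, symbolCoeff h α z k • weylOp h k

theorem hasSum_quantizedSymbol (α : ℝ) (hh : 0 < h) (hz : NotLevel h z) :
    HasSum (fun k => symbolCoeff h α z k • weylOp h k) (quantizedSymbol h α z) := by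
  refine (Summable.of_norm_bounded (summable_symbolCoeff α hh hz) fun k => ?_).hasSum
  rw [norm_smul]
  refine mul_le_of_le_one_right (norm_nonneg _) (ContinuousLinearMap.opNorm_le_bound _ zero_le_one ?_)
  intro f
  rw [norm_weylOp_apply, one_mul]

theorem hasSum_quantizedSymbol_apply (α : ℝ) (hh : 0 < h) (hz : NotLevel h z) (f : L2Line) :
    HasSum (fun k => symbolCoeff h α z k • weylOp h k f) (quantizedSymbol h α z f) :=
  (hasSum_quantizedSymbol α hh hz).mapL (ContinuousLinearMap.apply ℂ L2Line f)

/-- The adjoint of the k-th Weyl operator is the one of index -k, and the coefficients are even in k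
and are conjugated along with z. -/
theorem inner_quantizedSymbol_left (α : ℝ) (hh : 0 < h) (hz : NotLevel h z) (f g : L2Line) :
    ⟪quantizedSymbol h α (starRingEnd ℂ z) f, g⟫_ℂ = ⟪f, quantizedSymbol h α z g⟫_ℂ := by
  have h1 := (hasSum_quantizedSymbol_apply α hh hz g).mapL (innerSL ℂ f)
  have h2 := (hasSum_quantizedSymbol_apply α hh hz.conj f).mapL (innerSL ℂ g)
  have h3 := h2.star
  rw [← (Equiv.neg (ℤ × ℤ)).hasSum_iff] at h3
  simp only [innerSL_apply_apply] at h1 h3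
  have e : star ⟪g, quantizedSymbol h α (starRingEnd ℂ z) f⟫_ℂ =
      ⟪quantizedSymbol h α (starRingEnd ℂ z) f, g⟫_ℂ := inner_conj_symm _ _
  rw [e] at h3
  refine h3.unique (h1.congr_fun fun k => ?_)
  simp only [Function.comp, Equiv.neg_apply]
  have e2 : star ⟪g, symbolCoeff h α (starRingEnd ℂ z) (-k) • weylOp h (-k) f⟫_ℂ =
      ⟪symbolCoeff h α (starRingEnd ℂ z) (-k) • weylOp h (-k) f, g⟫_ℂ := inner_conj_symm _ _
  rw [e2, inner_smul_left, inner_smul_right, inner_weylOp, symbolCoeff_neg, symbolCoeff_conj,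
    Complex.conj_conj]

theorem isSelfAdjoint_quantizedSymbol (α : ℝ) (hh : 0 < h) {z : ℝ} (hz : NotLevel h z) :
    IsSelfAdjoint (quantizedSymbol h α z) := by
  rw [ContinuousLinearMap.isSelfAdjoint_iff_isSymmetric]
  intro f g
  have := inner_quantizedSymbol_left α hh hz f g
  rwa [Complex.conj_ofReal] at this

theorem exists_shiftOps (h : ℝ) : ∃ U : ℤ × ℤ → Seq →L[ℂ] Seq, (∀ k, ‖U k‖ ≤ 1) ∧ ∀ k ξ n,
    U k ξ n = gaugePhase h (latticePt n) (latticePt (n - k)) * ξ (n - k) := by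
  choose U h1 h2 using fun k : ℤ × ℤ => exists_weightedShift
    (p := fun n => gaugePhase h (latticePt n) (latticePt (n - k)))
    (fun n => (norm_gaugePhase _ _ _).le) (-k)
  exact ⟨U, h1, fun k ξ n => by rw [h2, ← sub_eq_add_neg]⟩

/-- Summing the matrix by diagonals, with m = n - k, and using that the coefficients are even,
exhibits Q + 1/α with the same coefficients as the quantized symbol; 1/α joins the index 0. -/
theorem hasSum_mOp (α : ℝ) (hh : 0 < h) (hz : NotLevel h z) {U : ℤ × ℤ → Seq →L[ℂ] Seq}
    (hU1 : ∀ k, ‖U k‖ ≤ 1) (hU : ∀ k ξ n, U k ξ n =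
      gaugePhase h (latticePt n) (latticePt (n - k)) * ξ (n - k)) :
    HasSum (fun k => symbolCoeff h α z k • U k) (mOp α hh hz) := by
  have hs : Summable fun k => symbolCoeff h α z k • U k :=
    Summable.of_norm_bounded (summable_symbolCoeff α hh hz) fun k => by
      rw [norm_smul]
      exact mul_le_of_le_one_right (norm_nonneg _) (hU1 k)
  convert hs.hasSum
  ext ξ n
  have h1 : HasSum (fun k => symbolCoeff h α z k * U k ξ n)
      ((∑' k, symbolCoeff h α z k • U k) ξ n) :=
    (hs.hasSum.mapL (ContinuousLinearMap.apply ℂ Seq ξ)).mapL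
      (lp.evalCLM ℂ (fun _ : ℤ × ℤ => ℂ) 2 n)
  have h2 := hasSum_qOp hh hz ξ n
  rw [← (Equiv.subLeft n).hasSum_iff] at h2
  have h3 := h2.add (hasSum_ite_zero fun k : ℤ × ℤ => (α : ℂ)⁻¹ * ξ (n - k))
  rw [sub_zero] at h3
  refine (h3.congr_fun fun k => ?_).unique h1
  simp only [Function.comp, Equiv.subLeft_apply]
  have e : n - k - n = -k := by abel
  rw [hU, qMatrix_eq, e, coeff_neg, symbolCoeff]
  split_ifs with hk
  · subst hk
    have : gaugePhase h (latticePt n) (latticePt (n - 0)) = 1 := by simp [gaugePhase]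
    rw [this]; ring
  · ring

/-- Lower bounds transfer between the two representations at z, and again at z̄ for the adjoints. -/
theorem isUnit_quantizedSymbol_iff (α : ℝ) (hh : 0 < h) (hz : NotLevel h z) :
    IsUnit (quantizedSymbol h α z) ↔ IsUnit (mOp α hh hz) := by
  obtain ⟨U, hU1, hU⟩ := exists_shiftOps h
  have key : ∀ {w : ℂ} (hw : NotLevel h w), (∃ c > 0, ∀ u, c * ‖u‖ ≤ ‖quantizedSymbol h α w u‖) ↔
      ∃ c > 0, ∀ ξ, c * ‖ξ‖ ≤ ‖mOp α hh hw ξ‖ := fun hw =>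
    (covariantSystem_weylOp hh).exists_bound_iff hU (hasSum_quantizedSymbol α hh hw)
      (hasSum_mOp α hh hw hU1 hU)
  rw [isUnit_iff_bounds (inner_quantizedSymbol_left α hh hz),
    isUnit_iff_bounds (inner_mOp_left α hh hz), key hz, key hz.conj]

end Quantized

/-! ### The Weyl quantization as an iterated integral -/

section Weyl

open scoped FourierTransform

/-- The series converges absolutely in L¹, and its L¹ sum agrees almost everywhere with the
pointwise sum. -/
theorem integrable_tsum_of_summable {X ι : Type*} [MeasurableSpace X] {μ : Measure X} [Countable ι]
    {F : ι → X → ℂ} (hF : ∀ i, Integrable (F i) μ) (hs : Summable fun i => ∫ x, ‖F i x‖ ∂μ)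
    (hp : ∀ x, Summable fun i => F i x) : Integrable (fun x => ∑' i, F i x) μ := by
  have h1 : Summable fun i => (hF i).toL1 (F i) :=
    Summable.of_norm (hs.congr fun i => (L1.norm_of_fun_eq_integral_norm (hF i)).symm)
  exact (L1.integrable_coeFn (∑' i, (hF i).toL1 (F i))).congr
    (ae_eq_of_hasSum_lp h1.hasSum (fun i => (hF i).coeFn_toL1) hp)

variable {h : ℝ} {a : ℤ × ℤ → ℂ}

/-- The term of index `k` of the inner integral of the Weyl quantization. -/
def weylTerm (h : ℝ) (f : 𝓢(ℝ, ℂ)) (x : ℝ) (k : ℤ × ℤ) (p : ℝ) : ℂ :=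
  Complex.exp (((k.1 * x / 2 + k.2 * p + p * x / h : ℝ) : ℂ) * Complex.I) *
    (𝓕 f : 𝓢(ℝ, ℂ)) ((2 * Real.pi * h)⁻¹ * p - k.1 / (4 * Real.pi))

theorem weylIntegrand_character (f : 𝓢(ℝ, ℂ)) (x p y : ℝ) (k : ℤ × ℤ) :
    weylIntegrand h (character k.1 k.2) f x p y =
      Complex.exp (((p * (x - y) / h + (k.1 * ((x + y) / 2) + k.2 * p) : ℝ) : ℂ) * Complex.I) *
        f y := by
  rw [weylIntegrand, character, ← Complex.exp_add]
  congr 2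
  push_cast; ring

theorem norm_weylIntegrand_character (f : 𝓢(ℝ, ℂ)) (x p y : ℝ) (k : ℤ × ℤ) :
    ‖weylIntegrand h (character k.1 k.2) f x p y‖ = ‖f y‖ := by
  rw [weylIntegrand_character, norm_mul, Complex.norm_exp_ofReal_mul_I, one_mul]

theorem integrable_weylIntegrand_character (f : 𝓢(ℝ, ℂ)) (x p : ℝ) (k : ℤ × ℤ) :
    Integrable (weylIntegrand h (character k.1 k.2) f x p) := by
  refine f.integrable.mono ?_ (Eventually.of_forall fun y => (norm_weylIntegrand_character ..).le)
  have : weylIntegrand h (character k.1 k.2) f x p = _ :=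
    funext fun y => weylIntegrand_character f x p y k
  rw [this]
  have hf := f.continuous
  exact Continuous.aestronglyMeasurable (by fun_prop)

/-- The y-dependent phase is linear in y, so the inner integral is a value of the Fourier transform;
its argument is shifted by k₁/(4π) because the symbol is evaluated at the midpoint. -/
theorem integral_weylIntegrand_character (hh : 0 < h) (f : 𝓢(ℝ, ℂ)) (x p : ℝ) (k : ℤ × ℤ) :
    ∫ y, weylIntegrand h (character k.1 k.2) f x p y = weylTerm h f x k p := by
  rw [weylTerm, SchwartzMap.fourier_coe, Real.fourier_real_eq_integral_exp_smul,
    ← integral_const_mul]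
  refine integral_congr_ae (Eventually.of_forall fun y => ?_)
  beta_reduce
  rw [weylIntegrand_character, smul_eq_mul, ← mul_assoc, ← Complex.exp_add, ← add_mul,
    ← Complex.ofReal_add]
  congr 4
  have := Real.pi_pos.ne'
  have := hh.ne'
  field_simp
  ring

theorem integrable_schwartz_affine (hh : 0 < h) (g : 𝓢(ℝ, ℂ)) (b : ℝ) :
    Integrable fun p => g ((2 * Real.pi * h)⁻¹ * p - b) :=
  (g.integrable.comp_sub_right b).comp_mul_left' (by have := Real.pi_pos; positivity)

theorem integral_affine {E : Type*} [NormedAddCommGroup E] [NormedSpace ℝ E] (hh : 0 < h)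
    (G : ℝ → E) (b : ℝ) :
    ∫ p, G ((2 * Real.pi * h)⁻¹ * p - b) = (2 * Real.pi * h) • ∫ ξ, G ξ := by
  have hp : 0 < 2 * Real.pi * h := by have := Real.pi_pos; positivity
  rw [Measure.integral_comp_mul_left (fun t => G (t - b)), integral_sub_right_eq_self, inv_inv,
    abs_of_pos hp]

theorem norm_weylTerm (f : 𝓢(ℝ, ℂ)) (x : ℝ) (k : ℤ × ℤ) (p : ℝ) : ‖weylTerm h f x k p‖ =
    ‖(𝓕 f : 𝓢(ℝ, ℂ)) ((2 * Real.pi * h)⁻¹ * p - k.1 / (4 * Real.pi))‖ := by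
  rw [weylTerm, norm_mul, Complex.norm_exp_ofReal_mul_I, one_mul]

theorem integrable_weylTerm (hh : 0 < h) (f : 𝓢(ℝ, ℂ)) (x : ℝ) (k : ℤ × ℤ) :
    Integrable (weylTerm h f x k) := by
  refine (integrable_schwartz_affine hh (𝓕 f) (k.1 / (4 * Real.pi))).mono ?_
    (Eventually.of_forall fun p => (norm_weylTerm f x k p).le)
  have hg := (𝓕 f : 𝓢(ℝ, ℂ)).continuous
  unfold weylTerm
  exact Continuous.aestronglyMeasurable (by fun_prop)

/-- After an affine change of p this is Fourier inversion at x + k₂h. The shift of the argument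
turns into the phase e^{i k₁k₂h/2} of the Weyl operator. -/
theorem integral_weylTerm (hh : 0 < h) (f : 𝓢(ℝ, ℂ)) (x : ℝ) (k : ℤ × ℤ) :
    ∫ p, weylTerm h f x k p = 2 * Real.pi * h *
      (Complex.exp (((k.1 * x + k.1 * k.2 * h / 2 : ℝ) : ℂ) * Complex.I) * f (x + k.2 * h)) := by
  have hpi := Real.pi_pos.ne'
  have hh0 := hh.ne'
  set g : 𝓢(ℝ, ℂ) := 𝓕 f with hg
  have hinv : ∀ w, f w = ∫ ξ : ℝ, Complex.exp (((2 * Real.pi * (ξ * w) : ℝ) : ℂ) * Complex.I) * g ξ := by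
    intro w
    have h1 : 𝓕⁻ g = f := FourierTransform.fourierInv_fourier_eq f
    have h2 := Real.fourierInv_eq' (⇑g) w
    rw [← SchwartzMap.fourierInv_coe, h1] at h2
    rw [h2]
    refine integral_congr_ae (Eventually.of_forall fun ξ => ?_)
    simp only [smul_eq_mul, RCLike.inner_apply, conj_trivial]
    rw [mul_comm w ξ]
  let G : ℝ → ℂ := fun ξ =>
    Complex.exp (((k.1 * x + k.1 * k.2 * h / 2 : ℝ) : ℂ) * Complex.I) *
      (Complex.exp (((2 * Real.pi * (ξ * (x + k.2 * h)) : ℝ) : ℂ) * Complex.I) * g ξ)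
  have h1 : weylTerm h f x k =
      fun p => G ((2 * Real.pi * h)⁻¹ * p - k.1 / (4 * Real.pi)) := by
    funext p
    simp only [G]
    rw [weylTerm, ← mul_assoc, ← Complex.exp_add, ← add_mul, ← Complex.ofReal_add]
    congr 4
    field_simp
    ring
  rw [h1, integral_affine hh G, integral_const_mul, ← hinv, Complex.real_smul]
  push_cast; ring

/-- Both integrations are done term by term. The L¹ norms of the terms, in y and then in p, are
|a_k| times a constant independent of k, so summability of the coefficients justifies both
exchanges. -/
theorem isWeylQuantization_of_hasSum (hh : 0 < h) (ha : Summable fun k => ‖a k‖)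
    {A : L2Line →L[ℂ] L2Line} (hA : ∀ f, HasSum (fun k => a k • weylOp h k f) (A f)) :
    IsWeylQuantization h (fun x p => ∑' k, a k * character k.1 k.2 x p) A := by
  intro f
  obtain ⟨C, hC⟩ : ∃ C, ∀ y, ‖f y‖ ≤ C :=
    ⟨_, fun y => BoundedContinuousFunction.norm_coe_le_norm f.toBoundedContinuousFunction y⟩
  obtain ⟨C', hC'⟩ : ∃ C, ∀ y, ‖(𝓕 f : 𝓢(ℝ, ℂ)) y‖ ≤ C :=
    ⟨_, fun y => BoundedContinuousFunction.norm_coe_le_norm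
      (𝓕 f : 𝓢(ℝ, ℂ)).toBoundedContinuousFunction y⟩
  have hbound : ∀ {c : ℤ × ℤ → ℂ} {B : ℝ}, (∀ k, ‖c k‖ ≤ B) → Summable fun k => a k * c k :=
    fun {c B} hc => Summable.of_norm_bounded (ha.mul_right B) fun k => by
      rw [norm_mul]; exact mul_le_mul_of_nonneg_left (hc k) (norm_nonneg _)
  have hpt : f.toLp 2 volume =ᵐ[volume] f := f.coeFn_toLp 2 volume
  have hval : A (f.toLp 2 volume) =ᵐ[volume] fun x => ∑' k : ℤ × ℤ, a k *
      (Complex.exp (((k.1 * x + k.1 * k.2 * h / 2 : ℝ) : ℂ) * Complex.I) * f (x + k.2 * h)) := by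
    refine ae_eq_of_hasSum_lp (hA _) (fun k => ?_) fun x => hbound (B := C) fun k => by
      rw [norm_mul, Complex.norm_exp_ofReal_mul_I, one_mul]; exact hC _
    filter_upwards [Lp.coeFn_smul (a k) (weylOp h k (f.toLp 2 volume)),
      Lp.coeFn_smul (Complex.exp (((k.1 * k.2 * h / 2 : ℝ) : ℂ) * Complex.I))
        (modTrans k.1 (k.2 * h) (f.toLp 2 volume)),
      modTrans_coeFn k.1 (k.2 * h) (f.toLp 2 volume),
      ae_comp_add_right hpt (k.2 * h)] with x h1 h2 h3 h4
    rw [h1, Pi.smul_apply, weylOp_apply, h2, Pi.smul_apply, h3, h4, smul_eq_mul, smul_eq_mul,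
      ← mul_assoc (Complex.exp _), ← Complex.exp_add, ← add_mul, ← Complex.ofReal_add,
      add_comm (k.1 * k.2 * h / 2 : ℝ)]
  filter_upwards [hval] with x hx
  have hintegrand : ∀ p, (fun y => weylIntegrand h (fun x p => ∑' k, a k * character k.1 k.2 x p)
      f x p y) = fun y => ∑' k : ℤ × ℤ, a k * weylIntegrand h (character k.1 k.2) f x p y := by
    intro p
    funext y
    rw [weylIntegrand, mul_assoc, ← tsum_mul_right, ← tsum_mul_left]
    refine tsum_congr fun k => ?_
    rw [weylIntegrand]; ring
  have hint : ∀ p (k : ℤ × ℤ),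
      Integrable fun y => a k * weylIntegrand h (character k.1 k.2) f x p y :=
    fun p k => (integrable_weylIntegrand_character f x p k).const_mul _
  have hsum : ∀ p, Summable fun k : ℤ × ℤ =>
      ∫ y, ‖a k * weylIntegrand h (character k.1 k.2) f x p y‖ := by
    intro p
    refine (ha.mul_right (∫ y, ‖f y‖)).congr fun k => ?_
    rw [← integral_const_mul]
    simp only [norm_mul, norm_weylIntegrand_character]
  have hinner : ∀ p, ∫ y, weylIntegrand h (fun x p => ∑' k, a k * character k.1 k.2 x p) f x p y =
      ∑' k, a k * weylTerm h f x k p := by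
    intro p
    have h1 := hasSum_integral_of_summable_integral_norm (hint p) (hsum p)
    rw [hintegrand, ← h1.tsum_eq]
    refine tsum_congr fun k => ?_
    rw [integral_const_mul, integral_weylIntegrand_character hh]
  have hint2 : ∀ k : ℤ × ℤ, Integrable fun p => a k * weylTerm h f x k p :=
    fun k => (integrable_weylTerm hh f x k).const_mul _
  have hsum2 : Summable fun k : ℤ × ℤ => ∫ p, ‖a k * weylTerm h f x k p‖ := by
    refine (ha.mul_right ((2 * Real.pi * h) • ∫ ξ, ‖(𝓕 f : 𝓢(ℝ, ℂ)) ξ‖)).congr fun k => ?_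
    simp only [norm_mul, norm_weylTerm]
    rw [integral_const_mul, integral_affine hh fun ξ => ‖(𝓕 f : 𝓢(ℝ, ℂ)) ξ‖]
  refine ⟨fun p => ?_, ?_, ?_⟩
  · rw [hintegrand]
    exact integrable_tsum_of_summable (hint p) (hsum p) fun y => hbound (B := C) fun k => by
      rw [norm_weylIntegrand_character]; exact hC y
  · simp only [hinner]
    exact integrable_tsum_of_summable hint2 hsum2 fun p => hbound (B := C') fun k => by
      rw [norm_weylTerm]; exact hC' _
  · simp only [hinner]
    rw [hx, ← (hasSum_integral_of_summable_integral_norm hint2 hsum2).tsum_eq, ← tsum_mul_left]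
    refine tsum_congr fun k => ?_
    have hpi : (Real.pi : ℂ) ≠ 0 := by exact_mod_cast Real.pi_pos.ne'
    have hh' : (h : ℂ) ≠ 0 := by exact_mod_cast hh.ne'
    rw [integral_const_mul, integral_weylTerm hh]
    field_simp

theorem isWeylQuantization_quantizedSymbol (α : ℝ) (hh : 0 < h) {z : ℂ} (hz : NotLevel h z) :
    IsWeylQuantization h (effSymbol h α z) (quantizedSymbol h α z) := by
  have : effSymbol h α z = fun x p => ∑' k : ℤ × ℤ, symbolCoeff h α z k * character k.1 k.2 x p :=
    funext fun x => funext fun p => effSymbol_eq_tsum α hh hz x p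
  rw [this]
  exact isWeylQuantization_of_hasSum hh (summable_symbolCoeff α hh hz)
    (hasSum_quantizedSymbol_apply α hh hz)

end Weyl

end PointLandau

end

/-! ### The main theorem -/

open PointLandau in
theorem mainTheorem4 (h α : ℝ) (hh : 0 < h) (hα : α ≠ 0) :
    -- the functions entering the symbols: for `z ∉ spec H_h`, `G_h` is the integral kernel of
    -- the resolvent, and `q` is its renormalized value on the diagonal
    (∀ z ∉ unboundedSpectrum (landau h),
      (∀ R : L2Plane →L[ℂ] L2Plane, IsResolventAt (landau h) z R → ∀ v : L2Plane,
        (∀ x, Integrable (fun y => green h z x y * v y)) ∧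
        R v =ᵐ[volume] fun x => ∫ y, green h z x y * v y) ∧
      (∀ y : ℝ × ℝ, Tendsto
        (fun x => green h z x y - 1 / (2 * Real.pi) * (Real.log (1 / eDist x y) : ℂ))
        (𝓝[≠] y) (𝓝 (qFun h z)))) ∧
    -- the two forms of the symbols and of their coefficients
    (∀ z ∉ unboundedSpectrum (landau h),
      (∀ m n : ℤ, 1 ≤ |m| + |n| →
        lam h z m n = greenGauged h z (latticePt (0, 0)) (latticePt (m, n))) ∧
      Summable (fun k : ℤ × ℤ => ‖qMatrix h z (0, 0) k‖) ∧
      ∀ x p : ℝ, effSymbol h α z x p =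
        (∑' k : ℤ × ℤ, qMatrix h z (0, 0) k * Complex.exp (-(Complex.I * k.1 * k.2 * h / 2)) *
          character k.1 k.2 x p) + (α : ℂ)⁻¹) ∧
    -- the spectrum of `H_{h,α}` outside `spec H_h` is the `z`-spectrum of the quantized symbols
    ∃ A : ℂ → L2Line →L[ℂ] L2Line,
      (∀ z ∉ unboundedSpectrum (landau h), IsWeylQuantization h (effSymbol h α z) (A z)) ∧
      (∀ z : ℝ, (z : ℂ) ∉ unboundedSpectrum (landau h) → IsSelfAdjoint (A z)) ∧
      (∀ z ∈ unboundedSpectrum (pointLandau h α), z.im = 0) ∧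
      unboundedSpectrum (pointLandau h α) \ unboundedSpectrum (landau h) =
        pencilSpectrum (unboundedSpectrum (landau h))ᶜ A := by
  have hl : ∀ {z : ℂ}, z ∉ unboundedSpectrum (landau h) → NotLevel h z :=
    (notMem_unboundedSpectrum_landau hh).1
  refine ⟨fun z hz => ⟨fun R hR v => ?_, fun y => ?_⟩, fun z hz => ⟨fun m n hmn => ?_, ?_, ?_⟩,
    quantizedSymbol h α, fun z hz => isWeylQuantization_quantizedSymbol α hh (hl hz),
    fun z hz => isSelfAdjoint_quantizedSymbol α hh (hl hz),
    fun z hz => im_eq_zero_of_mem_spectrum hα hh hz, ?_⟩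
  · have hL := hl hz
    simp only [green_eq]
    refine ⟨(convDominated_regGreen hh hL le_rfl).integrable_mul (Lp.memLp v), ?_⟩
    -- A resolvent is unique, so an arbitrary one is the Green operator, whose kernel is explicit.
    rw [hR.unique (isResolventAt_greenOp hh hL)]
    exact greenOp_coeFn hh hL v
  · exact hasLogExpansion_green hh (hl hz) y
  · rw [lam_eq, greenGauged_eq]
    simp [sqDist, latticePt]
  · simp only [norm_qMatrix_zero]
    exact summable_coeff hh (hl hz)
  · intro x p
    simp only [qMatrix_zero_mul_exp]
    exact effSymbol_eq hh α (hl hz) x p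
  · ext z
    simp only [Set.mem_sdiff, pencilSpectrum, Set.mem_ofPred_eq, Set.mem_compl_iff]
    rw [and_comm]
    refine and_congr_right fun hz => ?_
    rw [spectrum.zero_mem_iff, isUnit_quantizedSymbol_iff α hh (hl hz),
      ← notMem_unboundedSpectrum_pointLandau hα hh (hl hz), not_not]
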